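/- Let $N\ge 1$ be an integer, $\mu>-1$ real, $\xi\in\mathbb C$, and let $C$ be a non-zero constant. For real $s,x$ put $(s-x)^\mu:=e^{-\pi i\mu}|s-x|^\mu$ when $x>s$ (and the usual positive value when $x<s$), and for real $\eta_1,\eta_2$ define $$\tilde E_N^{\rm Cy}(s;(\eta_1,\eta_2),\mu;\xi)=\frac1C\prod_{l=1}^N\Big(\int_{-\infty}^\infty-\xi\int_s^\infty\Big)dx_l\,\frac{(s-x_l)^\mu}{(1+ix_l)^{\eta_1+i\eta_2}(1-ix_l)^{\eta_1-i\eta_2}}\prod_{1\le j<k\le N}(x_k-x_j)^2 .$$ **Part 1 (Cauchy average).** Suppose $2\eta_1>2N-1+\mu$. Then the integrals converge absolutely, $\tilde E_N^{\rm Cy}$ is differentiable in $s\in\mathbb R$, and the following hold. Put $\mathbf b=(b_1,b_2,b_3,b_4)=(N-\eta_1,\,i\eta_2,\,\eta_1,\,-\mu+\eta_1-N)$, $e_2'[\mathbf b]=b_1b_3+b_1b_4+b_3b_4$, $e_2[\mathbf b]=\sum_{j<k}b_jb_k$. (a) *($\tau$-function.)* For $\mathbf b^0=(N-\eta_1,i\eta_2,\eta_1-N,-\mu+\eta_1-N)$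 (so $b^0_1+b^0_3=0$) let $\tau_3[n](t)=\tau_3(t;b^0_1,b^0_2,b^0_3+n,b^0_4)$ be Okamoto's $\tau$-function sequence for P$_{\rm VI}$: $\frac{d}{dt}\log\tau_3[n]$ is the Hamiltonian $H$, $$t(t-1)H=q(q-1)(q-t)p^2-[\alpha_4(q-1)(q-t)+\alpha_3q(q-t)+(\alpha_0-1)q(q-1)]p+\alpha_2(\alpha_1+\alpha_2)(q-t),$$ with $\alpha_0=1+b_3+b_4$, $\alpha_1=b_3-b_4$, $\alpha_2=-(b_1+b_3)$, $\alpha_3=b_1-b_2$, $\alpha_4=b_1+b_2$ at $(b_1,b_2,b_3,b_4)=(b^0_1,b^0_2,b^0_3+n,b^0_4)$, evaluated on a solution $(q,p)=(q[n],p[n])$ of $q'=\partial H/\partial p$, $p'=-\partial H/\partial q$; consecutive solutions, for $n\ge1$, are related by the B\"acklund transformation $T_3$ which shifts $b_3$ to $b_3+1$; $\tau_3[0]=1$; and $\tau_3[1]$ is, up to a constant factor, the solution $$\tau_3[1]\big(\tfrac{1+is}2\big)\propto\Big(\int_{-\infty}^\infty-\xi\int_s^\infty\Big)(1+iu)^{a-c}(1-iu)^{c-b-1}(s-u)^{-a}\,du,\qquad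 a=b^0_1+b^0_4,\ b=1+b^0_3+b^0_4,\ c=1+b^0_2+b^0_4,$$ of the Gauss hypergeometric equation. Then, on any connected open subset of $0<\mathrm{Re}\,t<1$ on which such a sequence is regular (no zeros of the $\tau_3[n]$, no vanishing denominators in $T_3$), and at the points of the line $t=(1+is)/2$ in it, $$\tilde E_N^{\rm Cy}(s;(\eta_1,\eta_2),\mu;\xi)=\text{const}\cdot\tau_3\big(\tfrac{is+1}2;\mathbf b\big)$$ with a non-zero constant. On the whole line, without regularity assumptions, the same holds (with a non-zero constant) for $\tau_3[N]$ given by $\bar\tau_3[N]=\det[\delta^{j+k}\bar\tau_3[1]]_{j,k=0,\dots,N-1}$, $\delta=t(t-1)\frac d{dt}$, $\bar\tau_3[n]=(t(t-1))^{n(n+b^0_3+b^0_4)/2}\tau_3[n]$. (b) *($\sigma$-form.)* Let $$U_N^{\rm Cy}(t;(\eta_1,\eta_2),\mu;\xi)=(t^2+1)\frac d{dt}\log\Big((it-1)^{e_2'[\mathbf b]-\frac12e_2[\mathbf b]}(it+1)^{\frac12e_2[\mathbf b]}\tilde E_N^{\rm Cy}(t;(\eta_1,\eta_2),\mu;\xi)\Big).$$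 At every real $t$ with $\tilde E_N^{\rm Cy}\ne0$ the function $h=U_N^{\rm Cy}$ satisfies $$h'\big((1+t^2)h''\big)^2+4\big(h'(h-th')-ib_1b_2b_3b_4\big)^2+4\prod_{k=1}^4(h'+b_k^2)=0 .$$ (c) *($\xi=1$.)* $e_2'[\mathbf b]+N(N+\mu-2\eta_1)=-\eta_1^2$, and as $t\to-\infty$ $$U_N^{\rm Cy}(t;(\eta_1,\eta_2),\mu;1)=-\eta_1^2t-\frac{\eta_2(N-\eta_1)(N+\mu-\eta_1)}{\eta_1}+O(1/t).$$ (d) *($\xi=0$.)* $e_2'[\mathbf b]+N\mu=-(N-\eta_1)^2$; if $2\eta_1>2N-1$ then $U_N^{\rm Cy}(t;(\eta_1,\eta_2),\mu;0)/t\to-(N-\eta_1)^2$ as $t\to-\infty$, and if $\eta_1>N$ then $U_N^{\rm Cy}(t;(\eta_1,\eta_2),\mu;0)=-(N-\eta_1)^2t+O(1)$. **Part 2 (circular Jacobi average).** Let $\omega_1,\omega_2$ be real with $2\omega_1>-1$, let $\langle\cdot\rangle_{\rm cJUE}$ be the average over the density on $[-\pi,\pi]^N$ proportional to $\prod_l|1+z_l|^{2\omega_1}\prod_{j<k}|z_k-z_j|^2$,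 $z_l=e^{i\theta_l}$, put $$\tilde E_N^{\rm cJ}(\phi;(\omega_1,\omega_2),\mu;\xi)=\Big\langle\prod_{l=1}^N\big(1-\xi\chi_{(\pi-\phi,\pi)}(\theta_l)\big)e^{\omega_2\theta_l}|e^{i(\pi-\phi)}-e^{i\theta_l}|^\mu\Big\rangle_{\rm cJUE},$$ and $\xi^*=1-(1-\xi)e^{-\pi i\mu}$. Then for $0<\phi<2\pi$, with a non-zero constant independent of $\phi$, $$\tilde E_N^{\rm cJ}(\phi;(\omega_1,\omega_2),\mu;\xi^*)=\text{const}\cdot(1+s^2)^{-N\mu/2}\,\tilde E_N^{\rm Cy}(s;(N+\omega_1+\mu/2,\omega_2),\mu;\xi)\Big|_{s=\cot(\phi/2)} .$$ If moreover $2\omega_1+\mu>-1$, $0\le\phi<2\pi$ and $\tilde E_N^{\rm cJ}(\theta;(\omega_1,\omega_2),\mu;\xi^*)\ne0$ for $0<\theta\le\phi$, then $$\tilde E_N^{\rm cJ}(\phi;(\omega_1,\omega_2),\mu;\xi^*)=\frac{M_N(\omega_1-i\omega_2+\mu/2,\omega_1+i\omega_2+\mu/2)}{M_N(\omega_1,\omega_1)}\exp\Big\{-\frac12\int_0^\phi\Big(U_N^{\rm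 Cy}(\cot\tfrac\theta2;(N+\omega_1+\tfrac\mu2,\omega_2),\mu;\xi)+\omega_2(N+\omega_1-\tfrac12\mu)+(\omega_1+\tfrac12\mu)^2\cot\tfrac\theta2\Big)d\theta\Big\},$$ the integral converging absolutely, where $M_N(a,b)=\int_{[-1/2,1/2]^N}\prod_lz_l^{(a-b)/2}|1+z_l|^{a+b}\prod_{j<k}|z_j-z_k|^2\,dx$, $z_l=e^{2\pi ix_l}$. -/

import Mathlib

open MeasureTheory Filter Topology

noncomputable section

namespace CauchyPVI

/-! ### The averages -/

/-- The branch of `(s - x)^ν` for real `s`, `x`: the principal value for `x ≤ s`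
and `e^{-π i ν} |s - x|^ν` for `x > s`. -/
def branchPow (s x : ℝ) (ν : ℂ) : ℂ :=
  if x ≤ s then ((s - x : ℝ) : ℂ) ^ ν
  else Complex.exp (-(Real.pi * Complex.I * ν)) * ((x - s : ℝ) : ℂ) ^ ν

/-- The kernel of the operation `∫_{-∞}^{∞} - ξ ∫_s^∞`: the value `1 - ξ` for `x > s`, else `1`. -/
def cut (ξ : ℂ) (s x : ℝ) : ℂ := if s < x then 1 - ξ else 1

/-- The weight `1 / ((1 + i x)^{η₁ + i η₂} (1 - i x)^{η₁ - i η₂})`. -/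
def cauchyWeight (η₁ η₂ x : ℝ) : ℂ :=
  1 / ((1 + Complex.I * x) ^ ((η₁ : ℂ) + Complex.I * η₂) *
    (1 - Complex.I * x) ^ ((η₁ : ℂ) - Complex.I * η₂))

/-- The integrand of the generalised Cauchy average. -/
def cauchyIntegrand (N : ℕ) (η₁ η₂ μ : ℝ) (ξ : ℂ) (s : ℝ) (x : Fin N → ℝ) : ℂ :=
  (∏ l, cut ξ s (x l) * (branchPow s (x l) μ * cauchyWeight η₁ η₂ (x l))) *
    ∏ j, ∏ k ∈ Finset.Ioi j, ((x k - x j : ℝ) : ℂ) ^ 2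

/-- The generalised Cauchy average `Ẽ_N^Cy(s; (η₁, η₂), μ; ξ)`, with normalisation `1 / C`. -/
def cauchyE (C : ℂ) (N : ℕ) (η₁ η₂ μ : ℝ) (ξ : ℂ) (s : ℝ) : ℂ :=
  1 / C * ∫ x : Fin N → ℝ, cauchyIntegrand N η₁ η₂ μ ξ s x

/-- The unnormalised density of the cJUE in the angles `θ_l ∈ [-π, π]`, `z_l = e^{i θ_l}`. -/
def cJUEWeight (N : ℕ) (ω₁ : ℝ) (θ : Fin N → ℝ) : ℝ :=
  (∏ l, ‖1 + Complex.exp (Complex.I * θ l)‖ ^ (2 * ω₁)) *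
    ∏ j, ∏ k ∈ Finset.Ioi j,
      ‖Complex.exp (Complex.I * θ k) - Complex.exp (Complex.I * θ j)‖ ^ 2

/-- The average `Ẽ_N^cJ(φ; (ω₁, ω₂), μ; ξ)`, that is
`⟨∏ (1 - ξ χ_{(π - φ, π)}(θ_l)) e^{ω₂ θ_l} |e^{i (π - φ)} - e^{i θ_l}|^μ⟩` in the cJUE. -/
def cJE (N : ℕ) (ω₁ ω₂ μ : ℝ) (ξ : ℂ) (φ : ℝ) : ℂ :=
  (∫ θ in Set.pi Set.univ (fun _ : Fin N => Set.Icc (-Real.pi) Real.pi),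
      (∏ l, (1 - ξ * Set.indicator (Set.Ioo (Real.pi - φ) Real.pi) (fun _ => (1 : ℂ)) (θ l)) *
        (((Real.exp (ω₂ * θ l) *
          ‖Complex.exp (Complex.I * ((Real.pi - φ : ℝ) : ℂ)) -
            Complex.exp (Complex.I * θ l)‖ ^ μ : ℝ)) : ℂ)) *
      ((cJUEWeight N ω₁ θ : ℝ) : ℂ)) /
    ((∫ θ in Set.pi Set.univ (fun _ : Fin N => Set.Icc (-Real.pi) Real.pi),
      cJUEWeight N ω₁ θ : ℝ) : ℂ)

/-- `M_N(a, b) = ∫_{[-1/2,1/2]^N} ∏ z_l^{(a-b)/2} |1 + z_l|^{a+b} ∏_{j<k} |z_j - z_k|^2`,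
with `z_l = e^{2 π i x_l}` and `z_l^{(a-b)/2} = e^{π i x_l (a-b)}`. -/
def morrisM (N : ℕ) (a b : ℂ) : ℂ :=
  ∫ x in Set.pi Set.univ (fun _ : Fin N => Set.Icc (-(1 / 2) : ℝ) (1 / 2)),
    (∏ l, Complex.exp (Real.pi * Complex.I * x l * (a - b)) *
      ((‖1 + Complex.exp (2 * Real.pi * Complex.I * x l)‖ : ℝ) : ℂ) ^ (a + b)) *
    ∏ j, ∏ k ∈ Finset.Ioi j,
      ((‖Complex.exp (2 * Real.pi * Complex.I * x j) -
        Complex.exp (2 * Real.pi * Complex.I * x k)‖ ^ 2 : ℝ) : ℂ)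

/-! ### The parameters -/

/-- Second elementary symmetric function of `b₁, b₃, b₄`. -/
def e2' (b : Fin 4 → ℂ) : ℂ := b 0 * b 2 + b 0 * b 3 + b 2 * b 3

/-- Second elementary symmetric function of `b₁, b₂, b₃, b₄`. -/
def e2 (b : Fin 4 → ℂ) : ℂ :=
  b 0 * b 1 + b 0 * b 2 + b 0 * b 3 + b 1 * b 2 + b 1 * b 3 + b 2 * b 3

/-- `(b₁, b₂, b₃ + n, b₄)`. -/
def shift3 (b : Fin 4 → ℂ) (n : ℕ) : Fin 4 → ℂ := ![b 0, b 1, b 2 + n, b 3]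

/-- `𝐛 = (N - η₁, i η₂, η₁, -μ + η₁ - N)`. -/
def bCy (N : ℕ) (η₁ η₂ μ : ℝ) : Fin 4 → ℂ :=
  ![(N : ℂ) - η₁, Complex.I * η₂, η₁, -(μ : ℂ) + η₁ - N]

/-- The initial parameters `(b₁, b₂, b₃, b₄)` with `b₁ + b₃ = 0` from which `N` shifts of `b₃`
lead to `bCy`. -/
def bSeed (N : ℕ) (η₁ η₂ μ : ℝ) : Fin 4 → ℂ :=
  ![(N : ℂ) - η₁, Complex.I * η₂, (η₁ : ℂ) - N, -(μ : ℂ) + η₁ - N]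

theorem shift3_bSeed (N : ℕ) (η₁ η₂ μ : ℝ) :
    shift3 (bSeed N η₁ η₂ μ) N = bCy N η₁ η₂ μ := by
  funext i
  fin_cases i <;> simp [shift3, bSeed, bCy]

/-- The parameters `α₀, …, α₄` of the Hamiltonian in terms of `b`, i.e. the solution of
`b₁ = (α₃ + α₄)/2`, `b₂ = (α₄ - α₃)/2`, `b₃ = (α₀ + α₁ - 1)/2`, `b₄ = (α₀ - α₁ - 1)/2`,
`α₀ + α₁ + 2 α₂ + α₃ + α₄ = 1`. -/
def alphaOf (b : Fin 4 → ℂ) : Fin 5 → ℂ :=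
  ![1 + b 2 + b 3, b 2 - b 3, -(b 0 + b 2), b 0 - b 1, b 0 + b 1]

/-! ### The sixth Painlevé Hamiltonian, the shift `T₃` and the `τ`-function sequence -/

/-- The polynomial `t (t - 1) H`. -/
def hamK (α : Fin 5 → ℂ) (t q p : ℂ) : ℂ :=
  q * (q - 1) * (q - t) * p ^ 2
    - (α 4 * (q - 1) * (q - t) + α 3 * q * (q - t) + (α 0 - 1) * q * (q - 1)) * p
    + α 2 * (α 1 + α 2) * (q - t)

/-- The Hamiltonian of the sixth Painlevé equation. -/
def ham (α : Fin 5 → ℂ) (t q p : ℂ) : ℂ := hamK α t q p / (t * (t - 1))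

/-- Hamilton's equations `q' = ∂H/∂p`, `p' = -∂H/∂q` on `D`. -/
def SolvesHamilton (α : Fin 5 → ℂ) (D : Set ℂ) (q p : ℂ → ℂ) : Prop :=
  ∀ t ∈ D, HasDerivAt q (deriv (fun y => ham α t (q t) y) (p t)) t ∧
    HasDerivAt p (-deriv (fun x => ham α t x (p t)) (q t)) t

/-- The polynomial `X_u` in the explicit form of `T₃`. -/
def Xu (α : Fin 5 → ℂ) (t q p : ℂ) : ℂ :=
  q * (q - 1) * (q - t) ^ 2 * p ^ 2
    - (α 4 * (q - 1) * (q - t) + α 3 * q * (q - t) + (α 0 - 1 - α 1) * q * (q - 1)) * (q - t) * p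
    + (α 1 + α 2) ^ 2 * (q - t) ^ 2
    + (α 1 + α 2) * ((α 1 + α 2 + α 4) * t + (α 1 + α 2 + α 3) * (t - 1)) * (q - t)
    - α 0 * (α 1 + 1) * t * (t - 1)

/-- First further factor in the explicit form of `T₃`. -/
def Yu (α : Fin 5 → ℂ) (t q p : ℂ) : ℂ :=
  q * (q - t) * p + (α 1 + α 2) * (q - t) - α 0 * t

/-- Second further factor in the explicit form of `T₃`. -/
def Zu (α : Fin 5 → ℂ) (t q p : ℂ) : ℂ :=
  (q - 1) * (q - t) * p + (α 1 + α 2) * (q - t) - α 0 * (t - 1)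

/-- `q`-component of the Bäcklund transformation `T₃` (the composite
`r₁ s₀ s₁ s₂ s₃ s₄ s₂` of the elementary Bäcklund transformations), which shifts
`b₃` to `b₃ + 1`, equivalently `(α₀, α₁, α₂, α₃, α₄)` to `(α₀ + 1, α₁ + 1, α₂ - 1, α₃, α₄)`. -/
def T3q (α : Fin 5 → ℂ) (t q p : ℂ) : ℂ :=
  t / (q - t) * Zu α t q p *
    (q * (q - 1) * (q - t) * p + (α 1 + α 2) * q * (q - t) - α 0 * (t - 1) * q + α 4 * (q - t)) /
    Xu α t q p

/-- `p`-component of the Bäcklund transformation `T₃`. -/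
def T3p (α : Fin 5 → ℂ) (t q p : ℂ) : ℂ :=
  -((q - t) / (t * (t - 1))) * (((q - t) * p + α 1 + α 2) * Xu α t q p /
    (Yu α t q p * Zu α t q p))

/-- `(q', p') = T₃ (q, p)`, with no vanishing denominator. -/
def IsT3Image (α : Fin 5 → ℂ) (t q p q' p' : ℂ) : Prop :=
  q - t ≠ 0 ∧ Xu α t q p ≠ 0 ∧ Yu α t q p ≠ 0 ∧ Zu α t q p ≠ 0 ∧
    q' = T3q α t q p ∧ p' = T3p α t q p

/-- `τ 0, …, τ N` is, on `D`, the `τ`-function sequence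
`τ₃[n](t) = τ₃(t; b₁, b₂, b₃ + n, b₄)` with `τ₃[0] = 1`, for initial parameters `b` with
`b₁ + b₃ = 0`: the logarithmic derivative of `τ n` is the Hamiltonian with parameters
`(b₁, b₂, b₃ + n, b₄)` along the solution `(q n, p n)` of its Hamilton equations, and successive
solutions are related by `T₃`. The member `n = 0` is the classical solution `p = 0`, `H = 0`,
for which `q 0` need not be finite; so solutions are only asked for from `n = 1` on. -/
structure IsTauSequence (b : Fin 4 → ℂ) (N : ℕ) (D : Set ℂ) (q p τ : ℕ → ℂ → ℂ) : Prop where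
  seed : b 0 + b 2 = 0
  tau_zero : ∀ t ∈ D, τ 0 t = 1
  solves : ∀ n, 1 ≤ n → n ≤ N → SolvesHamilton (alphaOf (shift3 b n)) D (q n) (p n)
  step : ∀ n, 1 ≤ n → n < N → ∀ t ∈ D,
    IsT3Image (alphaOf (shift3 b n)) t (q n t) (p n t) (q (n + 1) t) (p (n + 1) t)
  log_deriv : ∀ n, 1 ≤ n → n ≤ N → ∀ t ∈ D, τ n t ≠ 0 ∧
    HasDerivAt (τ n) (ham (alphaOf (shift3 b n)) t (q n t) (p n t) * τ n t) t

/-- The point `(1 + i s) / 2`. -/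
def linePt (s : ℝ) : ℂ := (Complex.I * s + 1) / 2

/-- The integral solution of the Gauss hypergeometric equation, at `(1 + i s)/2`, as a function of
`s`:
`(∫_{-∞}^∞ - ξ ∫_s^∞) (1 + i u)^{a - c} (1 - i u)^{c - b - 1} (s - u)^{-a} du`. -/
def fCy (a b c ξ : ℂ) (s : ℝ) : ℂ :=
  ∫ u : ℝ, cut ξ s u * ((1 + Complex.I * u) ^ (a - c) * (1 - Complex.I * u) ^ (c - b - 1) *
    branchPow s u (-a))

/-- The first member `τ₃[1]` at `(1 + i s)/2` (up to a constant factor): the function `fCy` with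
`a = b₁ + b₄`, `b = 1 + b₃ + b₄`, `c = 1 + b₂ + b₄`. -/
def tauOne (b : Fin 4 → ℂ) (ξ : ℂ) (s : ℝ) : ℂ :=
  fCy (b 0 + b 3) (1 + b 2 + b 3) (1 + b 1 + b 3) ξ s

/-- `δ = t (t - 1) d/dt` along `t = (1 + i s)/2`, where `d/dt = (2/i) d/ds`. -/
def deltaLine (g : ℝ → ℂ) (s : ℝ) : ℂ :=
  linePt s * (linePt s - 1) * (2 / Complex.I * deriv g s)

/-- The factor `(t (t - 1))^{(n + b₁ + b₃)(n + b₃ + b₄)/2}` at `t = (1 + i s)/2` between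
`τ̄₃[n]` and `τ₃[n]`. There `t (t - 1)` is a negative real number and the principal power is
a constant multiple of a power of `1 + s²`. -/
def barFactor (b : Fin 4 → ℂ) (n : ℕ) (s : ℝ) : ℂ :=
  (linePt s * (linePt s - 1)) ^ ((n + b 0 + b 2) * (n + b 2 + b 3) / 2)

/-- The solution `τ₃[n]`, at `t = (1 + i s)/2`, of the Toda lattice equation
`δ² log τ̄₃[n] = τ̄₃[n-1] τ̄₃[n+1] / τ̄₃[n]²` with `τ̄₃[0] = 1`, that is
`τ̄₃[n] = det [δ^{j+k} τ̄₃[1]]_{j,k = 0, …, n-1}`. -/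
def tauDet (b : Fin 4 → ℂ) (ξ : ℂ) (n : ℕ) (s : ℝ) : ℂ :=
  (Matrix.of fun j k : Fin n =>
      deltaLine^[(j : ℕ) + (k : ℕ)] (fun r => barFactor b 1 r * tauOne b ξ r) s).det /
    barFactor b n s

/-! ### The `σ`-form -/

/-- The logarithmic derivative
`U_N^Cy = (t² + 1) d/dt log ((i t - 1)^{e₂' - e₂/2} (i t + 1)^{e₂/2} Ẽ_N^Cy)`.
The constant `(-1)^{e₂' - e₂/2}` has been dropped from the logarithm, so that the principal
powers are smooth in `t`. -/
def cauchyU (C : ℂ) (N : ℕ) (η₁ η₂ μ : ℝ) (ξ : ℂ) (t : ℝ) : ℂ :=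
  ((t : ℂ) ^ 2 + 1) * logDeriv (fun r : ℝ =>
    (1 - Complex.I * r) ^ (e2' (bCy N η₁ η₂ μ) - 1 / 2 * e2 (bCy N η₁ η₂ μ)) *
    (1 + Complex.I * r) ^ (1 / 2 * e2 (bCy N η₁ η₂ μ)) * cauchyE C N η₁ η₂ μ ξ r) t

/-- `h` satisfies, at the points of `S`, the transformed Jimbo-Miwa-Okamoto `σ`-form
`h' ((1+s²) h'')² + 4 (h' (h - s h') - i b₁ b₂ b₃ b₄)² + 4 ∏ (h' + b_k²) = 0`. -/
def SatisfiesSigmaForm (b : Fin 4 → ℂ) (h : ℝ → ℂ) (S : Set ℝ) : Prop :=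
  ∀ s ∈ S, DifferentiableAt ℝ h s ∧ DifferentiableAt ℝ (deriv h) s ∧
    deriv h s * ((1 + (s : ℂ) ^ 2) * deriv (deriv h) s) ^ 2
      + 4 * (deriv h s * (h s - s * deriv h s) - Complex.I * (b 0 * b 1 * b 2 * b 3)) ^ 2
      + 4 * ∏ k, (deriv h s + b k ^ 2) = 0

end CauchyPVI

end

noncomputable section
namespace CauchyPVI

/-! ### Determinantal integrals -/

/-! The variable `s` enters only through the one-particle kernel `|x - s|^μ`, with relative weight
`1` on `x ≤ s` and `b = (1 - ξ) e^{-π i μ}` on `x > s`. Everything is therefore expressed by the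
integrals `I_{p,q}(s)` (`fullI`) of this kernel against `(1 + i x)^p (1 - i x)^q`. The squared
Vandermonde product is a constant times a product of two determinants homogeneous in `1 + i x`, `1 -
i x`. Andréief's identity (`integral_det_mul_det`) then makes the Cauchy average a constant multiple
of the Toeplitz determinant of `I_{p+j-k, q-j+k}` (`hdet`). The substitution `θ = 2 arctan u` gives
the same determinant for the circular average (`integral_circle`).

Integration by parts yields contiguity relations for `I`. They transform the Toeplitz determinant
into the Hankel determinant of `D^{j+k} f`, with `D = (1 + s²) d/ds` and `f = (1 + s²)^κ I_{p,q}`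
(`det_opD_iterate`). This is the determinant solution of the Toda lattice, which is the `τ`-function
statement on the whole line. Jacobi's identity provides the Toda equation itself (`hankelD_toda`),
and the contiguity relations provide the hypergeometric equation for `f` (`ladderE_ode`).

For suitably normalised logarithmic derivatives `U_n` (`chainU`), two algebraic relations connect
`U_n`, `U_{n+1}` and their first derivatives. They hold at `n = 0` and propagate along the Toda
equation (`TodaChain.relations`); eliminating `U_n` leaves the `σ`-form for `U_{n+1}`
(`TodaChain.sigmaForm`). The induction divides by the lower determinants, which may vanish for
special `ξ`. They are polynomials in `b` that do not vanish at `b = 0`, by positivity of Gram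
determinants, so generic `b` is harmless and continuity in `b` covers the rest (`sigmaExpr_chainU`).

For a Hamiltonian `τ`-sequence, `T₃` changes the Hamiltonian by an explicit polynomial (`hamK_T3`).
This gives a forward relation; the matching backward relation is inherited on the line from the
determinants already identified and extends to the domain by the identity theorem. Together they
give a Toda equation up to a constant, which is shown to be non-zero, so the next `τ`-function is
again a multiple of the determinant (`tau_succ_eq_hdet`).

At `-∞`, if `ξ ≠ 1` the integrals divided by `(1 + s²)^{μ/2}` converge with a rate. If `ξ = 1`,
scaling shows that `U + η₁² t` is a smooth function of `1/t`, and the limiting `σ`-form is a perfect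
square that determines its value at `0`. The exponential formula for the circular average integrates
a logarithmic derivative along `s = cot (θ/2)` from `θ = 0`, where the average is a quotient of
Morris integrals. -/

theorem det_mul_det_eq_sum {α : Type*} {n : ℕ} (φ ψ : Fin n → α → ℂ) (x : Fin n → α) :
    (Matrix.of fun l j => φ j (x l)).det * (Matrix.of fun l k => ψ k (x l)).det =
      ∑ σ : Equiv.Perm (Fin n), ∑ τ : Equiv.Perm (Fin n),
        (((Equiv.Perm.sign σ : ℤ) : ℂ) * ((Equiv.Perm.sign τ : ℤ) : ℂ)) *
          ∏ l, φ (σ l) (x l) * ψ (τ l) (x l) := by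
  rw [← Matrix.det_transpose, ← Matrix.det_transpose (Matrix.of fun l k => ψ k (x l)),
    Matrix.det_apply', Matrix.det_apply', Finset.sum_mul_sum]
  refine Finset.sum_congr rfl fun σ _ => Finset.sum_congr rfl fun τ _ => ?_
  simp only [Matrix.transpose_apply, Matrix.of_apply, Finset.prod_mul_distrib]
  ring

/-- **Andréief's identity**. -/
theorem integral_det_mul_det {α : Type*} [MeasurableSpace α] (ν : Measure α) [SigmaFinite ν]
    {n : ℕ} (φ ψ : Fin n → α → ℂ) (h : ∀ j k, Integrable (fun x => φ j x * ψ k x) ν) :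
    Integrable (fun x : Fin n → α => (Matrix.of fun l j => φ j (x l)).det *
      (Matrix.of fun l k => ψ k (x l)).det) (Measure.pi fun _ => ν) ∧
    ∫ x : Fin n → α, (Matrix.of fun l j => φ j (x l)).det *
      (Matrix.of fun l k => ψ k (x l)).det ∂(Measure.pi fun _ => ν) =
      (n.factorial : ℂ) * (Matrix.of fun j k => ∫ x, φ j x * ψ k x ∂ν).det := by
  have hint : ∀ σ τ : Equiv.Perm (Fin n), Integrable (fun x : Fin n → α =>
      (((Equiv.Perm.sign σ : ℤ) : ℂ) * ((Equiv.Perm.sign τ : ℤ) : ℂ)) *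
        ∏ l, φ (σ l) (x l) * ψ (τ l) (x l)) (Measure.pi fun _ => ν) := fun σ τ =>
    (Integrable.fintype_prod (f := fun l x => φ (σ l) x * ψ (τ l) x)
      (fun l => h (σ l) (τ l))).const_mul _
  simp only [det_mul_det_eq_sum]
  refine ⟨integrable_finsetSum _ fun σ _ => integrable_finsetSum _ fun τ _ => hint σ τ, ?_⟩
  rw [integral_finsetSum _ fun σ _ => integrable_finsetSum _ fun τ _ => hint σ τ]
  -- Every `σ` contributes the same amount: with `τ = ρ σ` the signs reduce to the sign of `ρ`, and
  -- relabelling the factors by `σ` leaves the Leibniz sum over `ρ`. The outer sum then only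
  -- produces `n!`.
  have key : ∀ σ : Equiv.Perm (Fin n), (∫ x : Fin n → α, ∑ τ : Equiv.Perm (Fin n),
      (((Equiv.Perm.sign σ : ℤ) : ℂ) * ((Equiv.Perm.sign τ : ℤ) : ℂ)) *
        ∏ l, φ (σ l) (x l) * ψ (τ l) (x l) ∂(Measure.pi fun _ => ν)) =
      (Matrix.of fun j k => ∫ x, φ j x * ψ k x ∂ν).det := by
    intro σ
    rw [integral_finsetSum _ fun τ _ => hint σ τ, ← Matrix.det_transpose, Matrix.det_apply',
      ← Equiv.sum_comp (Equiv.mulRight σ)]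
    refine Finset.sum_congr rfl fun ρ _ => ?_
    rw [integral_const_mul,
      integral_fintype_prod_eq_prod (𝕜 := ℂ)
        (fun l x => φ (σ l) x * ψ ((Equiv.mulRight σ) ρ l) x)]
    have hs : (((Equiv.Perm.sign σ : ℤ) : ℂ) *
        ((Equiv.Perm.sign ((Equiv.mulRight σ) ρ) : ℤ) : ℂ)) = ((Equiv.Perm.sign ρ : ℤ) : ℂ) := by
      have : ((Equiv.Perm.sign σ : ℤ) : ℂ) * ((Equiv.Perm.sign σ : ℤ) : ℂ) = 1 := by
        rw [← Int.cast_mul, Int.units_coe_mul_self]; simp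
      simp only [Equiv.coe_mulRight, map_mul, Units.val_mul, Int.cast_mul]
      linear_combination ((Equiv.Perm.sign ρ : ℤ) : ℂ) * this
    rw [hs]
    congr 1
    rw [← Equiv.prod_comp σ (fun l => (Matrix.of fun j k => ∫ x, φ j x * ψ k x ∂ν).transpose
      (ρ l) l)]
    simp
  simp only [key, Finset.sum_const, Finset.card_univ, Fintype.card_perm, Fintype.card_fin,
    nsmul_eq_mul]

/-- A null vector of this Gram matrix yields a combination `g` of the `φ j` with `∫ w |g|² = 0`.
Hence `g` vanishes almost everywhere on `S`, in particular at `n` distinct points, where the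
interpolation matrix would be singular. All positivity arguments below come from this lemma. -/
theorem det_gram_ne_zero {n : ℕ} (φ : Fin n → ℝ → ℂ) (w : ℝ → ℝ) (S : Set ℝ) (hS : volume S ≠ 0)
    (hw : ∀ x, 0 ≤ w x) (hpos : ∀ x ∈ S, 0 < w x)
    (h : ∀ j k, Integrable (fun x => (w x : ℂ) * (φ j x * (starRingEnd ℂ) (φ k x))))
    (hφ : ∀ y : Fin n → ℝ, Function.Injective y → (Matrix.of fun l j => φ j (y l)).det ≠ 0) :
    (Matrix.of fun j k => ∫ x, (w x : ℂ) * (φ j x * (starRingEnd ℂ) (φ k x))).det ≠ 0 := by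
  intro hdet
  obtain ⟨v, hv0, hv⟩ := Matrix.exists_mulVec_eq_zero_iff.mpr hdet
  set g : ℝ → ℂ := fun x => ∑ j, (starRingEnd ℂ) (v j) * φ j x with hg
  have hexp : ∀ x, ((w x * ‖g x‖ ^ 2 : ℝ) : ℂ) = ∑ j, ∑ k, (starRingEnd ℂ) (v j) * v k *
      ((w x : ℂ) * (φ j x * (starRingEnd ℂ) (φ k x))) := by
    intro x
    rw [Complex.ofReal_mul, Complex.ofReal_pow, ← Complex.mul_conj', hg]
    simp only [map_sum, map_mul, Complex.conj_conj]
    rw [Finset.sum_mul_sum, Finset.mul_sum]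
    simp only [Finset.mul_sum]
    refine Finset.sum_congr rfl fun j _ => Finset.sum_congr rfl fun k _ => ?_
    ring
  have hi : Integrable (fun x => ((w x * ‖g x‖ ^ 2 : ℝ) : ℂ)) := by
    simp only [hexp]
    exact integrable_finsetSum _ fun j _ => integrable_finsetSum _ fun k _ => (h j k).const_mul _
  have h0 : ∫ x, ((w x * ‖g x‖ ^ 2 : ℝ) : ℂ) = 0 := by
    simp only [hexp]
    rw [integral_finsetSum _ fun j _ => integrable_finsetSum _ fun k _ => (h j k).const_mul _]
    refine Finset.sum_eq_zero fun j _ => ?_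
    rw [integral_finsetSum _ fun k _ => (h j k).const_mul _]
    have := congrFun hv j
    simp only [Matrix.mulVec, dotProduct, Matrix.of_apply, Pi.zero_apply] at this
    simp only [integral_const_mul]
    rw [← mul_zero ((starRingEnd ℂ) (v j)), ← this, Finset.mul_sum]
    refine Finset.sum_congr rfl fun k _ => by ring
  rw [integral_complex_ofReal, Complex.ofReal_eq_zero] at h0
  have hir : Integrable (fun x => w x * ‖g x‖ ^ 2) := by
    have := hi.re
    simp only [RCLike.re_to_complex, Complex.ofReal_re] at this
    exact this
  rw [integral_eq_zero_iff_of_nonneg (fun x => mul_nonneg (hw x) (sq_nonneg _)) hir] at h0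
  -- If `g` had finitely many zeros in `S`, then `S` would be the union of a finite set and a null
  -- set.
  have hinf : (S ∩ {x | g x = 0}).Infinite := by
    intro hfin
    apply hS
    have hz : volume {x | ¬ (w x * ‖g x‖ ^ 2 = 0)} = 0 := h0
    refine measure_mono_null (t := (S ∩ {x | g x = 0}) ∪ {x | ¬ (w x * ‖g x‖ ^ 2 = 0)}) ?_
      (measure_union_null (hfin.measure_zero _) hz)
    intro x hx
    by_cases hgx : g x = 0
    · exact Or.inl ⟨hx, hgx⟩
    · right
      have := hpos x hx
      have := norm_pos_iff.mpr hgx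
      simp only [Set.mem_ofPred_eq]
      positivity
  obtain ⟨t, htS, htc⟩ := hinf.exists_subset_card_eq n
  let y : Fin n → ℝ := fun l => (t.equivFinOfCardEq htc).symm l
  have hy : Function.Injective y :=
    Subtype.val_injective.comp (t.equivFinOfCardEq htc).symm.injective
  apply hφ y hy
  refine Matrix.exists_mulVec_eq_zero_iff.mp ⟨fun j => (starRingEnd ℂ) (v j), ?_, ?_⟩
  · intro hc
    apply hv0
    funext j
    have := congrFun hc j
    simpa using this
  · funext l
    have : g (y l) = 0 := (htS ((t.equivFinOfCardEq htc).symm l).2).2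
    rw [hg] at this
    simp only [Matrix.mulVec, dotProduct, Matrix.of_apply, Pi.zero_apply]
    rw [← this]
    exact Finset.sum_congr rfl fun j _ => mul_comm _ _

section

/-! ### One-dimensional integrals -/

/-- The two-parameter weight `(1 + i x)^p (1 - i x)^q`. -/
def gW (p q : ℂ) (x : ℝ) : ℂ := (1 + Complex.I * x) ^ p * (1 - Complex.I * x) ^ q

theorem one_add_mem_slitPlane (x : ℝ) : 1 + Complex.I * x ∈ Complex.slitPlane := by
  left; simp

theorem one_sub_mem_slitPlane (x : ℝ) : 1 - Complex.I * x ∈ Complex.slitPlane := by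
  left; simp

theorem one_add_ne_zero' (x : ℝ) : (1 + Complex.I * x : ℂ) ≠ 0 :=
  Complex.slitPlane_ne_zero (one_add_mem_slitPlane x)

theorem one_sub_ne_zero' (x : ℝ) : (1 - Complex.I * x : ℂ) ≠ 0 :=
  Complex.slitPlane_ne_zero (one_sub_mem_slitPlane x)

theorem gW_neg (p q : ℂ) (x : ℝ) : gW p q (-x) = gW q p x := by
  simp only [gW, Complex.ofReal_neg, mul_neg, sub_neg_eq_add, ← sub_eq_add_neg]
  ring

theorem gW_add_left (p q : ℂ) (x : ℝ) : gW (p + 1) q x = (1 + Complex.I * x) * gW p q x := by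
  rw [gW, gW, Complex.cpow_add _ _ (one_add_ne_zero' x), Complex.cpow_one]; ring

theorem gW_add_right (p q : ℂ) (x : ℝ) : gW p (q + 1) x = (1 - Complex.I * x) * gW p q x := by
  rw [gW, gW, Complex.cpow_add _ _ (one_sub_ne_zero' x), Complex.cpow_one]; ring

theorem gW_sub_left (p q : ℂ) (x : ℝ) : gW p q x = (1 + Complex.I * x) * gW (p - 1) q x := by
  rw [← gW_add_left, sub_add_cancel]

theorem gW_sub_right (p q : ℂ) (x : ℝ) : gW p q x = (1 - Complex.I * x) * gW p (q - 1) x := by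
  rw [← gW_add_right, sub_add_cancel]

theorem hasDerivAt_one_add_cpow (p : ℂ) (x : ℝ) :
    HasDerivAt (fun x : ℝ => (1 + Complex.I * x) ^ p)
      (p * (1 + Complex.I * x) ^ (p - 1) * Complex.I) x := by
  have h : HasDerivAt (fun z : ℂ => 1 + Complex.I * z) Complex.I (x : ℂ) := by
    simpa using ((hasDerivAt_id (x : ℂ)).const_mul Complex.I).const_add 1
  exact (h.cpow_const (one_add_mem_slitPlane x)).comp_ofReal

theorem hasDerivAt_one_sub_cpow (p : ℂ) (x : ℝ) :
    HasDerivAt (fun x : ℝ => (1 - Complex.I * x) ^ p)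
      (p * (1 - Complex.I * x) ^ (p - 1) * -Complex.I) x := by
  have h : HasDerivAt (fun z : ℂ => 1 - Complex.I * z) (-Complex.I) (x : ℂ) := by
    simpa using ((hasDerivAt_id (x : ℂ)).const_mul Complex.I).const_sub 1
  exact (h.cpow_const (one_sub_mem_slitPlane x)).comp_ofReal

theorem gW_hasDerivAt (p q : ℂ) (x : ℝ) :
    HasDerivAt (gW p q)
      (Complex.I * p * gW (p - 1) q x - Complex.I * q * gW p (q - 1) x) x := by
  convert! (hasDerivAt_one_add_cpow p x).mul (hasDerivAt_one_sub_cpow q x) using 1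
  simp only [gW]; ring

theorem gW_continuous (p q : ℂ) : Continuous (gW p q) :=
  continuous_iff_continuousAt.mpr fun x => (gW_hasDerivAt p q x).continuousAt

theorem norm_cpow_le_exp (z p : ℂ) (hz : z ≠ 0) :
    ‖z ^ p‖ ≤ ‖z‖ ^ p.re * Real.exp (Real.pi * |p.im|) := by
  rw [Complex.norm_cpow_of_ne_zero hz, div_eq_mul_inv, ← Real.exp_neg]
  gcongr
  have := mul_le_mul (Complex.abs_arg_le_pi z) le_rfl (abs_nonneg p.im) Real.pi_pos.le
  rw [← abs_mul] at this
  exact (neg_le_abs _).trans this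

theorem norm_one_add (x : ℝ) : ‖(1 + Complex.I * x : ℂ)‖ = √(1 + x ^ 2) := by
  rw [Complex.norm_def, Complex.normSq_apply]; simp; ring_nf

theorem norm_one_sub (x : ℝ) : ‖(1 - Complex.I * x : ℂ)‖ = √(1 + x ^ 2) := by
  rw [Complex.norm_def, Complex.normSq_apply]; simp; ring_nf

theorem norm_gW_le (p q : ℂ) (x : ℝ) :
    ‖gW p q x‖ ≤ Real.exp (Real.pi * |p.im|) * Real.exp (Real.pi * |q.im|) *
      (1 + x ^ 2) ^ ((p + q).re / 2) := by
  have h1 := norm_cpow_le_exp _ p (one_add_ne_zero' x)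
  have h2 := norm_cpow_le_exp _ q (one_sub_ne_zero' x)
  rw [norm_one_add] at h1
  rw [norm_one_sub] at h2
  rw [gW, norm_mul]
  refine (mul_le_mul h1 h2 (norm_nonneg _) (by positivity)).trans (le_of_eq ?_)
  have hx : (0 : ℝ) < 1 + x ^ 2 := by positivity
  rw [Real.sqrt_eq_rpow, ← Real.rpow_mul hx.le, ← Real.rpow_mul hx.le,
    show (p + q).re / 2 = 1 / 2 * p.re + 1 / 2 * q.re by rw [Complex.add_re]; ring,
    Real.rpow_add hx]
  ring

/-- A form of Peetre's inequality: translating the weight by a bounded amount changes it by a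
bounded factor. It supplies a majorant uniform in `|s| ≤ r` for differentiation under the integral
sign. -/
theorem one_add_sq_rpow_le {σ : ℝ} (hσ : σ ≤ 0) (r s y : ℝ) (hs : |s| ≤ r) (hy : 0 ≤ y) :
    (1 + (s + y) ^ 2) ^ (σ / 2) ≤ (2 * (1 + r) ^ 2) ^ (-(σ / 2)) * (1 + y) ^ σ := by
  have hr : 0 ≤ r := (abs_nonneg s).trans hs
  have h1 : (1 + y) ^ 2 ≤ 2 * (1 + r) ^ 2 * (1 + (s + y) ^ 2) := by
    have ha : 1 + y ≤ (1 + r) * (1 + |s + y|) := by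
      have : y ≤ |s + y| + |s| := by
        have := abs_sub (s + y) s
        rw [add_sub_cancel_left, abs_of_nonneg hy] at this
        exact this
      nlinarith [abs_nonneg (s + y)]
    have hb : (1 + |s + y|) ^ 2 ≤ 2 * (1 + (s + y) ^ 2) := by
      nlinarith [sq_abs (s + y), sq_nonneg (1 - |s + y|)]
    calc (1 + y) ^ 2 ≤ ((1 + r) * (1 + |s + y|)) ^ 2 := by gcongr
      _ = (1 + r) ^ 2 * (1 + |s + y|) ^ 2 := by ring
      _ ≤ (1 + r) ^ 2 * (2 * (1 + (s + y) ^ 2)) := by gcongr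
      _ = _ := by ring
  have hA : (0 : ℝ) < 2 * (1 + r) ^ 2 := by positivity
  have hB : (0 : ℝ) < 1 + y := by linarith
  have h2 : ((1 + y) ^ 2 / (2 * (1 + r) ^ 2)) ≤ 1 + (s + y) ^ 2 := by
    rw [div_le_iff₀ hA]; linarith
  calc (1 + (s + y) ^ 2) ^ (σ / 2) ≤ ((1 + y) ^ 2 / (2 * (1 + r) ^ 2)) ^ (σ / 2) :=
        Real.rpow_le_rpow_of_nonpos (by positivity) h2 (by linarith)
    _ = _ := by
        rw [Real.div_rpow (by positivity) hA.le, Real.rpow_neg hA.le, ← Real.rpow_natCast (1 + y) 2,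
          ← Real.rpow_mul hB.le, div_eq_mul_inv, mul_comm]
        congr 2; push_cast; ring

theorem integrableOn_rpow_mul_one_add_rpow {μ σ : ℝ} (hμ : -1 < μ) (hσ : σ + μ < -1) :
    IntegrableOn (fun y : ℝ => y ^ μ * (1 + y) ^ σ) (Set.Ioi 0) := by
  have hσ0 : σ ≤ 0 := by linarith
  have hmeas : ∀ S : Set ℝ, AEStronglyMeasurable (fun y : ℝ => y ^ μ * (1 + y) ^ σ)
      (volume.restrict S) := fun S => by
    apply Measurable.aestronglyMeasurable
    fun_prop
  rw [← Set.Ioc_union_Ioi_eq_Ioi (zero_le_one (α := ℝ))]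
  refine IntegrableOn.union ?_ ?_
  · have h1 : IntegrableOn (fun y : ℝ => y ^ μ) (Set.Ioc 0 1) := by
      have := intervalIntegral.intervalIntegrable_rpow' (a := 0) (b := 1) hμ
      rwa [intervalIntegrable_iff_integrableOn_Ioc_of_le zero_le_one] at this
    refine Integrable.mono' h1 (hmeas _) ?_
    filter_upwards [ae_restrict_mem measurableSet_Ioc] with y hy
    have h0 : 0 ≤ y ^ μ := Real.rpow_nonneg hy.1.le _
    rw [Real.norm_of_nonneg (mul_nonneg h0 (Real.rpow_nonneg (by linarith [hy.1]) _))]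
    exact mul_le_of_le_one_right h0 (Real.rpow_le_one_of_one_le_of_nonpos (by linarith [hy.1]) hσ0)
  · refine Integrable.mono' (integrableOn_Ioi_rpow_of_lt (a := μ + σ) (by linarith) one_pos)
      (hmeas _) ?_
    filter_upwards [ae_restrict_mem measurableSet_Ioi] with y hy
    have hy' : (1 : ℝ) < y := hy
    have h0 : 0 ≤ y ^ μ := Real.rpow_nonneg (by linarith) _
    rw [Real.norm_of_nonneg (mul_nonneg h0 (Real.rpow_nonneg (by linarith) _)),
      Real.rpow_add (by linarith)]
    gcongr ?_ * ?_
    exact Real.rpow_le_rpow_of_nonpos (by linarith) (by linarith) hσ0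

/-- A constant with `‖gW p q (s + y)‖ ≤ gC p q r (1 + y)^Re(p+q)` for `|s| ≤ r`, `0 ≤ y`. -/
def gC (p q : ℂ) (r : ℝ) : ℝ := Real.exp (Real.pi * |p.im|) * Real.exp (Real.pi * |q.im|) *
  (2 * (1 + r) ^ 2) ^ (-((p + q).re / 2))

theorem gC_nonneg (p q : ℂ) (r : ℝ) : 0 ≤ gC p q r := by unfold gC; positivity

theorem norm_gW_shift_le {p q : ℂ} (hσ : (p + q).re ≤ 0) {r s y : ℝ} (hs : |s| ≤ r) (hy : 0 ≤ y) :
    ‖gW p q (s + y)‖ ≤ gC p q r * (1 + y) ^ (p + q).re := by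
  refine (norm_gW_le p q (s + y)).trans ?_
  rw [gC, mul_assoc (_ * _)]
  gcongr
  exact one_add_sq_rpow_le hσ r s y hs hy

/-- `∫_0^∞ y^μ (1 + i (s + y))^p (1 - i (s + y))^q dy`. -/
def halfI (μ : ℝ) (p q : ℂ) (s : ℝ) : ℂ :=
  ∫ y in Set.Ioi (0 : ℝ), ((y ^ μ : ℝ) : ℂ) * gW p q (s + y)

theorem aestronglyMeasurable_halfI (μ : ℝ) (p q : ℂ) (s : ℝ) (ν : Measure ℝ) :
    AEStronglyMeasurable (fun y : ℝ => ((y ^ μ : ℝ) : ℂ) * gW p q (s + y)) ν := by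
  have h : Measurable (gW p q) := (gW_continuous p q).measurable
  apply Measurable.aestronglyMeasurable
  fun_prop

theorem integrableOn_halfI {μ : ℝ} (hμ : -1 < μ) {p q : ℂ} (h : (p + q).re + μ < -1) (s : ℝ) :
    IntegrableOn (fun y : ℝ => ((y ^ μ : ℝ) : ℂ) * gW p q (s + y)) (Set.Ioi 0) := by
  refine Integrable.mono' ((integrableOn_rpow_mul_one_add_rpow hμ h).const_mul (gC p q |s|))
    (aestronglyMeasurable_halfI _ _ _ _ _) ?_
  filter_upwards [ae_restrict_mem measurableSet_Ioi] with y hy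
  have hy' : (0 : ℝ) < y := hy
  rw [norm_mul, Complex.norm_real, Real.norm_of_nonneg (Real.rpow_nonneg hy'.le _)]
  have := norm_gW_shift_le (p := p) (q := q) (by linarith) (le_refl |s|) hy'.le
  calc y ^ μ * ‖gW p q (s + y)‖ ≤ y ^ μ * (gC p q |s| * (1 + y) ^ (p + q).re) := by gcongr
    _ = _ := by ring

/-- After translation the singular factor `y^μ` does not depend on `s`; only the smooth weight is
differentiated. So no condition beyond `μ > -1` is needed at the endpoint. -/
theorem hasDerivAt_halfI {μ : ℝ} (hμ : -1 < μ) {p q : ℂ} (h : (p + q).re + μ < -1) (s : ℝ) :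
    HasDerivAt (halfI μ p q) (Complex.I * p * halfI μ (p - 1) q s -
      Complex.I * q * halfI μ p (q - 1) s) s := by
  have e1 : (p - 1 + q).re = (p + q).re - 1 := by simp; ring
  have e2 : (p + (q - 1)).re = (p + q).re - 1 := by simp; ring
  have i1 := integrableOn_halfI hμ (p := p - 1) (q := q) (by rw [e1]; linarith) s
  have i2 := integrableOn_halfI hμ (p := p) (q := q - 1) (by rw [e2]; linarith) s
  set K : ℝ := ‖p‖ * gC (p - 1) q (|s| + 1) + ‖q‖ * gC p (q - 1) (|s| + 1) with hK
  have key := hasDerivAt_integral_of_dominated_loc_of_deriv_le (μ := volume.restrict (Set.Ioi 0))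
    (F := fun s (y : ℝ) => ((y ^ μ : ℝ) : ℂ) * gW p q (s + y))
    (F' := fun s (y : ℝ) => ((y ^ μ : ℝ) : ℂ) * (Complex.I * p * gW (p - 1) q (s + y) -
      Complex.I * q * gW p (q - 1) (s + y)))
    (bound := fun y => K * (y ^ μ * (1 + y) ^ (p + q).re)) (x₀ := s) (s := Metric.ball s 1)
    (Metric.ball_mem_nhds s one_pos)
    (Eventually.of_forall fun s => aestronglyMeasurable_halfI _ _ _ _ _)
    (integrableOn_halfI hμ h s) ?_ ?_ ((integrableOn_rpow_mul_one_add_rpow hμ h).const_mul K) ?_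
  · convert! key.2 using 1
    rw [halfI, halfI, ← integral_const_mul, ← integral_const_mul, ← integral_sub (i1.const_mul _)
      (i2.const_mul _)]
    refine integral_congr_ae (Eventually.of_forall fun y => ?_)
    simp only; ring
  · have h1 : Measurable (gW (p - 1) q) := (gW_continuous _ _).measurable
    have h2 : Measurable (gW p (q - 1)) := (gW_continuous _ _).measurable
    apply Measurable.aestronglyMeasurable
    fun_prop
  · filter_upwards [ae_restrict_mem measurableSet_Ioi] with y hy x hx
    have hy' : (0 : ℝ) < y := hy
    have hxr : |x| ≤ |s| + 1 := by
      rw [Metric.mem_ball, Real.dist_eq] at hx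
      have := abs_sub_abs_le_abs_sub x s
      linarith
    have b1 := norm_gW_shift_le (p := p - 1) (q := q) (by rw [e1]; linarith) hxr hy'.le
    have b2 := norm_gW_shift_le (p := p) (q := q - 1) (by rw [e2]; linarith) hxr hy'.le
    -- Lowering an exponent improves the decay, so the majorant of the undifferentiated integrand
    -- serves both terms.
    have hle : (1 + y) ^ ((p + q).re - 1) ≤ (1 + y) ^ (p + q).re :=
      Real.rpow_le_rpow_of_exponent_le (by linarith) (by linarith)
    rw [e1] at b1
    rw [e2] at b2
    rw [norm_mul, Complex.norm_real, Real.norm_of_nonneg (Real.rpow_nonneg hy'.le _)]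
    have hb : ‖Complex.I * p * gW (p - 1) q (x + y) - Complex.I * q * gW p (q - 1) (x + y)‖ ≤
        K * (1 + y) ^ (p + q).re := by
      refine (norm_sub_le _ _).trans ?_
      simp only [norm_mul, Complex.norm_I, one_mul]
      rw [hK, add_mul, mul_assoc, mul_assoc]
      have g1 := gC_nonneg (p - 1) q (|s| + 1)
      have g2 := gC_nonneg p (q - 1) (|s| + 1)
      gcongr
      · exact b1.trans (by gcongr)
      · exact b2.trans (by gcongr)
    calc _ ≤ y ^ μ * (K * (1 + y) ^ (p + q).re) := by gcongr
      _ = _ := by ring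
  · refine Eventually.of_forall fun y x _ => ?_
    exact ((gW_hasDerivAt p q (x + y)).comp_add_const x y).const_mul _

/-- The derivative of `y^(μ+1) gW p q (s + y)` integrates to zero: the boundary terms vanish because
`μ + 1 > 0` and because of the decay at infinity. -/
theorem halfI_euler {μ : ℝ} (hμ : -1 < μ) {p q : ℂ} (h : (p + q).re + μ < -1) (s : ℝ) :
    (1 + μ + p + q) * halfI μ p q s = p * (1 + Complex.I * s) * halfI μ (p - 1) q s +
      q * (1 - Complex.I * s) * halfI μ p (q - 1) s := by
  have e1 : (p - 1 + q).re = (p + q).re - 1 := by simp; ring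
  have e2 : (p + (q - 1)).re = (p + q).re - 1 := by simp; ring
  have i0 := integrableOn_halfI hμ (p := p) (q := q) h s
  have i1 := integrableOn_halfI hμ (p := p - 1) (q := q) (by rw [e1]; linarith) s
  have i2 := integrableOn_halfI hμ (p := p) (q := q - 1) (by rw [e2]; linarith) s
  set F' : ℝ → ℂ := fun y => (1 + μ + p + q) * (((y ^ μ : ℝ) : ℂ) * gW p q (s + y)) -
    p * (1 + Complex.I * s) * (((y ^ μ : ℝ) : ℂ) * gW (p - 1) q (s + y)) -
    q * (1 - Complex.I * s) * (((y ^ μ : ℝ) : ℂ) * gW p (q - 1) (s + y)) with hF'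
  have hF'i : IntegrableOn F' (Set.Ioi 0) :=
    ((i0.const_mul _).sub (i1.const_mul _)).sub (i2.const_mul _)
  have hsplit : ∫ y in Set.Ioi (0 : ℝ), F' y = (1 + μ + p + q) * halfI μ p q s -
      p * (1 + Complex.I * s) * halfI μ (p - 1) q s -
      q * (1 - Complex.I * s) * halfI μ p (q - 1) s := by
    have h1 := integral_sub ((i0.const_mul (1 + μ + p + q)).sub
      (i1.const_mul (p * (1 + Complex.I * s)))) (i2.const_mul (q * (1 - Complex.I * s)))
    have h2 := integral_sub (i0.const_mul (1 + μ + p + q)) (i1.const_mul (p * (1 + Complex.I * s)))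
    simp only [Pi.sub_apply] at h1
    rw [hF', h1, h2]
    simp only [integral_const_mul, halfI]
  have hzero : ∫ y in Set.Ioi (0 : ℝ), F' y = 0 := by
    have := integral_Ioi_of_hasDerivAt_of_tendsto (a := 0) (m := 0)
      (f := fun y : ℝ => ((y ^ (μ + 1) : ℝ) : ℂ) * gW p q (s + y)) (f' := F') ?_ ?_ hF'i ?_
    · rw [this, Real.zero_rpow (by linarith)]; simp
    · refine ContinuousAt.continuousWithinAt ?_
      refine ContinuousAt.mul ?_ ?_
      · exact Complex.continuous_ofReal.continuousAt.comp
          (Real.continuousAt_rpow_const _ _ (Or.inr (by linarith)))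
      · exact ((gW_continuous p q).comp (continuous_const.add continuous_id)).continuousAt
    · intro y hy
      have hy' : (0 : ℝ) < y := hy
      have d1 : HasDerivAt (fun y : ℝ => ((y ^ (μ + 1) : ℝ) : ℂ))
          ((((μ + 1) * y ^ μ : ℝ)) : ℂ) y := by
        have := Real.hasDerivAt_rpow_const (x := y) (p := μ + 1) (Or.inl hy'.ne')
        rw [add_sub_cancel_right] at this
        exact this.ofReal_comp
      have d2 : HasDerivAt (fun y : ℝ => gW p q (s + y)) _ y :=
        (gW_hasDerivAt p q (s + y)).comp_const_add s y
      convert! d1.mul d2 using 1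
      rw [hF', Real.rpow_add hy', Real.rpow_one]
      -- The extra factor is rewritten by `i y = (1 + i (s + y)) - (1 + i s)` and its conjugate,
      -- which restores `gW p q`.
      have g1 := gW_sub_left p q (s + y)
      have g2 := gW_sub_right p q (s + y)
      push_cast at g1 g2 ⊢
      linear_combination ((y ^ μ : ℝ) : ℂ) * p * g1 + ((y ^ μ : ℝ) : ℂ) * q * g2
    · rw [tendsto_zero_iff_norm_tendsto_zero]
      have hlim : Tendsto (fun y : ℝ => gC p q |s| * y ^ (μ + 1 + (p + q).re)) atTop (𝓝 0) := by
        have := (tendsto_rpow_neg_atTop (y := -(μ + 1 + (p + q).re)) (by linarith)).const_mul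
          (gC p q |s|)
        simpa using this
      refine squeeze_zero' (Eventually.of_forall fun y => norm_nonneg _) ?_ hlim
      filter_upwards [eventually_gt_atTop 0] with y hy
      rw [norm_mul, Complex.norm_real, Real.norm_of_nonneg (Real.rpow_nonneg hy.le _)]
      have b := norm_gW_shift_le (p := p) (q := q) (by linarith) (le_refl |s|) hy.le
      have b' : (1 + y) ^ (p + q).re ≤ y ^ (p + q).re :=
        Real.rpow_le_rpow_of_nonpos hy (by linarith) (by linarith)
      have g := gC_nonneg p q |s|
      calc _ ≤ y ^ (μ + 1) * (gC p q |s| * y ^ (p + q).re) := by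
            gcongr; exact b.trans (by gcongr)
        _ = _ := by rw [Real.rpow_add hy (μ + 1)]; ring
  rw [hsplit] at hzero
  linear_combination hzero

/-- This is `(1 - i x) + (1 + i x) = 2` under the integral sign. -/
theorem halfI_add {μ : ℝ} (hμ : -1 < μ) {p q : ℂ} (h : (p + q).re + μ < -1) (s : ℝ) :
    halfI μ p q s + halfI μ (p + 1) (q - 1) s = 2 * halfI μ p (q - 1) s := by
  have e1 : (p + 1 + (q - 1)).re = (p + q).re := by simp
  have e2 : (p + (q - 1)).re = (p + q).re - 1 := by simp; ring
  have i0 := integrableOn_halfI hμ (p := p) (q := q) h s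
  have i1 := integrableOn_halfI hμ (p := p + 1) (q := q - 1) (by rw [e1]; linarith) s
  rw [halfI, halfI, halfI, ← integral_add i0 i1, ← integral_const_mul]
  refine integral_congr_ae (Eventually.of_forall fun y => ?_)
  simp only
  rw [gW_sub_right p q, gW_add_left]
  ring

/-- `∫ |x - s|^μ (a 1_{x ≤ s} + b 1_{x > s}) (1 + i x)^p (1 - i x)^q dx`. -/
def fullI (μ : ℝ) (a b p q : ℂ) (s : ℝ) : ℂ := b * halfI μ p q s + a * halfI μ q p (-s)

variable {μ : ℝ} {p q : ℂ}

theorem hasDerivAt_fullI (hμ : -1 < μ) (h : (p + q).re + μ < -1) (a b : ℂ) (s : ℝ) :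
    HasDerivAt (fullI μ a b p q) (Complex.I * p * fullI μ a b (p - 1) q s -
      Complex.I * q * fullI μ a b p (q - 1) s) s := by
  have h' : (q + p).re + μ < -1 := by rwa [add_comm q p]
  have d1 := hasDerivAt_halfI hμ h s
  have d2 := (hasDerivAt_halfI hμ h' (-s)).scomp s (hasDerivAt_neg s)
  convert! (d1.const_mul b).add (d2.const_mul a) using 1
  simp only [fullI, neg_smul, one_smul]; ring

theorem fullI_euler (hμ : -1 < μ) (h : (p + q).re + μ < -1) (a b : ℂ) (s : ℝ) :
    (1 + μ + p + q) * fullI μ a b p q s = p * (1 + Complex.I * s) * fullI μ a b (p - 1) q s +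
      q * (1 - Complex.I * s) * fullI μ a b p (q - 1) s := by
  have h' : (q + p).re + μ < -1 := by rwa [add_comm q p]
  have d1 := halfI_euler hμ h s
  have d2 := halfI_euler hμ h' (-s)
  push_cast at d2
  simp only [fullI]
  linear_combination b * d1 + a * d2

theorem fullI_add (hμ : -1 < μ) (h : (p + q).re + μ < -1) (a b : ℂ) (s : ℝ) :
    fullI μ a b p q s + fullI μ a b (p + 1) (q - 1) s = 2 * fullI μ a b p (q - 1) s := by
  have h' : (q - 1 + (p + 1)).re + μ < -1 := by
    rw [show q - 1 + (p + 1) = p + q by ring]; exact h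
  have d1 := halfI_add hμ h s
  have d2 := halfI_add hμ h' (-s)
  rw [sub_add_cancel, add_sub_cancel_right] at d2
  simp only [fullI]
  linear_combination b * d1 + a * d2

/-- Contiguity relation: `fullI_euler` and `fullI_add` eliminate the integrals of total exponent `p
+ q - 1` from the derivative. Only neighbours with the same `p + q` remain, that is, adjacent
diagonals of the Toeplitz matrix. -/
theorem fullI_raise (hμ : -1 < μ) (h : (p + q).re + μ < -1) (a b : ℂ) (s : ℝ) :
    HasDerivAt (fullI μ a b p q) ((s + Complex.I) / (1 + s ^ 2) *
      ((1 + μ + p) * fullI μ a b p q s - q * fullI μ a b (p + 1) (q - 1) s)) s := by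
  convert! hasDerivAt_fullI hμ h a b s using 1
  have e := fullI_euler hμ h a b s
  have f := fullI_add hμ h a b s
  have hs : (1 + s ^ 2 : ℂ) ≠ 0 := by
    exact_mod_cast (by positivity : (1 + s ^ 2 : ℝ) ≠ 0)
  rw [div_mul_eq_mul_div, div_eq_iff hs]
  linear_combination (s + Complex.I) * e - (s + Complex.I) * q * f +
    (p * s * fullI μ a b (p - 1) q s - q * s * fullI μ a b p (q - 1) s) * Complex.I_sq

theorem fullI_lower (hμ : -1 < μ) (h : (p + q).re + μ < -1) (a b : ℂ) (s : ℝ) :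
    HasDerivAt (fullI μ a b p q) ((s - Complex.I) / (1 + s ^ 2) *
      ((1 + μ + q) * fullI μ a b p q s - p * fullI μ a b (p - 1) (q + 1) s)) s := by
  convert! hasDerivAt_fullI hμ h a b s using 1
  have e := fullI_euler hμ h a b s
  have f := fullI_add hμ (p := p - 1) (q := q + 1) (by simpa using h) a b s
  rw [sub_add_cancel, add_sub_cancel_right] at f
  have hs : (1 + s ^ 2 : ℂ) ≠ 0 := by
    exact_mod_cast (by positivity : (1 + s ^ 2 : ℝ) ≠ 0)
  rw [div_mul_eq_mul_div, div_eq_iff hs]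
  linear_combination (s - Complex.I) * e - (s - Complex.I) * p * f +
    (q * s * fullI μ a b p (q - 1) s - p * s * fullI μ a b (p - 1) q s) * Complex.I_sq

theorem contDiff_fullI (hμ : -1 < μ) (h : (p + q).re + μ < -1) (a b : ℂ) (n : ℕ) :
    ContDiff ℝ n (fullI μ a b p q) := by
  induction n generalizing p q with
  | zero =>
    exact contDiff_zero.mpr
      (continuous_iff_continuousAt.mpr fun s => (hasDerivAt_fullI hμ h a b s).continuousAt)
  | succ n ih =>
    have hd : deriv (fullI μ a b p q) = fun s => Complex.I * p * fullI μ a b (p - 1) q s -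
        Complex.I * q * fullI μ a b p (q - 1) s :=
      funext fun s => (hasDerivAt_fullI hμ h a b s).deriv
    push_cast
    rw [contDiff_succ_iff_deriv]
    refine ⟨fun s => (hasDerivAt_fullI hμ h a b s).differentiableAt, by simp, ?_⟩
    rw [hd]
    refine (contDiff_const.mul (ih ?_)).sub (contDiff_const.mul (ih ?_))
    · simp at h ⊢; linarith
    · simp at h ⊢; linarith

end

/-! ### The averages as determinants -/

/-- The kernel `|y|^μ (a 1_{y ≤ 0} + b 1_{y > 0})`. -/
def kap (μ : ℝ) (a b : ℂ) (y : ℝ) : ℂ :=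
  if y ≤ 0 then a * (((-y) ^ μ : ℝ) : ℂ) else b * ((y ^ μ : ℝ) : ℂ)

theorem kap_mul_gW (μ : ℝ) (a b : ℂ) (hμ : -1 < μ) {p q : ℂ} (h : (p + q).re + μ < -1) (s : ℝ) :
    Integrable (fun x => kap μ a b (x - s) * gW p q x) ∧
      ∫ x, kap μ a b (x - s) * gW p q x = fullI μ a b p q s := by
  have h' : (q + p).re + μ < -1 := by rwa [add_comm q p]
  set F : ℝ → ℂ := fun y => kap μ a b y * gW p q (s + y) with hF
  have hFx : (fun x => kap μ a b (x - s) * gW p q x) = fun x => F (x - s) := by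
    funext x; simp [hF]
  have e1 : Set.EqOn F (fun y => b * (((y ^ μ : ℝ) : ℂ) * gW p q (s + y))) (Set.Ioi 0) := by
    intro y hy
    have hy' : ¬ y ≤ 0 := not_le.mpr hy
    simp only [hF, kap, if_neg hy']; ring
  have e2 : Set.EqOn (fun y => F (-y)) (fun y => a * (((y ^ μ : ℝ) : ℂ) * gW q p (-s + y)))
      (Set.Ioi 0) := by
    intro y hy
    have hy' : -y ≤ 0 := neg_nonpos.mpr (le_of_lt hy)
    simp only [hF, kap, if_pos hy', neg_neg]
    rw [show s + -y = -(-s + y) by ring, gW_neg]; ring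
  have i1 : IntegrableOn F (Set.Ioi 0) :=
    IntegrableOn.congr_fun (Integrable.const_mul (integrableOn_halfI hμ h s) b) e1.symm
      measurableSet_Ioi
  have i2' : IntegrableOn (fun y => F (-y)) (Set.Ioi 0) :=
    IntegrableOn.congr_fun (Integrable.const_mul (integrableOn_halfI hμ h' (-s)) a) e2.symm
      measurableSet_Ioi
  have i2 : IntegrableOn F (Set.Iic 0) := by
    rw [integrableOn_Iic_iff_integrableOn_Iio]
    have := i2'.comp_neg
    simpa using this
  have hi : Integrable F := by
    rw [← integrableOn_univ, ← Set.Iic_union_Ioi (a := (0 : ℝ))]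
    exact i2.union i1
  refine ⟨by rw [hFx]; exact hi.comp_sub_right s, ?_⟩
  rw [hFx, integral_sub_right_eq_self F s, ← setIntegral_univ, ← Set.Iic_union_Ioi (a := (0 : ℝ)),
    setIntegral_union (Set.Iic_disjoint_Ioi le_rfl) measurableSet_Ioi i2 i1,
    setIntegral_congr_fun measurableSet_Ioi e1, ← neg_zero, ← integral_comp_neg_Ioi, neg_zero,
    setIntegral_congr_fun measurableSet_Ioi e2, integral_const_mul, integral_const_mul, fullI,
    halfI, halfI, add_comm]

theorem gW_shift (p q : ℂ) (n m : ℕ) (x : ℝ) :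
    gW (p + n) (q + m) x = (1 + Complex.I * x) ^ n * (1 - Complex.I * x) ^ m * gW p q x := by
  rw [gW, gW, Complex.cpow_add _ _ (one_add_ne_zero' x), Complex.cpow_add _ _ (one_sub_ne_zero' x),
    Complex.cpow_natCast, Complex.cpow_natCast]
  ring

theorem cut_mul_branchPow (ξ : ℂ) (μ s x : ℝ) :
    cut ξ s x * branchPow s x μ =
      kap μ 1 ((1 - ξ) * Complex.exp (-(Real.pi * Complex.I * μ))) (x - s) := by
  rcases le_or_gt x s with h | h
  · rw [cut, branchPow, kap, if_neg (not_lt.mpr h), if_pos h, if_pos (by linarith), neg_sub,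
      Complex.ofReal_cpow (by linarith)]
  · rw [cut, branchPow, kap, if_pos h, if_neg (not_le.mpr h), if_neg (by linarith),
      Complex.ofReal_cpow (by linarith)]
    ring

theorem cauchyWeight_eq (η₁ η₂ x : ℝ) :
    cauchyWeight η₁ η₂ x = gW (-(η₁ + Complex.I * η₂)) (-(η₁ - Complex.I * η₂)) x := by
  rw [cauchyWeight, gW, Complex.cpow_neg, Complex.cpow_neg, one_div, mul_inv]

/-- The normalisation between the two forms of the squared Vandermonde determinant. -/
def pairConst (N : ℕ) : ℂ := ∏ i : Fin N, ∏ _j ∈ Finset.Ioi i, (4 : ℂ)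

theorem pairConst_ne_zero (N : ℕ) : pairConst N ≠ 0 :=
  Finset.prod_ne_zero_iff.mpr fun _ _ => Finset.prod_ne_zero_iff.mpr fun _ _ => by norm_num

/-- The homogeneous Vandermonde determinant in the pairs `(1 + i x, 1 - i x)` has factors `2 i (x_j
- x_i)`; with the two entries exchanged the factors are `-2 i (x_j - x_i)`. Their product is `4 (x_j
- x_i)²` for each pair. Both determinants have degree `N - 1` in every variable, which shifts `p -
(N - 1)` to `p + j - k` in the entries. -/
theorem integral_prod_mul_vandermonde_sq (N : ℕ) (k : ℝ → ℂ) (p q : ℂ)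
    (h : ∀ i j : Fin N, Integrable fun x =>
      k x * gW (p + ((i : ℕ) : ℂ) - ((j : ℕ) : ℂ)) (q - ((i : ℕ) : ℂ) + ((j : ℕ) : ℂ)) x) :
    Integrable (fun x : Fin N → ℝ => (∏ l, k (x l) * gW (p - (N - 1)) (q - (N - 1)) (x l)) *
      ∏ i, ∏ j ∈ Finset.Ioi i, ((x j - x i : ℝ) : ℂ) ^ 2) ∧
    pairConst N * ∫ x : Fin N → ℝ, (∏ l, k (x l) * gW (p - (N - 1)) (q - (N - 1)) (x l)) *
      ∏ i, ∏ j ∈ Finset.Ioi i, ((x j - x i : ℝ) : ℂ) ^ 2 =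
    (N.factorial : ℂ) * (Matrix.of fun i j : Fin N => ∫ x,
      k x * gW (p + ((i : ℕ) : ℂ) - ((j : ℕ) : ℂ)) (q - ((i : ℕ) : ℂ) + ((j : ℕ) : ℂ)) x).det := by
  set w : ℝ → ℂ := fun x => k x * gW (p - (N - 1)) (q - (N - 1)) x with hw
  set φ : Fin N → ℝ → ℂ := fun j x =>
    w x * ((1 + Complex.I * x) ^ (j : ℕ) * (1 - Complex.I * x) ^ (j.rev : ℕ)) with hφ
  set ψ : Fin N → ℝ → ℂ := fun j x =>
    (1 - Complex.I * x) ^ (j : ℕ) * (1 + Complex.I * x) ^ (j.rev : ℕ) with hψ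
  have hφψ : ∀ i j, (fun x => φ i x * ψ j x) = fun x =>
      k x * gW (p + ((i : ℕ) : ℂ) - ((j : ℕ) : ℂ)) (q - ((i : ℕ) : ℂ) + ((j : ℕ) : ℂ)) x := by
    intro i j
    funext x
    have hr : ∀ i : Fin N, ((i.rev : ℕ) : ℂ) = N - 1 - ((i : ℕ) : ℂ) := by
      intro i
      rw [Fin.val_rev, Nat.cast_sub (by omega)]; push_cast; ring
    have e := gW_shift (p - (N - 1)) (q - (N - 1)) (i + j.rev : ℕ) (i.rev + j : ℕ) x
    rw [show p - (N - 1) + ((i + j.rev : ℕ) : ℂ) = p + ((i : ℕ) : ℂ) - ((j : ℕ) : ℂ) by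
        push_cast; rw [hr]; ring,
      show q - (N - 1) + ((i.rev + j : ℕ) : ℂ) = q - ((i : ℕ) : ℂ) + ((j : ℕ) : ℂ) by
        push_cast; rw [hr]; ring] at e
    rw [e, hφ, hψ, hw, pow_add, pow_add]
    ring
  have hdet : ∀ x : Fin N → ℝ, (Matrix.of fun l j => φ j (x l)).det *
      (Matrix.of fun l j => ψ j (x l)).det = pairConst N * ((∏ l, w (x l)) *
        ∏ i, ∏ j ∈ Finset.Ioi i, ((x j - x i : ℝ) : ℂ) ^ 2) := by
    intro x
    have e1 : (Matrix.of fun l j => φ j (x l)).det = (∏ l, w (x l)) *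
        (Matrix.projVandermonde (fun l => 1 + Complex.I * x l)
          (fun l => 1 - Complex.I * x l)).det := by
      rw [← Matrix.det_mul_column]
      rfl
    have e2 : (Matrix.of fun l j => ψ j (x l)) = Matrix.projVandermonde
        (fun l => 1 - Complex.I * x l) (fun l => 1 + Complex.I * x l) := rfl
    rw [e1, e2, Matrix.det_projVandermonde, Matrix.det_projVandermonde, pairConst, mul_assoc,
      mul_left_comm (∏ i : Fin N, ∏ _j ∈ Finset.Ioi i, (4 : ℂ))]
    congr 1
    rw [← Finset.prod_mul_distrib, ← Finset.prod_mul_distrib]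
    refine Finset.prod_congr rfl fun i _ => ?_
    rw [← Finset.prod_mul_distrib, ← Finset.prod_mul_distrib]
    refine Finset.prod_congr rfl fun j _ => ?_
    push_cast
    linear_combination (-4 * ((x j : ℂ) - x i) ^ 2) * Complex.I_sq
  have hA := integral_det_mul_det volume φ ψ (fun i j => by rw [hφψ]; exact h i j)
  simp only [hφψ] at hA
  simp only [hdet] at hA
  rw [integral_const_mul] at hA
  refine ⟨?_, hA.2⟩
  have := hA.1.const_mul (pairConst N)⁻¹
  simp only [inv_mul_cancel_left₀ (pairConst_ne_zero N)] at this
  exact this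

/-- `det [I_{p + j - k, q - j + k}]_{j, k < n}`. -/
def hdet (μ : ℝ) (a b p q : ℂ) (n : ℕ) (s : ℝ) : ℂ :=
  (Matrix.of fun j k : Fin n =>
    fullI μ a b (p + ((j : ℕ) : ℂ) - ((k : ℕ) : ℂ)) (q - ((j : ℕ) : ℂ) + ((k : ℕ) : ℂ)) s).det

theorem shift_re (p q x y : ℂ) : (p + x - y + (q - x + y)).re = (p + q).re := by
  congr 1; ring

theorem contDiff_hdet {μ : ℝ} (hμ : -1 < μ) {p q : ℂ} (h : (p + q).re + μ < -1) (a b : ℂ)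
    (n m : ℕ) : ContDiff ℝ m (hdet μ a b p q n) := by
  unfold hdet
  simp only [Matrix.det_apply', Matrix.of_apply]
  refine ContDiff.sum fun σ _ => contDiff_const.mul (contDiff_prod fun i _ => ?_)
  exact contDiff_fullI hμ (by rwa [shift_re]) a b m

/-- For `q` conjugate to `p` the factor `(1 + i x)^p (1 - i x)^q` equals `|(1 + i x)^p|²`. The
matrix is then the Gram matrix of the powers of the Cayley transform `c = (1 + i x)/(1 - i x)`,
which has modulus one and is injective, for a nonnegative weight positive on a half line. -/
theorem hdet_ne_zero {μ : ℝ} (hμ : -1 < μ) {p q : ℂ} (h : (p + q).re + μ < -1)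
    (hpq : (starRingEnd ℂ) p = q) {a b : ℝ} (ha : 0 ≤ a) (hb : 0 ≤ b) (hab : 0 < a ∨ 0 < b)
    (n : ℕ) (s : ℝ) : hdet μ a b p q n s ≠ 0 := by
  set c : ℝ → ℂ := fun x => (1 + Complex.I * x) / (1 - Complex.I * x) with hc
  have hconj : ∀ x : ℝ, (starRingEnd ℂ) (1 + Complex.I * x) = 1 - Complex.I * x := by
    intro x; simp [sub_eq_add_neg]
  set w : ℝ → ℝ := fun x => (if x - s ≤ 0 then a * (-(x - s)) ^ μ else b * (x - s) ^ μ) *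
    ‖(1 + Complex.I * x : ℂ) ^ p‖ ^ 2 with hw
  have hwg : ∀ x, (w x : ℂ) = kap μ a b (x - s) * gW p q x := by
    intro x
    have h1 : (1 - Complex.I * x : ℂ) ^ q = (starRingEnd ℂ) ((1 + Complex.I * x) ^ p) := by
      rw [← hconj, ← hpq, Complex.conj_cpow_eq_ite, if_neg]
      · simp
      · exact Complex.slitPlane_arg_ne_pi (one_add_mem_slitPlane x)
    rw [gW, h1, Complex.mul_conj', kap]
    simp only [hw]
    split_ifs <;> push_cast <;> ring
  have hentry : ∀ j k : Fin n, ∀ x : ℝ, (w x : ℂ) * (c x ^ (j : ℕ) *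
      (starRingEnd ℂ) (c x ^ (k : ℕ))) = kap μ a b (x - s) *
        gW (p + ((j : ℕ) : ℂ) - ((k : ℕ) : ℂ)) (q - ((j : ℕ) : ℂ) + ((k : ℕ) : ℂ)) x := by
    intro j k x
    have h1 := one_add_ne_zero' x
    have h2 := one_sub_ne_zero' x
    have hcc : (starRingEnd ℂ) (1 - Complex.I * x) = 1 + Complex.I * x := by
      rw [← hconj, Complex.conj_conj]
    have e1 := gW_shift (p - ((k : ℕ) : ℂ)) (q - ((j : ℕ) : ℂ)) j k x
    have e2 := gW_shift (p - ((k : ℕ) : ℂ)) (q - ((j : ℕ) : ℂ)) k j x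
    rw [sub_add_cancel, sub_add_cancel] at e2
    rw [show p + ((j : ℕ) : ℂ) - ((k : ℕ) : ℂ) = p - ((k : ℕ) : ℂ) + ((j : ℕ) : ℂ) by ring, e1,
      hwg, e2, hc]
    simp only [map_pow, map_div₀, hconj, hcc, div_pow]
    field_simp
  have hI : ∀ j k : Fin n, Integrable (fun x => (w x : ℂ) * (c x ^ (j : ℕ) *
      (starRingEnd ℂ) (c x ^ (k : ℕ)))) ∧ ∫ x, (w x : ℂ) * (c x ^ (j : ℕ) *
      (starRingEnd ℂ) (c x ^ (k : ℕ))) = fullI μ a b (p + ((j : ℕ) : ℂ) - ((k : ℕ) : ℂ))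
        (q - ((j : ℕ) : ℂ) + ((k : ℕ) : ℂ)) s := by
    intro j k
    simp only [hentry]
    exact kap_mul_gW μ a b hμ (by rwa [shift_re]) s
  have hpos : ∀ x : ℝ, 0 < ‖(1 + Complex.I * x : ℂ) ^ p‖ ^ 2 := fun x => by
    have : (1 + Complex.I * x : ℂ) ^ p ≠ 0 := by
      rw [Complex.cpow_def_of_ne_zero (one_add_ne_zero' x)]; exact Complex.exp_ne_zero _
    positivity
  have hnn : ∀ x, 0 ≤ w x := by
    intro x
    simp only [hw]
    refine mul_nonneg ?_ (hpos x).le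
    split_ifs with hx
    · exact mul_nonneg ha (Real.rpow_nonneg (by linarith) _)
    · exact mul_nonneg hb (Real.rpow_nonneg (by linarith) _)
  have hinj : Function.Injective c := by
    intro x y hxy
    simp only [hc] at hxy
    rw [div_eq_div_iff (one_sub_ne_zero' x) (one_sub_ne_zero' y)] at hxy
    have : (2 * Complex.I) * ((x : ℂ) - y) = 0 := by linear_combination hxy
    have h2 : (x : ℂ) - y = 0 := by
      rcases mul_eq_zero.mp this with h | h
      · simp at h
      · exact h
    exact_mod_cast sub_eq_zero.mp h2
  have hφ : ∀ y : Fin n → ℝ, Function.Injective y →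
      (Matrix.of fun l (j : Fin n) => c (y l) ^ (j : ℕ)).det ≠ 0 := by
    intro y hy
    exact Matrix.det_vandermonde_ne_zero_iff.mpr (hinj.comp hy)
  have key := det_gram_ne_zero (fun (j : Fin n) x => c x ^ (j : ℕ)) w
    (if 0 < a then Set.Iio s else Set.Ioi s) (by split_ifs <;> simp) hnn ?_
    (fun j k => (hI j k).1) hφ
  · simp only [fun j k => (hI j k).2] at key
    exact key
  · intro x hx
    simp only [hw]
    refine mul_pos ?_ (hpos x)
    split_ifs at hx with h0
    · have hx' : x < s := hx
      rw [if_pos (by linarith)]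
      exact mul_pos h0 (Real.rpow_pos_of_pos (by linarith) _)
    · have hx' : s < x := hx
      rw [if_neg (by linarith)]
      exact mul_pos (hab.resolve_left h0) (Real.rpow_pos_of_pos (by linarith) _)

/-- The exponent `N - 1 - η₁ - i η₂`. -/
def pCy (N : ℕ) (η₁ η₂ : ℝ) : ℂ := N - 1 - η₁ - Complex.I * η₂

/-- The exponent `N - 1 - η₁ + i η₂`. -/
def qCy (N : ℕ) (η₁ η₂ : ℝ) : ℂ := N - 1 - η₁ + Complex.I * η₂

/-- The relative weight of the half line `x > s`. -/
def bWt (ξ : ℂ) (μ : ℝ) : ℂ := (1 - ξ) * Complex.exp (-(Real.pi * Complex.I * μ))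

theorem conj_pCy (N : ℕ) (η₁ η₂ : ℝ) : (starRingEnd ℂ) (pCy N η₁ η₂) = qCy N η₁ η₂ := by
  simp [pCy, qCy]

theorem pCy_add_qCy_re (N : ℕ) (η₁ η₂ : ℝ) :
    (pCy N η₁ η₂ + qCy N η₁ η₂).re = 2 * N - 2 - 2 * η₁ := by
  simp [pCy, qCy]; ring

theorem exponent_lt {N : ℕ} {μ η₁ : ℝ} (η₂ : ℝ) (h : 2 * (N : ℝ) - 1 + μ < 2 * η₁) :
    (pCy N η₁ η₂ + qCy N η₁ η₂).re + μ < -1 := by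
  rw [pCy_add_qCy_re]; linarith

theorem cauchyIntegrand_eq (N : ℕ) (η₁ η₂ μ : ℝ) (ξ : ℂ) (s : ℝ) (x : Fin N → ℝ) :
    cauchyIntegrand N η₁ η₂ μ ξ s x = (∏ l, kap μ 1 (bWt ξ μ) (x l - s) *
      gW (pCy N η₁ η₂ - (N - 1)) (qCy N η₁ η₂ - (N - 1)) (x l)) *
      ∏ i, ∏ j ∈ Finset.Ioi i, ((x j - x i : ℝ) : ℂ) ^ 2 := by
  rw [cauchyIntegrand]
  congr 1
  refine Finset.prod_congr rfl fun l _ => ?_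
  rw [← mul_assoc, cut_mul_branchPow, cauchyWeight_eq, bWt]
  congr 2 <;> simp only [pCy, qCy] <;> ring

theorem cauchyE_eq_hdet (N : ℕ) {η₁ μ : ℝ} (η₂ : ℝ) (hμ : -1 < μ)
    (h : 2 * (N : ℝ) - 1 + μ < 2 * η₁) (ξ C : ℂ) :
    (∀ s : ℝ, Integrable (cauchyIntegrand N η₁ η₂ μ ξ s)) ∧
    ∀ s, cauchyE C N η₁ η₂ μ ξ s = 1 / C * (N.factorial / pairConst N *
      hdet μ 1 (bWt ξ μ) (pCy N η₁ η₂) (qCy N η₁ η₂) N s) := by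
  have hI : ∀ s, ∀ i j : Fin N, _ := fun s i j =>
    kap_mul_gW μ 1 (bWt ξ μ) hμ (p := pCy N η₁ η₂ + ((i : ℕ) : ℂ) - ((j : ℕ) : ℂ))
      (q := qCy N η₁ η₂ - ((i : ℕ) : ℂ) + ((j : ℕ) : ℂ))
      (by rw [shift_re]; exact exponent_lt η₂ h) s
  have key := fun s => integral_prod_mul_vandermonde_sq N (fun x => kap μ 1 (bWt ξ μ) (x - s))
    (pCy N η₁ η₂) (qCy N η₁ η₂) (fun i j => (hI s i j).1)
  have hfun : ∀ s, cauchyIntegrand N η₁ η₂ μ ξ s = _ :=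
    fun s => funext fun x => cauchyIntegrand_eq N η₁ η₂ μ ξ s x
  refine ⟨fun s => ?_, fun s => ?_⟩
  · rw [hfun]; exact (key s).1
  · rw [cauchyE, hfun]
    congr 1
    have e := (key s).2
    simp only [fun i j => (hI s i j).2] at e
    rw [div_mul_eq_mul_div, eq_div_iff (pairConst_ne_zero N), mul_comm, e, hdet]

/-! ### The Hankel determinant of iterated derivatives -/

/-- `(1 + s²) d/ds`. -/
def opD (g : ℝ → ℂ) (s : ℝ) : ℂ := (1 + (s : ℂ) ^ 2) * deriv g s

theorem one_add_sq_ne_zero (s : ℝ) : (1 + (s : ℂ) ^ 2) ≠ 0 := by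
  exact_mod_cast (by positivity : (1 + s ^ 2 : ℝ) ≠ 0)

theorem contDiff_opD {f : ℝ → ℂ} (hf : ∀ n : ℕ, ContDiff ℝ n f) (n : ℕ) :
    ContDiff ℝ n (opD f) := by
  have h1 : ContDiff ℝ n (deriv f) := by
    have := hf (n + 1)
    push_cast at this
    exact (contDiff_succ_iff_deriv.mp this).2.2
  have h2 : ContDiff ℝ n (fun s : ℝ => (1 + (s : ℂ) ^ 2)) :=
    contDiff_const.add (Complex.ofRealCLM.contDiff.pow 2)
  exact h2.mul h1

theorem contDiff_opD_iterate {f : ℝ → ℂ} (hf : ∀ n : ℕ, ContDiff ℝ n f) (i : ℕ) :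
    ∀ n : ℕ, ContDiff ℝ n (opD^[i] f) := by
  induction i with
  | zero => exact hf
  | succ i ih =>
    rw [Function.iterate_succ_apply']
    exact contDiff_opD ih

theorem hasDerivAt_opD_iterate {f : ℝ → ℂ} (hf : ∀ n : ℕ, ContDiff ℝ n f) (i : ℕ) (s : ℝ) :
    HasDerivAt (opD^[i] f) (opD^[i + 1] f s / (1 + (s : ℂ) ^ 2)) s := by
  rw [Function.iterate_succ_apply', opD, mul_div_cancel_left₀ _ (one_add_sq_ne_zero s)]
  exact (((contDiff_opD_iterate hf i 1).differentiable (by simp)) s).hasDerivAt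

open Polynomial in
/-- Substitution of `D^i f` for `X^i`. -/
def applyD (f : ℝ → ℂ) (s : ℝ) : ℂ[X] →ₗ[ℂ] ℂ :=
  Polynomial.lsum fun i => LinearMap.mulRight ℂ (opD^[i] f s)

open Polynomial in
theorem applyD_eq_sum (f : ℝ → ℂ) (s : ℝ) (R : ℂ[X]) {d : ℕ} (h : R.natDegree < d) :
    applyD f s R = ∑ i ∈ Finset.range d, R.coeff i * opD^[i] f s := by
  rw [applyD, Polynomial.lsum_apply, Polynomial.sum_over_range' _ _ _ h]
  · rfl
  · simp

open Polynomial in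
theorem applyD_X_pow (f : ℝ → ℂ) (s : ℝ) (i : ℕ) :
    applyD f s (X ^ i) = opD^[i] f s := by
  rw [applyD, Polynomial.lsum_apply, ← Polynomial.monomial_one_right_eq_X_pow,
    Polynomial.sum_monomial_index]
  · simp
  · simp

open Polynomial in
theorem applyD_C_mul (f : ℝ → ℂ) (s : ℝ) (c : ℂ) (R : ℂ[X]) :
    applyD f s (C c * R) = c * applyD f s R := by
  rw [← Polynomial.smul_eq_C_mul, map_smul, smul_eq_mul]

open Polynomial in
/-- Coefficientwise `(1 + s²) R' = R'`. -/
def CoeffDeriv (R R' : ℝ → ℂ[X]) : Prop :=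
  ∀ s i, HasDerivAt (fun s => (R s).coeff i) ((R' s).coeff i / (1 + (s : ℂ) ^ 2)) s

open Polynomial in
theorem CoeffDeriv.mul {R R' S S' : ℝ → ℂ[X]} (hR : CoeffDeriv R R') (hS : CoeffDeriv S S') :
    CoeffDeriv (fun s => R s * S s) (fun s => R' s * S s + R s * S' s) := by
  intro s i
  simp only [Polynomial.coeff_mul, Polynomial.coeff_add]
  rw [← Finset.sum_add_distrib, Finset.sum_div]
  refine (HasDerivAt.fun_sum fun x _ => (hR s x.1).mul (hS s x.2)).congr_deriv ?_
  refine Finset.sum_congr rfl fun x _ => ?_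
  ring

open Polynomial in
theorem CoeffDeriv.add {R R' S S' : ℝ → ℂ[X]} (hR : CoeffDeriv R R') (hS : CoeffDeriv S S') :
    CoeffDeriv (fun s => R s + S s) (fun s => R' s + S' s) := by
  intro s i
  simp only [Polynomial.coeff_add, add_div]
  exact (hR s i).add (hS s i)

open Polynomial in
theorem CoeffDeriv.const (R : ℂ[X]) : CoeffDeriv (fun _ => R) (fun _ => 0) := by
  intro s i
  simpa using hasDerivAt_const s (R.coeff i)

open Polynomial in
theorem CoeffDeriv.C {g g' : ℝ → ℂ} (h : ∀ s : ℝ, HasDerivAt g (g' s / (1 + (s : ℂ) ^ 2)) s) :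
    CoeffDeriv (fun s => C (g s)) (fun s => C (g' s)) := by
  intro s i
  rcases Nat.eq_zero_or_pos i with rfl | hi
  · simpa using h s
  · simpa [Polynomial.coeff_C, hi.ne'] using hasDerivAt_const s (0 : ℂ)

open Polynomial in
-- Leibniz rule for a differential operator with variable coefficients: differentiating the
-- coefficients gives `R'`, and applying `D` to each `D^i f` is multiplication by `X`.
theorem hasDerivAt_applyD {f : ℝ → ℂ} (hf : ∀ n : ℕ, ContDiff ℝ n f) {R R' : ℝ → ℂ[X]}
    (hR : CoeffDeriv R R') {d : ℕ} (hd : ∀ s, (R s).natDegree < d) (hd' : ∀ s, (R' s).natDegree < d)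
    (s : ℝ) : HasDerivAt (fun s => applyD f s (R s))
      ((applyD f s (R' s) + applyD f s (X * R s)) / (1 + (s : ℂ) ^ 2)) s := by
  have e1 : (fun s => applyD f s (R s)) = fun s =>
      ∑ i ∈ Finset.range d, (R s).coeff i * opD^[i] f s := funext fun s => applyD_eq_sum f s _ (hd s)
  have e2 : applyD f s (X * R s) = ∑ i ∈ Finset.range d, (R s).coeff i * opD^[i + 1] f s := by
    rw [applyD_eq_sum f s (X * R s) (d := d + 1), Finset.sum_range_succ']
    · simp [Polynomial.coeff_X_mul]
    · refine (Polynomial.natDegree_mul_le).trans_lt ?_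
      have := hd s
      have := Polynomial.natDegree_X_le (R := ℂ)
      omega
  rw [e1, e2, applyD_eq_sum f s _ (hd' s), ← Finset.sum_add_distrib, Finset.sum_div]
  refine (HasDerivAt.fun_sum fun i _ => (hR s i).mul (hasDerivAt_opD_iterate hf i s)).congr_deriv ?_
  refine Finset.sum_congr rfl fun x _ => ?_
  ring

/-- The coefficient of `P_j` in the recursion of `ladderPoly`. -/
def ladderA (x y : ℂ) (j : ℕ) (s : ℝ) : ℂ :=
  x * (s + Complex.I) + y * (s - Complex.I) - 2 * j * s

/-- The coefficient of `P_{j-1}` in the recursion of `ladderPoly`. -/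
def ladderB (x y : ℂ) (j : ℕ) (s : ℝ) : ℂ := j * (x + y - j + 1) * (1 + (s : ℂ) ^ 2)

open Polynomial in
/-- The monic polynomials `P_{j+1} = (X + α_j) P_j + β_j P_{j-1}` with `(1 + s²) P_j' = β_j P_{j-1}`,
where `'` acts on coefficients. -/
def ladderPoly (x y : ℂ) : ℕ → ℝ → ℂ[X]
  | 0, _ => 1
  | 1, s => X + C (ladderA x y 0 s)
  | (j + 2), s => (X + C (ladderA x y (j + 1) s)) * ladderPoly x y (j + 1) s +
      C (ladderB x y (j + 1) s) * ladderPoly x y j s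

open Polynomial in
theorem ladderPoly_succ (x y : ℂ) (j : ℕ) (s : ℝ) :
    ladderPoly x y (j + 1) s = (X + C (ladderA x y j s)) * ladderPoly x y j s +
      C (ladderB x y j s) * ladderPoly x y (j - 1) s := by
  cases j with
  | zero => simp [ladderPoly, ladderB]
  | succ j => rfl

open Polynomial in
theorem ladderPoly_monic_natDegree (x y : ℂ) (j : ℕ) (s : ℝ) :
    (ladderPoly x y j s).Monic ∧ (ladderPoly x y j s).natDegree = j := by
  induction j using Nat.strong_induction_on with
  | _ j ih =>
    match j with
    | 0 => simp [ladderPoly]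
    | j + 1 =>
      obtain ⟨hm, hd⟩ := ih j (by omega)
      obtain ⟨-, hd'⟩ := ih (j - 1) (by omega)
      rw [ladderPoly_succ]
      have hm2 := (Polynomial.monic_X_add_C (ladderA x y j s)).mul hm
      have hdeg : ((X + C (ladderA x y j s)) * ladderPoly x y j s).natDegree = j + 1 := by
        rw [(Polynomial.monic_X_add_C _).natDegree_mul hm, Polynomial.natDegree_X_add_C, hd,
          add_comm]
      have hlt : (C (ladderB x y j s) * ladderPoly x y (j - 1) s).degree <
          ((X + C (ladderA x y j s)) * ladderPoly x y j s).degree := by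
        rw [Polynomial.degree_eq_natDegree hm2.ne_zero, hdeg]
        refine (Polynomial.degree_le_natDegree).trans_lt ?_
        have := (Polynomial.natDegree_C_mul_le (ladderB x y j s) (ladderPoly x y (j - 1) s))
        exact_mod_cast (by omega)
      refine ⟨hm2.add_of_left hlt, ?_⟩
      rw [Polynomial.natDegree_add_eq_left_of_degree_lt hlt, hdeg]

theorem hasDerivAt_ofReal (s : ℝ) : HasDerivAt (fun s : ℝ => (s : ℂ)) 1 s :=
  Complex.ofRealCLM.hasDerivAt

open Polynomial in
-- The recursion is differentiated. Since `ladderA x y j + 2 s = ladderA x y (j - 1)`, the terms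
-- with `P_{j-1}` and `P_{j-2}` regroup to a multiple of `P_j`. The coefficients then add up by `(x
-- + y - 2 j) + j (x + y - j + 1) = (j + 1) (x + y - j)`.
theorem coeffDeriv_ladderPoly (x y : ℂ) (j : ℕ) : CoeffDeriv (ladderPoly x y j)
    (fun s => C (ladderB x y j s) * ladderPoly x y (j - 1) s) := by
  induction j using Nat.strong_induction_on with
  | _ j ih =>
    match j with
    | 0 => simpa [ladderPoly, ladderB] using CoeffDeriv.const 1
    | j + 1 =>
      have hA : ∀ s : ℝ, HasDerivAt (ladderA x y j)
          ((x + y - 2 * j) * (1 + (s : ℂ) ^ 2) / (1 + (s : ℂ) ^ 2)) s := by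
        intro s
        rw [mul_div_cancel_right₀ _ (one_add_sq_ne_zero s)]
        have h := hasDerivAt_ofReal s
        convert! (((h.add_const Complex.I).const_mul x).add
          ((h.sub_const Complex.I).const_mul y)).sub (h.const_mul (2 * (j : ℂ))) using 1
        ring
      have hB : ∀ s : ℝ, HasDerivAt (ladderB x y j)
          (2 * s * ladderB x y j s / (1 + (s : ℂ) ^ 2)) s := by
        intro s
        have h := ((hasDerivAt_ofReal s).pow 2).const_add 1
        convert! h.const_mul (j * (x + y - j + 1)) using 1
        rw [ladderB]
        have := one_add_sq_ne_zero s
        field_simp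
        ring
      have hsum := (((CoeffDeriv.const (X : ℂ[X])).add (CoeffDeriv.C hA)).mul
        (ih j (by omega))).add ((CoeffDeriv.C hB).mul (ih (j - 1) (by omega)))
      have e : (fun s => ladderPoly x y (j + 1) s) = fun s =>
          (X + C (ladderA x y j s)) * ladderPoly x y j s +
          C (ladderB x y j s) * ladderPoly x y (j - 1) s :=
        funext fun s => ladderPoly_succ x y j s
      change CoeffDeriv (fun s => ladderPoly x y (j + 1) s) _
      rw [e]
      convert hsum using 2 with s
      rw [Nat.add_sub_cancel]
      cases j with
      | zero => simp [ladderPoly, ladderB]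
      | succ j =>
        rw [Nat.add_sub_cancel, ladderPoly_succ x y j s]
        simp only [ladderA, ladderB]
        simp only [map_add, map_sub, map_mul, map_one, map_pow]
        push_cast
        simp only [map_add, map_one, map_natCast, map_ofNat]
        ring

/-- `(1 + i s)^{k+κ} (1 - i s)^{j+κ} I_{j-k}`. -/
def ladderE (μ : ℝ) (a b p q κ : ℂ) (j k : ℕ) (s : ℝ) : ℂ :=
  gW (k + κ) (j + κ) s * fullI μ a b (p + j - k) (q - j + k) s

theorem gW_hasDerivAt' (p q : ℂ) (s : ℝ) : HasDerivAt (gW p q)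
    ((p * (s + Complex.I) + q * (s - Complex.I)) / (1 + (s : ℂ) ^ 2) * gW p q s) s := by
  convert! gW_hasDerivAt p q s using 1
  rw [div_mul_eq_mul_div, div_eq_iff (one_add_sq_ne_zero s)]
  linear_combination p * (s + Complex.I) * gW_sub_left p q s +
    q * (s - Complex.I) * gW_sub_right p q s +
    (p * s * gW (p - 1) q s + q * s * gW p (q - 1) s) * Complex.I_sq

/-- Since `s + i = i (1 - i s)`, the power of `1 - i s` in `ladderE` absorbs the coefficient of the
contiguity relation, so that raising `j` needs no further factor in `s`. -/
theorem ladderE_raise {μ : ℝ} (hμ : -1 < μ) {p q : ℂ} (h : (p + q).re + μ < -1) (a b κ : ℂ)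
    (j k : ℕ) (s : ℝ) : HasDerivAt (ladderE μ a b p q κ j k)
      ((-ladderA (-κ - 1 - μ - p) (-κ) j s * ladderE μ a b p q κ j k s -
        Complex.I * (q - j + k) * ladderE μ a b p q κ (j + 1) k s) / (1 + (s : ℂ) ^ 2)) s := by
  have d := (gW_hasDerivAt' (k + κ) (j + κ) s).mul (fullI_raise hμ (p := p + j - k)
    (q := q - j + k) (by rwa [shift_re]) a b s)
  convert! d using 1
  have e : gW (k + κ) (((j + 1 : ℕ) : ℂ) + κ) s = (1 - Complex.I * s) * gW (k + κ) (j + κ) s := by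
    rw [← gW_add_right]; push_cast; congr 1; ring
  have e1 : p + ((j + 1 : ℕ) : ℂ) - k = p + j - k + 1 := by push_cast; ring
  have e2 : q - ((j + 1 : ℕ) : ℂ) + k = q - j + k - 1 := by push_cast; ring
  simp only [ladderE, ladderA]
  rw [e, e1, e2]
  have := one_add_sq_ne_zero s
  field_simp
  linear_combination (-(q - j + k) * s * gW (k + κ) (j + κ) s *
    fullI μ a b (p + j - k + 1) (q - j + k - 1) s) * (-1) * Complex.I_sq

/-- The mirror relation, raising `k`. The row `j = 0` suffices, because all later rows are reached
by raising `j`. -/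
theorem ladderE_lower_zero {μ : ℝ} (hμ : -1 < μ) {p q : ℂ} (h : (p + q).re + μ < -1) (a b κ : ℂ)
    (k : ℕ) (s : ℝ) : HasDerivAt (ladderE μ a b p q κ 0 k)
      ((-ladderA (-κ) (-κ - 1 - μ - q) k s * ladderE μ a b p q κ 0 k s +
        Complex.I * (p - k) * ladderE μ a b p q κ 0 (k + 1) s) / (1 + (s : ℂ) ^ 2)) s := by
  have d := (gW_hasDerivAt' (k + κ) ((0 : ℕ) + κ) s).mul (fullI_lower hμ (p := p + (0 : ℕ) - k)
    (q := q - (0 : ℕ) + k) (by rwa [shift_re]) a b s)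
  convert! d using 1
  have e : gW (((k + 1 : ℕ) : ℂ) + κ) ((0 : ℕ) + κ) s =
      (1 + Complex.I * s) * gW (k + κ) ((0 : ℕ) + κ) s := by
    rw [← gW_add_left]; push_cast; congr 1; ring
  have e1 : p + (0 : ℕ) - ((k + 1 : ℕ) : ℂ) = p + (0 : ℕ) - k - 1 := by push_cast; ring
  have e2 : q - (0 : ℕ) + ((k + 1 : ℕ) : ℂ) = q - (0 : ℕ) + k + 1 := by push_cast; ring
  simp only [ladderE, ladderA]
  rw [e, e1, e2]
  have := one_add_sq_ne_zero s
  field_simp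
  push_cast
  linear_combination ((p - k) * s * gW (k + κ) (0 + κ) s *
    fullI μ a b (p + 0 - k - 1) (q - 0 + k + 1) s) * Complex.I_sq

theorem ladderE_shift (μ : ℝ) (a b p q κ : ℂ) (j k : ℕ) (s : ℝ) :
    (1 + (s : ℂ) ^ 2) * ladderE μ a b p q κ j k s = ladderE μ a b p q κ (j + 1) (k + 1) s := by
  simp only [ladderE]
  rw [show (((k + 1 : ℕ) : ℂ) + κ) = k + κ + 1 by push_cast; ring,
    show (((j + 1 : ℕ) : ℂ) + κ) = j + κ + 1 by push_cast; ring, gW_add_left, gW_add_right,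
    show p + ((j + 1 : ℕ) : ℂ) - ((k + 1 : ℕ) : ℂ) = p + j - k by push_cast; ring,
    show q - ((j + 1 : ℕ) : ℂ) + ((k + 1 : ℕ) : ℂ) = q - j + k by push_cast; ring]
  linear_combination (-(s : ℂ) ^ 2 * gW (k + κ) (j + κ) s *
    fullI μ a b (p + j - k) (q - j + k) s) * (-1) * Complex.I_sq

/-- `∏_{l < j} c (x - l)`. -/
def fallC (c x : ℂ) (j : ℕ) : ℂ := ∏ l ∈ Finset.range j, c * (x - l)

theorem contDiff_gW (p q : ℂ) (n : ℕ) : ContDiff ℝ n (gW p q) := by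
  induction n generalizing p q with
  | zero => exact contDiff_zero.mpr (gW_continuous p q)
  | succ n ih =>
    have hd : deriv (gW p q) = fun s => Complex.I * p * gW (p - 1) q s -
        Complex.I * q * gW p (q - 1) s := funext fun s => (gW_hasDerivAt p q s).deriv
    push_cast
    rw [contDiff_succ_iff_deriv]
    refine ⟨fun s => (gW_hasDerivAt p q s).differentiableAt, by simp, ?_⟩
    rw [hd]
    exact (contDiff_const.mul (ih _ _)).sub (contDiff_const.mul (ih _ _))

theorem contDiff_ladderE {μ : ℝ} (hμ : -1 < μ) {p q : ℂ} (h : (p + q).re + μ < -1) (a b κ : ℂ)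
    (j k n : ℕ) : ContDiff ℝ n (ladderE μ a b p q κ j k) :=
  (contDiff_gW _ _ n).mul (contDiff_fullI hμ (by rwa [shift_re]) a b n)

open Polynomial in
-- The Toeplitz entries are obtained from `f` by applying `P_j(D) Q_k(D)`. Induction along the row
-- `j = 0` and then in `j`: both sides are differentiated, once by the Leibniz rule for operators
-- and once by contiguity, and the derivatives are compared. The recursion absorbs the terms with `X
-- P_j` and `P_{j-1}`. The leftover term with `Q_{k-1}` carries a factor `1 + s²`, which by
-- `ladderE_shift` moves it to the entry `(j + 1, k)`.
theorem applyD_ladder {μ : ℝ} (hμ : -1 < μ) {p q : ℂ} (h : (p + q).re + μ < -1) (a b : ℂ) {κ : ℂ}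
    (hκ : 2 * κ = -(1 + μ + p + q)) (j k : ℕ) (s : ℝ) :
    applyD (ladderE μ a b p q κ 0 0) s (ladderPoly (-κ - 1 - μ - p) (-κ) j s *
      ladderPoly (-κ) (-κ - 1 - μ - q) k s) =
    fallC (-Complex.I) q j * fallC Complex.I p k * ladderE μ a b p q κ j k s := by
  set f := ladderE μ a b p q κ 0 0 with hf
  have hfs : ∀ n : ℕ, ContDiff ℝ n f := contDiff_ladderE hμ h a b κ 0 0
  set P := ladderPoly (-κ - 1 - μ - p) (-κ) with hP
  set Q := ladderPoly (-κ) (-κ - 1 - μ - q) with hQ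
  -- The choice of `κ` makes the parameter sums of the two polynomial families equal to `q` and `p`;
  -- the coefficients of `ladderB` then match those produced by contiguity.
  have hxy : -κ - 1 - μ - p + -κ = q := by linear_combination -hκ
  have hxy' : -κ + (-κ - 1 - μ - q) = p := by linear_combination -hκ
  have dP : ∀ j s, (P j s).natDegree = j := fun j s => (ladderPoly_monic_natDegree _ _ j s).2
  have dQ : ∀ j s, (Q j s).natDegree = j := fun j s => (ladderPoly_monic_natDegree _ _ j s).2
  have hder : ∀ j k s, HasDerivAt (fun s => applyD f s (P j s * Q k s))
      ((ladderB (-κ - 1 - μ - p) (-κ) j s * applyD f s (P (j - 1) s * Q k s) +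
        ladderB (-κ) (-κ - 1 - μ - q) k s * applyD f s (P j s * Q (k - 1) s) +
        applyD f s (X * (P j s * Q k s))) / (1 + (s : ℂ) ^ 2)) s := by
    intro j k s
    have hPQ := (coeffDeriv_ladderPoly (-κ - 1 - μ - p) (-κ) j).mul
      (coeffDeriv_ladderPoly (-κ) (-κ - 1 - μ - q) k)
    rw [← hP, ← hQ] at hPQ
    have key := hasDerivAt_applyD hfs hPQ (d := j + k + 1) ?_ ?_ s
    · convert key using 3
      rw [map_add, mul_assoc, applyD_C_mul, mul_left_comm, applyD_C_mul]
    · intro s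
      refine (Polynomial.natDegree_mul_le).trans_lt ?_
      rw [dP, dQ]; omega
    · intro s
      refine (Polynomial.natDegree_add_le _ _).trans_lt (max_lt ?_ ?_)
      · rw [mul_assoc]
        refine (Polynomial.natDegree_C_mul_le _ _).trans_lt
          ((Polynomial.natDegree_mul_le).trans_lt ?_)
        rw [dP, dQ]; omega
      · rw [mul_left_comm]
        refine (Polynomial.natDegree_C_mul_le _ _).trans_lt
          ((Polynomial.natDegree_mul_le).trans_lt ?_)
        rw [dP, dQ]; omega
  induction j generalizing k s with
  | zero =>
    induction k generalizing s with
    | zero =>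
      have : applyD f s 1 = f s := by simpa using applyD_X_pow f s 0
      simpa [hP, hQ, ladderPoly, fallC] using this
    | succ k ih =>
      have d1 := hder 0 k s
      rw [funext ih] at d1
      have d2 := (ladderE_lower_zero hμ h a b κ k s).const_mul
        (fallC (-Complex.I) q 0 * fallC Complex.I p k)
      have e := d1.unique d2
      have hs := one_add_sq_ne_zero s
      rw [mul_div_assoc', div_left_inj' hs] at e
      have hrec : P 0 s * Q (k + 1) s = X * (P 0 s * Q k s) +
          C (ladderA (-κ) (-κ - 1 - μ - q) k s) * (P 0 s * Q k s) +
          C (ladderB (-κ) (-κ - 1 - μ - q) k s) * (P 0 s * Q (k - 1) s) := by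
        rw [hQ, ladderPoly_succ]; ring
      rw [hrec, map_add, map_add, applyD_C_mul, applyD_C_mul, ih]
      have hB0 : ladderB (-κ - 1 - μ - p) (-κ) 0 s = 0 := by simp [ladderB]
      rw [hB0] at e
      have hfc : fallC Complex.I p (k + 1) = fallC Complex.I p k * (Complex.I * (p - k)) := by
        rw [fallC, Finset.prod_range_succ, fallC]
      rw [hfc]
      linear_combination e
  | succ j ih =>
    have d1 := hder j k s
    have ihk : (fun s => applyD f s (P j s * Q k s)) = fun s =>
        fallC (-Complex.I) q j * fallC Complex.I p k * ladderE μ a b p q κ j k s :=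
      funext fun s => ih k s
    rw [ihk] at d1
    have d2 := (ladderE_raise hμ h a b κ j k s).const_mul
      (fallC (-Complex.I) q j * fallC Complex.I p k)
    have e := d1.unique d2
    have hs := one_add_sq_ne_zero s
    rw [mul_div_assoc', div_left_inj' hs] at e
    have hrec : P (j + 1) s * Q k s = X * (P j s * Q k s) +
        C (ladderA (-κ - 1 - μ - p) (-κ) j s) * (P j s * Q k s) +
        C (ladderB (-κ - 1 - μ - p) (-κ) j s) * (P (j - 1) s * Q k s) := by
      rw [hP, ladderPoly_succ]; ring
    rw [hrec, map_add, map_add, applyD_C_mul, applyD_C_mul, ih]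
    have hfq : fallC (-Complex.I) q (j + 1) = fallC (-Complex.I) q j * (-Complex.I * (q - j)) := by
      rw [fallC, Finset.prod_range_succ, fallC]
    rw [hfq]
    rw [ih] at e
    cases k with
    | zero =>
      have hB0 : ladderB (-κ) (-κ - 1 - μ - q) 0 s = 0 := by simp [ladderB]
      rw [hB0] at e
      push_cast at e
      linear_combination e
    | succ k =>
      have hfc : fallC Complex.I p (k + 1) = fallC Complex.I p k * (Complex.I * (p - k)) := by
        rw [fallC, Finset.prod_range_succ, fallC]
      have hB : ladderB (-κ) (-κ - 1 - μ - q) (k + 1) s =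
          (k + 1) * (p - k) * (1 + (s : ℂ) ^ 2) := by
        rw [ladderB, hxy']; push_cast; ring
      have hE := ladderE_shift μ a b p q κ j k s
      rw [hB, Nat.add_sub_cancel] at e
      rw [hfc] at e ⊢
      push_cast at e ⊢
      linear_combination e + (-(k + 1) * (p - k) * fallC (-Complex.I) q j * fallC Complex.I p k) * hE
        - ((k + 1) * (p - k) * fallC (-Complex.I) q j * fallC Complex.I p k *
          ladderE μ a b p q κ (j + 1) (k + 1) s) * Complex.I_sq

/-- The coefficient matrices of the monic families `P_j` and `Q_k` are triangular of determinant
one. Multiplying the Hankel matrix by them on both sides therefore does not change its determinant,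
while by `applyD_ladder` it becomes the Toeplitz matrix with row and column factors. -/
theorem det_opD_iterate {μ : ℝ} (hμ : -1 < μ) {p q : ℂ} (h : (p + q).re + μ < -1) (a b : ℂ) {κ : ℂ}
    (hκ : 2 * κ = -(1 + μ + p + q)) (n : ℕ) (s : ℝ) :
    (Matrix.of fun j k : Fin n => opD^[(j : ℕ) + k] (ladderE μ a b p q κ 0 0) s).det =
      (∏ j : Fin n, fallC (-Complex.I) q j * fallC Complex.I p j * gW (j + κ) (j + κ) s) *
        hdet μ a b p q n s := by
  set f := ladderE μ a b p q κ 0 0 with hf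
  set P : Matrix (Fin n) (Fin n) ℂ := Matrix.of fun l j =>
    (ladderPoly (-κ - 1 - μ - p) (-κ) j s).coeff l with hP
  set Q : Matrix (Fin n) (Fin n) ℂ := Matrix.of fun m k =>
    (ladderPoly (-κ) (-κ - 1 - μ - q) k s).coeff m with hQ
  set M : Matrix (Fin n) (Fin n) ℂ := Matrix.of fun j k => opD^[(j : ℕ) + k] f s with hM
  have dP : P.det = 1 := Matrix.det_matrixOfPolynomials
    (fun j : Fin n => ladderPoly (-κ - 1 - μ - p) (-κ) j s)
    (fun j => (ladderPoly_monic_natDegree _ _ j s).2)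
    (fun j => (ladderPoly_monic_natDegree _ _ j s).1)
  have dQ : Q.det = 1 := Matrix.det_matrixOfPolynomials
    (fun j : Fin n => ladderPoly (-κ) (-κ - 1 - μ - q) j s)
    (fun j => (ladderPoly_monic_natDegree _ _ j s).2)
    (fun j => (ladderPoly_monic_natDegree _ _ j s).1)
  have hX : P.transpose * M * Q = Matrix.of fun j k : Fin n =>
      (fallC (-Complex.I) q j * (1 - Complex.I * s) ^ (((j : ℕ) : ℂ) + κ)) *
      ((fallC Complex.I p k * (1 + Complex.I * s) ^ (((k : ℕ) : ℂ) + κ)) *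
        fullI μ a b (p + ((j : ℕ) : ℂ) - ((k : ℕ) : ℂ)) (q - ((j : ℕ) : ℂ) + ((k : ℕ) : ℂ)) s) := by
    ext j k
    have key := applyD_ladder hμ h a b hκ j k s
    have e1 := fun (R : Polynomial ℂ) (hR : R.natDegree < n) =>
      (Polynomial.as_sum_range' R n hR)
    have r1 := e1 (ladderPoly (-κ - 1 - μ - p) (-κ) j s)
      (by rw [(ladderPoly_monic_natDegree _ _ _ s).2]; exact j.2)
    have r2 := e1 (ladderPoly (-κ) (-κ - 1 - μ - q) k s)
      (by rw [(ladderPoly_monic_natDegree _ _ _ s).2]; exact k.2)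
    rw [r1, r2, Finset.sum_mul_sum, map_sum] at key
    simp only [map_sum, Polynomial.monomial_mul_monomial] at key
    have hmono : ∀ (i : ℕ) (c : ℂ), applyD (ladderE μ a b p q κ 0 0) s (Polynomial.monomial i c) =
        c * opD^[i] f s := by
      intro i c
      rw [← Polynomial.C_mul_X_pow_eq_monomial, applyD_C_mul, applyD_X_pow]
    simp only [hmono] at key
    rw [Matrix.of_apply, Matrix.mul_apply]
    simp only [Matrix.mul_apply, Matrix.transpose_apply]
    rw [Finset.sum_congr rfl fun m _ => Finset.sum_mul _ _ _, Finset.sum_comm]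
    rw [Finset.sum_range] at key
    simp only [Finset.sum_range] at key
    rw [Finset.sum_congr rfl fun l _ => Finset.sum_congr rfl fun m _ => ?_, key, ladderE, gW]
    · ring
    · simp only [hP, hQ, hM, Matrix.of_apply]; ring
  have hd := congrArg Matrix.det hX
  rw [Matrix.det_mul, Matrix.det_mul, Matrix.det_transpose, dP, dQ, one_mul, mul_one] at hd
  rw [hd]
  have h1 := Matrix.det_mul_column (fun j : Fin n =>
    fallC (-Complex.I) q j * (1 - Complex.I * s) ^ (((j : ℕ) : ℂ) + κ)) (Matrix.of fun j k : Fin n =>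
      ((fallC Complex.I p k * (1 + Complex.I * s) ^ (((k : ℕ) : ℂ) + κ)) *
        fullI μ a b (p + ((j : ℕ) : ℂ) - ((k : ℕ) : ℂ)) (q - ((j : ℕ) : ℂ) + ((k : ℕ) : ℂ)) s))
  have h2 := Matrix.det_mul_row (fun k : Fin n =>
    fallC Complex.I p k * (1 + Complex.I * s) ^ (((k : ℕ) : ℂ) + κ)) (Matrix.of fun j k : Fin n =>
        fullI μ a b (p + ((j : ℕ) : ℂ) - ((k : ℕ) : ℂ)) (q - ((j : ℕ) : ℂ) + ((k : ℕ) : ℂ)) s)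
  simp only [Matrix.of_apply] at h1 h2
  rw [h1, h2, ← mul_assoc, ← Finset.prod_mul_distrib, hdet]
  congr 1
  refine Finset.prod_congr rfl fun j _ => ?_
  rw [gW]; ring

/-! ### The Toda equation for Hankel determinants -/

theorem hasDerivAt_det {ι : Type*} [Fintype ι] [DecidableEq ι] {M : ℝ → Matrix ι ι ℂ}
    {M' : Matrix ι ι ℂ} {s : ℝ} (h : ∀ i j, HasDerivAt (fun s => M s i j) (M' i j) s) :
    HasDerivAt (fun s => (M s).det) (∑ j, ((M s).updateCol j fun i => M' i j).det) s := by
  simp only [Matrix.det_apply']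
  rw [Finset.sum_comm]
  refine HasDerivAt.fun_sum fun σ _ => ?_
  rw [← Finset.mul_sum]
  refine HasDerivAt.const_mul _ ?_
  refine (HasDerivAt.fun_finsetProd fun i _ => h (σ i) i).congr_deriv ?_
  refine Finset.sum_congr rfl fun j _ => ?_
  rw [← Finset.mul_prod_erase _ _ (Finset.mem_univ j), smul_eq_mul, mul_comm]
  congr 1
  · simp
  · refine Finset.prod_congr rfl fun i hi => ?_
    rw [Matrix.updateCol_ne (Finset.ne_of_mem_erase hi)]

/-- The Hankel matrix of `g` with rows `0, …, n-1, x` and columns `0, …, n-1, y`. -/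
def borderedHankel (g : ℕ → ℂ) (n x y : ℕ) : Matrix (Fin n ⊕ Fin 1) (Fin n ⊕ Fin 1) ℂ :=
  Matrix.of fun j k => g (Sum.elim (fun i : Fin n => (i : ℕ)) (fun _ => x) j +
    Sum.elim (fun i : Fin n => (i : ℕ)) (fun _ => y) k)

theorem borderedHankel_det_symm (g : ℕ → ℂ) (n x y : ℕ) :
    (borderedHankel g n x y).det = (borderedHankel g n y x).det := by
  rw [← Matrix.det_transpose]
  congr 1
  ext j k
  simp [borderedHankel, add_comm]

theorem borderedHankel_det_self (g : ℕ → ℂ) (n : ℕ) :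
    (borderedHankel g n n n).det =
      (Matrix.of fun j k : Fin (n + 1) => g ((j : ℕ) + k)).det := by
  rw [← Matrix.det_submatrix_equiv_self (finSumFinEquiv (m := n) (n := 1))]
  congr 1
  ext j k
  rcases j with j | j <;> rcases k with k | k <;> simp [borderedHankel]

/-- Differentiating a column replaces it by the next one. For every column but the last this
duplicates an existing column, so only the border contributes. -/
theorem hasDerivAt_borderedHankel_det {f : ℕ → ℝ → ℂ} {w : ℝ → ℂ}
    (hf : ∀ i s, HasDerivAt (f i) (f (i + 1) s / w s) s) (n x : ℕ) (s : ℝ) :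
    HasDerivAt (fun s => (borderedHankel (fun i => f i s) n x n).det)
      ((borderedHankel (fun i => f i s) n x (n + 1)).det / w s) s := by
  refine (hasDerivAt_det (M := fun s => borderedHankel (fun i => f i s) n x n)
    (M' := (w s)⁻¹ • Matrix.of fun j k => f (Sum.elim (fun i : Fin n => (i : ℕ)) (fun _ => x) j +
    Sum.elim (fun i : Fin n => (i : ℕ)) (fun _ => n) k + 1) s) ?_).congr_deriv ?_
  · intro i j
    refine (hf _ s).congr_deriv ?_
    simp [div_eq_inv_mul]
  · rw [Finset.sum_eq_single (Sum.inr 0)]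
    · have : (fun i => ((w s)⁻¹ • Matrix.of fun j k =>
          f (Sum.elim (fun i : Fin n => (i : ℕ)) (fun _ => x) j +
          Sum.elim (fun i : Fin n => (i : ℕ)) (fun _ => n) k + 1) s :
          Matrix (Fin n ⊕ Fin 1) (Fin n ⊕ Fin 1) ℂ) i (Sum.inr 0)) =
          (w s)⁻¹ • fun i => borderedHankel (fun i => f i s) n x (n + 1) i (Sum.inr 0) := by
        funext i
        simp [borderedHankel, add_assoc]
      rw [this, Matrix.det_updateCol_smul, div_eq_inv_mul]
      congr 2
      ext j k
      rcases k with k | k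
      · rw [Matrix.updateCol_ne (by simp)]
        simp [borderedHankel]
      · rw [Subsingleton.elim k 0, Matrix.updateCol_self]
    · intro j _ hj
      rcases j with j | j
      · have hcol : (fun i => ((w s)⁻¹ • Matrix.of fun j k =>
            f (Sum.elim (fun i : Fin n => (i : ℕ)) (fun _ => x) j +
            Sum.elim (fun i : Fin n => (i : ℕ)) (fun _ => n) k + 1) s :
            Matrix (Fin n ⊕ Fin 1) (Fin n ⊕ Fin 1) ℂ) i (Sum.inl j)) = (w s)⁻¹ • fun i =>
            f (Sum.elim (fun i : Fin n => (i : ℕ)) (fun _ => x) i + (j + 1)) s := by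
          funext i
          simp [add_assoc]
        rw [hcol, Matrix.det_updateCol_smul]
        -- The duplicate is the column `j + 1`, or the border column when `j + 1 = n`.
        rcases Nat.lt_or_ge (j + 1) n with hjn | hjn
        · rw [Matrix.det_zero_of_column_eq (i := Sum.inl j) (j := Sum.inl ⟨j + 1, hjn⟩), mul_zero]
          · simp [Fin.ext_iff]
          · intro i
            rw [Matrix.updateCol_self, Matrix.updateCol_ne (by simp [Fin.ext_iff])]
            simp [borderedHankel]
        · rw [Matrix.det_zero_of_column_eq (i := Sum.inl j) (j := Sum.inr 0), mul_zero]
          · simp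
          · intro i
            rw [Matrix.updateCol_self, Matrix.updateCol_ne (by simp)]
            have : (j : ℕ) + 1 = n := by have := j.2; omega
            simp [borderedHankel, this]
      · exact absurd (by rw [Subsingleton.elim j 0]) hj
    · simp

/-- **Jacobi's identity** for Hankel determinants. -/
theorem hankel_jacobi (g : ℕ → ℂ) (n : ℕ)
    (h : (Matrix.of fun j k : Fin n => g ((j : ℕ) + k)).det ≠ 0) :
    (Matrix.of fun j k : Fin (n + 2) => g ((j : ℕ) + k)).det *
      (Matrix.of fun j k : Fin n => g ((j : ℕ) + k)).det =
    (borderedHankel g n n n).det * (borderedHankel g n (n + 1) (n + 1)).det -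
      (borderedHankel g n (n + 1) n).det * (borderedHankel g n n (n + 1)).det := by
  set A : Matrix (Fin n) (Fin n) ℂ := Matrix.of fun j k : Fin n => g ((j : ℕ) + k) with hA
  let _ : Invertible A := Matrix.invertibleOfIsUnitDet A (isUnit_iff_ne_zero.mpr h)
  -- `S` gives the entries of the Schur complement of the leading block `A`. The bordered
  -- determinants are `det A` times its entries, and the determinant of size `n + 2` is `det A`
  -- times a `2 × 2` minor of `S`.
  set S : ℕ → ℕ → ℂ := fun x y => g (x + y) - ((Matrix.of fun (_ : Fin 1) (k : Fin n) => g (x + k))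
    * ⅟A * (Matrix.of fun (j : Fin n) (_ : Fin 1) => g (j + y))) 0 0 with hS
  have hb : ∀ x y, (borderedHankel g n x y).det = A.det * S x y := by
    intro x y
    have : borderedHankel g n x y = Matrix.fromBlocks A
        (Matrix.of fun (j : Fin n) (_ : Fin 1) => g (j + y))
        (Matrix.of fun (_ : Fin 1) (k : Fin n) => g (x + k))
        (Matrix.of fun (_ : Fin 1) (_ : Fin 1) => g (x + y)) := by
      ext j k
      rcases j with j | j <;> rcases k with k | k <;> simp [borderedHankel, hA]
    rw [this, Matrix.det_fromBlocks₁₁, Matrix.det_fin_one]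
    simp [hS]
  have h2 : (Matrix.of fun j k : Fin (n + 2) => g ((j : ℕ) + k)).det = A.det *
      (S n n * S (n + 1) (n + 1) - S n (n + 1) * S (n + 1) n) := by
    rw [← Matrix.det_submatrix_equiv_self (finSumFinEquiv (m := n) (n := 2))]
    have : (Matrix.of fun j k : Fin (n + 2) => g ((j : ℕ) + k)).submatrix
        (finSumFinEquiv (m := n) (n := 2)) (finSumFinEquiv (m := n) (n := 2)) =
        Matrix.fromBlocks A
        (Matrix.of fun (j : Fin n) (y : Fin 2) => g (j + (n + y)))
        (Matrix.of fun (x : Fin 2) (k : Fin n) => g (n + x + k))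
        (Matrix.of fun (x : Fin 2) (y : Fin 2) => g (n + x + (n + y))) := by
      ext j k
      rcases j with j | j <;> rcases k with k | k <;> simp [hA]
    rw [this, Matrix.det_fromBlocks₁₁, Matrix.det_fin_two]
    have e : ∀ x y : Fin 2, ((Matrix.of fun (x : Fin 2) (y : Fin 2) => g (n + x + (n + y))) -
        (Matrix.of fun (x : Fin 2) (k : Fin n) => g (n + x + k)) * ⅟A *
        (Matrix.of fun (j : Fin n) (y : Fin 2) => g (j + (n + y)))) x y = S (n + x) (n + y) := by
      intro x y
      simp [hS, Matrix.mul_apply]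
    rw [e, e, e, e]
    simp
  rw [h2, hb, hb, hb, hb]
  ring

/-- `det [D^{j+k} f]_{j, k < n}`. -/
def hankelD (f : ℝ → ℂ) (n : ℕ) (s : ℝ) : ℂ :=
  (Matrix.of fun j k : Fin n => opD^[(j : ℕ) + k] f s).det

/-- The `D`-derivative of the determinant shifts its last column; by symmetry this equals the
determinant with its last row shifted. A second derivative shifts the column as well. Jacobi's
identity for these borders is the bilinear Toda equation. -/
theorem hankelD_toda {f : ℝ → ℂ} (hf : ∀ n : ℕ, ContDiff ℝ n f) (n : ℕ) :
    ∃ T1 T2 : ℝ → ℂ, (∀ s, HasDerivAt (hankelD f (n + 1)) (T1 s / (1 + (s : ℂ) ^ 2)) s) ∧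
      (∀ s, HasDerivAt T1 (T2 s / (1 + (s : ℂ) ^ 2)) s) ∧
      ∀ s, hankelD f n s ≠ 0 → hankelD f (n + 2) s * hankelD f n s =
        hankelD f (n + 1) s * T2 s - T1 s ^ 2 := by
  have hd := hasDerivAt_opD_iterate hf
  refine ⟨fun s => (borderedHankel (fun i => opD^[i] f s) n (n + 1) n).det,
    fun s => (borderedHankel (fun i => opD^[i] f s) n (n + 1) (n + 1)).det, fun s => ?_, fun s => ?_,
    fun s hs => ?_⟩
  · have h1 := hasDerivAt_borderedHankel_det (f := fun i => opD^[i] f)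
      (w := fun s => 1 + (s : ℂ) ^ 2) hd n n s
    rw [borderedHankel_det_symm (fun i => opD^[i] f s) n n (n + 1)] at h1
    have e : hankelD f (n + 1) = fun s => (borderedHankel (fun i => opD^[i] f s) n n n).det :=
      funext fun s => (borderedHankel_det_self (fun i => opD^[i] f s) n).symm
    rw [e]
    exact h1
  · exact hasDerivAt_borderedHankel_det (f := fun i => opD^[i] f)
      (w := fun s => 1 + (s : ℂ) ^ 2) hd n (n + 1) s
  · have := hankel_jacobi (fun i => opD^[i] f s) n hs
    rw [borderedHankel_det_symm (fun i => opD^[i] f s) n n (n + 1), borderedHankel_det_self] at this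
    simp only [hankelD]
    rw [this]; ring

/-! ### Comparison with the determinant solution of the Toda lattice -/

theorem gW_mul_gW (p q p' q' : ℂ) (x : ℝ) : gW p q x * gW p' q' x = gW (p + p') (q + q') x := by
  rw [gW, gW, gW, Complex.cpow_add _ _ (one_add_ne_zero' x), Complex.cpow_add _ _ (one_sub_ne_zero' x)]
  ring

theorem gW_ne_zero (p q : ℂ) (x : ℝ) : gW p q x ≠ 0 := by
  rw [gW, Complex.cpow_def_of_ne_zero (one_add_ne_zero' x),
    Complex.cpow_def_of_ne_zero (one_sub_ne_zero' x)]
  exact mul_ne_zero (Complex.exp_ne_zero _) (Complex.exp_ne_zero _)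

theorem gW_self (κ : ℂ) (s : ℝ) : gW κ κ s = Complex.exp (Real.log (1 + s ^ 2) * κ) := by
  have hconj : (1 - Complex.I * s : ℂ) = (starRingEnd ℂ) (1 + Complex.I * s) := by
    simp [sub_eq_add_neg]
  rw [gW, Complex.cpow_def_of_ne_zero (one_add_ne_zero' s),
    Complex.cpow_def_of_ne_zero (one_sub_ne_zero' s), ← Complex.exp_add, ← add_mul, hconj,
    Complex.log_conj _ (Complex.slitPlane_arg_ne_pi (one_add_mem_slitPlane s)), Complex.add_conj,
    Complex.log_re, norm_one_add, Real.log_sqrt (by positivity)]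
  congr 2
  push_cast; ring

theorem linePt_mul (s : ℝ) : linePt s * (linePt s - 1) = -((1 + (s : ℂ) ^ 2) / 4) := by
  simp only [linePt]
  linear_combination ((s : ℂ) ^ 2 / 4) * Complex.I_sq

theorem linePt_cpow (κ : ℂ) (s : ℝ) : (linePt s * (linePt s - 1)) ^ κ =
    Complex.exp ((Real.pi * Complex.I - Real.log 4) * κ) * gW κ κ s := by
  have hx : (0 : ℝ) < (1 + s ^ 2) / 4 := by positivity
  have h : linePt s * (linePt s - 1) = ((-((1 + s ^ 2) / 4) : ℝ) : ℂ) := by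
    rw [linePt_mul]; push_cast; ring
  have hne : ((-((1 + s ^ 2) / 4) : ℝ) : ℂ) ≠ 0 := by
    exact_mod_cast (neg_neg_of_pos hx).ne
  rw [h, Complex.cpow_def_of_ne_zero hne, gW_self, ← Complex.exp_add]
  congr 1
  have hlog : Complex.log ((-((1 + s ^ 2) / 4) : ℝ) : ℂ) =
      Real.log (1 + s ^ 2) - Real.log 4 + Real.pi * Complex.I := by
    apply Complex.ext
    · rw [Complex.log_re, Complex.norm_real, norm_neg, Real.norm_of_nonneg hx.le,
        Real.log_div (by positivity) (by norm_num)]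
      generalize Real.log 4 = L
      generalize Real.log (1 + s ^ 2) = L'
      simp
    · rw [Complex.log_im, Complex.arg_ofReal_of_neg (neg_neg_of_pos hx)]
      generalize Real.log 4 = L
      generalize Real.log (1 + s ^ 2) = L'
      simp
  rw [hlog]
  ring

theorem deltaLine_eq (g : ℝ → ℂ) : deltaLine g = fun s => Complex.I / 2 * opD g s := by
  funext s
  rw [deltaLine, opD, linePt_mul]
  have := Complex.I_ne_zero
  field_simp
  linear_combination (-deriv g s * (1 + (s : ℂ) ^ 2)) * Complex.I_sq * 4

theorem opD_const_mul (c : ℂ) (g : ℝ → ℂ) : opD (fun s => c * g s) = fun s => c * opD g s := by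
  funext s
  rw [opD, opD, deriv_const_mul_field]
  ring

theorem opD_iterate_const_mul (c : ℂ) (g : ℝ → ℂ) (m : ℕ) :
    opD^[m] (fun s => c * g s) = fun s => c * opD^[m] g s := by
  induction m with
  | zero => rfl
  | succ m ih => rw [Function.iterate_succ_apply', ih, opD_const_mul, Function.iterate_succ_apply']

theorem deltaLine_iterate (g : ℝ → ℂ) (m : ℕ) :
    deltaLine^[m] g = fun s => (Complex.I / 2) ^ m * opD^[m] g s := by
  induction m with
  | zero => simp
  | succ m ih =>
    rw [Function.iterate_succ_apply', ih, deltaLine_eq]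
    funext s
    rw [opD_const_mul, Function.iterate_succ_apply', pow_succ]
    ring

/-- The exponent `(1 + b₃ + b₄)/2` of the prefactor of the first `τ`-function. -/
def kapCy (N : ℕ) (η₁ μ : ℝ) : ℂ := (1 + 2 * η₁ - 2 * N - μ) / 2

theorem two_mul_kapCy (N : ℕ) (η₁ η₂ μ : ℝ) :
    2 * kapCy N η₁ μ = -(1 + μ + pCy N η₁ η₂ + qCy N η₁ η₂) := by
  rw [kapCy, pCy, qCy]; ring

theorem tauOne_bSeed (N : ℕ) {η₁ μ : ℝ} (η₂ : ℝ) (hμ : -1 < μ)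
    (h : 2 * (N : ℝ) - 1 + μ < 2 * η₁) (ξ : ℂ) (s : ℝ) :
    tauOne (bSeed N η₁ η₂ μ) ξ s =
      fullI μ 1 (bWt ξ μ) (pCy N η₁ η₂) (qCy N η₁ η₂) s := by
  rw [tauOne, fCy, ← (kap_mul_gW μ 1 (bWt ξ μ) hμ (exponent_lt η₂ h) s).2]
  refine integral_congr_ae (Eventually.of_forall fun u => ?_)
  simp only [bSeed, Matrix.cons_val_zero, Matrix.cons_val_one, Matrix.cons_val]
  rw [bWt, ← cut_mul_branchPow, gW,
    show -((N : ℂ) - η₁ + (-μ + η₁ - N)) = μ by ring,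
    show (N : ℂ) - η₁ + (-μ + η₁ - N) - (1 + Complex.I * η₂ + (-μ + η₁ - N)) = pCy N η₁ η₂ by
      rw [pCy]; ring,
    show 1 + Complex.I * η₂ + (-(μ : ℂ) + η₁ - N) - (1 + ((η₁ : ℂ) - N) + (-μ + η₁ - N)) - 1 =
      qCy N η₁ η₂ by rw [qCy]; ring]
  ring

theorem barFactor_bSeed (N : ℕ) (η₁ η₂ μ : ℝ) (n : ℕ) :
    ∃ c : ℂ, c ≠ 0 ∧ ∀ s, barFactor (bSeed N η₁ η₂ μ) n s =
      c * gW (n * (n - 1 + 2 * kapCy N η₁ μ) / 2) (n * (n - 1 + 2 * kapCy N η₁ μ) / 2) s := by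
  refine ⟨_, Complex.exp_ne_zero ((Real.pi * Complex.I - Real.log 4) *
    (n * (n - 1 + 2 * kapCy N η₁ μ) / 2)), fun s => ?_⟩
  rw [← linePt_cpow, barFactor]
  congr 1
  simp only [bSeed, Matrix.cons_val_zero, Matrix.cons_val, kapCy]
  ring

theorem prod_gW (κ : ℂ) (n : ℕ) (s : ℝ) : ∏ j : Fin n, gW (((j : ℕ) : ℂ) + κ) (((j : ℕ) : ℂ) + κ) s =
    gW (n * (n - 1 + 2 * κ) / 2) (n * (n - 1 + 2 * κ) / 2) s := by
  induction n with
  | zero => simp [gW]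
  | succ n ih =>
    rw [Fin.prod_univ_castSucc]
    simp only [Fin.val_castSucc, Fin.val_last]
    rw [ih, gW_mul_gW]
    congr 1 <;> push_cast <;> ring

theorem fallC_ne_zero {c x : ℂ} (hc : c ≠ 0) (hx : x.re < 0) (j : ℕ) : fallC c x j ≠ 0 := by
  refine Finset.prod_ne_zero_iff.mpr fun l _ => mul_ne_zero hc fun h0 => ?_
  have := congrArg Complex.re h0
  simp at this
  have : (0 : ℝ) ≤ l := Nat.cast_nonneg l
  linarith

/-- The constant between `det [D^{j+k} f]` and `hdet`. -/
def hankelConst (p q : ℂ) (n : ℕ) : ℂ :=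
  ∏ j : Fin n, fallC (-Complex.I) q j * fallC Complex.I p j

theorem hankelConst_ne_zero {p q : ℂ} (hp : p.re < 0) (hq : q.re < 0) (n : ℕ) :
    hankelConst p q n ≠ 0 :=
  Finset.prod_ne_zero_iff.mpr fun j _ => mul_ne_zero
    (fallC_ne_zero (neg_ne_zero.mpr Complex.I_ne_zero) hq j) (fallC_ne_zero Complex.I_ne_zero hp j)

theorem hankelD_eq {μ : ℝ} (hμ : -1 < μ) {p q : ℂ} (h : (p + q).re + μ < -1) (a b : ℂ) {κ : ℂ}
    (hκ : 2 * κ = -(1 + μ + p + q)) (n : ℕ) (s : ℝ) :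
    hankelD (ladderE μ a b p q κ 0 0) n s = hankelConst p q n *
      gW (n * (n - 1 + 2 * κ) / 2) (n * (n - 1 + 2 * κ) / 2) s * hdet μ a b p q n s := by
  rw [hankelD, det_opD_iterate hμ h a b hκ, Finset.prod_mul_distrib, prod_gW, hankelConst]

theorem pCy_re_neg {N : ℕ} {μ η₁ : ℝ} (η₂ : ℝ) (hμ : -1 < μ) (h : 2 * (N : ℝ) - 1 + μ < 2 * η₁) :
    (pCy N η₁ η₂).re < 0 := by
  simp [pCy]; linarith

theorem qCy_re_neg {N : ℕ} {μ η₁ : ℝ} (η₂ : ℝ) (hμ : -1 < μ) (h : 2 * (N : ℝ) - 1 + μ < 2 * η₁) :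
    (qCy N η₁ η₂).re < 0 := by
  simp [qCy]; linarith

/-- On the line `δ = (i/2) D`, which only contributes row and column constants. The power of `1 +
s²` produced by the ladder is exactly the one in `barFactor`. The remaining constant is non-zero
because `p` and `q` have negative real part, so that no factor `p - l` or `q - l` vanishes. -/
theorem tauDet_eq_hdet (N : ℕ) {η₁ μ : ℝ} (η₂ : ℝ) (hμ : -1 < μ)
    (h : 2 * (N : ℝ) - 1 + μ < 2 * η₁) (ξ : ℂ) (n : ℕ) :
    ∃ c : ℂ, c ≠ 0 ∧ ∀ s, tauDet (bSeed N η₁ η₂ μ) ξ n s =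
      c * hdet μ 1 (bWt ξ μ) (pCy N η₁ η₂) (qCy N η₁ η₂) n s := by
  obtain ⟨c1, hc1, h1⟩ := barFactor_bSeed N η₁ η₂ μ 1
  obtain ⟨cn, hcn, hn⟩ := barFactor_bSeed N η₁ η₂ μ n
  set f := ladderE μ 1 (bWt ξ μ) (pCy N η₁ η₂) (qCy N η₁ η₂) (kapCy N η₁ μ) 0 0 with hf
  have hfun : (fun r => barFactor (bSeed N η₁ η₂ μ) 1 r * tauOne (bSeed N η₁ η₂ μ) ξ r) =
      fun r => c1 * f r := by
    funext r
    rw [h1, tauOne_bSeed N η₂ hμ h, hf, ladderE]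
    simp only [Nat.cast_zero, Nat.cast_one, zero_add, sub_self, add_zero, sub_zero, one_mul]
    rw [mul_div_cancel_left₀ _ (two_ne_zero)]
    ring
  have hent : ∀ (j k : ℕ) s, deltaLine^[j + k] (fun r => barFactor (bSeed N η₁ η₂ μ) 1 r *
      tauOne (bSeed N η₁ η₂ μ) ξ r) s =
      c1 * (Complex.I / 2) ^ j * ((Complex.I / 2) ^ k * opD^[j + k] f s) := by
    intro j k s
    rw [hfun, deltaLine_iterate, opD_iterate_const_mul, pow_add]
    ring
  have hK := hankelConst_ne_zero (pCy_re_neg η₂ hμ h) (qCy_re_neg η₂ hμ h) n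
  refine ⟨(∏ j : Fin n, c1 * (Complex.I / 2) ^ (j : ℕ)) * (∏ k : Fin n, (Complex.I / 2) ^ (k : ℕ)) *
    hankelConst (pCy N η₁ η₂) (qCy N η₁ η₂) n / cn, ?_, fun s => ?_⟩
  · have hI : Complex.I / 2 ≠ 0 := by simp
    refine div_ne_zero (mul_ne_zero (mul_ne_zero ?_ ?_) hK) hcn
    · exact Finset.prod_ne_zero_iff.mpr fun j _ => mul_ne_zero hc1 (pow_ne_zero _ hI)
    · exact Finset.prod_ne_zero_iff.mpr fun j _ => pow_ne_zero _ hI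
  · rw [tauDet]
    simp only [hent]
    have e1 := Matrix.det_mul_column (fun j : Fin n => c1 * (Complex.I / 2) ^ (j : ℕ))
      (Matrix.of fun j k : Fin n => (Complex.I / 2) ^ (k : ℕ) * opD^[(j : ℕ) + k] f s)
    have e2 := Matrix.det_mul_row (fun k : Fin n => (Complex.I / 2) ^ (k : ℕ))
      (Matrix.of fun j k : Fin n => opD^[(j : ℕ) + k] f s)
    have e3 := hankelD_eq hμ (exponent_lt η₂ h) 1 (bWt ξ μ) (two_mul_kapCy N η₁ η₂ μ) n s
    simp only [Matrix.of_apply] at e1 e2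
    rw [e1, e2, hn]
    rw [hankelD] at e3
    rw [e3]
    have := gW_ne_zero (n * (n - 1 + 2 * kapCy N η₁ μ) / 2) (n * (n - 1 + 2 * kapCy N η₁ μ) / 2) s
    field_simp

section

/-! ### The edge relations along a Toda chain and the `σ`-form -/

/-- Data of a Toda chain in logarithmic form on an open set. -/
structure TodaChain (b₁ b₂ b₄ : ℂ) (N : ℕ) (V : Set ℝ) (U U1 U2 : ℕ → ℝ → ℂ) : Prop where
  isOpen : IsOpen V
  deriv1 : ∀ n ≤ N, ∀ s ∈ V, HasDerivAt (U n) (U1 n s) s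
  deriv2 : ∀ n ≤ N, ∀ s ∈ V, HasDerivAt (U1 n) (U2 n s) s
  toda : ∀ n, n + 1 < N → ∀ s ∈ V, (U1 (n + 1) s + (n + 1 - b₁) ^ 2) *
    (U (n + 2) s + U n s - 2 * U (n + 1) s) = (1 + (s : ℂ) ^ 2) * U2 (n + 1) s
  ne_zero : ∀ n, n + 1 < N → ∀ s ∈ V, U1 (n + 1) s + (n + 1 - b₁) ^ 2 ≠ 0
  base0 : ∀ s ∈ V, U 0 s = -b₁ ^ 2 * s + Complex.I * b₂ * b₄
  base1 : 1 ≤ N → ∀ s ∈ V, (1 + (s : ℂ) ^ 2) * (U1 0 s + U1 1 s) =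
    2 * s * (U 1 s - (1 - b₁) * (U 1 s - U 0 s)) - (b₁ ^ 2 + b₂ ^ 2 + b₄ ^ 2) -
      (U 1 s - U 0 s) ^ 2

/-- The first relation between consecutive members `U n`, `U (n+1)` of a chain. -/
def EdgeSum (b₁ b₂ b₄ : ℂ) (U U1 : ℕ → ℝ → ℂ) (n : ℕ) (s : ℝ) : Prop :=
  (1 + (s : ℂ) ^ 2) * (U1 n s + U1 (n + 1) s) =
    2 * s * (U (n + 1) s - (n + 1 - b₁) * (U (n + 1) s - U n s)) -
      (b₁ ^ 2 + b₂ ^ 2 + b₄ ^ 2) - (U (n + 1) s - U n s) ^ 2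

/-- The second relation between consecutive members `U n`, `U (n+1)` of a chain. -/
def EdgeProd (b₁ b₂ b₄ : ℂ) (U U1 : ℕ → ℝ → ℂ) (n : ℕ) (s : ℝ) : Prop :=
  (1 + (s : ℂ) ^ 2) * (U1 n s * U1 (n + 1) s) =
    (U (n + 1) s - (n + 1 - b₁) * (U (n + 1) s - U n s)) ^ 2 +
      (b₁ ^ 2 * b₂ ^ 2 + b₁ ^ 2 * b₄ ^ 2 + b₂ ^ 2 * b₄ ^ 2) -
      2 * Complex.I * (b₁ * b₂ * b₄) * (U (n + 1) s - U n s)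

/-- The backward first-order relation for the member `U (n+1)` of a chain. -/
def BackRel (b₁ b₂ b₄ : ℂ) (U U1 U2 : ℕ → ℝ → ℂ) (n : ℕ) (s : ℝ) : Prop :=
  2 * (U1 (n + 1) s + (n + 1 - b₁) ^ 2) * (U (n + 1) s - U n s) =
    2 * (n + 1 - b₁) * (U (n + 1) s - s * U1 (n + 1) s) + 2 * Complex.I * (b₁ * b₂ * b₄) -
      (1 + (s : ℂ) ^ 2) * U2 (n + 1) s

namespace TodaChain

variable {b₁ b₂ b₄ : ℂ} {N : ℕ} {V : Set ℝ} {U U1 U2 : ℕ → ℝ → ℂ}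

theorem hasDerivAt_eq {V : Set ℝ} (hV : IsOpen V) {f g : ℝ → ℂ} {f' g' : ℂ} {s : ℝ} (hs : s ∈ V)
    (h : ∀ s ∈ V, f s = g s) (hf : HasDerivAt f f' s) (hg : HasDerivAt g g' s) : f' = g' :=
  hf.unique (hg.congr_of_eventuallyEq (eventually_of_mem (hV.mem_nhds hs) h))

theorem U1_zero (H : TodaChain b₁ b₂ b₄ N V U U1 U2) {s : ℝ} (hs : s ∈ V) : U1 0 s = -b₁ ^ 2 := by
  have h : HasDerivAt (fun s : ℝ => -b₁ ^ 2 * (s : ℂ) + Complex.I * b₂ * b₄) (-b₁ ^ 2) s := by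
    simpa using ((hasDerivAt_ofReal s).const_mul (-b₁ ^ 2)).add_const (Complex.I * b₂ * b₄)
  exact hasDerivAt_eq H.isOpen hs H.base0 (H.deriv1 0 (Nat.zero_le _) s hs) h

theorem U2_zero (H : TodaChain b₁ b₂ b₄ N V U U1 U2) {s : ℝ} (hs : s ∈ V) : U2 0 s = 0 :=
  hasDerivAt_eq H.isOpen hs (fun _ h => H.U1_zero h) (H.deriv2 0 (Nat.zero_le _) s hs)
    (hasDerivAt_const s _)

/-- Adding the forward first-order relation for `U n` to the derivative of the sum relation gives
the backward relation for `U (n + 1)`. -/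
theorem backRel_of_edge (H : TodaChain b₁ b₂ b₄ N V U U1 U2) {n : ℕ} (hn : n + 1 ≤ N)
    (hE : ∀ s ∈ V, EdgeSum b₁ b₂ b₄ U U1 n s)
    (hF : ∀ s ∈ V, 2 * (U1 n s + (n - b₁) ^ 2) * (U (n + 1) s - U n s) =
      2 * (n - b₁) * (U n s - s * U1 n s) + 2 * Complex.I * (b₁ * b₂ * b₄) +
      (1 + (s : ℂ) ^ 2) * U2 n s) {s : ℝ} (hs : s ∈ V) : BackRel b₁ b₂ b₄ U U1 U2 n s := by
  have d0 := H.deriv1 n (by omega) s hs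
  have d1 := H.deriv1 (n + 1) hn s hs
  have e0 := H.deriv2 n (by omega) s hs
  have e1 := H.deriv2 (n + 1) hn s hs
  have ds := hasDerivAt_ofReal s
  have l := ((ds.fun_pow 2).const_add 1).mul (e0.add e1)
  have r := (((ds.const_mul 2).mul (d1.sub ((d1.sub d0).const_mul ((n : ℂ) + 1 - b₁)))).sub_const
    (b₁ ^ 2 + b₂ ^ 2 + b₄ ^ 2)).sub ((d1.sub d0).fun_pow 2)
  have key := hasDerivAt_eq H.isOpen hs hE l r
  have hFs := hF s hs
  simp only [BackRel]
  simp only [Pi.add_apply, Pi.sub_apply] at key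
  push_cast at key
  linear_combination hFs + key

/-- Adding the backward relation and the Toda equation removes the second derivative and gives `hS`,
an expression for `U (n + 2) - U n`. Differentiating `hS` then controls the difference of the sum
relations at `n + 1` and `n`; the product relation follows algebraically from the sum relations and
`hS`. -/
theorem edge_succ (H : TodaChain b₁ b₂ b₄ N V U U1 U2) {n : ℕ} (hn : n + 1 < N)
    (hE : ∀ s ∈ V, EdgeSum b₁ b₂ b₄ U U1 n s) (hP : ∀ s ∈ V, EdgeProd b₁ b₂ b₄ U U1 n s)
    (hB : ∀ s ∈ V, BackRel b₁ b₂ b₄ U U1 U2 n s) {s : ℝ} (hs : s ∈ V) :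
    EdgeSum b₁ b₂ b₄ U U1 (n + 1) s ∧ EdgeProd b₁ b₂ b₄ U U1 (n + 1) s := by
  have hS : ∀ s ∈ V, (U1 (n + 1) s + (n + 1 - b₁) ^ 2) * (U (n + 2) s - U n s) =
      2 * (n + 1 - b₁) * (U (n + 1) s - s * U1 (n + 1) s) + 2 * Complex.I * (b₁ * b₂ * b₄) := by
    intro s hs
    have h1 := hB s hs
    have h2 := H.toda n hn s hs
    simp only [BackRel] at h1
    linear_combination h1 + h2
  have d0 := H.deriv1 n (by omega) s hs
  have d1 := H.deriv1 (n + 1) (by omega) s hs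
  have d2 := H.deriv1 (n + 2) (by omega) s hs
  have e1 := H.deriv2 (n + 1) (by omega) s hs
  have ds := hasDerivAt_ofReal s
  have l := (e1.add_const (((n : ℂ) + 1 - b₁) ^ 2)).mul (d2.sub d0)
  have r := ((d1.sub (ds.mul e1)).const_mul (2 * ((n : ℂ) + 1 - b₁))).add_const
    (2 * Complex.I * (b₁ * b₂ * b₄))
  have key := hasDerivAt_eq H.isOpen hs hS l r
  have hT := H.toda n hn s hs
  have hW := H.ne_zero n hn s hs
  have hEs := hE s hs
  have hPs := hP s hs
  have hSs := hS s hs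
  simp only [EdgeSum, EdgeProd] at hEs hPs ⊢
  simp only [Pi.sub_apply] at key
  -- The derivative of `hS` still contains `U2`. The Toda equation replaces `(1 + s²) U2` by `U1 +
  -- (n + 1 - b₁)²` times a second difference, so this non-zero factor cancels.
  have hdiff : (1 + (s : ℂ) ^ 2) * (U1 (n + 2) s - U1 n s) = (U (n + 1) s - U n s) ^ 2 -
      (U (n + 2) s - U (n + 1) s) ^ 2 - 2 * (n + 1 - b₁) * s *
        (U (n + 2) s + U n s - 2 * U (n + 1) s) := by
    apply mul_left_cancel₀ hW
    linear_combination (1 + (s : ℂ) ^ 2) * key +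
      (U (n + 2) s - U n s + 2 * (n + 1 - b₁) * s) * hT
  have h1 : (1 + (s : ℂ) ^ 2) * (U1 (n + 1) s + U1 (n + 1 + 1) s) =
      2 * s * (U (n + 1 + 1) s - (((n + 1 : ℕ) : ℂ) + 1 - b₁) *
        (U (n + 1 + 1) s - U (n + 1) s)) -
      (b₁ ^ 2 + b₂ ^ 2 + b₄ ^ 2) - (U (n + 1 + 1) s - U (n + 1) s) ^ 2 := by
    push_cast
    linear_combination hEs + hdiff
  refine ⟨h1, ?_⟩
  push_cast at h1 ⊢
  linear_combination U1 (n + 1) s * h1 - U1 (n + 1) s * hEs + hPs -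
    (U (n + 2) s + U n s - 2 * U (n + 1) s) * hSs

theorem relations (H : TodaChain b₁ b₂ b₄ N V U U1 U2) (n : ℕ) (hn : n + 1 ≤ N) :
    ∀ s ∈ V, EdgeSum b₁ b₂ b₄ U U1 n s ∧ EdgeProd b₁ b₂ b₄ U U1 n s ∧
      BackRel b₁ b₂ b₄ U U1 U2 n s := by
  induction n with
  | zero =>
    have hE : ∀ s ∈ V, EdgeSum b₁ b₂ b₄ U U1 0 s := by
      intro s hs
      have := H.base1 hn s hs
      simp only [EdgeSum]
      push_cast
      linear_combination this
    intro s hs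
    -- At the start `U 0` is linear with slope `-b₁²`: the product relation is `-b₁²` times the sum
    -- relation, and both sides of the forward relation are explicit.
    refine ⟨hE s hs, ?_, H.backRel_of_edge hn hE ?_ hs⟩
    · have h1 := hE s hs
      simp only [EdgeSum, EdgeProd] at h1 ⊢
      have h0 := H.base0 s hs
      have h2 := H.U1_zero hs
      rw [h2, h0] at h1 ⊢
      push_cast at h1 ⊢
      linear_combination (-b₁ ^ 2) * h1 - (b₂ ^ 2 * b₄ ^ 2) * Complex.I_sq
    · intro s hs
      rw [H.U1_zero hs, H.U2_zero hs, H.base0 s hs]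
      push_cast
      ring
  | succ n ih =>
    have hprev := ih (by omega)
    have hnext := fun s hs => H.edge_succ (by omega) (fun s hs => (hprev s hs).1)
      (fun s hs => (hprev s hs).2.1) (fun s hs => (hprev s hs).2.2) (s := s) hs
    intro s hs
    refine ⟨(hnext s hs).1, (hnext s hs).2, H.backRel_of_edge hn (fun s hs => (hnext s hs).1) ?_ hs⟩
    -- The forward relation for `U (n + 1)` is the backward one plus twice the Toda equation.
    intro s hs
    have h1 := (hprev s hs).2.2
    have h2 := H.toda n (by omega) s hs
    simp only [BackRel] at h1
    push_cast
    linear_combination h1 + 2 * h2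

/-- Relation between `U n` and `U (n+1)` that involves only the derivative of the latter. -/
theorem edge_quadratic {n : ℕ} {s : ℝ} (h1 : EdgeSum b₁ b₂ b₄ U U1 n s)
    (h2 : EdgeProd b₁ b₂ b₄ U U1 n s) :
    (U (n + 1) s - U n s) * (2 * (n + 1 - b₁) * (U (n + 1) s - s * U1 (n + 1) s) +
      2 * Complex.I * (b₁ * b₂ * b₄)) -
      (U1 (n + 1) s + (n + 1 - b₁) ^ 2) * (U (n + 1) s - U n s) ^ 2 =
    (U (n + 1) s - s * U1 (n + 1) s) ^ 2 + U1 (n + 1) s ^ 2 +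
      (b₁ ^ 2 + b₂ ^ 2 + b₄ ^ 2) * U1 (n + 1) s +
      (b₁ ^ 2 * b₂ ^ 2 + b₁ ^ 2 * b₄ ^ 2 + b₂ ^ 2 * b₄ ^ 2) := by
  simp only [EdgeSum, EdgeProd] at h1 h2
  linear_combination (-U1 (n + 1) s) * h1 + h2

/-- `BackRel` expresses `(1 + s²) U2` as `R - 2 W Δ`, where `Δ = U (n + 1) - U n`, `W = U1 (n + 1) +
(n + 1 - b₁)²`, and `R` contains only `U (n + 1)` and its first derivative. Squaring gives `R² - 4 W
(Δ R - W Δ²)`, and `edge_quadratic` evaluates the bracket without `U n`. -/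
theorem sigmaForm {n : ℕ} {s : ℝ} (h1 : EdgeSum b₁ b₂ b₄ U U1 n s)
    (h2 : EdgeProd b₁ b₂ b₄ U U1 n s) (h3 : BackRel b₁ b₂ b₄ U U1 U2 n s) :
    U1 (n + 1) s * ((1 + (s : ℂ) ^ 2) * U2 (n + 1) s) ^ 2 +
      4 * (U1 (n + 1) s * (U (n + 1) s - s * U1 (n + 1) s) -
        Complex.I * (b₁ * b₂ * (n + 1 - b₁) * b₄)) ^ 2 +
      4 * ((U1 (n + 1) s + b₁ ^ 2) * (U1 (n + 1) s + b₂ ^ 2) *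
        (U1 (n + 1) s + (n + 1 - b₁) ^ 2) * (U1 (n + 1) s + b₄ ^ 2)) = 0 := by
  have h4 := edge_quadratic h1 h2
  simp only [BackRel] at h3
  have h5 : (1 + (s : ℂ) ^ 2) * U2 (n + 1) s =
    2 * (n + 1 - b₁) * (U (n + 1) s - s * U1 (n + 1) s) + 2 * Complex.I * (b₁ * b₂ * b₄) -
    2 * (U1 (n + 1) s + (n + 1 - b₁) ^ 2) * (U (n + 1) s - U n s) := by linear_combination h3
  rw [h5]
  linear_combination (-4 * U1 (n + 1) s * (U1 (n + 1) s + (n + 1 - b₁) ^ 2)) * h4 +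
    4 * (b₁ * b₂ * b₄) ^ 2 * (U1 (n + 1) s + (n + 1 - b₁) ^ 2) * Complex.I_sq

end TodaChain

end

/-! ### The chain of logarithmic derivatives of Hankel determinants -/

theorem hasDerivAt_opD {f : ℝ → ℂ} (hf : ∀ n : ℕ, ContDiff ℝ n f) (s : ℝ) :
    HasDerivAt f (opD f s / (1 + (s : ℂ) ^ 2)) s := by
  simpa using hasDerivAt_opD_iterate hf 0 s

theorem opD_eq_of_hasDerivAt {f : ℝ → ℂ} {x : ℂ} {s : ℝ}
    (h : HasDerivAt f (x / (1 + (s : ℂ) ^ 2)) s) : opD f s = x := by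
  rw [opD, h.deriv, mul_div_cancel₀ _ (one_add_sq_ne_zero s)]

/-- The logarithmic derivative `(1 + s²) f' / f`. -/
def logD1 (f : ℝ → ℂ) (s : ℝ) : ℂ := opD f s / f s

/-- The derivative of `logD1 f`. -/
def logD2 (f : ℝ → ℂ) (s : ℝ) : ℂ :=
  (opD (opD f) s / f s - (opD f s / f s) ^ 2) / (1 + (s : ℂ) ^ 2)

/-- The derivative of `logD2 f`. -/
def logD3 (f : ℝ → ℂ) (s : ℝ) : ℂ :=
  ((opD (opD (opD f)) s / f s - 3 * (opD f s / f s) * (opD (opD f) s / f s) +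
    2 * (opD f s / f s) ^ 3) / (1 + (s : ℂ) ^ 2) - 2 * s * logD2 f s) / (1 + (s : ℂ) ^ 2)

theorem hasDerivAt_logD1 {f : ℝ → ℂ} (hf : ∀ n : ℕ, ContDiff ℝ n f) {s : ℝ} (h : f s ≠ 0) :
    HasDerivAt (logD1 f) (logD2 f s) s := by
  have h0 := hasDerivAt_opD hf s
  have h1 := hasDerivAt_opD (contDiff_opD hf) s
  refine (h1.div h0 h).congr_deriv ?_
  have := one_add_sq_ne_zero s
  rw [logD2]
  field_simp

theorem hasDerivAt_logD2 {f : ℝ → ℂ} (hf : ∀ n : ℕ, ContDiff ℝ n f) {s : ℝ} (h : f s ≠ 0) :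
    HasDerivAt (logD2 f) (logD3 f s) s := by
  have h0 := hasDerivAt_opD hf s
  have h1 := hasDerivAt_opD (contDiff_opD hf) s
  have h2 := hasDerivAt_opD (contDiff_opD (contDiff_opD hf)) s
  have hw := ((hasDerivAt_ofReal s).fun_pow 2).const_add 1
  have hne := one_add_sq_ne_zero s
  refine (((h2.div h0 h).sub ((h1.div h0 h).fun_pow 2)).div hw hne).congr_deriv ?_
  simp only [logD3, logD2, Pi.sub_apply, Pi.div_apply, Nat.reduceSub, pow_one, Nat.cast_ofNat]
  field_simp
  ring

theorem contDiff_hankelD {f : ℝ → ℂ} (hf : ∀ n : ℕ, ContDiff ℝ n f) (n m : ℕ) :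
    ContDiff ℝ m (hankelD f n) := by
  unfold hankelD
  simp only [Matrix.det_apply', Matrix.of_apply]
  refine ContDiff.sum fun σ _ => contDiff_const.mul (contDiff_prod fun i _ => ?_)
  exact contDiff_opD_iterate hf _ m

theorem isOpen_hankelD_ne {f : ℝ → ℂ} (hf : ∀ n : ℕ, ContDiff ℝ n f) (N : ℕ) :
    IsOpen {s | ∀ m ≤ N, hankelD f m s ≠ 0} := by
  have : {s | ∀ m ≤ N, hankelD f m s ≠ 0} = ⋂ m ∈ Finset.Iic N, {s | hankelD f m s ≠ 0} := by
    ext s; simp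
  rw [this]
  exact isOpen_biInter_finset fun m _ =>
    isOpen_ne_fun (contDiff_hankelD hf m 0).continuous continuous_const

theorem hankelD_zero (f : ℝ → ℂ) (s : ℝ) : hankelD f 0 s = 1 := by simp [hankelD]

theorem hankelD_one (f : ℝ → ℂ) : hankelD f 1 = f := by
  funext s; simp [hankelD]

theorem logD2_hankelD {f : ℝ → ℂ} (hf : ∀ n : ℕ, ContDiff ℝ n f) (n : ℕ) {s : ℝ}
    (h0 : hankelD f n s ≠ 0) (h1 : hankelD f (n + 1) s ≠ 0) :
    logD2 (hankelD f (n + 1)) s =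
      hankelD f (n + 2) s * hankelD f n s / hankelD f (n + 1) s ^ 2 / (1 + (s : ℂ) ^ 2) := by
  obtain ⟨T1, T2, hT1, hT2, hT⟩ := hankelD_toda hf n
  have e1 : opD (hankelD f (n + 1)) = T1 := funext fun s => opD_eq_of_hasDerivAt (hT1 s)
  have e2 : opD T1 = T2 := funext fun s => opD_eq_of_hasDerivAt (hT2 s)
  rw [logD2, e1, e2, hT s h0]
  field_simp

/-- The `n`-th member of the chain built on `f`. -/
def chainU (b₁ b₂ b₄ : ℂ) (f : ℝ → ℂ) (n : ℕ) (s : ℝ) : ℂ :=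
  logD1 (hankelD f n) s - (n - b₁) ^ 2 * s + Complex.I * b₂ * (n + b₄)

/-- The hypothesis `hode` is the relation between `U 0` and `U 1` cleared of its denominators: the
Riccati form of a linear second-order equation for `f`. The Toda relation of the chain is a
logarithmic derivative of the bilinear one. -/
theorem todaChain_hankelD {f : ℝ → ℂ} (hf : ∀ n : ℕ, ContDiff ℝ n f) {b₁ b₂ b₄ : ℂ} (N : ℕ)
    (hode : ∀ s, (opD (opD f) s - (1 + (s : ℂ) ^ 2) * ((1 - b₁) ^ 2 + b₁ ^ 2) * f s) =
      2 * s * ((b₁ * opD f s) + (-(1 - b₁) ^ 2 * s + Complex.I * b₂ * (1 + b₄) -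
        (1 - b₁) * ((2 * b₁ - 1) * s + Complex.I * b₂)) * f s) -
      (b₁ ^ 2 + b₂ ^ 2 + b₄ ^ 2) * f s - (2 * opD f s * ((2 * b₁ - 1) * s + Complex.I * b₂) +
        ((2 * b₁ - 1) * s + Complex.I * b₂) ^ 2 * f s)) :
    TodaChain b₁ b₂ b₄ N {s | ∀ m ≤ N, hankelD f m s ≠ 0} (chainU b₁ b₂ b₄ f)
      (fun n s => logD2 (hankelD f n) s - (n - b₁) ^ 2) (fun n => logD3 (hankelD f n)) where
  isOpen := isOpen_hankelD_ne hf N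
  deriv1 n hn s hs := by
    have h := hasDerivAt_logD1 (contDiff_hankelD hf n) (hs n hn)
    refine ((h.sub ((hasDerivAt_ofReal s).const_mul _)).add_const _).congr_deriv ?_
    simp
  deriv2 n hn s hs := (hasDerivAt_logD2 (contDiff_hankelD hf n) (hs n hn)).sub_const _
  toda n hn s hs := by
    have d0 := hasDerivAt_opD (contDiff_hankelD hf n) s
    have d1 := hasDerivAt_opD (contDiff_hankelD hf (n + 1)) s
    have d2 := hasDerivAt_opD (contDiff_hankelD hf (n + 2)) s
    have n0 := hs n (by omega)
    have n1 := hs (n + 1) (by omega)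
    have n2 := hs (n + 2) (by omega)
    have hw := ((hasDerivAt_ofReal s).fun_pow 2).const_add 1
    have hne := one_add_sq_ne_zero s
    have key := TodaChain.hasDerivAt_eq (isOpen_hankelD_ne hf N) hs
      (fun r hr => logD2_hankelD hf n (hr n (by omega)) (hr (n + 1) (by omega)))
      (hasDerivAt_logD2 (contDiff_hankelD hf (n + 1)) n1)
      (((d2.mul d0).div (d1.fun_pow 2) (pow_ne_zero 2 n1)).div hw hne)
    rw [key, logD2_hankelD hf n n0 n1]
    simp only [Pi.mul_apply, Pi.div_apply, chainU, logD1]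
    push_cast
    field_simp
    ring
  ne_zero n hn s hs := by
    have n0 := hs n (by omega)
    have n1 := hs (n + 1) (by omega)
    have n2 := hs (n + 2) (by omega)
    have hne := one_add_sq_ne_zero s
    rw [logD2_hankelD hf n n0 n1]
    push_cast
    rw [sub_add_cancel]
    exact div_ne_zero (div_ne_zero (mul_ne_zero n2 n0) (pow_ne_zero 2 n1)) hne
  base0 s _ := by
    have : hankelD f 0 = fun _ => 1 := funext (hankelD_zero f)
    rw [chainU, logD1, this, opD]
    simp
  base1 hN s hs := by
    have n1 := hs 1 hN
    have hne := one_add_sq_ne_zero s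
    have h := hode s
    have h0 : hankelD f 0 = fun _ => 1 := funext (hankelD_zero f)
    rw [hankelD_one] at n1
    have z0 : opD (fun _ : ℝ => (1 : ℂ)) = fun _ => 0 := by funext s; simp [opD]
    have z1 : opD (fun _ : ℝ => (0 : ℂ)) = fun _ => 0 := by funext s; simp [opD]
    simp only [chainU, logD1, logD2, h0, z0, z1, hankelD_one]
    push_cast
    field_simp
    linear_combination f s * h

theorem opD_mul {f g : ℝ → ℂ} {s : ℝ} (hf : DifferentiableAt ℝ f s) (hg : DifferentiableAt ℝ g s) :
    opD (fun s => f s * g s) s = opD f s * g s + f s * opD g s := by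
  have := (hf.hasDerivAt.fun_mul hg.hasDerivAt).deriv
  rw [opD, this, opD, opD]
  ring

/-- Raising and lowering close into a first-order system for the two contiguous integrals `J0` and
`J1`. Computing two `D`-derivatives of `f` in this system gives the hypergeometric equation in the
form required by the chain. -/
theorem ladderE_ode {μ : ℝ} (hμ : -1 < μ) {p q : ℂ} (h : (p + q).re + μ < -1) (a b : ℂ) {κ b₁ b₂ b₄ : ℂ}
    (hκ : 2 * κ = -(1 + μ + p + q)) (hp : p = b₁ - b₂ - 1) (hq : q = b₁ + b₂ - 1)
    (hb₄ : b₄ = -μ - b₁) (s : ℝ) : let f := ladderE μ a b p q κ 0 0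
    (opD (opD f) s - (1 + (s : ℂ) ^ 2) * ((1 - b₁) ^ 2 + b₁ ^ 2) * f s) =
      2 * s * ((b₁ * opD f s) + (-(1 - b₁) ^ 2 * s + Complex.I * b₂ * (1 + b₄) -
        (1 - b₁) * ((2 * b₁ - 1) * s + Complex.I * b₂)) * f s) -
      (b₁ ^ 2 + b₂ ^ 2 + b₄ ^ 2) * f s - (2 * opD f s * ((2 * b₁ - 1) * s + Complex.I * b₂) +
        ((2 * b₁ - 1) * s + Complex.I * b₂) ^ 2 * f s) := by
  intro f
  set G := gW κ κ with hG
  set J0 := fullI μ a b p q with hJ0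
  set J1 := fullI μ a b (p + 1) (q - 1) with hJ1
  have dG : ∀ s : ℝ, HasDerivAt G (2 * κ * s * G s / (1 + (s : ℂ) ^ 2)) s := fun s =>
    (gW_hasDerivAt' κ κ s).congr_deriv (by rw [← hG]; ring)
  have d0 : ∀ s : ℝ, HasDerivAt J0 ((s + Complex.I) * ((1 + μ + p) * J0 s - q * J1 s) /
      (1 + (s : ℂ) ^ 2)) s := fun s =>
    (fullI_raise hμ h a b s).congr_deriv (by rw [← hJ0, ← hJ1]; ring)
  have d1 : ∀ s : ℝ, HasDerivAt J1 ((s - Complex.I) * ((μ + q) * J1 s - (p + 1) * J0 s) /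
      (1 + (s : ℂ) ^ 2)) s := fun s =>
    (fullI_lower hμ (p := p + 1) (q := q - 1) (by
      rwa [show p + 1 + (q - 1) = p + q by ring]) a b s).congr_deriv (by
        rw [← hJ1, add_sub_cancel_right, sub_add_cancel, ← hJ0]; ring)
  have hf : f = fun s => G s * J0 s := by
    funext s; simp [f, ladderE, hG, hJ0]
  have e1 : opD f = fun s : ℝ => G s * (2 * κ * s * J0 s +
      (s + Complex.I) * ((1 + μ + p) * J0 s - q * J1 s)) := by
    funext s
    refine opD_eq_of_hasDerivAt ?_
    rw [hf]
    exact ((dG s).fun_mul (d0 s)).congr_deriv (by ring)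
  have e2 : opD (opD f) s = 2 * κ * s * G s * (2 * κ * s * J0 s +
      (s + Complex.I) * ((1 + μ + p) * J0 s - q * J1 s)) +
      G s * ((1 + (s : ℂ) ^ 2) * (2 * κ * J0 s + ((1 + μ + p) * J0 s - q * J1 s)) +
        2 * κ * s * ((s + Complex.I) * ((1 + μ + p) * J0 s - q * J1 s)) +
        (s + Complex.I) * ((1 + μ + p) * ((s + Complex.I) * ((1 + μ + p) * J0 s - q * J1 s)) -
          q * ((s - Complex.I) * ((μ + q) * J1 s - (p + 1) * J0 s)))) := by
    refine opD_eq_of_hasDerivAt ?_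
    rw [e1]
    have ds := hasDerivAt_ofReal s
    refine ((dG s).fun_mul ((((ds.const_mul (2 * κ)).fun_mul (d0 s))).fun_add
      ((ds.add_const Complex.I).fun_mul (((d0 s).const_mul (1 + μ + p)).fun_sub
        ((d1 s).const_mul q))))).congr_deriv ?_
    have hne := one_add_sq_ne_zero s
    field_simp
    ring
  rw [e2, e1, hf]
  have hκ' : κ = -(1 + μ + p + q) / 2 := by rw [← hκ]; ring
  have hμ' : (μ : ℂ) = -b₄ - b₁ := by rw [hb₄]; ring
  rw [hκ', hp, hq, hμ']
  dsimp only
  generalize J0 s = x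
  generalize J1 s = y
  linear_combination (G s * ((-b₄ - b₂) * ((-b₄ - b₂) * x - (b₁ + b₂ - 1) * y) +
    (b₁ + b₂ - 1) * ((-b₄ + b₂ - 1) * y - (b₁ - b₂) * x)) +
    2 * b₂ * G s * ((-b₄ - b₂) * x - (b₁ + b₂ - 1) * y) + b₂ ^ 2 * G s * x) * Complex.I_sq

section

/-! ### Polynomial dependence on the relative weight -/

open Polynomial in
/-- The determinant `hdet μ 1 b p q n s` as a polynomial in `b`. -/
def hdetPoly (μ : ℝ) (p q : ℂ) (n : ℕ) (s : ℝ) : ℂ[X] :=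
  ((X : ℂ[X]) • (Matrix.of fun j k : Fin n => halfI μ (p + ((j : ℕ) : ℂ) - ((k : ℕ) : ℂ))
    (q - ((j : ℕ) : ℂ) + ((k : ℕ) : ℂ)) s).map C +
    (Matrix.of fun j k : Fin n => halfI μ (q - ((j : ℕ) : ℂ) + ((k : ℕ) : ℂ))
      (p + ((j : ℕ) : ℂ) - ((k : ℕ) : ℂ)) (-s)).map C).det

open Polynomial in
theorem eval_hdetPoly (μ : ℝ) (b p q : ℂ) (n : ℕ) (s : ℝ) :
    (hdetPoly μ p q n s).eval b = hdet μ 1 b p q n s := by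
  rw [hdetPoly, ← coe_evalRingHom, RingHom.map_det, hdet]
  congr 1
  ext j k
  simp [fullI]
  ring

/-- The Lagrange basis for the nodes `0, …, n`. -/
def nodeBasis (n : ℕ) (j : ℕ) : Polynomial ℂ :=
  Lagrange.basis (Finset.range (n + 1)) (fun j : ℕ => (j : ℂ)) j

/-- As a function of `b` the determinant is a polynomial of degree at most `n`. Interpolation at `0,
…, n` separates `b` from `s`, so every `s`-derivative is polynomial, and hence continuous, in `b`.
-/
theorem hdet_interpolate (μ : ℝ) (b p q : ℂ) (n : ℕ) (s : ℝ) :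
    hdet μ 1 b p q n s = ∑ j ∈ Finset.range (n + 1), (nodeBasis n j).eval b *
      hdet μ 1 j p q n s := by
  have hdeg : (hdetPoly μ p q n s).degree < (Finset.range (n + 1)).card := by
    rw [Finset.card_range]
    have h1 := Polynomial.natDegree_det_X_add_C_le
      (Matrix.of fun j k : Fin n => halfI μ (p + ((j : ℕ) : ℂ) - ((k : ℕ) : ℂ))
        (q - ((j : ℕ) : ℂ) + ((k : ℕ) : ℂ)) s)
      (Matrix.of fun j k : Fin n => halfI μ (q - ((j : ℕ) : ℂ) + ((k : ℕ) : ℂ))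
        (p + ((j : ℕ) : ℂ) - ((k : ℕ) : ℂ)) (-s))
    rw [Fintype.card_fin] at h1
    exact (Polynomial.degree_le_of_natDegree_le h1).trans_lt
      (WithBot.coe_lt_coe.mpr (Nat.lt_succ_self n))
  have h := Lagrange.eq_interpolate (s := Finset.range (n + 1)) (v := fun j : ℕ => (j : ℂ))
    (fun i _ j _ hij => Nat.cast_injective hij) hdeg
  rw [← eval_hdetPoly, h, Lagrange.interpolate_apply, Polynomial.eval_finsetSum]
  refine Finset.sum_congr rfl fun j _ => ?_
  rw [Polynomial.eval_mul, Polynomial.eval_C, eval_hdetPoly, mul_comm, nodeBasis]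

theorem opD_sum {ι : Type*} (S : Finset ι) (c : ι → ℂ) {g : ι → ℝ → ℂ}
    (hg : ∀ i ∈ S, Differentiable ℝ (g i)) :
    opD (fun s => ∑ i ∈ S, c i * g i s) = fun s => ∑ i ∈ S, c i * opD (g i) s := by
  funext s
  have := (HasDerivAt.fun_sum fun i hi => ((hg i hi) s).hasDerivAt.const_mul (c i)).deriv
  rw [opD, this, Finset.mul_sum]
  refine Finset.sum_congr rfl fun i _ => ?_
  rw [opD]; ring

theorem opD_iterate_sum {ι : Type*} (S : Finset ι) (c : ι → ℂ) {g : ι → ℝ → ℂ}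
    (hg : ∀ i ∈ S, ∀ n : ℕ, ContDiff ℝ n (g i)) (m : ℕ) :
    opD^[m] (fun s => ∑ i ∈ S, c i * g i s) = fun s => ∑ i ∈ S, c i * opD^[m] (g i) s := by
  induction m with
  | zero => rfl
  | succ m ih =>
    rw [Function.iterate_succ_apply', ih, opD_sum S c (fun i hi =>
      (contDiff_opD_iterate (hg i hi) m 1).differentiable (by simp))]
    simp only [Function.iterate_succ_apply']

variable {μ : ℝ} {p q κ : ℂ}

theorem continuous_opD_iterate_hankelD (hμ : -1 < μ) (h : (p + q).re + μ < -1)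
    (hκ : 2 * κ = -(1 + μ + p + q)) (n m : ℕ) (s : ℝ) :
    Continuous fun b : ℂ => opD^[m] (hankelD (ladderE μ 1 b p q κ 0 0) n) s := by
  have e : ∀ b : ℂ, hankelD (ladderE μ 1 b p q κ 0 0) n = fun s =>
      ∑ j ∈ Finset.range (n + 1), (nodeBasis n j).eval b *
        hankelD (ladderE μ 1 j p q κ 0 0) n s := by
    intro b
    funext s
    rw [hankelD_eq hμ h 1 b hκ, hdet_interpolate, Finset.mul_sum]
    refine Finset.sum_congr rfl fun j _ => ?_
    rw [hankelD_eq hμ h 1 j hκ]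
    ring
  have e2 : ∀ b : ℂ, opD^[m] (hankelD (ladderE μ 1 b p q κ 0 0) n) s =
      ∑ j ∈ Finset.range (n + 1), (nodeBasis n j).eval b *
        opD^[m] (hankelD (ladderE μ 1 j p q κ 0 0) n) s := by
    intro b
    rw [e b, opD_iterate_sum _ _ (fun j _ => contDiff_hankelD (contDiff_ladderE hμ h 1 _ κ 0 0) n)]
  rw [funext e2]
  exact continuous_finsetSum _ fun j _ => (Polynomial.continuous _).mul continuous_const

/-- At `b = 0` the weight lives on `x ≤ s` and the determinants are non-zero Gram determinants.
Their product over `m ≤ N` is thus a non-zero polynomial in `b`, with finitely many roots. -/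
theorem dense_hankelD_ne_zero (hμ : -1 < μ) (h : (p + q).re + μ < -1)
    (hκ : 2 * κ = -(1 + μ + p + q)) (hpq : (starRingEnd ℂ) p = q) (hp : p.re < 0) (N : ℕ) (s : ℝ) :
    Dense {b : ℂ | ∀ m ≤ N, hankelD (ladderE μ 1 b p q κ 0 0) m s ≠ 0} := by
  have hq : q.re < 0 := by rw [← hpq]; simpa using hp
  set P : Polynomial ℂ := ∏ m ∈ Finset.Iic N, hdetPoly μ p q m s with hP
  have hP0 : P ≠ 0 := by
    refine Finset.prod_ne_zero_iff.mpr fun m _ hm => ?_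
    have := hdet_ne_zero hμ h hpq (a := 1) (b := 0) zero_le_one le_rfl (Or.inl one_pos) m s
    apply this
    have e := eval_hdetPoly μ 0 p q m s
    rw [hm, Polynomial.eval_zero] at e
    simpa using e.symm
  have hd := (P.roots.toFinset.finite_toSet.countable).dense_compl ℂ
  refine hd.mono fun b hb m hm => ?_
  have hb' : P.eval b ≠ 0 := by
    intro h0
    exact hb (by simp [hP0, h0])
  rw [hP, Polynomial.eval_prod, Finset.prod_ne_zero_iff] at hb'
  have := hb' m (by simpa using hm)
  rw [eval_hdetPoly] at this
  rw [hankelD_eq hμ h 1 b hκ]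
  exact mul_ne_zero (mul_ne_zero (hankelConst_ne_zero hp hq m) (gW_ne_zero _ _ _)) this

theorem todaChain_ladderE (hμ : -1 < μ) (h : (p + q).re + μ < -1) (hκ : 2 * κ = -(1 + μ + p + q))
    {b₁ b₂ b₄ : ℂ} (hp : p = b₁ - b₂ - 1) (hq : q = b₁ + b₂ - 1) (hb₄ : b₄ = -μ - b₁) (N : ℕ)
    (b : ℂ) : let f := ladderE μ 1 b p q κ 0 0
    TodaChain b₁ b₂ b₄ N {s | ∀ m ≤ N, hankelD f m s ≠ 0} (chainU b₁ b₂ b₄ f)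
      (fun n s => logD2 (hankelD f n) s - (n - b₁) ^ 2) (fun n => logD3 (hankelD f n)) :=
  todaChain_hankelD (contDiff_ladderE hμ h 1 b κ 0 0) N (ladderE_ode hμ h 1 b hκ hp hq hb₄)

/-- The left side of the `σ`-form in the variables `h`, `h'`, `h''`. -/
def sigmaExpr (b₁ b₂ b₃ b₄ : ℂ) (s : ℝ) (h h1 h2 : ℂ) : ℂ :=
  h1 * ((1 + (s : ℂ) ^ 2) * h2) ^ 2 +
    4 * (h1 * (h - s * h1) - Complex.I * (b₁ * b₂ * b₃ * b₄)) ^ 2 +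
    4 * ((h1 + b₁ ^ 2) * (h1 + b₂ ^ 2) * (h1 + b₃ ^ 2) * (h1 + b₄ ^ 2))

/-- The chain requires all determinants up to `N` to be non-zero, whereas the `σ`-form only involves
the `N`-th. The expression is continuous in `b`; a non-zero value would persist at a nearby generic
`b`, where the chain forces it to vanish. -/
theorem sigmaExpr_chainU (hμ : -1 < μ) (h : (p + q).re + μ < -1) (hκ : 2 * κ = -(1 + μ + p + q))
    (hpq : (starRingEnd ℂ) p = q) (hpr : p.re < 0)
    {b₁ b₂ b₄ : ℂ} (hp : p = b₁ - b₂ - 1) (hq : q = b₁ + b₂ - 1) (hb₄ : b₄ = -μ - b₁) {N : ℕ}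
    (hN : 1 ≤ N) (b : ℂ) (s : ℝ) (hs : hankelD (ladderE μ 1 b p q κ 0 0) N s ≠ 0) :
    sigmaExpr b₁ b₂ (N - b₁) b₄ s (chainU b₁ b₂ b₄ (ladderE μ 1 b p q κ 0 0) N s)
      (logD2 (hankelD (ladderE μ 1 b p q κ 0 0) N) s - (N - b₁) ^ 2)
      (logD3 (hankelD (ladderE μ 1 b p q κ 0 0) N) s) = 0 := by
  obtain ⟨n, rfl⟩ : ∃ n, N = n + 1 := ⟨N - 1, by omega⟩
  by_contra hne
  have hc : ∀ m, ContinuousAt (fun b : ℂ => opD^[m] (hankelD (ladderE μ 1 b p q κ 0 0) (n + 1)) s) b :=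
    fun m => (continuous_opD_iterate_hankelD hμ h hκ (n + 1) m s).continuousAt
  have c0 := hc 0
  have c1 := hc 1
  have c2 := hc 2
  have c3 := hc 3
  simp only [Function.iterate_succ, Function.iterate_zero, Function.comp_apply, id_eq] at c0 c1 c2 c3
  have d1 := c1.div c0 hs
  have d2 := c2.div c0 hs
  have d3 := c3.div c0 hs
  have cl2 : ContinuousAt (fun b : ℂ => logD2 (hankelD (ladderE μ 1 b p q κ 0 0) (n + 1)) s) b :=
    (d2.sub (d1.pow 2)).div_const _
  have cl3 : ContinuousAt (fun b : ℂ => logD3 (hankelD (ladderE μ 1 b p q κ 0 0) (n + 1)) s) b :=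
    (((d3.sub ((d1.const_mul 3).mul d2)).add ((d1.pow 3).const_mul 2)).div_const _ |>.sub
      (cl2.const_mul (2 * (s : ℂ)))).div_const _
  have cu : ContinuousAt (fun b : ℂ => chainU b₁ b₂ b₄ (ladderE μ 1 b p q κ 0 0) (n + 1) s) b :=
    (d1.sub_const _).add_const _
  have ce : ContinuousAt (fun b : ℂ => sigmaExpr b₁ b₂ ((n + 1 : ℕ) - b₁) b₄ s
      (chainU b₁ b₂ b₄ (ladderE μ 1 b p q κ 0 0) (n + 1) s)
      (logD2 (hankelD (ladderE μ 1 b p q κ 0 0) (n + 1)) s - ((n + 1 : ℕ) - b₁) ^ 2)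
      (logD3 (hankelD (ladderE μ 1 b p q κ 0 0) (n + 1)) s)) b := by
    have cU1 := cl2.sub_const ((((n + 1 : ℕ) : ℂ) - b₁) ^ 2)
    exact ((cU1.mul ((cl3.const_mul _).pow 2)).add ((((cU1.mul (cu.sub (cU1.const_mul _))).sub_const
      _).pow 2).const_mul 4)).add (((((cU1.add_const _).mul (cU1.add_const _)).mul
      (cU1.add_const _)).mul (cU1.add_const _)).const_mul 4)
  have hev := ce.eventually_ne hne
  obtain ⟨b', hb', hgood⟩ := (dense_hankelD_ne_zero hμ h hκ hpq hpr (n + 1) s).inter_nhds_nonempty hev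
  have H := todaChain_ladderE hμ h hκ hp hq hb₄ (n + 1) b'
  have rel := H.relations n le_rfl s hb'
  have := TodaChain.sigmaForm rel.1 rel.2.1 rel.2.2
  apply hgood
  rw [sigmaExpr]
  push_cast at this ⊢
  exact this

/-! ### The `σ`-form of the Cauchy average -/

theorem logD1_const_mul {f : ℝ → ℂ} {c : ℂ} (hc : c ≠ 0) (s : ℝ) :
    logD1 (fun s => c * f s) s = logD1 f s := by
  rw [logD1, opD_const_mul, logD1, mul_div_mul_left _ _ hc]

theorem opD_gW (x y : ℂ) (s : ℝ) :
    opD (gW x y) s = (x * (s + Complex.I) + y * (s - Complex.I)) * gW x y s :=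
  opD_eq_of_hasDerivAt ((gW_hasDerivAt' x y s).congr_deriv (by ring))

theorem logD1_gW_mul (x y : ℂ) {f : ℝ → ℂ} {s : ℝ} (hf : DifferentiableAt ℝ f s) (h : f s ≠ 0) :
    logD1 (fun s => gW x y s * f s) s =
      x * (s + Complex.I) + y * (s - Complex.I) + logD1 f s := by
  rw [logD1, opD_mul (gW_hasDerivAt x y s).differentiableAt hf, opD_gW, logD1]
  have := gW_ne_zero x y s
  field_simp

theorem cauchyU_eq_logD1 (N : ℕ) {η₁ μ : ℝ} (η₂ : ℝ) (hμ : -1 < μ)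
    (h : 2 * (N : ℝ) - 1 + μ < 2 * η₁) (ξ : ℂ) {C : ℂ} (hC : C ≠ 0) {s : ℝ}
    (hs : hdet μ 1 (bWt ξ μ) (pCy N η₁ η₂) (qCy N η₁ η₂) N s ≠ 0) :
    cauchyU C N η₁ η₂ μ ξ s = logD1 (hdet μ 1 (bWt ξ μ) (pCy N η₁ η₂) (qCy N η₁ η₂) N) s +
      e2' (bCy N η₁ η₂ μ) * s + η₂ * (μ - η₁) := by
  have hd := (contDiff_hdet hμ (exponent_lt η₂ h) 1 (bWt ξ μ) N 1).differentiable (by simp)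
  have hk : (1 / C * (N.factorial / pairConst N) : ℂ) ≠ 0 :=
    mul_ne_zero (one_div_ne_zero hC) (div_ne_zero (Nat.cast_ne_zero.mpr N.factorial_ne_zero)
      (pairConst_ne_zero N))
  have e : (fun r : ℝ =>
    (1 - Complex.I * r) ^ (e2' (bCy N η₁ η₂ μ) - 1 / 2 * e2 (bCy N η₁ η₂ μ)) *
    (1 + Complex.I * r) ^ (1 / 2 * e2 (bCy N η₁ η₂ μ)) * cauchyE C N η₁ η₂ μ ξ r) = fun r =>
      (1 / C * (N.factorial / pairConst N) : ℂ) * (gW (1 / 2 * e2 (bCy N η₁ η₂ μ))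
        (e2' (bCy N η₁ η₂ μ) - 1 / 2 * e2 (bCy N η₁ η₂ μ)) r *
        hdet μ 1 (bWt ξ μ) (pCy N η₁ η₂) (qCy N η₁ η₂) N r) := by
    funext r
    rw [(cauchyE_eq_hdet N η₂ hμ h ξ C).2, gW]
    ring
  have e3 : cauchyU C N η₁ η₂ μ ξ s = logD1 (fun r =>
      (1 / C * (N.factorial / pairConst N) : ℂ) * (gW (1 / 2 * e2 (bCy N η₁ η₂ μ))
        (e2' (bCy N η₁ η₂ μ) - 1 / 2 * e2 (bCy N η₁ η₂ μ)) r *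
        hdet μ 1 (bWt ξ μ) (pCy N η₁ η₂) (qCy N η₁ η₂) N r)) s := by
    rw [cauchyU, e, logD1, opD, logDeriv_apply]
    ring
  rw [e3, logD1_const_mul hk, logD1_gW_mul _ _ (hd s) hs]
  simp only [e2, e2', bCy, Matrix.cons_val_zero, Matrix.cons_val_one, Matrix.cons_val]
  linear_combination (-η₂ * (μ - η₁) : ℂ) * (Complex.I_sq)

theorem chainU_eq_logD1_hdet (hμ : -1 < μ) (h : (p + q).re + μ < -1)
    (hκ : 2 * κ = -(1 + μ + p + q)) (hp : p.re < 0) (hq : q.re < 0) (b₁ b₂ b₄ b : ℂ) (n : ℕ) {s : ℝ}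
    (hs : hdet μ 1 b p q n s ≠ 0) :
    chainU b₁ b₂ b₄ (ladderE μ 1 b p q κ 0 0) n s = logD1 (hdet μ 1 b p q n) s +
      (n * (n - 1 + 2 * κ) - (n - b₁) ^ 2) * s + Complex.I * b₂ * (n + b₄) := by
  have hd := (contDiff_hdet hμ h 1 b n 1).differentiable (by simp)
  have e : hankelD (ladderE μ 1 b p q κ 0 0) n = fun s => hankelConst p q n *
      (gW (n * (n - 1 + 2 * κ) / 2) (n * (n - 1 + 2 * κ) / 2) s * hdet μ 1 b p q n s) := by
    funext s
    rw [hankelD_eq hμ h 1 b hκ, mul_assoc]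
  rw [chainU, e, logD1_const_mul (hankelConst_ne_zero hp hq n), logD1_gW_mul _ _ (hd s) hs]
  ring

/-- With `b₁ = N - η₁`, `b₂ = i η₂` and `b₄ = -μ - b₁`, the prefactor in `cauchyU` contributes
exactly the linear term of `chainU`, and `N - b₁ = η₁` is the remaining parameter `b₃`. -/
theorem satisfiesSigmaForm_cauchyU {N : ℕ} (hN : 1 ≤ N) {η₁ μ : ℝ} (η₂ : ℝ) (hμ : -1 < μ)
    (h : 2 * (N : ℝ) - 1 + μ < 2 * η₁) (ξ : ℂ) {C : ℂ} (hC : C ≠ 0) :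
    SatisfiesSigmaForm (bCy N η₁ η₂ μ) (cauchyU C N η₁ η₂ μ ξ)
      {t | cauchyE C N η₁ η₂ μ ξ t ≠ 0} := by
  have h' := exponent_lt η₂ h
  have hκ := two_mul_kapCy N η₁ η₂ μ
  have hp0 := pCy_re_neg η₂ hμ h
  have hq0 := qCy_re_neg η₂ hμ h
  set f := ladderE μ 1 (bWt ξ μ) (pCy N η₁ η₂) (qCy N η₁ η₂) (kapCy N η₁ μ) 0 0 with hf
  have hfs : ∀ n : ℕ, ContDiff ℝ n f := contDiff_ladderE hμ h' 1 _ _ 0 0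
  have hTs := contDiff_hankelD hfs N
  set b₁ : ℂ := N - η₁
  set b₂ : ℂ := Complex.I * η₂
  set b₄ : ℂ := -μ - b₁ with hb₄
  have hset : ∀ s : ℝ, cauchyE C N η₁ η₂ μ ξ s ≠ 0 ↔
      hdet μ 1 (bWt ξ μ) (pCy N η₁ η₂) (qCy N η₁ η₂) N s ≠ 0 := by
    intro s
    rw [(cauchyE_eq_hdet N η₂ hμ h ξ C).2]
    simp [hC, N.factorial_ne_zero, pairConst_ne_zero]
  have hset' : ∀ s : ℝ, cauchyE C N η₁ η₂ μ ξ s ≠ 0 ↔ hankelD f N s ≠ 0 := by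
    intro s
    rw [hset, hankelD_eq hμ h' 1 _ hκ]
    simp [hankelConst_ne_zero hp0 hq0, gW_ne_zero]
  have hU : ∀ s : ℝ, hankelD f N s ≠ 0 → cauchyU C N η₁ η₂ μ ξ s = chainU b₁ b₂ b₄ f N s := by
    intro s hs
    have hs' := (hset s).mp ((hset' s).mpr hs)
    rw [cauchyU_eq_logD1 N η₂ hμ h ξ hC hs', chainU_eq_logD1_hdet hμ h' hκ hp0 hq0 _ _ _ _ N hs']
    simp only [e2', bCy, Matrix.cons_val_zero, Matrix.cons_val, b₁, b₂, hb₄, kapCy]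
    linear_combination (-η₂ * (η₁ - μ) : ℂ) * (Complex.I_sq)
  have hopen : IsOpen {s | hankelD f N s ≠ 0} :=
    isOpen_ne_fun (hTs 0).continuous continuous_const
  have hd1 : ∀ s : ℝ, hankelD f N s ≠ 0 →
      HasDerivAt (cauchyU C N η₁ η₂ μ ξ) (logD2 (hankelD f N) s - (N - b₁) ^ 2) s := by
    intro s hs
    refine HasDerivAt.congr_of_eventuallyEq ?_ (eventually_of_mem (hopen.mem_nhds hs) hU)
    refine (((hasDerivAt_logD1 hTs hs).sub
      ((hasDerivAt_ofReal s).const_mul _)).add_const _).congr_deriv ?_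
    simp
  have hd2 : ∀ s : ℝ, hankelD f N s ≠ 0 →
      HasDerivAt (deriv (cauchyU C N η₁ η₂ μ ξ)) (logD3 (hankelD f N) s) s := by
    intro s hs
    exact ((hasDerivAt_logD2 hTs hs).sub_const _).congr_of_eventuallyEq
      (eventually_of_mem (hopen.mem_nhds hs) fun r hr => (hd1 r hr).deriv)
  intro s hs
  have hs' := (hset' s).mp hs
  refine ⟨(hd1 s hs').differentiableAt, (hd2 s hs').differentiableAt, ?_⟩
  have key := sigmaExpr_chainU hμ h' hκ (conj_pCy N η₁ η₂) hp0 (b₁ := b₁) (b₂ := b₂) (b₄ := b₄)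
    (by simp only [pCy, b₁, b₂]; ring) (by simp only [qCy, b₁, b₂]; ring) hb₄ hN _ s hs'
  rw [(hd1 s hs').deriv, (hd2 s hs').deriv, hU s hs', ← key, sigmaExpr, Fin.prod_univ_four]
  simp only [bCy, Matrix.cons_val_zero, Matrix.cons_val_one, Matrix.cons_val, b₁, b₂, hb₄]
  ring

end

section

/-! ### The Hamiltonian along `T₃` -/

/-- The three factors `q'`, `q' - 1`, `q' - t` have factored numerators over the common denominator
`(q - t) X`. This quantity is also a factor of the numerator of `p'`, and only `Y Z` remains to be
cancelled. -/
theorem hamK_T3 {α α' : Fin 5 → ℂ} (hα : α 0 + α 1 + 2 * α 2 + α 3 + α 4 = 1)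
    (h0 : α' 0 = α 0 + 1) (h1 : α' 1 = α 1 + 1) (h2 : α' 2 = α 2 - 1) (h3 : α' 3 = α 3)
    (h4 : α' 4 = α 4) {t q p q' p' : ℂ} (ht : t ≠ 0) (ht1 : t - 1 ≠ 0)
    (h : IsT3Image α t q p q' p') :
    hamK α' t q' p' = hamK α t q p - q * (q - 1) * p - (α 1 + α 2) * (q - t) := by
  obtain ⟨hd, hX, hY, hZ, hq, hp⟩ := h
  set X := Xu α t q p with hXd
  set Y := Yu α t q p with hYd
  set Z := Zu α t q p with hZd
  have a0 : α 0 = 1 - α 1 - 2 * α 2 - α 3 - α 4 := by linear_combination hα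
  set A := (q - t) * p + α 1 + α 2 with hA
  set M0 := q * Z + α 4 * (q - t) with hM0
  set M1 := (q - 1) * Y - α 3 * (q - t) with hM1
  -- The common denominator is the difference of the numerators of `q'` and `q' - 1`.
  have hE : (q - t) * X = t * Z * M0 - (t - 1) * Y * M1 := by
    rw [hM0, hM1, hXd, hYd, hZd, Xu, Yu, Zu, a0]; ring
  have hAd : (q - t) * A = t * Z - (t - 1) * Y := by
    rw [hA, hYd, hZd, Yu, Zu]; ring
  have hq0 : q' = t * Z * M0 / ((q - t) * X) := by
    rw [hq, T3q, ← hXd, ← hZd, hM0, hZd, Zu]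
    field_simp
  have hEne : (q - t) * X ≠ 0 := mul_ne_zero hd hX
  have hq1 : q' - 1 = (t - 1) * Y * M1 / ((q - t) * X) := by
    rw [hq0, div_sub_one hEne]; congr 1; linear_combination -hE
  have hqt : q' - t = t * (t - 1) * (Y * M1 - Z * M0) / ((q - t) * X) := by
    rw [hq0, div_sub' hEne]; congr 1; linear_combination -t * hE
  have hp0 : p' = -(A * ((q - t) * X) / (t * (t - 1) * (Y * Z))) := by
    rw [hp, T3p, ← hXd, ← hYd, ← hZd, hA]
    field_simp
  -- This identity makes the terms quadratic and linear in `p'` jointly divisible by `Y Z`.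
  have key : M0 * M1 * A + α 4 * (t - 1) * M1 * Y + α 3 * t * M0 * Z =
      Y * Z * (q * (q - 1) * A + α 3 * (t - 1) * q + α 4 * t * (q - 1)) := by
    rw [hM0, hM1]
    linear_combination (α 4 * (q - 1) * Y - α 3 * q * Z - α 3 * α 4 * (q - t)) * hAd
  have hK : hamK α' t q' p' * ((q - t) * X) = (Y * M1 - Z * M0) * A *
      (q * (q - 1) * A + α 3 * (t - 1) * q + α 4 * t * (q - 1)) + α 0 * M0 * M1 * A +
      (α 2 - 1) * (α 1 + α 2) * t * (t - 1) * (Y * M1 - Z * M0) := by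
    rw [hamK, hq1, hqt, h0, h1, h2, h3, h4, hq0, hp0]
    generalize (q - t) * X = E at *
    apply mul_left_cancel₀ (mul_ne_zero hY hZ)
    field_simp
    linear_combination (Y * M1 - Z * M0) * A * key
  apply mul_right_cancel₀ hEne
  rw [hK, hE, hM0, hM1, hYd, hZd, hA, Yu, Zu, hamK, a0]
  ring

/-- The explicit `t`-derivative of `hamK`. -/
def hamKt (α : Fin 5 → ℂ) (q p : ℂ) : ℂ :=
  -(q * (q - 1) * p ^ 2) + (α 4 * (q - 1) + α 3 * q) * p - α 2 * (α 1 + α 2)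

/-- The partial derivative of `hamK` in `p`. -/
def hamKp (α : Fin 5 → ℂ) (t q p : ℂ) : ℂ :=
  2 * (q * (q - 1) * (q - t)) * p
    - (α 4 * (q - 1) * (q - t) + α 3 * q * (q - t) + (α 0 - 1) * q * (q - 1))

/-- The partial derivative of `hamK` in `q`. -/
def hamKq (α : Fin 5 → ℂ) (t q p : ℂ) : ℂ :=
  ((q - 1) * (q - t) + q * (q - t) + q * (q - 1)) * p ^ 2
    - (α 4 * ((q - t) + (q - 1)) + α 3 * ((q - t) + q) + (α 0 - 1) * ((q - 1) + q)) * p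
    + α 2 * (α 1 + α 2)

/-- The value of `t (t - 1) d/dt` on `hamKt` along a solution. -/
def hamKtt (α : Fin 5 → ℂ) (t q p : ℂ) : ℂ :=
  (-((2 * q - 1) * p ^ 2) + (α 4 + α 3) * p) * hamKp α t q p -
    (-(2 * q * (q - 1) * p) + (α 4 * (q - 1) + α 3 * q)) * hamKq α t q p

theorem hasDerivAt_ham_right (α : Fin 5 → ℂ) (t q p : ℂ) :
    HasDerivAt (fun y => ham α t q y) (hamKp α t q p / (t * (t - 1))) p := by
  have h := hasDerivAt_id p
  refine HasDerivAt.div_const (((((h.fun_pow 2).const_mul (q * (q - 1) * (q - t))).fun_sub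
    (h.const_mul (α 4 * (q - 1) * (q - t) + α 3 * q * (q - t) + (α 0 - 1) * q * (q - 1)))).add_const
      (α 2 * (α 1 + α 2) * (q - t))).congr_deriv ?_) _
  simp [hamKp]
  ring

theorem hasDerivAt_ham_left (α : Fin 5 → ℂ) (t q p : ℂ) :
    HasDerivAt (fun x => ham α t x p) (hamKq α t q p / (t * (t - 1))) q := by
  have h := hasDerivAt_id q
  have h1 := h.sub_const 1
  have ht := h.sub_const t
  refine HasDerivAt.div_const ((((((h.fun_mul h1).fun_mul ht).mul_const (p ^ 2)).fun_sub
    ((((h1.const_mul (α 4)).fun_mul ht).fun_add ((h.const_mul (α 3)).fun_mul ht)).fun_add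
      ((h.const_mul (α 0 - 1)).fun_mul h1) |>.mul_const p)).fun_add
      (ht.const_mul (α 2 * (α 1 + α 2)))).congr_deriv ?_) _
  simp [hamKq]
  ring

namespace SolvesHamilton

variable {α : Fin 5 → ℂ} {D : Set ℂ} {q p : ℂ → ℂ}

theorem hasDerivAt_q (h : SolvesHamilton α D q p) {t : ℂ} (ht : t ∈ D) :
    HasDerivAt q (hamKp α t (q t) (p t) / (t * (t - 1))) t := by
  have := (h t ht).1
  rwa [(hasDerivAt_ham_right α t (q t) (p t)).deriv] at this

theorem hasDerivAt_p (h : SolvesHamilton α D q p) {t : ℂ} (ht : t ∈ D) :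
    HasDerivAt p (-(hamKq α t (q t) (p t) / (t * (t - 1)))) t := by
  have := (h t ht).2
  rwa [(hasDerivAt_ham_left α t (q t) (p t)).deriv] at this

/-- Along a Hamiltonian flow the contributions of `q'` and `p'` cancel, which leaves the explicit
`t`-derivative. -/
theorem hasDerivAt_hamK (h : SolvesHamilton α D q p) {t : ℂ} (ht : t ∈ D) :
    HasDerivAt (fun t => hamK α t (q t) (p t)) (hamKt α (q t) (p t)) t := by
  have hq := h.hasDerivAt_q ht
  have hp := h.hasDerivAt_p ht
  have hi := hasDerivAt_id t
  have h1 := hq.sub_const 1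
  have h2 := hq.fun_sub hi
  refine ((((((hq.fun_mul h1).fun_mul h2).fun_mul (hp.fun_pow 2)).fun_sub
    ((((h1.const_mul (α 4)).fun_mul h2).fun_add ((hq.const_mul (α 3)).fun_mul h2)).fun_add
      ((hq.const_mul (α 0 - 1)).fun_mul h1) |>.fun_mul hp)).fun_add
      (h2.const_mul (α 2 * (α 1 + α 2)))).congr_deriv ?_)
  simp only [hamKt, hamKp, hamKq, id]
  push_cast
  ring

theorem hasDerivAt_hamKt (h : SolvesHamilton α D q p) {t : ℂ} (ht : t ∈ D) :
    HasDerivAt (fun t => hamKt α (q t) (p t)) (hamKtt α t (q t) (p t) / (t * (t - 1))) t := by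
  have hq := h.hasDerivAt_q ht
  have hp := h.hasDerivAt_p ht
  have h1 := hq.sub_const 1
  refine (((((hq.fun_mul h1).fun_mul (hp.fun_pow 2)).fun_neg.fun_add
    (((h1.const_mul (α 4)).fun_add (hq.const_mul (α 3))).fun_mul hp)).sub_const
      (α 2 * (α 1 + α 2))).congr_deriv ?_)
  simp only [hamKtt]
  push_cast
  ring

end SolvesHamilton

/-- The forward relation along `T₃`. -/
theorem hamKt_forward (b : Fin 4 → ℂ) (t q p : ℂ) :
    2 * (hamKt (alphaOf b) q p + (b 0 + b 2) * (b 2 + b 3)) *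
      (-(q * (q - 1) * p) + (b 0 + b 3) * q - (b 0 + b 1 + b 3) / 2) =
    b 2 * (2 * (hamK (alphaOf b) t q p + e2' b * t - e2 b / 2) -
      (2 * t - 1) * (hamKt (alphaOf b) q p + e2' b)) - b 0 * b 1 * b 3 +
      hamKtt (alphaOf b) t q p := by
  simp only [hamKt, hamKtt, hamKp, hamKq, hamK, alphaOf, e2', e2, Matrix.cons_val_zero,
    Matrix.cons_val_one, Matrix.cons_val]
  ring

end

/-! ### Hamiltonian `τ`-sequences on the line -/

/-- The hypotheses are the backward and quadratic relations when the derivative equals `-c²` and the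
second derivative vanishes. Eliminating `u` leaves the cubic `∏ (c² - b_k²)` over `b₁`, `b₂`, `b₄`.
-/
theorem edge_degenerate {b₁ b₂ b₄ c u u₀ s : ℂ}
    (rB : 0 = 2 * c * (u + s * c ^ 2) + 2 * Complex.I * (b₁ * b₂ * b₄))
    (quad : (u - u₀) * (2 * c * (u + s * c ^ 2) + 2 * Complex.I * (b₁ * b₂ * b₄)) =
      (u + s * c ^ 2) ^ 2 + c ^ 4 - (b₁ ^ 2 + b₂ ^ 2 + b₄ ^ 2) * c ^ 2 +
      (b₁ ^ 2 * b₂ ^ 2 + b₁ ^ 2 * b₄ ^ 2 + b₂ ^ 2 * b₄ ^ 2)) :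
    (c ^ 2 - b₁ ^ 2) * (c ^ 2 - b₂ ^ 2) * (c ^ 2 - b₄ ^ 2) = 0 := by
  linear_combination (-c ^ 2) * quad - (c ^ 2 * (u - u₀)) * rB +
    (c * (u + s * c ^ 2) - Complex.I * (b₁ * b₂ * b₄)) / 2 * rB -
    (b₁ * b₂ * b₄) ^ 2 * Complex.I_sq

/-- A chain member cannot be linear to second order with slope `-(n - β)²`: for real `β`, `η`, `μ`
in this range the factors of `edge_degenerate` are non-zero, up to one borderline case. This later
excludes a vanishing constant in the Toda equation of a Hamiltonian sequence. -/
theorem TodaChain.not_degenerate {β η μ : ℝ} {n : ℕ} {V : Set ℝ} {U U1 U2 : ℕ → ℝ → ℂ}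
    (H : TodaChain β (Complex.I * η) (-μ - β) n V U U1 U2) (hn : 1 ≤ n) (hμ : -1 < μ)
    (hβ : 2 * β < 1 - μ) {s : ℝ} (hs : s ∈ V) (h1 : U1 n s = -(n - β) ^ 2) (h2 : U2 n s = 0) :
    False := by
  obtain ⟨m, rfl⟩ : ∃ m, n = m + 1 := ⟨n - 1, by omega⟩
  obtain ⟨rS, rP, rB⟩ := H.relations m le_rfl s hs
  have quad := TodaChain.edge_quadratic rS rP
  simp only [BackRel] at rB
  have hI := Complex.I_sq
  push_cast at h1
  rw [h2, h1] at rB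
  rw [h1] at quad
  have hprod := edge_degenerate (b₁ := β) (b₂ := Complex.I * η) (b₄ := -μ - β) (c := m + 1 - β)
    (u := U (m + 1) s) (u₀ := U m s) (s := s) (by linear_combination rB) (by linear_combination quad)
  have hm : (0 : ℝ) ≤ m := Nat.cast_nonneg m
  have hreal : (((m : ℝ) + 1 - β) ^ 2 - β ^ 2) * (((m : ℝ) + 1 - β) ^ 2 + η ^ 2) *
      (((m : ℝ) + 1 - β) ^ 2 - (-μ - β) ^ 2) = 0 := by
    have : ((((m : ℝ) + 1 - β) ^ 2 - β ^ 2) * (((m : ℝ) + 1 - β) ^ 2 + η ^ 2) *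
      (((m : ℝ) + 1 - β) ^ 2 - (-μ - β) ^ 2) : ℂ) = 0 := by
      rw [mul_pow, hI] at hprod
      push_cast
      linear_combination hprod
    exact_mod_cast this
  rcases mul_eq_zero.mp hreal with h | h
  rcases mul_eq_zero.mp h with h | h
  · have h3 : ((m : ℝ) + 1) * (m + 1 - 2 * β) = 0 := by linear_combination h
    rcases mul_eq_zero.mp h3 with h3 | h3
    · linarith
    have hm0 : m = 0 := by
      have : (m : ℝ) < 1 := by linarith
      exact_mod_cast Nat.lt_one_iff.mp (by exact_mod_cast this)
    subst hm0
    -- The borderline case is `m = 0`, `β = 1/2`. The sum relation between `U 0` and `U 1` then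
    -- forces `μ (μ + 1) = 0`, against `-1 < μ < 0`.
    have hβ' : β = 1 / 2 := by push_cast at h3; linarith
    have u0 := H.base0 s hs
    have v0 := H.U1_zero hs
    simp only [EdgeSum] at rS
    rw [h1, v0, u0] at rS
    rw [hβ'] at rB rS hβ
    have hu : U 1 s = -(1 / 4 : ℂ) * s + η * (-μ - 1 / 2) := by
      push_cast at rB
      linear_combination (-rB) - (η * (-μ - 1 / 2) : ℂ) * hI
    norm_num at rS
    have hII : Complex.I * (Complex.I * (η : ℂ)) = -η := by linear_combination (η : ℂ) * hI
    rw [hu, hII, mul_pow, hI] at rS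
    have hfin : ((1 + 4 * η ^ 2) * (μ * (μ + 1)) : ℂ) = 0 := by
      linear_combination rS
    have hfin' : (1 + 4 * η ^ 2) * (μ * (μ + 1)) = 0 := by exact_mod_cast hfin
    have : (1 + 4 * η ^ 2) ≠ 0 := by positivity
    have h4 : μ + 1 ≠ 0 := by linarith
    have h5 : μ ≠ 0 := by linarith
    exact (mul_ne_zero this (mul_ne_zero h5 h4)) hfin'
  · have h3 : (m : ℝ) + 1 - β = 0 := by nlinarith [sq_nonneg ((m : ℝ) + 1 - β), sq_nonneg η]
    linarith
  · have h3 : ((m : ℝ) + 1 + μ) * (m + 1 - μ - 2 * β) = 0 := by linear_combination h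
    rcases mul_eq_zero.mp h3 with h3 | h3 <;> linarith

/-! ### The Toda equation of a Hamiltonian `τ`-sequence. -/

section

theorem hasDerivAt_linePt (s : ℝ) : HasDerivAt linePt (Complex.I / 2) s := by
  refine ((((hasDerivAt_ofReal s).const_mul Complex.I).add_const 1).div_const 2).congr_deriv ?_
  simp

/-- Points of the line accumulate at each of its points, which is the input of the identity theorem
on a complex domain. -/
theorem frequently_linePt {P : ℂ → Prop} {s : ℝ} (h : ∀ᶠ r in 𝓝 s, P (linePt r)) :
    ∃ᶠ t in 𝓝[≠] (linePt s), P t := by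
  have hinj : Function.Injective linePt := by
    intro x y hxy
    simpa [linePt] using hxy
  have ht : Tendsto linePt (𝓝[≠] s) (𝓝[≠] (linePt s)) :=
    tendsto_nhdsWithin_of_tendsto_nhds_of_eventually_within _
      ((hasDerivAt_linePt s).continuousAt.tendsto.mono_left nhdsWithin_le_nhds)
      (eventually_mem_nhdsWithin.mono fun x hx h' => hx (hinj h'))
  exact ht.frequently (h.filter_mono nhdsWithin_le_nhds).frequently

variable {N : ℕ} {η₁ η₂ μ : ℝ} {D : Set ℂ} {q p τ : ℕ → ℂ → ℂ}

/-- The numerator `t (t - 1) d/dt log τ` of the `n`-th member, with value `0` for `n = 0`. -/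
def seqK (b : Fin 4 → ℂ) (q p : ℕ → ℂ → ℂ) (n : ℕ) (t : ℂ) : ℂ :=
  if n = 0 then 0 else hamK (alphaOf (shift3 b n)) t (q n t) (p n t)

theorem IsTauSequence.hasDerivAt {b : Fin 4 → ℂ} (h : IsTauSequence b N D q p τ) (hD : IsOpen D)
    {n : ℕ} (hn : n ≤ N) {t : ℂ} (ht : t ∈ D) :
    τ n t ≠ 0 ∧ HasDerivAt (τ n) (seqK b q p n t / (t * (t - 1)) * τ n t) t := by
  rcases Nat.eq_zero_or_pos n with rfl | h0
  · refine ⟨by rw [h.tau_zero t ht]; exact one_ne_zero, ?_⟩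
    have := (hasDerivAt_const t (1 : ℂ)).congr_of_eventuallyEq
      (eventually_of_mem (hD.mem_nhds ht) h.tau_zero)
    simpa [seqK] using this
  · have := h.log_deriv n h0 hn t ht
    simpa [seqK, h0.ne', ham] using this

theorem IsTauSequence.differentiableAt_seqK {b : Fin 4 → ℂ} (h : IsTauSequence b N D q p τ)
    {n : ℕ} (hn : n ≤ N) {t : ℂ} (ht : t ∈ D) : DifferentiableAt ℂ (seqK b q p n) t := by
  rcases Nat.eq_zero_or_pos n with rfl | h0
  · exact differentiableAt_const 0
  · have := ((h.solves n h0 hn).hasDerivAt_hamK ht).differentiableAt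
    refine this.congr_of_eventuallyEq (Eventually.of_forall fun t => ?_)
    rw [seqK, if_neg h0.ne']

theorem IsTauSequence.seqK_succ {b : Fin 4 → ℂ} (h : IsTauSequence b N D q p τ)
    {n : ℕ} (h0 : 1 ≤ n) (hn : n < N) {t : ℂ} (ht : t ∈ D) (ht0 : t ≠ 0) (ht1 : t - 1 ≠ 0) :
    seqK b q p (n + 1) t = seqK b q p n t - q n t * (q n t - 1) * p n t +
      (b 0 + b 3) * (q n t - t) := by
  have hs := h.step n h0 hn t ht
  rw [seqK, seqK, if_neg (by omega), if_neg (by omega), hamK_T3 ?_ ?_ ?_ ?_ ?_ ?_ ht0 ht1 hs]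
  all_goals
    simp only [alphaOf, shift3, Matrix.cons_val_zero, Matrix.cons_val_one, Matrix.cons_val,
      Nat.cast_add, Nat.cast_one]
    try ring

/-- The polynomial in the relation between `τ (n + 1)`, `τ n` and `τ (n - 1)`. -/
def seqW (b : Fin 4 → ℂ) (q p : ℕ → ℂ → ℂ) (n : ℕ) (t : ℂ) : ℂ :=
  hamKt (alphaOf (shift3 b n)) (q n t) (p n t) +
    (shift3 b n 0 + shift3 b n 2) * (shift3 b n 2 + shift3 b n 3)

/-- The defect in the backward relation between the members `n` and `n - 1`. -/
def seqB (b : Fin 4 → ℂ) (q p : ℕ → ℂ → ℂ) (n : ℕ) (t : ℂ) : ℂ :=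
  2 * seqW b q p n t * (seqK b q p n t - seqK b q p (n - 1) t + (b 0 + b 3) * t -
    (b 0 + b 1 + b 3) / 2) -
  ((b 2 + n) * (2 * (seqK b q p n t + e2' (shift3 b n) * t - e2 (shift3 b n) / 2) -
    (2 * t - 1) * (hamKt (alphaOf (shift3 b n)) (q n t) (p n t) + e2' (shift3 b n))) -
    b 0 * b 1 * b 3 - hamKtt (alphaOf (shift3 b n)) t (q n t) (p n t))

/-- The vanishing of `seqB` is the backward relation; `hamKt_forward` together with the change of
the Hamiltonian under `T₃` is the forward one. Half their difference is the Toda equation in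
logarithmic form. -/
theorem IsTauSequence.toda {b : Fin 4 → ℂ} (h : IsTauSequence b N D q p τ)
    {n : ℕ} (h0 : 1 ≤ n) (hn : n < N) {t : ℂ} (ht : t ∈ D) (ht0 : t ≠ 0) (ht1 : t - 1 ≠ 0)
    (hB : seqB b q p n t = 0) :
    seqW b q p n t * (seqK b q p (n + 1) t + seqK b q p (n - 1) t - 2 * seqK b q p n t) =
      hamKtt (alphaOf (shift3 b n)) t (q n t) (p n t) := by
  have hf := hamKt_forward (shift3 b n) t (q n t) (p n t)
  have hs := h.seqK_succ h0 hn ht ht0 ht1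
  have hK : seqK b q p n t = hamK (alphaOf (shift3 b n)) t (q n t) (p n t) := by
    rw [seqK, if_neg (by omega)]
  have c0 : shift3 b n 0 = b 0 := rfl
  have c1 : shift3 b n 1 = b 1 := rfl
  have c2 : shift3 b n 2 = b 2 + n := rfl
  have c3 : shift3 b n 3 = b 3 := rfl
  rw [seqB, seqW, c0, c2, c3] at hB
  rw [seqW, c0, c2, c3]
  rw [c0, c1, c2, c3, ← hK] at hf
  generalize e2 (shift3 b n) = x at *
  generalize e2' (shift3 b n) = y at *
  generalize hamKtt (alphaOf (shift3 b n)) t (q n t) (p n t) = z at *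
  generalize hamKt (alphaOf (shift3 b n)) (q n t) (p n t) = w at *
  rw [hs]
  linear_combination hf / 2 - hB / 2

/-- The logarithmic Toda equation says that the quotient of the two sides has zero derivative, and
the domain is connected. -/
theorem IsTauSequence.exists_const {b : Fin 4 → ℂ} (h : IsTauSequence b N D q p τ) (hD : IsOpen D)
    (hDc : IsPreconnected D) (hD0 : D ⊆ {t : ℂ | 0 < t.re ∧ t.re < 1}) {n : ℕ} (h0 : 1 ≤ n)
    (hn : n < N) (hB : ∀ t ∈ D, seqB b q p n t = 0) :
    ∃ c : ℂ, ∀ t ∈ D, seqW b q p n t * τ n t ^ 2 = c * (τ (n + 1) t * τ (n - 1) t) := by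
  have hne : ∀ t ∈ D, t ≠ 0 ∧ t - 1 ≠ 0 := by
    intro t ht
    have h1 := hD0 ht
    refine ⟨fun h => ?_, fun h => ?_⟩
    · rw [h] at h1; simp at h1
    · rw [sub_eq_zero.mp h] at h1; simp at h1
  have hder : ∀ t ∈ D, HasDerivAt
      (fun t => seqW b q p n t * τ n t ^ 2 / (τ (n + 1) t * τ (n - 1) t)) 0 t := by
    intro t ht
    obtain ⟨ht0, ht1⟩ := hne t ht
    obtain ⟨a0, d0⟩ := h.hasDerivAt hD (n := n - 1) (by omega) ht
    obtain ⟨a1, d1⟩ := h.hasDerivAt hD (n := n) (by omega) ht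
    obtain ⟨a2, d2⟩ := h.hasDerivAt hD (n := n + 1) (by omega) ht
    have dW : HasDerivAt (seqW b q p n)
      (hamKtt (alphaOf (shift3 b n)) t (q n t) (p n t) / (t * (t - 1))) t :=
      ((h.solves n h0 hn.le).hasDerivAt_hamKt ht).add_const _
    refine ((dW.fun_mul (d1.fun_pow 2)).fun_div (d2.fun_mul d0) (mul_ne_zero a2 a0)).congr_deriv ?_
    rw [← h.toda h0 hn ht ht0 ht1 (hB t ht)]
    simp only [Nat.reduceSub, pow_one, Nat.cast_ofNat]
    field_simp
    ring
  rcases D.eq_empty_or_nonempty with rfl | ⟨t₀, ht₀⟩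
  · exact ⟨0, by simp⟩
  refine ⟨seqW b q p n t₀ * τ n t₀ ^ 2 / (τ (n + 1) t₀ * τ (n - 1) t₀), fun t ht => ?_⟩
  have := hD.is_const_of_deriv_eq_zero (𝕜 := ℂ) hDc (f := fun t => seqW b q p n t * τ n t ^ 2 / (τ (n + 1) t * τ (n - 1) t))
    (fun t ht => (hder t ht).differentiableAt.differentiableWithinAt)
    (fun t ht => (hder t ht).deriv) ht ht₀
  rw [← this]
  have a0 := (h.hasDerivAt hD (n := n - 1) (by omega) ht).1
  have a2 := (h.hasDerivAt hD (n := n + 1) (by omega) ht).1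
  field_simp

theorem IsTauSequence.analyticOnNhd_seqB {b : Fin 4 → ℂ} (h : IsTauSequence b N D q p τ)
    (hD : IsOpen D) {n : ℕ} (h0 : 1 ≤ n) (hn : n ≤ N) : AnalyticOnNhd ℂ (seqB b q p n) D := by
  refine DifferentiableOn.analyticOnNhd (fun t ht => ?_) hD
  refine DifferentiableAt.differentiableWithinAt ?_
  have dq := ((h.solves n h0 hn).hasDerivAt_q ht).differentiableAt
  have dp := ((h.solves n h0 hn).hasDerivAt_p ht).differentiableAt
  have dK := h.differentiableAt_seqK hn ht
  have dK' := h.differentiableAt_seqK (n := n - 1) (by omega) ht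
  unfold seqB seqW hamKtt hamKt hamKp hamKq
  fun_prop

end

/-! ### Identification of the `τ`-sequence with the determinants. -/

section

theorem hasDerivAt_comp_linePt {g : ℂ → ℂ} {g' : ℂ} {s : ℝ} (h : HasDerivAt g g' (linePt s)) :
    HasDerivAt (fun s => g (linePt s)) (Complex.I / 2 * g') s := by
  simpa [Function.comp_def] using h.scomp s (hasDerivAt_linePt s)

theorem hankelD_toda_hdet {μ : ℝ} (hμ : -1 < μ) {p q : ℂ} (h : (p + q).re + μ < -1) {κ : ℂ}
    (hκ : 2 * κ = -(1 + μ + p + q)) (hp : p.re < 0) (hq : q.re < 0) (n : ℕ) :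
    ∃ k : ℂ, k ≠ 0 ∧ ∀ (b : ℂ) (s : ℝ), hdet μ 1 b p q n s ≠ 0 → hdet μ 1 b p q (n + 1) s ≠ 0 →
      logD2 (hankelD (ladderE μ 1 b p q κ 0 0) (n + 1)) s * hdet μ 1 b p q (n + 1) s ^ 2 =
        k * (hdet μ 1 b p q (n + 2) s * hdet μ 1 b p q n s) := by
  have k0 := hankelConst_ne_zero hp hq n
  have k1 := hankelConst_ne_zero hp hq (n + 1)
  have k2 := hankelConst_ne_zero hp hq (n + 2)
  refine ⟨hankelConst p q (n + 2) * hankelConst p q n / hankelConst p q (n + 1) ^ 2,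
    div_ne_zero (mul_ne_zero k2 k0) (pow_ne_zero 2 k1), fun b s h0 h1 => ?_⟩
  have e := fun m => hankelD_eq hμ h 1 b hκ m s
  have g0 : ∀ m : ℕ, gW (m * (m - 1 + 2 * κ) / 2) (m * (m - 1 + 2 * κ) / 2) s ≠ 0 :=
    fun m => gW_ne_zero _ _ _
  -- The exponents `n (n - 1 + 2 κ)/2` have second difference `1`; the resulting factor `1 + s²` is
  -- the one in `logD2`.
  have hg : gW (((n + 2 : ℕ) : ℂ) * ((n + 2 : ℕ) - 1 + 2 * κ) / 2)
      (((n + 2 : ℕ) : ℂ) * ((n + 2 : ℕ) - 1 + 2 * κ) / 2) s *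
      gW (n * (n - 1 + 2 * κ) / 2) (n * (n - 1 + 2 * κ) / 2) s = (1 + (s : ℂ) ^ 2) *
      gW (((n + 1 : ℕ) : ℂ) * ((n + 1 : ℕ) - 1 + 2 * κ) / 2)
      (((n + 1 : ℕ) : ℂ) * ((n + 1 : ℕ) - 1 + 2 * κ) / 2) s ^ 2 := by
    rw [pow_two (gW _ _ _), gW_mul_gW, gW_mul_gW]
    generalize hx : (((n + 1 : ℕ) : ℂ) * ((n + 1 : ℕ) - 1 + 2 * κ) / 2 +
      ((n + 1 : ℕ) : ℂ) * ((n + 1 : ℕ) - 1 + 2 * κ) / 2) = x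
    rw [show ((n + 2 : ℕ) : ℂ) * ((n + 2 : ℕ) - 1 + 2 * κ) / 2 + n * (n - 1 + 2 * κ) / 2 = x + 1 by
      rw [← hx]; push_cast; ring, gW_add_left, gW_add_right]
    linear_combination (-(s : ℂ) ^ 2 * gW x x s) * Complex.I_sq
  rw [logD2_hankelD (contDiff_ladderE hμ h 1 b κ 0 0) n, e, e, e]
  rotate_left
  · rw [e]; exact mul_ne_zero (mul_ne_zero k0 (g0 n)) h0
  · rw [e]; exact mul_ne_zero (mul_ne_zero k1 (g0 (n + 1))) h1
  have w := one_add_sq_ne_zero s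
  have g1 := g0 (n + 1)
  generalize gW (((n + 2 : ℕ) : ℂ) * ((n + 2 : ℕ) - 1 + 2 * κ) / 2)
      (((n + 2 : ℕ) : ℂ) * ((n + 2 : ℕ) - 1 + 2 * κ) / 2) s = G2 at *
  generalize gW (((n + 1 : ℕ) : ℂ) * ((n + 1 : ℕ) - 1 + 2 * κ) / 2)
      (((n + 1 : ℕ) : ℂ) * ((n + 1 : ℕ) - 1 + 2 * κ) / 2) s = G1 at *
  generalize gW (n * (n - 1 + 2 * κ) / 2) (n * (n - 1 + 2 * κ) / 2) s = G0 at *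
  field_simp
  linear_combination hdet μ 1 b p q (n + 2) s * hg

variable {N : ℕ} {η₁ η₂ μ : ℝ} {D : Set ℂ} {q p τ : ℕ → ℂ → ℂ}

/-- Along `t = (1 + i s)/2` one has `(1 + s²) d/ds = -2 i t (t - 1) d/dt`. This translates the chain
into the Hamiltonian shifted by `e2' t - e2/2`. -/
theorem chainU_line (hμ : -1 < μ) (h : 2 * (N : ℝ) - 1 + μ < 2 * η₁) (ξ : ℂ) (hD : IsOpen D)
    (hτ : IsTauSequence (bSeed N η₁ η₂ μ) N D q p τ) {m : ℕ} (hm : m ≤ N) {c : ℂ} (hc : c ≠ 0)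
    (hH : ∀ s : ℝ, linePt s ∈ D → hdet μ 1 (bWt ξ μ) (pCy N η₁ η₂) (qCy N η₁ η₂) m s =
      c * τ m (linePt s)) {s : ℝ} (hs : linePt s ∈ D) :
    chainU ((N - η₁ : ℝ) : ℂ) (Complex.I * η₂) (-μ - ((N - η₁ : ℝ) : ℂ))
      (ladderE μ 1 (bWt ξ μ) (pCy N η₁ η₂) (qCy N η₁ η₂) (kapCy N η₁ μ) 0 0) m s =
    -2 * Complex.I * (seqK (bSeed N η₁ η₂ μ) q p m (linePt s) +
      e2' (shift3 (bSeed N η₁ η₂ μ) m) * linePt s - e2 (shift3 (bSeed N η₁ η₂ μ) m) / 2) := by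
  obtain ⟨hne, hd⟩ := hτ.hasDerivAt hD hm hs
  have hopen : IsOpen {s | linePt s ∈ D} :=
    hD.preimage (continuous_iff_continuousAt.mpr fun s => (hasDerivAt_linePt s).continuousAt)
  have hne' : hdet μ 1 (bWt ξ μ) (pCy N η₁ η₂) (qCy N η₁ η₂) m s ≠ 0 := by
    rw [hH s hs]; exact mul_ne_zero hc hne
  have hd' := ((hasDerivAt_comp_linePt hd).const_mul c).congr_of_eventuallyEq
    (eventually_of_mem (hopen.mem_nhds hs) hH)
  rw [chainU_eq_logD1_hdet hμ (exponent_lt η₂ h) (two_mul_kapCy N η₁ η₂ μ) (pCy_re_neg η₂ hμ h)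
    (qCy_re_neg η₂ hμ h) _ _ _ _ m hne']
  have hl : logD1 (hdet μ 1 (bWt ξ μ) (pCy N η₁ η₂) (qCy N η₁ η₂) m) s =
      -2 * Complex.I * seqK (bSeed N η₁ η₂ μ) q p m (linePt s) := by
    rw [logD1, opD, hd'.deriv, hH s hs, linePt_mul]
    have := one_add_sq_ne_zero s
    field_simp
    ring
  rw [hl]
  simp only [e2', e2, shift3, bSeed, Matrix.cons_val_zero, Matrix.cons_val_one, Matrix.cons_val,
    linePt, kapCy]
  push_cast
  linear_combination (-m * μ * s + 2 * η₁ * N * s - η₁ ^ 2 * s - N ^ 2 * s : ℂ) * Complex.I_sq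


/-- The induction step: once the members up to `n + 1` are multiples of determinants, both sequences
satisfy Toda equations with the same left side, so the next members are proportional. The left sides
agree because `seqW` on the line is `logD2` of the Hankel determinant. -/
theorem tau_succ_eq_hdet (hμ : -1 < μ) (h : 2 * (N : ℝ) - 1 + μ < 2 * η₁) (ξ : ℂ) (hD : IsOpen D)
    (hDc : IsPreconnected D) (hD0 : D ⊆ {t : ℂ | 0 < t.re ∧ t.re < 1})
    (hτ : IsTauSequence (bSeed N η₁ η₂ μ) N D q p τ) {s₀ : ℝ} (hs₀ : linePt s₀ ∈ D)
    {n : ℕ} (hn : n + 1 < N)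
    (ih : ∀ m ≤ n + 1, ∃ c : ℂ, c ≠ 0 ∧ ∀ s : ℝ, linePt s ∈ D →
      hdet μ 1 (bWt ξ μ) (pCy N η₁ η₂) (qCy N η₁ η₂) m s = c * τ m (linePt s)) :
    ∃ c : ℂ, c ≠ 0 ∧ ∀ s : ℝ, linePt s ∈ D →
      hdet μ 1 (bWt ξ μ) (pCy N η₁ η₂) (qCy N η₁ η₂) (n + 2) s = c * τ (n + 2) (linePt s) := by
  have h' := exponent_lt η₂ h
  have hκ := two_mul_kapCy N η₁ η₂ μ
  have hp0 := pCy_re_neg η₂ hμ h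
  have hq0 := qCy_re_neg η₂ hμ h
  have hopen : IsOpen {s | linePt s ∈ D} :=
    hD.preimage (continuous_iff_continuousAt.mpr fun s => (hasDerivAt_linePt s).continuousAt)
  have hHne : ∀ m ≤ n + 1, ∀ s : ℝ, linePt s ∈ D →
      hdet μ 1 (bWt ξ μ) (pCy N η₁ η₂) (qCy N η₁ η₂) m s ≠ 0 := by
    intro m hm s hs
    obtain ⟨c, hc, e⟩ := ih m hm
    rw [e s hs]
    exact mul_ne_zero hc (hτ.hasDerivAt hD (by omega) hs).1
  set f := ladderE μ 1 (bWt ξ μ) (pCy N η₁ η₂) (qCy N η₁ η₂) (kapCy N η₁ μ) 0 0 with hf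
  have hV : ∀ s : ℝ, linePt s ∈ D → s ∈ {s | ∀ m ≤ n + 1, hankelD f m s ≠ 0} := by
    intro s hs m hm
    rw [hankelD_eq hμ h' 1 _ hκ]
    exact mul_ne_zero (mul_ne_zero (hankelConst_ne_zero hp0 hq0 m) (gW_ne_zero _ _ _))
      (hHne m hm s hs)
  have H := todaChain_ladderE hμ h' hκ (b₁ := ((N - η₁ : ℝ) : ℂ)) (b₂ := Complex.I * η₂)
    (b₄ := -μ - ((N - η₁ : ℝ) : ℂ)) (by simp only [pCy]; push_cast; ring)
    (by simp only [qCy]; push_cast; ring) rfl (n + 1) (bWt ξ μ)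
  simp only [← hf] at H
  set b := bSeed N η₁ η₂ μ with hb
  have hU : ∀ m ≤ n + 1, ∀ s : ℝ, linePt s ∈ D → chainU ((N - η₁ : ℝ) : ℂ) (Complex.I * η₂)
      (-μ - ((N - η₁ : ℝ) : ℂ)) f m s = -2 * Complex.I * (seqK b q p m (linePt s) +
        e2' (shift3 b m) * linePt s - e2 (shift3 b m) / 2) := by
    intro m hm s hs
    obtain ⟨c, hc, e⟩ := ih m hm
    exact chainU_line hμ h ξ hD hτ (by omega) hc e hs
  have solv := hτ.solves (n + 1) (by omega) hn.le
  have hU1 : ∀ s : ℝ, linePt s ∈ D → logD2 (hankelD f (n + 1)) s =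
      seqW b q p (n + 1) (linePt s) := by
    intro s hs
    have d1 := H.deriv1 (n + 1) le_rfl s (hV s hs)
    have dK : HasDerivAt (seqK b q p (n + 1)) (hamKt (alphaOf (shift3 b (n + 1)))
        (q (n + 1) (linePt s)) (p (n + 1) (linePt s))) (linePt s) :=
      (solv.hasDerivAt_hamK hs).congr_of_eventuallyEq (Eventually.of_forall fun t => by
        rw [seqK, if_neg (by omega)])
    have d2 := (hasDerivAt_comp_linePt ((dK.fun_add ((hasDerivAt_id (linePt s)).const_mul
      (e2' (shift3 b (n + 1))))).sub_const (e2 (shift3 b (n + 1)) / 2))).const_mul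
        (-2 * Complex.I)
    have key := TodaChain.hasDerivAt_eq hopen hs (hU (n + 1) le_rfl) d1 d2
    rw [seqW]
    rw [mul_one] at key
    generalize hamKt (alphaOf (shift3 b (n + 1))) (q (n + 1) (linePt s))
      (p (n + 1) (linePt s)) = w at *
    simp only [e2', shift3, hb, bSeed, Matrix.cons_val_zero, Matrix.cons_val_one,
      Matrix.cons_val] at key ⊢
    push_cast at key ⊢
    linear_combination key - (w + ((N - η₁) * (η₁ - N + (n + 1)) + (N - η₁) * (-μ + η₁ - N) +
      (η₁ - N + (n + 1)) * (-μ + η₁ - N) : ℂ)) * Complex.I_sq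
  have hU2 : ∀ s : ℝ, linePt s ∈ D → (1 + (s : ℂ) ^ 2) * logD3 (hankelD f (n + 1)) s =
      -2 * Complex.I * hamKtt (alphaOf (shift3 b (n + 1))) (linePt s) (q (n + 1) (linePt s))
        (p (n + 1) (linePt s)) := by
    intro s hs
    have d1 := hasDerivAt_logD2 (contDiff_hankelD (contDiff_ladderE hμ h' 1 _ _ 0 0) (n + 1))
      (hV s hs (n + 1) le_rfl)
    have d2 := hasDerivAt_comp_linePt ((solv.hasDerivAt_hamKt hs).add_const
      ((shift3 b (n + 1) 0 + shift3 b (n + 1) 2) * (shift3 b (n + 1) 2 + shift3 b (n + 1) 3)))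
    have key := TodaChain.hasDerivAt_eq hopen hs hU1 d1 d2
    rw [key, linePt_mul]
    have := one_add_sq_ne_zero s
    field_simp
    ring
  -- The backward relation of the determinant chain is here read in the Hamiltonian variables.
  have hBline : ∀ s : ℝ, linePt s ∈ D → seqB b q p (n + 1) (linePt s) = 0 := by
    intro s hs
    have rel := (H.relations n le_rfl s (hV s hs)).2.2
    simp only [BackRel] at rel
    rw [hU2 s hs, hU1 s hs, hU (n + 1) le_rfl s hs, hU n (by omega) s hs] at rel
    rw [seqB, Nat.add_sub_cancel]
    rw [seqW] at rel ⊢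
    have hI0 : (-2 * Complex.I) ≠ 0 := by simp
    apply mul_left_cancel₀ hI0
    generalize hamKtt (alphaOf (shift3 b (n + 1))) (linePt s) (q (n + 1) (linePt s))
        (p (n + 1) (linePt s)) = z at *
    generalize hamKt (alphaOf (shift3 b (n + 1))) (q (n + 1) (linePt s))
      (p (n + 1) (linePt s)) = w at *
    generalize seqK b q p (n + 1) (linePt s) = k1 at *
    generalize seqK b q p n (linePt s) = k0 at *
    simp only [e2', e2, shift3, hb, bSeed, linePt, Matrix.cons_val_zero, Matrix.cons_val_one,
      Matrix.cons_val] at rel ⊢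
    push_cast at rel ⊢
    linear_combination rel - 2 * s * ((n : ℂ) + 1 - (N - η₁)) * (w +
      ((N - η₁) * (η₁ - N + (n + 1)) + (N - η₁) * (-μ + η₁ - N) +
      (η₁ - N + (n + 1)) * (-μ + η₁ - N) : ℂ)) *
      Complex.I_sq
  have hB : ∀ t ∈ D, seqB b q p (n + 1) t = 0 :=
    (hτ.analyticOnNhd_seqB hD (by omega) hn.le).eqOn_zero_of_preconnected_of_frequently_eq_zero
      hDc hs₀ (frequently_linePt (eventually_of_mem (hopen.mem_nhds hs₀) hBline))
  obtain ⟨c, hc⟩ := hτ.exists_const hD hDc hD0 (by omega) hn hB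
  rw [Nat.add_sub_cancel] at hc
  -- If `c = 0`, then `logD2` vanishes on the line inside `D`, so the chain member has derivative
  -- `-(n + 1 - b₁)²` and zero second derivative, which `not_degenerate` excludes.
  have hc0 : c ≠ 0 := by
    rintro rfl
    have hz : ∀ s : ℝ, linePt s ∈ D → logD2 (hankelD f (n + 1)) s = 0 := by
      intro s hs
      have := hc _ hs
      rw [zero_mul] at this
      rw [hU1 s hs]
      exact (mul_eq_zero.mp this).resolve_right
        (pow_ne_zero 2 (hτ.hasDerivAt hD (by omega) hs).1)
    have hz2 := TodaChain.hasDerivAt_eq hopen hs₀ hz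
      (hasDerivAt_logD2 (contDiff_hankelD (contDiff_ladderE hμ h' 1 _ _ 0 0) (n + 1))
        (hV s₀ hs₀ (n + 1) le_rfl)) (hasDerivAt_const s₀ (0 : ℂ))
    refine H.not_degenerate (by omega) hμ (by linarith) (hV s₀ hs₀) ?_ hz2
    rw [hz s₀ hs₀, zero_sub]
  obtain ⟨k, hk, hT⟩ := hankelD_toda_hdet hμ h' hκ hp0 hq0 n
  obtain ⟨c0, hc0', e0⟩ := ih n (by omega)
  obtain ⟨c1, hc1', e1⟩ := ih (n + 1) le_rfl
  refine ⟨c * c1 ^ 2 / (k * c0), div_ne_zero (mul_ne_zero hc0 (pow_ne_zero 2 hc1'))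
    (mul_ne_zero hk hc0'), fun s hs => ?_⟩
  have hT' := hT (bWt ξ μ) s (hHne n (by omega) s hs) (hHne (n + 1) le_rfl s hs)
  rw [← hf, hU1 s hs, e0 s hs, e1 s hs] at hT'
  have hcs := hc _ hs
  have t0 := (hτ.hasDerivAt hD (n := n) (by omega) hs).1
  rw [div_mul_eq_mul_div, eq_div_iff (mul_ne_zero hk hc0')]
  apply mul_right_cancel₀ t0
  linear_combination c1 ^ 2 * hcs - hT'

theorem tau_eq_hdet (hμ : -1 < μ) (h : 2 * (N : ℝ) - 1 + μ < 2 * η₁) (ξ : ℂ) (hD : IsOpen D)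
    (hDc : IsPreconnected D) (hD0 : D ⊆ {t : ℂ | 0 < t.re ∧ t.re < 1})
    (hτ : IsTauSequence (bSeed N η₁ η₂ μ) N D q p τ)
    (h1 : ∃ k : ℂ, k ≠ 0 ∧ ∀ s : ℝ, linePt s ∈ D →
      τ 1 (linePt s) = k * tauOne (bSeed N η₁ η₂ μ) ξ s)
    {s₀ : ℝ} (hs₀ : linePt s₀ ∈ D) (n : ℕ) (hn : n ≤ N) :
    ∃ c : ℂ, c ≠ 0 ∧ ∀ s : ℝ, linePt s ∈ D →
      hdet μ 1 (bWt ξ μ) (pCy N η₁ η₂) (qCy N η₁ η₂) n s = c * τ n (linePt s) := by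
  induction n using Nat.strong_induction_on with
  | _ n ih =>
    match n with
    | 0 =>
      refine ⟨1, one_ne_zero, fun s hs => ?_⟩
      rw [hτ.tau_zero _ hs]
      simp [hdet]
    | 1 =>
      obtain ⟨k, hk, e⟩ := h1
      refine ⟨k⁻¹, inv_ne_zero hk, fun s hs => ?_⟩
      rw [e s hs, tauOne_bSeed N η₂ hμ h, inv_mul_cancel_left₀ hk]
      simp [hdet]
    | n + 2 =>
      exact tau_succ_eq_hdet hμ h ξ hD hDc hD0 hτ hs₀ (by omega)
        fun m hm => ih m (by omega) (by omega)

theorem cauchyE_eq_tau (hμ : -1 < μ) (h : 2 * (N : ℝ) - 1 + μ < 2 * η₁) (ξ : ℂ) {C : ℂ} (hC : C ≠ 0)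
    (hD : IsOpen D) (hDc : IsPreconnected D) (hD0 : D ⊆ {t : ℂ | 0 < t.re ∧ t.re < 1})
    (hτ : IsTauSequence (bSeed N η₁ η₂ μ) N D q p τ)
    (h1 : ∃ k : ℂ, k ≠ 0 ∧ ∀ s : ℝ, linePt s ∈ D →
      τ 1 (linePt s) = k * tauOne (bSeed N η₁ η₂ μ) ξ s) :
    ∃ c : ℂ, c ≠ 0 ∧ ∀ s : ℝ, linePt s ∈ D →
      cauchyE C N η₁ η₂ μ ξ s = c * τ N (linePt s) := by
  by_cases hex : ∃ s₀ : ℝ, linePt s₀ ∈ D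
  · obtain ⟨s₀, hs₀⟩ := hex
    obtain ⟨c, hc, e⟩ := tau_eq_hdet hμ h ξ hD hDc hD0 hτ h1 hs₀ N le_rfl
    refine ⟨1 / C * (N.factorial / pairConst N * c), ?_, fun s hs => ?_⟩
    · exact mul_ne_zero (one_div_ne_zero hC) (mul_ne_zero (div_ne_zero
        (Nat.cast_ne_zero.mpr N.factorial_ne_zero) (pairConst_ne_zero N)) hc)
    · rw [(cauchyE_eq_hdet N η₂ hμ h ξ C).2, e s hs]
      ring
  · exact ⟨1, one_ne_zero, fun s hs => (hex ⟨s, hs⟩).elim⟩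

theorem cauchyE_eq_tauDet (N : ℕ) {η₁ μ : ℝ} (η₂ : ℝ) (hμ : -1 < μ)
    (h : 2 * (N : ℝ) - 1 + μ < 2 * η₁) (ξ : ℂ) {C : ℂ} (hC : C ≠ 0) :
    ∃ c : ℂ, c ≠ 0 ∧ ∀ s : ℝ,
      cauchyE C N η₁ η₂ μ ξ s = c * tauDet (bSeed N η₁ η₂ μ) ξ N s := by
  obtain ⟨c, hc, e⟩ := tauDet_eq_hdet N η₂ hμ h ξ N
  refine ⟨1 / C * (N.factorial / pairConst N / c), ?_, fun s => ?_⟩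
  · exact mul_ne_zero (one_div_ne_zero hC) (div_ne_zero (div_ne_zero
      (Nat.cast_ne_zero.mpr N.factorial_ne_zero) (pairConst_ne_zero N)) hc)
  · rw [(cauchyE_eq_hdet N η₂ hμ h ξ C).2, e s]
    field_simp

theorem differentiable_cauchyE (N : ℕ) {η₁ μ : ℝ} (η₂ : ℝ) (hμ : -1 < μ)
    (h : 2 * (N : ℝ) - 1 + μ < 2 * η₁) (ξ C : ℂ) :
    Differentiable ℝ (cauchyE C N η₁ η₂ μ ξ) := by
  rw [funext (cauchyE_eq_hdet N η₂ hμ h ξ C).2]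
  exact (((contDiff_hdet hμ (exponent_lt η₂ h) 1 (bWt ξ μ) N 1).differentiable
    (by simp)).const_mul _).const_mul _

end

/-! ### Behaviour at infinity -/

theorem kap_mul_left (μ : ℝ) (a b : ℂ) {s : ℝ} (hs : 0 < s) (y : ℝ) :
    kap μ a b (s * y) = ((s ^ μ : ℝ) : ℂ) * kap μ a b y := by
  rcases le_or_gt y 0 with h | h
  · rw [kap, kap, if_pos (mul_nonpos_of_nonneg_of_nonpos hs.le h), if_pos h, ← mul_neg,
      Real.mul_rpow hs.le (by linarith)]
    push_cast; ring
  · rw [kap, kap, if_neg (not_le.mpr (mul_pos hs h)), if_neg (not_le.mpr h),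
      Real.mul_rpow hs.le h.le]
    push_cast; ring

theorem norm_kap_le (μ : ℝ) (a b : ℂ) (y : ℝ) : ‖kap μ a b y‖ ≤ (‖a‖ + ‖b‖) * ‖kap μ 1 1 y‖ := by
  unfold kap
  split_ifs
  · rw [norm_mul, norm_mul, norm_one, one_mul]
    gcongr
    linarith [norm_nonneg b]
  · rw [norm_mul, norm_mul, norm_one, one_mul]
    gcongr
    linarith [norm_nonneg a]

theorem kap_sub_one_near (μ : ℝ) (a b : ℂ) : ∃ δ K : ℝ, 0 < δ ∧ δ ≤ 1 ∧ 0 ≤ K ∧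
    ∀ y : ℝ, |y| ≤ δ → ‖kap μ a b (y - 1) - a‖ ≤ K * |y| := by
  have hd : HasDerivAt (fun y : ℝ => (1 - y) ^ μ) (-1 * μ * (1 - 0) ^ (μ - 1)) 0 :=
    ((hasDerivAt_id (0 : ℝ)).const_sub 1).rpow_const (Or.inl (by norm_num))
  obtain ⟨K, hK⟩ := hd.isBigO_sub.bound
  obtain ⟨r, hr, hb⟩ := Metric.eventually_nhds_iff.mp hK
  refine ⟨min (r / 2) 1, ‖a‖ * |K|, by positivity, min_le_right _ _, by positivity, fun y hy => ?_⟩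
  have h1 : |y| ≤ r / 2 := hy.trans (min_le_left _ _)
  have h2 : |y| ≤ 1 := hy.trans (min_le_right _ _)
  have h3 := hb (y := y) (by rw [Real.dist_eq, sub_zero]; linarith)
  have h4 : y - 1 ≤ 0 := by linarith [le_abs_self y]
  rw [kap, if_pos h4, neg_sub]
  rw [sub_zero, sub_zero, Real.one_rpow, Real.norm_eq_abs, Real.norm_eq_abs] at h3
  have h5 : a * (((1 - y) ^ μ : ℝ) : ℂ) - a = a * (((1 - y) ^ μ - 1 : ℝ) : ℂ) := by push_cast; ring
  rw [h5, norm_mul, Complex.norm_real, Real.norm_eq_abs, mul_assoc]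
  gcongr
  exact h3.trans (by gcongr; exact le_abs_self K)

theorem norm_gW_self (x y : ℝ) : ‖gW (x : ℂ) x y‖ = (1 + y ^ 2) ^ x := by
  rw [gW_self, Complex.norm_exp, Real.rpow_def_of_pos (by positivity)]
  congr 1
  rw [Complex.re_mul_ofReal, Complex.ofReal_re]

theorem integral_gW {p q : ℂ} (h : (p + q).re < -1) :
    Integrable (gW p q) ∧ ∀ s, ∫ x, gW p q x = fullI 0 1 1 p q s := by
  have hk : ∀ y, kap 0 1 1 y = 1 := by
    intro y; unfold kap; split_ifs <;> simp
  have := fun s => kap_mul_gW 0 1 1 (by norm_num) (p := p) (q := q) (by simpa using h) s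
  simp only [hk, one_mul] at this
  exact ⟨(this 0).1, fun s => (this s).2⟩

/-- By homogeneity `s^(-μ) kap (x - s) = kap (x/s - 1)`, which tends to `a` for fixed `x`. For `|x|
≤ δ s` the error is linear in `|x|/s`, hence at most a constant times `(|x|/s)^ε`; this costs `ε` of
the available decay. For `|x| > δ s` the decay of the weight is used. -/
theorem fullI_scaled_sub_le {μ : ℝ} (hμ : -1 < μ) {p q : ℂ} (h : (p + q).re + μ < -1) (a b : ℂ)
    {ε : ℝ} (hε : 0 < ε) (hε1 : ε ≤ 1) (hσ : (p + q).re + ε < -1) :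
    ∃ K : ℝ, ∀ s : ℝ, 1 ≤ s →
      ‖((s ^ (-μ) : ℝ) : ℂ) * fullI μ a b p q s - a * ∫ x, gW p q x‖ ≤ K * s ^ (-ε) := by
  set σ := (p + q).re with hσd
  obtain ⟨δ, K₀, hδ, hδ1, hK₀, hnear⟩ := kap_sub_one_near μ a b
  set c₀ := Real.exp (Real.pi * |p.im|) * Real.exp (Real.pi * |q.im|) with hc₀
  set K₁ := K₀ + ‖a‖ * δ ^ (-ε) with hK₁
  set c₁ := (δ ^ 2 / 2) ^ (σ / 2) with hc₁
  have hσ0 : σ ≤ 0 := by linarith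
  have hi1 : Integrable fun x : ℝ => ((1 : ℝ) + ‖x‖ ^ 2) ^ (-(-(σ + ε)) / 2) :=
    integrable_rpow_neg_one_add_norm_sq (by simp; linarith)
  have hi2 : Integrable fun y : ℝ => ‖kap μ 1 1 (y - 1)‖ * (1 + y ^ 2) ^ (σ / 2) := by
    have := (kap_mul_gW μ 1 1 hμ (p := ((σ / 2 : ℝ) : ℂ)) (q := ((σ / 2 : ℝ) : ℂ))
      (by rw [← Complex.ofReal_add, Complex.ofReal_re]; linarith) 1).1.norm
    simpa only [norm_mul, norm_gW_self] using this
  have hpt : ∀ s : ℝ, 1 ≤ s → ∀ x : ℝ,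
      ‖(((s ^ (-μ) : ℝ) : ℂ) * kap μ a b (x - s) - a) * gW p q x‖ ≤
      c₀ * K₁ * s ^ (-ε) * (1 + ‖x‖ ^ 2) ^ (-(-(σ + ε)) / 2) +
      c₀ * (‖a‖ + ‖b‖) * c₁ * s ^ σ * (‖kap μ 1 1 (x / s - 1)‖ * (1 + (x / s) ^ 2) ^ (σ / 2)) := by
    intro s hs x
    have hs0 : 0 < s := by linarith
    have e1 : ((s ^ (-μ) : ℝ) : ℂ) * kap μ a b (x - s) = kap μ a b (x / s - 1) := by
      rw [show x - s = s * (x / s - 1) by field_simp, kap_mul_left μ a b hs0, ← mul_assoc,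
        ← Complex.ofReal_mul, ← Real.rpow_add hs0]
      simp
    rw [e1, norm_mul]
    have hg := norm_gW_le p q x
    rw [← hc₀, ← hσd] at hg
    have hx1 : (0 : ℝ) < 1 + x ^ 2 := by positivity
    have hxe : |x| ^ ε ≤ (1 + x ^ 2) ^ (ε / 2) := by
      have : |x| ^ ε = (x ^ 2) ^ (ε / 2) := by
        rw [← sq_abs, ← Real.rpow_natCast, ← Real.rpow_mul (abs_nonneg x)]; congr 1; push_cast; ring
      rw [this]
      exact Real.rpow_le_rpow (by positivity) (by linarith) (by positivity)
    have hK1 : 0 ≤ K₁ := by positivity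
    have hterm1 : ∀ z : ℝ, z ≤ K₁ * |x / s| ^ ε → z * ‖gW p q x‖ ≤
        c₀ * K₁ * s ^ (-ε) * (1 + ‖x‖ ^ 2) ^ (-(-(σ + ε)) / 2) := by
      intro z hz
      have e2 : |x / s| ^ ε = s ^ (-ε) * |x| ^ ε := by
        rw [abs_div, abs_of_pos hs0, Real.div_rpow (abs_nonneg x) hs0.le, Real.rpow_neg hs0.le]
        ring
      calc z * ‖gW p q x‖ ≤ (K₁ * |x / s| ^ ε) * (c₀ * (1 + x ^ 2) ^ (σ / 2)) := by gcongr
        _ ≤ K₁ * (s ^ (-ε) * (1 + x ^ 2) ^ (ε / 2)) * (c₀ * (1 + x ^ 2) ^ (σ / 2)) := by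
          rw [e2]; gcongr
        _ = _ := by
          rw [Real.norm_eq_abs, sq_abs, show -(-(σ + ε)) / 2 = ε / 2 + σ / 2 by ring,
            Real.rpow_add hx1]; ring
    have hterm2 : 0 ≤ c₀ * (‖a‖ + ‖b‖) * c₁ * s ^ σ *
        (‖kap μ 1 1 (x / s - 1)‖ * (1 + (x / s) ^ 2) ^ (σ / 2)) := by positivity
    rcases le_or_gt |x / s| δ with hc | hc
    · refine (hterm1 _ ?_).trans (le_add_of_nonneg_right hterm2)
      refine (hnear _ hc).trans ?_
      have : |x / s| ≤ |x / s| ^ ε := by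
        nth_rewrite 1 [← Real.rpow_one |x / s|]
        rcases eq_or_lt_of_le (abs_nonneg (x / s)) with h0 | h0
        · rw [← h0, Real.zero_rpow one_ne_zero, Real.zero_rpow hε.ne']
        · exact Real.rpow_le_rpow_of_exponent_ge h0 (hc.trans hδ1) hε1
      calc K₀ * |x / s| ≤ K₀ * |x / s| ^ ε := by gcongr
        _ ≤ K₁ * |x / s| ^ ε := by
          gcongr
          rw [hK₁]
          linarith [show 0 ≤ ‖a‖ * δ ^ (-ε) by positivity]
    -- In the outer region the constant `a` is itself at most `‖a‖ δ^(-ε) |x/s|^ε`.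
    · have ha : ‖a‖ * ‖gW p q x‖ ≤ c₀ * K₁ * s ^ (-ε) * (1 + ‖x‖ ^ 2) ^ (-(-(σ + ε)) / 2) := by
        refine hterm1 _ ?_
        have h1 : 1 ≤ δ ^ (-ε) * |x / s| ^ ε := by
          rw [Real.rpow_neg hδ.le, ← div_eq_inv_mul, one_le_div (by positivity)]
          exact Real.rpow_le_rpow hδ.le hc.le hε.le
        calc ‖a‖ ≤ ‖a‖ * (δ ^ (-ε) * |x / s| ^ ε) := le_mul_of_one_le_right (norm_nonneg a) h1
          _ = (‖a‖ * δ ^ (-ε)) * |x / s| ^ ε := by ring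
          _ ≤ K₁ * |x / s| ^ ε := by gcongr; rw [hK₁]; linarith
      -- Here `1 + x²` is comparable to `s² (1 + (x/s)²)`, so the weight gives `s^σ` times an
      -- integrable function of `x/s`. The change of variables adds a factor `s`, and `σ + 1 ≤ -ε`.
      have hk : ‖kap μ a b (x / s - 1)‖ * ‖gW p q x‖ ≤ c₀ * (‖a‖ + ‖b‖) * c₁ * s ^ σ *
          (‖kap μ 1 1 (x / s - 1)‖ * (1 + (x / s) ^ 2) ^ (σ / 2)) := by
        have hlow : δ ^ 2 / 2 * (s ^ 2 * (1 + (x / s) ^ 2)) ≤ 1 + x ^ 2 := by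
          have hx : x ^ 2 = s ^ 2 * (x / s) ^ 2 := by field_simp
          have h2 : δ ^ 2 ≤ (x / s) ^ 2 := by
            rw [← sq_abs (x / s)]; gcongr
          have h3 : δ ^ 2 ≤ 1 := by nlinarith
          have h4 : 0 ≤ s ^ 2 := sq_nonneg s
          have h5 : 0 ≤ s ^ 2 * (x / s) ^ 2 := by positivity
          rw [hx]
          nlinarith [mul_le_mul_of_nonneg_left h2 h4, mul_le_mul_of_nonneg_right h3 h5]
        have hσ' : (1 + x ^ 2) ^ (σ / 2) ≤ c₁ * (s ^ σ * (1 + (x / s) ^ 2) ^ (σ / 2)) := by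
          have e3 : s ^ σ = (s ^ 2) ^ (σ / 2) := by
            rw [← Real.rpow_natCast, ← Real.rpow_mul hs0.le]; congr 1; push_cast; ring
          rw [e3, ← Real.mul_rpow (by positivity) (by positivity), hc₁,
            ← Real.mul_rpow (by positivity) (by positivity)]
          exact Real.rpow_le_rpow_of_nonpos (by positivity) hlow (by linarith)
        calc ‖kap μ a b (x / s - 1)‖ * ‖gW p q x‖ ≤
            ((‖a‖ + ‖b‖) * ‖kap μ 1 1 (x / s - 1)‖) * (c₀ * (1 + x ^ 2) ^ (σ / 2)) := by
              gcongr
              exact norm_kap_le _ _ _ _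
          _ ≤ ((‖a‖ + ‖b‖) * ‖kap μ 1 1 (x / s - 1)‖) *
              (c₀ * (c₁ * (s ^ σ * (1 + (x / s) ^ 2) ^ (σ / 2)))) := by gcongr
          _ = _ := by ring
      calc ‖kap μ a b (x / s - 1) - a‖ * ‖gW p q x‖ ≤
          (‖kap μ a b (x / s - 1)‖ + ‖a‖) * ‖gW p q x‖ := by gcongr; exact norm_sub_le _ _
        _ ≤ _ := by rw [add_mul, add_comm]; exact add_le_add ha hk
  refine ⟨c₀ * K₁ * (∫ x : ℝ, (1 + ‖x‖ ^ 2) ^ (-(-(σ + ε)) / 2)) + c₀ * (‖a‖ + ‖b‖) * c₁ *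
    ∫ y : ℝ, ‖kap μ 1 1 (y - 1)‖ * (1 + y ^ 2) ^ (σ / 2), fun s hs => ?_⟩
  have hs0 : 0 < s := by linarith
  obtain ⟨k1, k2⟩ := kap_mul_gW μ a b hμ h s
  have hG := (integral_gW (p := p) (q := q) (by linarith)).1
  have e : ((s ^ (-μ) : ℝ) : ℂ) * fullI μ a b p q s - a * ∫ x, gW p q x =
      ∫ x, (((s ^ (-μ) : ℝ) : ℂ) * kap μ a b (x - s) - a) * gW p q x := by
    rw [← k2, ← integral_const_mul, ← integral_const_mul, ← integral_sub (k1.const_mul _)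
      (hG.const_mul _)]
    congr 1; funext x; ring
  rw [e]
  have j2 := hi2.comp_div hs0.ne'
  refine (norm_integral_le_of_norm_le ((hi1.const_mul _).add (j2.const_mul _))
    (Eventually.of_forall (hpt s hs))).trans ?_
  rw [integral_add' (hi1.const_mul _) (j2.const_mul _), integral_const_mul, integral_const_mul,
    Measure.integral_comp_div (fun y => ‖kap μ 1 1 (y - 1)‖ * (1 + y ^ 2) ^ (σ / 2)) s,
    abs_of_pos hs0, smul_eq_mul, add_mul]
  refine add_le_add (le_of_eq (by ring)) ?_
  have h6 : s ^ σ * s ≤ s ^ (-ε) := by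
    nth_rewrite 2 [← Real.rpow_one s]
    rw [← Real.rpow_add hs0]
    exact Real.rpow_le_rpow_of_exponent_le hs (by linarith)
  have h7 : 0 ≤ ∫ y : ℝ, ‖kap μ 1 1 (y - 1)‖ * (1 + y ^ 2) ^ (σ / 2) :=
    integral_nonneg fun y => by positivity
  calc _ = c₀ * (‖a‖ + ‖b‖) * c₁ * (∫ y : ℝ, ‖kap μ 1 1 (y - 1)‖ * (1 + y ^ 2) ^ (σ / 2)) *
        (s ^ σ * s) := by ring
    _ ≤ _ := by gcongr

/-! ### Normalised integrals and their determinants at `+∞`. -/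

section

theorem gW_ofReal_self (x y : ℝ) : gW (x : ℂ) x y = (((1 + y ^ 2) ^ x : ℝ) : ℂ) := by
  rw [gW_self, Real.rpow_def_of_pos (by positivity), Complex.ofReal_exp, Complex.ofReal_mul]

/-- The function `fullI` normalised by its growth. -/
def hatI (μ : ℝ) (a b p q : ℂ) (s : ℝ) : ℂ :=
  gW ((-μ / 2 : ℝ) : ℂ) ((-μ / 2 : ℝ) : ℂ) s * fullI μ a b p q s

theorem inv_isBigO_rpow {ε : ℝ} (hε1 : ε ≤ 1) :
    (fun s : ℝ => s⁻¹) =O[atTop] fun s : ℝ => s ^ (-ε) := by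
  refine Asymptotics.IsBigO.of_bound 1 ?_
  filter_upwards [eventually_ge_atTop 1] with s hs
  rw [one_mul, Real.norm_of_nonneg (by positivity), Real.norm_of_nonneg (by positivity),
    ← Real.rpow_neg_one]
  exact Real.rpow_le_rpow_of_exponent_le hs (by linarith)

theorem rpow_neg_isBigO_one {ε : ℝ} (hε : 0 < ε) :
    (fun s : ℝ => s ^ (-ε)) =O[atTop] fun _ : ℝ => (1 : ℝ) :=
  (tendsto_rpow_neg_atTop hε).isBigO_one ℝ

theorem one_add_sq_rpow_sub_one (μ : ℝ) {ε : ℝ} (hε1 : ε ≤ 1) :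
    (fun s : ℝ => (1 + s ^ 2) ^ (-μ / 2) * s ^ μ - 1) =O[atTop] fun s : ℝ => s ^ (-ε) := by
  have hd : DifferentiableAt ℝ (fun y : ℝ => (1 + y ^ 2) ^ (-μ / 2)) 0 := by
    refine DifferentiableAt.rpow_const (by fun_prop) (Or.inl (by norm_num))
  have h1 := (hd.hasDerivAt.isBigO_sub.comp_tendsto tendsto_inv_atTop_zero).trans
    (((Asymptotics.isBigO_refl (fun s : ℝ => s⁻¹) atTop).congr_left fun s => by simp).trans
      (inv_isBigO_rpow hε1))
  refine h1.congr' ?_ EventuallyEq.rfl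
  filter_upwards [eventually_gt_atTop 0] with s hs
  have e : (1 + s ^ 2) = s ^ 2 * (1 + s⁻¹ ^ 2) := by field_simp; ring
  simp only [Function.comp_apply]
  rw [e, Real.mul_rpow (by positivity) (by positivity), ← Real.rpow_natCast s 2,
    ← Real.rpow_mul hs.le, mul_right_comm, ← Real.rpow_add hs]
  norm_num
  ring_nf
  simp

variable {μ : ℝ} {p q : ℂ} {ε : ℝ}

theorem hatI_sub_isBigO (hμ : -1 < μ) (h : (p + q).re + μ < -1) (a b : ℂ)
    (hε : 0 < ε) (hε1 : ε ≤ 1) (hσ : (p + q).re + ε < -1) :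
    (fun s => hatI μ a b p q s - a * ∫ x, gW p q x) =O[atTop] fun s : ℝ => s ^ (-ε) := by
  obtain ⟨K, hK⟩ := fullI_scaled_sub_le hμ h a b hε hε1 hσ
  have h1 : (fun s : ℝ => ((s ^ (-μ) : ℝ) : ℂ) * fullI μ a b p q s - a * ∫ x, gW p q x)
      =O[atTop] fun s : ℝ => s ^ (-ε) := by
    refine Asymptotics.IsBigO.of_bound K ?_
    filter_upwards [eventually_ge_atTop 1] with s hs
    rw [Real.norm_of_nonneg (Real.rpow_nonneg (by linarith) _)]
    exact hK s hs
  have hb : (fun s : ℝ => ((s ^ (-μ) : ℝ) : ℂ) * fullI μ a b p q s)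
      =O[atTop] fun _ : ℝ => (1 : ℝ) := by
    have := (h1.trans (rpow_neg_isBigO_one hε)).add
      (Asymptotics.isBigO_const_const (a * ∫ x, gW p q x) (one_ne_zero (α := ℝ)) atTop)
    simpa using this
  have hr : (fun s : ℝ => (((1 + s ^ 2) ^ (-μ / 2) * s ^ μ - 1 : ℝ) : ℂ))
      =O[atTop] fun s : ℝ => s ^ (-ε) :=
    (Complex.isBigO_ofReal_left).mpr (one_add_sq_rpow_sub_one μ hε1)
  refine (((hr.mul hb).congr_right fun s => mul_one _).add h1).congr' ?_ EventuallyEq.rfl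
  filter_upwards [eventually_gt_atTop 0] with s hs
  have e : s ^ μ * s ^ (-μ) = 1 := by rw [← Real.rpow_add hs]; simp
  rw [hatI, gW_ofReal_self]
  have e' : ((s ^ μ : ℝ) : ℂ) * ((s ^ (-μ) : ℝ) : ℂ) = 1 := by exact_mod_cast e
  push_cast
  linear_combination (((1 + s ^ 2) ^ (-μ / 2) : ℝ) : ℂ) * fullI μ a b p q s * e'

theorem contDiff_hatI (hμ : -1 < μ) (h : (p + q).re + μ < -1) (a b : ℂ) (n : ℕ) :
    ContDiff ℝ n (hatI μ a b p q) :=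
  (contDiff_gW _ _ n).mul (contDiff_fullI hμ h a b n)

/-- For `μ = 0` and equal weights the integral does not depend on `s`, so the derivative given by
contiguity vanishes. -/
theorem gW_integral_raise (hσ : (p + q).re < -1) :
    (1 + p) * (∫ x, gW p q x) - q * ∫ x, gW (p + 1) (q - 1) x = 0 := by
  have hs : (p + 1 + (q - 1)).re < -1 := by rwa [show p + 1 + (q - 1) = p + q by ring]
  have h0 := fullI_raise (μ := 0) (by norm_num) (by simpa using hσ) 1 1 (p := p) (q := q) 0
  have hc : fullI 0 1 1 p q = fun _ => ∫ x, gW p q x :=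
    funext fun s => ((integral_gW hσ).2 s).symm
  rw [← (integral_gW hs).2 0, hc] at h0
  have := h0.unique (hasDerivAt_const 0 _)
  simpa using this

theorem opD_hatI (hμ : -1 < μ) (h : (p + q).re + μ < -1) (a b : ℂ) (s : ℝ) :
    opD (hatI μ a b p q) s = s * ((1 + p) * hatI μ a b p q s - q * hatI μ a b (p + 1) (q - 1) s) +
      Complex.I * ((1 + μ + p) * hatI μ a b p q s - q * hatI μ a b (p + 1) (q - 1) s) := by
  have d := fullI_raise hμ h a b s
  unfold hatI
  rw [opD_mul (gW_hasDerivAt _ _ s).differentiableAt d.differentiableAt, opD_gW]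
  rw [opD_eq_of_hasDerivAt (d.congr_deriv (show _ = (s + Complex.I) * ((1 + μ + p) *
    fullI μ a b p q s - q * fullI μ a b (p + 1) (q - 1) s) / (1 + (s : ℂ) ^ 2) by ring))]
  push_cast
  ring

/-- Bounded differentiable functions whose derivative decays like `s^{-1-ε}`. -/
def SlowlyVarying (ε : ℝ) (f : ℝ → ℂ) : Prop :=
  Differentiable ℝ f ∧ f =O[atTop] (fun _ => (1 : ℝ)) ∧ opD f =O[atTop] fun s : ℝ => s ^ (1 - ε)

theorem slowlyVarying_const (ε : ℝ) (c : ℂ) : SlowlyVarying ε fun _ => c := by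
  refine ⟨differentiable_const c, Asymptotics.isBigO_const_const c one_ne_zero _, ?_⟩
  have : opD (fun _ : ℝ => c) = fun _ => 0 := by funext s; simp [opD]
  rw [this]
  exact Asymptotics.isBigO_zero _ _

theorem SlowlyVarying.add {f g : ℝ → ℂ} (hf : SlowlyVarying ε f) (hg : SlowlyVarying ε g) :
    SlowlyVarying ε fun s => f s + g s := by
  refine ⟨hf.1.add hg.1, hf.2.1.add hg.2.1, ?_⟩
  have : opD (fun s => f s + g s) = fun s => opD f s + opD g s := by
    funext s
    rw [opD, ((hf.1 s).hasDerivAt.fun_add (hg.1 s).hasDerivAt).deriv, opD, opD]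
    ring
  rw [this]
  exact hf.2.2.add hg.2.2

theorem SlowlyVarying.mul {f g : ℝ → ℂ} (hf : SlowlyVarying ε f) (hg : SlowlyVarying ε g) :
    SlowlyVarying ε fun s => f s * g s := by
  refine ⟨hf.1.mul hg.1, (hf.2.1.mul hg.2.1).congr_right fun s => mul_one _, ?_⟩
  have : opD (fun s => f s * g s) = fun s => opD f s * g s + f s * opD g s :=
    funext fun s => opD_mul (hf.1 s) (hg.1 s)
  rw [this]
  exact ((hf.2.2.mul hg.2.1).congr_right fun s => mul_one _).add
    ((hf.2.1.mul hg.2.2).congr_right fun s => one_mul _)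

theorem SlowlyVarying.sum {ι : Type*} (S : Finset ι) {f : ι → ℝ → ℂ}
    (h : ∀ i ∈ S, SlowlyVarying ε (f i)) : SlowlyVarying ε fun s => ∑ i ∈ S, f i s := by
  classical
  induction S using Finset.induction_on with
  | empty => simpa using slowlyVarying_const ε 0
  | insert i S hi ih =>
    simp only [Finset.sum_insert hi]
    exact (h i (Finset.mem_insert_self i S)).add
      (ih fun j hj => h j (Finset.mem_insert_of_mem hj))

theorem SlowlyVarying.prod {ι : Type*} (S : Finset ι) {f : ι → ℝ → ℂ}
    (h : ∀ i ∈ S, SlowlyVarying ε (f i)) : SlowlyVarying ε fun s => ∏ i ∈ S, f i s := by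
  classical
  induction S using Finset.induction_on with
  | empty => simpa using slowlyVarying_const ε 1
  | insert i S hi ih =>
    simp only [Finset.prod_insert hi]
    exact (h i (Finset.mem_insert_self i S)).mul
      (ih fun j hj => h j (Finset.mem_insert_of_mem hj))

theorem tendsto_hatI (hμ : -1 < μ) (h : (p + q).re + μ < -1) (a b : ℂ) (hσ : (p + q).re < -1) :
    Tendsto (hatI μ a b p q) atTop (𝓝 (a * ∫ x, gW p q x)) := by
  obtain ⟨ε, hε, hε1, hε2⟩ : ∃ ε : ℝ, 0 < ε ∧ ε ≤ 1 ∧ (p + q).re + ε < -1 :=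
    ⟨min 1 ((-1 - (p + q).re) / 2), lt_min one_pos (by linarith), min_le_left _ _, by
      linarith [min_le_right 1 ((-1 - (p + q).re) / 2)]⟩
  have := (hatI_sub_isBigO hμ h a b hε hε1 hε2).trans_tendsto (tendsto_rpow_neg_atTop hε)
  simpa using this.add_const (a * ∫ x, gW p q x)

/-- In `opD_hatI` the coefficient of `s` tends to zero by `gW_integral_raise`, at the rate `s^(-ε)`
of the integrals themselves. This improves the naive bound `s` to `s^(1 - ε)`. -/
theorem slowlyVarying_hatI (hμ : -1 < μ) (h : (p + q).re + μ < -1) (a b : ℂ)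
    (hε : 0 < ε) (hε1 : ε ≤ 1) (hσ : (p + q).re + ε < -1) : SlowlyVarying ε (hatI μ a b p q) := by
  have e : (p + 1 + (q - 1)) = p + q := by ring
  have hb0 := (tendsto_hatI hμ h a b (by linarith)).isBigO_one ℝ
  have hb1 := (tendsto_hatI hμ (p := p + 1) (q := q - 1) (by rwa [e]) a b
    (by rw [e]; linarith)).isBigO_one ℝ
  have h0 := hatI_sub_isBigO hμ h a b hε hε1 hσ
  have h1 := hatI_sub_isBigO hμ (p := p + 1) (q := q - 1) (by rwa [e]) a b hε hε1 (by rwa [e])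
  refine ⟨(contDiff_hatI hμ h a b 1).differentiable (by simp), hb0, ?_⟩
  rw [funext (opD_hatI hμ h a b)]
  have hs : (fun s : ℝ => (s : ℂ)) =O[atTop] fun s : ℝ => s :=
    Complex.isBigO_ofReal_left.mpr (Asymptotics.isBigO_refl _ _)
  have hone : (fun _ : ℝ => (1 : ℝ)) =O[atTop] fun s : ℝ => s ^ (1 - ε) := by
    refine Asymptotics.IsBigO.of_bound 1 ?_
    filter_upwards [eventually_ge_atTop 1] with s hs
    rw [one_mul, norm_one, Real.norm_of_nonneg (by positivity)]
    exact Real.one_le_rpow hs (by linarith)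
  refine Asymptotics.IsBigO.add ?_ ?_
  · have hb := (h0.const_mul_left (1 + p)).sub (h1.const_mul_left q)
    refine ((hs.mul hb).congr_left fun s => ?_).congr' EventuallyEq.rfl ?_
    · linear_combination (-(s : ℂ) * a) * gW_integral_raise (p := p) (q := q) (by linarith)
    · filter_upwards [eventually_gt_atTop 0] with s hs
      rw [sub_eq_add_neg, Real.rpow_add hs, Real.rpow_one]
  · exact ((((hb0.const_mul_left (1 + μ + p)).sub (hb1.const_mul_left q)).const_mul_left _)).trans hone

/-- The determinant of the normalised functions. -/
def hatDet (μ : ℝ) (a b p q : ℂ) (n : ℕ) (s : ℝ) : ℂ :=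
  (Matrix.of fun j k : Fin n =>
    hatI μ a b (p + ((j : ℕ) : ℂ) - ((k : ℕ) : ℂ)) (q - ((j : ℕ) : ℂ) + ((k : ℕ) : ℂ)) s).det

theorem hatDet_eq (μ : ℝ) (a b p q : ℂ) (n : ℕ) (s : ℝ) :
    hatDet μ a b p q n s = gW ((n * (-μ / 2) : ℝ) : ℂ) ((n * (-μ / 2) : ℝ) : ℂ) s *
      hdet μ a b p q n s := by
  have e := Matrix.det_mul_row (fun _ : Fin n => gW ((-μ / 2 : ℝ) : ℂ) ((-μ / 2 : ℝ) : ℂ) s)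
    (Matrix.of fun j k : Fin n =>
      fullI μ a b (p + ((j : ℕ) : ℂ) - ((k : ℕ) : ℂ)) (q - ((j : ℕ) : ℂ) + ((k : ℕ) : ℂ)) s)
  simp only [Matrix.of_apply] at e
  simp only [hatDet, hatI]
  rw [e, Finset.prod_const, Finset.card_univ, Fintype.card_fin, hdet, gW_ofReal_self,
    gW_ofReal_self, mul_comm (n : ℝ), Real.rpow_mul_natCast (by positivity), Complex.ofReal_pow]

theorem slowlyVarying_hatDet (hμ : -1 < μ) (h : (p + q).re + μ < -1) (a b : ℂ)
    (hε : 0 < ε) (hε1 : ε ≤ 1) (hσ : (p + q).re + ε < -1) (n : ℕ) :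
    SlowlyVarying ε (hatDet μ a b p q n) := by
  unfold hatDet
  simp only [Matrix.det_apply', Matrix.of_apply]
  refine SlowlyVarying.sum _ fun τ _ => (slowlyVarying_const ε _).mul
    (SlowlyVarying.prod _ fun i _ => ?_)
  exact slowlyVarying_hatI hμ (by rwa [shift_re]) a b hε hε1 (by rwa [shift_re])

theorem tendsto_hatDet (hμ : -1 < μ) (h : (p + q).re + μ < -1) (a b : ℂ) (hσ : (p + q).re < -1)
    (n : ℕ) : Tendsto (hatDet μ a b p q n) atTop (𝓝 (a ^ n * hdet 0 1 1 p q n 0)) := by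
  have e := Matrix.det_mul_row (fun _ : Fin n => a) (Matrix.of fun j k : Fin n =>
    fullI 0 1 1 (p + ((j : ℕ) : ℂ) - ((k : ℕ) : ℂ)) (q - ((j : ℕ) : ℂ) + ((k : ℕ) : ℂ)) 0)
  rw [Finset.prod_const, Finset.card_univ, Fintype.card_fin] at e
  rw [hdet, ← e]
  have hc : Continuous fun M : Matrix (Fin n) (Fin n) ℂ => M.det := continuous_id.matrix_det
  refine (hc.tendsto _).comp ?_
  refine tendsto_pi_nhds.mpr fun j => tendsto_pi_nhds.mpr fun k => ?_
  have := tendsto_hatI hμ (p := p + ((j : ℕ) : ℂ) - ((k : ℕ) : ℂ))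
    (q := q - ((j : ℕ) : ℂ) + ((k : ℕ) : ℂ)) (by rwa [shift_re]) a b (by rwa [shift_re])
  rwa [(integral_gW (by rwa [shift_re])).2 0] at this

theorem hatDet_limit_ne_zero (hpq : (starRingEnd ℂ) p = q) {a : ℂ} (ha : a ≠ 0)
    (hσ : (p + q).re < -1) (n : ℕ) : a ^ n * hdet 0 1 1 p q n 0 ≠ 0 :=
  mul_ne_zero (pow_ne_zero n ha) (by
    simpa using hdet_ne_zero (μ := 0) (by norm_num) (by simpa using hσ) hpq
      zero_le_one zero_le_one (Or.inl one_pos) n 0)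

theorem logD1_hdet_eq (hμ : -1 < μ) (h : (p + q).re + μ < -1) (a b : ℂ) (n : ℕ) {s : ℝ}
    (hs : hatDet μ a b p q n s ≠ 0) :
    logD1 (hdet μ a b p q n) s = logD1 (hatDet μ a b p q n) s + n * μ * s := by
  have hd : DifferentiableAt ℝ (hatDet μ a b p q n) s := by
    rw [funext (hatDet_eq μ a b p q n)]
    exact (gW_hasDerivAt _ _ s).differentiableAt.mul
      ((contDiff_hdet hμ h a b n 1).differentiable (by simp) s)
  have e : hdet μ a b p q n = fun s => gW ((n * (μ / 2) : ℝ) : ℂ) ((n * (μ / 2) : ℝ) : ℂ) s *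
      hatDet μ a b p q n s := by
    funext s
    rw [hatDet_eq, ← mul_assoc, gW_mul_gW]
    rw [show (((n * (μ / 2) : ℝ) : ℂ) + ((n * (-μ / 2) : ℝ) : ℂ)) = 0 by push_cast; ring]
    simp [gW]
  rw [e, logD1_gW_mul _ _ hd hs]
  push_cast
  ring

/-- The behaviour of the logarithmic derivative of `hdet` at `+∞`. -/
theorem logD1_hdet_isBigO (hμ : -1 < μ) (h : (p + q).re + μ < -1) (hpq : (starRingEnd ℂ) p = q)
    {a : ℂ} (ha : a ≠ 0) (b : ℂ) (hε : 0 < ε) (hε1 : ε ≤ 1) (hσ : (p + q).re + ε < -1) (n : ℕ) :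
    (∀ᶠ s in atTop, hdet μ a b p q n s ≠ 0) ∧
    (fun s => logD1 (hdet μ a b p q n) s - n * μ * s) =O[atTop] fun s : ℝ => s ^ (1 - ε) := by
  have ht := tendsto_hatDet hμ h a b (by linarith) n
  have hne := hatDet_limit_ne_zero hpq ha (by linarith) n
  have hev := ht.eventually_ne hne
  have hsv := slowlyVarying_hatDet hμ h a b hε hε1 hσ n
  refine ⟨hev.mono fun s hs => ?_, ?_⟩
  · rw [hatDet_eq] at hs
    exact right_ne_zero_of_mul hs
  · have hinv := (ht.inv₀ hne).isBigO_one ℝ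
    refine (hsv.2.2.mul hinv).congr' ?_ (Eventually.of_forall fun s => mul_one _)
    filter_upwards [hev] with s hs
    rw [logD1_hdet_eq hμ h a b n hs, logD1, add_sub_cancel_right]
    rfl

end

/-! ### Behaviour at `-∞` for `ξ ≠ 1`. -/

section

/-- The reflection `x ↦ -x` exchanges `p` with `q` and the two half lines, and transposes the
matrix. It transfers the asymptotics from `+∞` to `-∞`. -/
theorem hdet_neg (μ : ℝ) (a b p q : ℂ) (n : ℕ) (s : ℝ) :
    hdet μ a b p q n (-s) = hdet μ b a q p n s := by
  rw [hdet, hdet, ← Matrix.det_transpose]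
  congr 1
  ext j k
  simp only [Matrix.transpose_apply, Matrix.of_apply, fullI, neg_neg]
  rw [show q + (j : ℂ) - k = q - k + j by ring, show p - (j : ℂ) + k = p + k - j by ring]
  ring

theorem logD1_comp_neg {f g : ℝ → ℂ} (h : ∀ s, f (-s) = g s) (s : ℝ) :
    logD1 f (-s) = -logD1 g s := by
  have hg : g = fun s => f (-s) := funext fun s => (h s).symm
  rw [logD1, logD1, opD, opD, hg, deriv_comp_neg]
  push_cast
  ring

theorem e2'_add_mul (N : ℕ) (η₁ η₂ μ : ℝ) :
    e2' (bCy N η₁ η₂ μ) + N * μ = -((N : ℂ) - η₁) ^ 2 := by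
  simp only [e2', bCy, Matrix.cons_val_zero, Matrix.cons_val]
  ring

theorem e2'_add_mul_one (N : ℕ) (η₁ η₂ μ : ℝ) :
    e2' (bCy N η₁ η₂ μ) + N * (N + μ - 2 * η₁) = -(η₁ : ℂ) ^ 2 := by
  simp only [e2', bCy, Matrix.cons_val_zero, Matrix.cons_val]
  ring

theorem const_isBigO_rpow {ε : ℝ} (hε1 : ε ≤ 1) (c : ℂ) :
    (fun _ : ℝ => c) =O[atTop] fun s : ℝ => s ^ (1 - ε) := by
  refine Asymptotics.IsBigO.of_bound ‖c‖ ?_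
  filter_upwards [eventually_ge_atTop 1] with s hs
  rw [Real.norm_of_nonneg (by positivity)]
  exact le_mul_of_one_le_right (norm_nonneg c) (Real.one_le_rpow hs (by linarith))

variable {N : ℕ} {η₁ η₂ μ : ℝ} {ε : ℝ} {C : ℂ}

/-- After reflection the leading coefficient is the weight of the half line `x > s`, which is
non-zero because `ξ ≠ 1`. The average grows like `|s|^{N μ}`, and `e2' + N μ` is the slope. -/
theorem cauchyU_isBigO_atBot (hμ : -1 < μ) (h : 2 * (N : ℝ) - 1 + μ < 2 * η₁) {ξ : ℂ} (hξ : ξ ≠ 1)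
    (hC : C ≠ 0) (hε : 0 < ε) (hε1 : ε ≤ 1) (hσ : 2 * (N : ℝ) - 1 + ε < 2 * η₁) :
    (fun s : ℝ => cauchyU C N η₁ η₂ μ ξ (-s) - ((N : ℂ) - η₁) ^ 2 * s) =O[atTop]
      fun s : ℝ => s ^ (1 - ε) := by
  have hb : bWt ξ μ ≠ 0 := mul_ne_zero (sub_ne_zero.mpr hξ.symm) (Complex.exp_ne_zero _)
  have hqp : (starRingEnd ℂ) (qCy N η₁ η₂) = pCy N η₁ η₂ := by
    rw [← conj_pCy, Complex.conj_conj]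
  obtain ⟨hev, hO⟩ := logD1_hdet_isBigO hμ (p := qCy N η₁ η₂) (q := pCy N η₁ η₂)
    (by rw [add_comm (qCy N η₁ η₂)]; exact exponent_lt η₂ h) hqp hb 1 hε hε1
    (by rw [add_comm (qCy N η₁ η₂), pCy_add_qCy_re]; linarith) N
  refine ((const_isBigO_rpow hε1 (η₂ * (μ - η₁) : ℂ)).sub hO).congr' ?_ EventuallyEq.rfl
  filter_upwards [hev] with s hs
  rw [cauchyU_eq_logD1 N η₂ hμ h ξ hC (s := -s) (by rwa [hdet_neg]),
    logD1_comp_neg (hdet_neg μ 1 (bWt ξ μ) (pCy N η₁ η₂) (qCy N η₁ η₂) N)]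
  push_cast
  linear_combination (s : ℂ) * e2'_add_mul N η₁ η₂ μ

theorem tendsto_cauchyU_zero_div (hμ : -1 < μ) (h : 2 * (N : ℝ) - 1 + μ < 2 * η₁) (hC : C ≠ 0)
    (hσ : 2 * (N : ℝ) - 1 < 2 * η₁) :
    Tendsto (fun t : ℝ => cauchyU C N η₁ η₂ μ 0 t / t) atBot (𝓝 (-((N : ℂ) - η₁) ^ 2)) := by
  obtain ⟨ε, hε, hε1, hε2⟩ : ∃ ε : ℝ, 0 < ε ∧ ε ≤ 1 ∧ 2 * (N : ℝ) - 1 + ε < 2 * η₁ :=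
    ⟨min 1 ((2 * η₁ - (2 * N - 1)) / 2), lt_min one_pos (by linarith), min_le_left _ _, by
      linarith [min_le_right 1 ((2 * η₁ - (2 * (N : ℝ) - 1)) / 2)]⟩
  have hO := cauchyU_isBigO_atBot (η₂ := η₂) hμ h (ξ := 0) zero_ne_one hC hε hε1 hε2
  have hinv : (fun s : ℝ => ((s : ℂ))⁻¹) =O[atTop] fun s : ℝ => s⁻¹ := by
    refine Asymptotics.IsBigO.of_bound 1 (Eventually.of_forall fun s => ?_)
    simp
  have ht : Tendsto (fun s : ℝ => (cauchyU C N η₁ η₂ μ 0 (-s) - ((N : ℂ) - η₁) ^ 2 * s) *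
      (s : ℂ)⁻¹) atTop (𝓝 0) := by
    refine (hO.mul hinv).trans_tendsto ((tendsto_rpow_neg_atTop hε).congr' ?_)
    filter_upwards [eventually_gt_atTop 0] with s hs
    rw [sub_eq_add_neg, Real.rpow_add hs, Real.rpow_one]
    field_simp
  have h2 := ((ht.add_const (((N : ℂ) - η₁) ^ 2)).neg).comp tendsto_neg_atBot_atTop
  rw [zero_add] at h2
  refine h2.congr' ?_
  filter_upwards [eventually_lt_atBot 0] with t ht
  have : (t : ℂ) ≠ 0 := by exact_mod_cast ht.ne
  simp only [Function.comp_apply, neg_neg]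
  push_cast
  field_simp
  ring

theorem cauchyU_zero_isBigO (hμ : -1 < μ) (h : 2 * (N : ℝ) - 1 + μ < 2 * η₁) (hC : C ≠ 0)
    (hσ : (N : ℝ) < η₁) :
    (fun t : ℝ => cauchyU C N η₁ η₂ μ 0 t - (((-(N - η₁) ^ 2 * t : ℝ)) : ℂ))
      =O[atBot] (fun _ : ℝ => (1 : ℝ)) := by
  -- The hypothesis `N < η₁` is what allows the rate `ε = 1`.
  have hO := cauchyU_isBigO_atBot (η₂ := η₂) hμ h (ξ := 0) zero_ne_one hC one_pos le_rfl
    (by linarith)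
  have h2 := hO.comp_tendsto tendsto_neg_atBot_atTop
  refine h2.congr (fun t => ?_) (fun t => by simp)
  simp only [Function.comp_apply, neg_neg]
  push_cast
  ring

end

section

/-! ### The edge `s → -∞` for the weight supported on a half line -/

/-- The homogeneous form `(ε - i v)^p (ε + i v)^q` of `gW`. -/
def sclW (p q : ℂ) (ε v : ℝ) : ℂ := (ε - Complex.I * v) ^ p * (ε + Complex.I * v) ^ q

theorem sub_mem_slitPlane (ε : ℝ) {v : ℝ} (hv : 0 < v) :
    (ε - Complex.I * v : ℂ) ∈ Complex.slitPlane := by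
  right; simp; exact hv.ne'

theorem add_mem_slitPlane (ε : ℝ) {v : ℝ} (hv : 0 < v) :
    (ε + Complex.I * v : ℂ) ∈ Complex.slitPlane := by
  right; simp; exact hv.ne'

theorem hasDerivAt_sclW (p q : ℂ) (ε : ℝ) {v : ℝ} (hv : 0 < v) :
    HasDerivAt (fun ε => sclW p q ε v) (p * sclW (p - 1) q ε v + q * sclW p (q - 1) ε v) ε := by
  have h1 : HasDerivAt (fun z : ℂ => z - Complex.I * v) 1 (ε : ℂ) :=
    (hasDerivAt_id (ε : ℂ)).sub_const _
  have h2 : HasDerivAt (fun z : ℂ => z + Complex.I * v) 1 (ε : ℂ) :=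
    (hasDerivAt_id (ε : ℂ)).add_const _
  refine ((h1.cpow_const (c := p) (sub_mem_slitPlane ε hv)).comp_ofReal.fun_mul
    (h2.cpow_const (c := q) (add_mem_slitPlane ε hv)).comp_ofReal).congr_deriv ?_
  simp only [sclW]
  ring

theorem norm_sub_eq (ε v : ℝ) : ‖(ε - Complex.I * v : ℂ)‖ = √(ε ^ 2 + v ^ 2) := by
  rw [Complex.norm_def, Complex.normSq_apply]; simp; ring_nf

theorem norm_add_eq (ε v : ℝ) : ‖(ε + Complex.I * v : ℂ)‖ = √(ε ^ 2 + v ^ 2) := by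
  rw [Complex.norm_def, Complex.normSq_apply]; simp; ring_nf

/-- The constant in the bound of `sclW`. -/
def sclC (p q : ℂ) : ℝ := Real.exp (Real.pi * |p.im|) * Real.exp (Real.pi * |q.im|)

/-- The bound does not involve `ε` and holds at `ε = 0`, so the point at infinity becomes a regular
point of the scaled integrals. -/
theorem norm_sclW_le {p q : ℂ} (hσ : (p + q).re ≤ 0) (ε : ℝ) {v : ℝ} (hv : 0 < v) :
    ‖sclW p q ε v‖ ≤ sclC p q * v ^ (p + q).re := by
  have h1 := norm_cpow_le_exp _ p (Complex.slitPlane_ne_zero (sub_mem_slitPlane ε hv))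
  have h2 := norm_cpow_le_exp _ q (Complex.slitPlane_ne_zero (add_mem_slitPlane ε hv))
  rw [norm_sub_eq] at h1
  rw [norm_add_eq] at h2
  have hr : v ≤ √(ε ^ 2 + v ^ 2) := Real.le_sqrt_of_sq_le (by nlinarith [sq_nonneg ε])
  have hr0 : 0 < √(ε ^ 2 + v ^ 2) := hv.trans_le hr
  rw [sclW, norm_mul]
  calc _ ≤ (√(ε ^ 2 + v ^ 2) ^ p.re * Real.exp (Real.pi * |p.im|)) *
        (√(ε ^ 2 + v ^ 2) ^ q.re * Real.exp (Real.pi * |q.im|)) := by gcongr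
    _ = sclC p q * √(ε ^ 2 + v ^ 2) ^ (p + q).re := by
      rw [Complex.add_re, Real.rpow_add hr0, sclC]; ring
    _ ≤ _ := by
      have : 0 ≤ sclC p q := by unfold sclC; positivity
      exact mul_le_mul_of_nonneg_left (Real.rpow_le_rpow_of_nonpos hv hr hσ) this

/-- The moments of the scaled weight. -/
def sclI (μ : ℝ) (m : ℕ) (p q : ℂ) (ε : ℝ) : ℂ :=
  ∫ y in Set.Ioi (0 : ℝ), ((y ^ μ : ℝ) : ℂ) * ((1 + y : ℝ) ^ m * sclW p q ε (1 + y))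

theorem measurable_sclI (μ : ℝ) (m : ℕ) (p q : ℂ) (ε : ℝ) :
    Measurable (fun y : ℝ => ((y ^ μ : ℝ) : ℂ) * (((1 + y : ℝ) : ℂ) ^ m * sclW p q ε (1 + y))) := by
  unfold sclW
  fun_prop

variable {μ : ℝ} {m : ℕ} {p q : ℂ}

theorem norm_sclI_le (hσ : (p + q).re ≤ 0) (ε : ℝ) {y : ℝ} (hy : 0 < y) :
    ‖((y ^ μ : ℝ) : ℂ) * (((1 + y : ℝ) : ℂ) ^ m * sclW p q ε (1 + y))‖ ≤
      sclC p q * (y ^ μ * (1 + y) ^ ((p + q).re + m)) := by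
  have hy1 : 0 < 1 + y := by linarith
  rw [norm_mul, norm_mul, norm_pow, Complex.norm_real, Complex.norm_real,
    Real.norm_of_nonneg (Real.rpow_nonneg hy.le _), Real.norm_of_nonneg hy1.le]
  calc _ ≤ y ^ μ * ((1 + y) ^ m * (sclC p q * (1 + y) ^ (p + q).re)) := by
        gcongr
        exact norm_sclW_le hσ ε hy1
    _ = _ := by rw [Real.rpow_add hy1, Real.rpow_natCast]; ring

theorem integrableOn_sclI (hμ : -1 < μ) (h : (p + q).re + m + μ < -1) (ε : ℝ) :
    IntegrableOn (fun y : ℝ => ((y ^ μ : ℝ) : ℂ) * (((1 + y : ℝ) : ℂ) ^ m * sclW p q ε (1 + y)))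
      (Set.Ioi 0) := by
  have hm : (0 : ℝ) ≤ m := Nat.cast_nonneg m
  refine Integrable.mono' ((integrableOn_rpow_mul_one_add_rpow hμ h).const_mul (sclC p q))
    (measurable_sclI _ _ _ _ _).aestronglyMeasurable ?_
  filter_upwards [ae_restrict_mem measurableSet_Ioi] with y hy
  exact norm_sclI_le (by linarith) ε hy

theorem hasDerivAt_sclI (hμ : -1 < μ) (h : (p + q).re + m + μ < -1) (ε : ℝ) :
    HasDerivAt (sclI μ m p q) (p * sclI μ m (p - 1) q ε + q * sclI μ m p (q - 1) ε) ε := by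
  have hm : (0 : ℝ) ≤ m := Nat.cast_nonneg m
  have e1 : (p - 1 + q).re = (p + q).re - 1 := by simp; ring
  have e2 : (p + (q - 1)).re = (p + q).re - 1 := by simp; ring
  have i1 := integrableOn_sclI hμ (m := m) (p := p - 1) (q := q) (by rw [e1]; linarith) ε
  have i2 := integrableOn_sclI hμ (m := m) (p := p) (q := q - 1) (by rw [e2]; linarith) ε
  have key := hasDerivAt_integral_of_dominated_loc_of_deriv_le (μ := volume.restrict (Set.Ioi 0))
    (F := fun ε (y : ℝ) => ((y ^ μ : ℝ) : ℂ) * (((1 + y : ℝ) : ℂ) ^ m * sclW p q ε (1 + y)))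
    (F' := fun ε (y : ℝ) =>
      p * (((y ^ μ : ℝ) : ℂ) * (((1 + y : ℝ) : ℂ) ^ m * sclW (p - 1) q ε (1 + y))) +
      q * (((y ^ μ : ℝ) : ℂ) * (((1 + y : ℝ) : ℂ) ^ m * sclW p (q - 1) ε (1 + y))))
    (bound := fun y => (‖p‖ * sclC (p - 1) q + ‖q‖ * sclC p (q - 1)) *
      (y ^ μ * (1 + y) ^ ((p + q).re - 1 + m))) (x₀ := ε) (s := Set.univ)
    Filter.univ_mem
    (Eventually.of_forall fun ε => (measurable_sclI _ _ _ _ _).aestronglyMeasurable)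
    (integrableOn_sclI hμ h ε)
    ((((measurable_sclI _ _ _ _ _).const_mul p).add
      ((measurable_sclI _ _ _ _ _).const_mul q)).aestronglyMeasurable) ?_
    ((integrableOn_rpow_mul_one_add_rpow hμ (by linarith)).const_mul _) ?_
  · refine key.2.congr_deriv ?_
    rw [integral_add (i1.const_mul p) (i2.const_mul q), integral_const_mul, integral_const_mul,
      sclI, sclI]
  · filter_upwards [ae_restrict_mem measurableSet_Ioi] with y hy x _
    have b1 := norm_sclI_le (μ := μ) (m := m) (p := p - 1) (q := q) (by rw [e1]; linarith) x hy
    have b2 := norm_sclI_le (μ := μ) (m := m) (p := p) (q := q - 1) (by rw [e2]; linarith) x hy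
    rw [e1] at b1
    rw [e2] at b2
    refine (norm_add_le _ _).trans ?_
    rw [norm_mul p, norm_mul q, add_mul, mul_assoc, mul_assoc]
    gcongr
  · filter_upwards [ae_restrict_mem measurableSet_Ioi] with y hy x _
    have hy1 : 0 < 1 + y := add_pos one_pos hy
    refine (((hasDerivAt_sclW p q x hy1).const_mul _).const_mul _).congr_deriv ?_
    ring

theorem contDiff_sclI (hμ : -1 < μ) (h : (p + q).re + m + μ < -1) (n : ℕ) :
    ContDiff ℝ n (sclI μ m p q) := by
  induction n generalizing p q with
  | zero =>
    exact contDiff_zero.mpr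
      (continuous_iff_continuousAt.mpr fun s => (hasDerivAt_sclI hμ h s).continuousAt)
  | succ n ih =>
    have hd : deriv (sclI μ m p q) = fun s => p * sclI μ m (p - 1) q s + q * sclI μ m p (q - 1) s :=
      funext fun s => (hasDerivAt_sclI hμ h s).deriv
    push_cast
    rw [contDiff_succ_iff_deriv]
    refine ⟨fun s => (hasDerivAt_sclI hμ h s).differentiableAt, by simp, ?_⟩
    rw [hd]
    refine (contDiff_const.mul (ih ?_)).add (contDiff_const.mul (ih ?_))
    · simp at h ⊢; linarith
    · simp at h ⊢; linarith

theorem gW_scale (p q : ℂ) {t : ℝ} (ht : 0 < t) (v : ℝ) :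
    gW p q (-(t * v)) = (t : ℂ) ^ (p + q) * sclW p q t⁻¹ v := by
  have ht' : (t : ℂ) ≠ 0 := by exact_mod_cast ht.ne'
  have e1 : (1 + Complex.I * ((-(t * v) : ℝ) : ℂ)) = (t : ℂ) * ((t⁻¹ : ℝ) - Complex.I * v) := by
    push_cast; field_simp; ring
  have e2 : (1 - Complex.I * ((-(t * v) : ℝ) : ℂ)) = (t : ℂ) * ((t⁻¹ : ℝ) + Complex.I * v) := by
    push_cast; field_simp; ring
  have harg : ∀ z : ℂ, ∀ r : ℂ, ((t : ℂ) * z) ^ r = (t : ℂ) ^ r * z ^ r := by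
    intro z r
    rcases eq_or_ne z 0 with rfl | hz
    · rcases eq_or_ne r 0 with rfl | hr
      · simp
      · simp [Complex.zero_cpow hr]
    rw [Complex.cpow_def_of_ne_zero (mul_ne_zero ht' hz), Complex.cpow_def_of_ne_zero ht',
      Complex.cpow_def_of_ne_zero hz, Complex.log_ofReal_mul ht hz, ← Complex.exp_add,
      Complex.ofReal_log ht.le, add_mul]
  rw [gW, e1, e2, harg, harg, sclW, Complex.cpow_add _ _ ht']
  ring

/-- The substitution `x = -t (1 + y)`: all integration points are at distance at least `t` from the
origin, and by homogeneity the remaining integral depends only on `ε = 1/t`. -/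
theorem integral_kap_edge {t : ℝ} (ht : 0 < t) :
    ∫ x : ℝ, kap μ 1 0 (x - (-t)) * ((x : ℂ) ^ m * gW p q x) =
      (t : ℂ) ^ (p + q + (1 + μ)) * ((-t : ℂ) ^ m * sclI μ m p q t⁻¹) := by
  have ht' : (t : ℂ) ≠ 0 := by exact_mod_cast ht.ne'
  set F : ℝ → ℂ := fun x => kap μ 1 0 (x - (-t)) * ((x : ℂ) ^ m * gW p q x) with hF
  have e1 := Measure.integral_comp_mul_left F (-t)
  have e2 : ∀ u : ℝ, F (-t * u) = (t : ℂ) ^ (p + q + μ) * (-t : ℂ) ^ m *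
      (kap μ 1 0 (1 - u) * ((u : ℂ) ^ m * sclW p q t⁻¹ u)) := by
    intro u
    simp only [hF]
    rw [show -t * u - -t = t * (1 - u) by ring, kap_mul_left μ 1 0 ht, neg_mul, gW_scale p q ht,
      show (t : ℂ) ^ (p + q + μ) = (t : ℂ) ^ (p + q) * (t : ℂ) ^ (μ : ℂ) from
        Complex.cpow_add _ _ ht', Complex.ofReal_cpow ht.le]
    push_cast
    rw [← neg_mul, mul_pow]
    ring
  have e3 : ∫ u : ℝ, kap μ 1 0 (1 - u) * ((u : ℂ) ^ m * sclW p q t⁻¹ u) = sclI μ m p q t⁻¹ := by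
    rw [← integral_add_left_eq_self _ (1 : ℝ), sclI, ← integral_Ici_eq_integral_Ioi,
      ← integral_indicator measurableSet_Ici]
    congr 1
    funext y
    rw [show (1 : ℝ) - (1 + y) = -y by ring, kap]
    by_cases hy : 0 ≤ y
    · rw [if_pos (by linarith), Set.indicator_of_mem (Set.mem_Ici.mpr hy), neg_neg, one_mul]
    · rw [if_neg (by linarith), Set.indicator_of_notMem (by simpa using hy)]
      simp
  simp only [e2, integral_const_mul, e3] at e1
  rw [abs_inv, abs_neg, abs_of_pos ht] at e1
  have e4 : (t : ℂ) ^ (p + q + (1 + μ)) = (t : ℂ) * (t : ℂ) ^ (p + q + μ) := by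
    rw [show p + q + (1 + (μ : ℂ)) = p + q + μ + 1 by ring, Complex.cpow_add _ _ ht', Complex.cpow_one]
    ring
  have e5 : ∫ x, F x = (t : ℂ) * (t⁻¹ • ∫ x, F x) := by
    rw [Complex.real_smul]
    push_cast
    rw [← mul_assoc, mul_inv_cancel₀ ht', one_mul]
  rw [e5, ← e1, e4]
  ring

end

/-! ### Moment determinants of the scaled weight. -/

section

variable {μ : ℝ} {p q : ℂ}

/-- Since `x = ((1 + i x) - (1 - i x))/(2 i)`, each power of `x` is traded for one unit in an
exponent. -/
theorem integrable_kap_pow_gW (hμ : -1 < μ) (a b : ℂ) (s : ℝ) {m : ℕ}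
    (h : (p + q).re + m + μ < -1) :
    Integrable (fun x : ℝ => kap μ a b (x - s) * ((x : ℂ) ^ m * gW p q x)) := by
  induction m generalizing p q with
  | zero => simpa using (kap_mul_gW μ a b hμ (by simpa using h) s).1
  | succ m ih =>
    push_cast at h
    have e : (fun x : ℝ => kap μ a b (x - s) * ((x : ℂ) ^ (m + 1) * gW p q x)) = fun x : ℝ =>
        (1 / (2 * Complex.I)) * (kap μ a b (x - s) * ((x : ℂ) ^ m * gW (p + 1) q x) -
          kap μ a b (x - s) * ((x : ℂ) ^ m * gW p (q + 1) x)) := by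
      funext x
      rw [gW_add_left, gW_add_right]
      field_simp
      ring
    rw [e]
    refine ((ih ?_).sub (ih ?_)).const_mul _
    · simp at h ⊢; linarith
    · simp at h ⊢; linarith

/-- The determinant of the moments of the scaled weight. -/
def sclDet (μ : ℝ) (p q : ℂ) (n : ℕ) (ε : ℝ) : ℂ :=
  (Matrix.of fun j k : Fin n => sclI μ ((j : ℕ) + k) p q ε).det

theorem add_le_of_fin {n : ℕ} (j k : Fin n) : (((j : ℕ) + k : ℕ) : ℝ) ≤ 2 * n - 2 := by
  have : (j : ℕ) + k + 2 ≤ 2 * n := by omega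
  have : (((j : ℕ) + k + 2 : ℕ) : ℝ) ≤ ((2 * n : ℕ) : ℝ) := by exact_mod_cast this
  push_cast at this ⊢
  linarith

theorem contDiff_sclDet (hμ : -1 < μ) {n : ℕ} (h : (p + q).re + (2 * n - 2) + μ < -1) (r : ℕ) :
    ContDiff ℝ r (sclDet μ p q n) := by
  unfold sclDet
  simp only [Matrix.det_apply', Matrix.of_apply]
  refine ContDiff.sum fun σ _ => contDiff_const.mul (contDiff_prod fun i _ => ?_)
  exact contDiff_sclI hμ (by linarith [add_le_of_fin (σ i) i]) r

theorem sclW_zero (hpq : (starRingEnd ℂ) p = q) {v : ℝ} (hv : 0 < v) :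
    sclW p q 0 v = ((‖(Complex.I * v : ℂ) ^ q‖ ^ 2 : ℝ) : ℂ) := by
  have h1 : (-(Complex.I * v) : ℂ) ^ p = (starRingEnd ℂ) ((Complex.I * v : ℂ) ^ q) := by
    rw [← hpq, show (-(Complex.I * v) : ℂ) = (starRingEnd ℂ) (Complex.I * v) by simp,
      Complex.conj_cpow_eq_ite, if_neg]
    · have := add_mem_slitPlane 0 hv
      rw [Complex.ofReal_zero, zero_add] at this
      exact Complex.slitPlane_arg_ne_pi this
  rw [sclW, Complex.ofReal_zero, zero_sub, zero_add, h1, mul_comm, Complex.mul_conj']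
  push_cast
  rfl

/-- At `ε = 0` the weight is positive, and the determinant is the Gram determinant of the
polynomials `(1 + y)^j`. -/
theorem sclDet_zero_ne_zero (hμ : -1 < μ) {n : ℕ} (h : (p + q).re + (2 * n - 2) + μ < -1)
    (hpq : (starRingEnd ℂ) p = q) : sclDet μ p q n 0 ≠ 0 := by
  set w : ℝ → ℝ := (Set.Ioi (0 : ℝ)).indicator
    fun y => y ^ μ * ‖(Complex.I * (1 + y : ℝ) : ℂ) ^ q‖ ^ 2 with hw
  set φ : Fin n → ℝ → ℂ := fun j y => ((1 + y : ℝ) : ℂ) ^ (j : ℕ) with hφ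
  have e : ∀ j k : Fin n, (fun y => (w y : ℂ) * (φ j y * (starRingEnd ℂ) (φ k y))) =
      (Set.Ioi (0 : ℝ)).indicator fun y => ((y ^ μ : ℝ) : ℂ) *
        (((1 + y : ℝ) : ℂ) ^ ((j : ℕ) + k) * sclW p q 0 (1 + y)) := by
    intro j k
    funext y
    by_cases hy : y ∈ Set.Ioi (0 : ℝ)
    · have hy1 : 0 < 1 + y := add_pos one_pos hy
      rw [hw, Set.indicator_of_mem hy, Set.indicator_of_mem hy, sclW_zero hpq hy1, hφ]
      simp only [map_pow, Complex.conj_ofReal]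
      push_cast
      ring
    · rw [hw, Set.indicator_of_notMem hy, Set.indicator_of_notMem hy]
      simp
  have key := det_gram_ne_zero φ w (Set.Ioi 0) (by simp)
    (fun y => Set.indicator_nonneg (fun y hy => by
      have := Real.rpow_nonneg (le_of_lt hy) μ
      positivity) y)
    (fun y hy => by
      rw [hw, Set.indicator_of_mem hy]
      have hy0 : (0 : ℝ) < y := hy
      have hy1 : (Complex.I * (1 + y : ℝ) : ℂ) ≠ 0 :=
        mul_ne_zero Complex.I_ne_zero (by exact_mod_cast (add_pos one_pos hy0).ne')
      have : (Complex.I * (1 + y : ℝ) : ℂ) ^ q ≠ 0 := by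
        rw [Complex.cpow_def_of_ne_zero hy1]; exact Complex.exp_ne_zero _
      have := norm_pos_iff.mpr this
      have := Real.rpow_pos_of_pos hy0 μ
      positivity)
    (fun j k => by
      rw [e]
      exact (integrableOn_sclI hμ (by linarith [add_le_of_fin j k]) 0).integrable_indicator
        measurableSet_Ioi)
    (fun y hy => by
      have : (Matrix.of fun l j => φ j (y l)) = Matrix.vandermonde fun l => ((1 + y l : ℝ) : ℂ) := by
        ext l j; simp [hφ, Matrix.vandermonde]
      rw [this, Matrix.det_vandermonde_ne_zero_iff]
      intro a b hab
      apply hy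
      simpa using hab)
  simp only [e, integral_indicator measurableSet_Ioi] at key
  exact key

theorem integral_prod_mul_vandermonde_sq_moments (n : ℕ) (k : ℝ → ℂ)
    (h : ∀ i j : Fin n, Integrable fun x : ℝ => k x * (x : ℂ) ^ ((i : ℕ) + j)) :
    ∫ x : Fin n → ℝ, (∏ l, k (x l)) * ∏ i, ∏ j ∈ Finset.Ioi i, ((x j - x i : ℝ) : ℂ) ^ 2 =
      n.factorial * (Matrix.of fun i j : Fin n => ∫ x : ℝ, k x * (x : ℂ) ^ ((i : ℕ) + j)).det := by
  have e : ∀ i j : Fin n, (fun x : ℝ => (k x * (x : ℂ) ^ (i : ℕ)) * (x : ℂ) ^ (j : ℕ)) =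
      fun x : ℝ => k x * (x : ℂ) ^ ((i : ℕ) + j) := fun i j => by funext x; ring
  have key := (integral_det_mul_det (volume : Measure ℝ) (n := n)
    (fun i x => k x * (x : ℂ) ^ (i : ℕ)) (fun j x => (x : ℂ) ^ (j : ℕ))
    (fun i j => by rw [e]; exact h i j)).2
  simp only [e] at key
  rw [← key, ← volume_pi]
  congr 1
  funext x
  have h1 := Matrix.det_mul_column (fun l => k (x l)) (Matrix.vandermonde fun l => (x l : ℂ))
  have h2 : (Matrix.of fun l i : Fin n => k (x l) * (x l : ℂ) ^ (i : ℕ)) =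
      Matrix.of fun i j : Fin n => k (x i) * Matrix.vandermonde (fun l => (x l : ℂ)) i j := by
    ext l i; simp [Matrix.vandermonde]
  have h3 : (Matrix.of fun l i : Fin n => (x l : ℂ) ^ (i : ℕ)) =
      Matrix.vandermonde fun l => (x l : ℂ) := by
    ext l i; simp [Matrix.vandermonde]
  rw [h2, h1, h3, Matrix.det_vandermonde, mul_assoc, ← sq, ← Finset.prod_pow]
  simp only [← Finset.prod_pow, Complex.ofReal_sub]

theorem bWt_one (μ : ℝ) : bWt 1 μ = 0 := by simp [bWt]

variable {N : ℕ} {η₁ : ℝ}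

theorem pCy_sub_add_qCy_sub (N : ℕ) (η₁ η₂ : ℝ) :
    pCy N η₁ η₂ - (N - 1) + (qCy N η₁ η₂ - (N - 1)) = ((-(2 * η₁) : ℝ) : ℂ) := by
  simp only [pCy, qCy]; push_cast; ring

theorem conj_pCy_sub (N : ℕ) (η₁ η₂ : ℝ) :
    (starRingEnd ℂ) (pCy N η₁ η₂ - (N - 1)) = qCy N η₁ η₂ - (N - 1) := by
  rw [map_sub, conj_pCy]; simp

theorem edge_exponent (η₂ : ℝ) (h : 2 * (N : ℝ) - 1 + μ < 2 * η₁) :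
    (pCy N η₁ η₂ - (N - 1) + (qCy N η₁ η₂ - (N - 1))).re + (2 * N - 2) + μ < -1 := by
  rw [pCy_sub_add_qCy_sub, Complex.ofReal_re]; linarith

/-- Ordinary moments are used here because they scale by pure powers. The `N` one-particle factors
give `t^{N (1 + μ - 2 η₁)}`, the squared Vandermonde determinant gives `t^{N (N - 1)}`, and the rest
is a smooth function of `1/t`. -/
theorem cauchyE_one_neg (η₂ : ℝ) (hμ : -1 < μ) (h : 2 * (N : ℝ) - 1 + μ < 2 * η₁) (C : ℂ) :
    ∃ c : ℂ, ∀ t : ℝ, 0 < t → cauchyE C N η₁ η₂ μ 1 (-t) = c *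
      ((t : ℂ) ^ (N * (N + μ - 2 * η₁) : ℂ) *
        sclDet μ (pCy N η₁ η₂ - (N - 1)) (qCy N η₁ η₂ - (N - 1)) N t⁻¹) := by
  refine ⟨1 / C * N.factorial * ((∏ i : Fin N, (-1 : ℂ) ^ (i : ℕ)) ^ 2), fun t ht => ?_⟩
  have ht' : (t : ℂ) ≠ 0 := by exact_mod_cast ht.ne'
  set p := pCy N η₁ η₂ - (N - 1) with hp
  set q := qCy N η₁ η₂ - (N - 1) with hq
  have hpq : p + q = ((-(2 * η₁) : ℝ) : ℂ) := pCy_sub_add_qCy_sub N η₁ η₂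
  have hlt := edge_exponent η₂ h
  have e1 : ∀ m : ℕ, (fun x : ℝ => kap μ 1 0 (x - (-t)) * gW p q x * (x : ℂ) ^ m) =
      fun x : ℝ => kap μ 1 0 (x - (-t)) * ((x : ℂ) ^ m * gW p q x) := fun m => by
    funext x; ring
  have key := integral_prod_mul_vandermonde_sq_moments N (fun x => kap μ 1 0 (x - (-t)) * gW p q x)
    (fun i j => by
      rw [e1]
      exact integrable_kap_pow_gW hμ 1 0 _ (by linarith [add_le_of_fin i j]))
  simp only [e1, integral_kap_edge ht] at key
  have e2 : (Matrix.of fun i j : Fin N => (t : ℂ) ^ (p + q + (1 + μ)) *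
      ((-t : ℂ) ^ ((i : ℕ) + j) * sclI μ ((i : ℕ) + j) p q t⁻¹)) =
      (t : ℂ) ^ (p + q + (1 + μ)) • Matrix.of fun i j : Fin N => (-t : ℂ) ^ (i : ℕ) *
      (Matrix.of fun i j : Fin N => (-t : ℂ) ^ (j : ℕ) *
        (Matrix.of fun i j : Fin N => sclI μ ((i : ℕ) + j) p q t⁻¹) i j) i j := by
    ext i j
    simp only [Matrix.of_apply, Matrix.smul_apply, smul_eq_mul]
    ring
  have e3 : ∏ i : Fin N, (-t : ℂ) ^ (i : ℕ) = (∏ i : Fin N, (-1 : ℂ) ^ (i : ℕ)) *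
      ∏ i : Fin N, (t : ℂ) ^ (i : ℕ) := by
    rw [← Finset.prod_mul_distrib]
    refine Finset.prod_congr rfl fun i _ => ?_
    rw [← mul_pow, neg_one_mul]
  have e4 : (∏ i : Fin N, (t : ℂ) ^ (i : ℕ)) ^ 2 = (t : ℂ) ^ (N * (N - 1) : ℂ) := by
    rw [Finset.prod_pow_eq_pow_sum, ← pow_mul, Fin.sum_univ_eq_sum_range (fun i => i) N,
      Finset.sum_range_id_mul_two]
    rcases N with _ | n
    · simp
    · rw [← Complex.cpow_natCast]
      push_cast
      simp
  rw [e2, Matrix.det_smul, Matrix.det_mul_column, Matrix.det_mul_row, Fintype.card_fin, e3] at key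
  rw [cauchyE]
  simp only [cauchyIntegrand_eq, bWt_one]
  have e5 : (t : ℂ) ^ (N * (N + μ - 2 * η₁) : ℂ) =
      ((t : ℂ) ^ (p + q + (1 + μ))) ^ N * (∏ i : Fin N, (t : ℂ) ^ (i : ℕ)) ^ 2 := by
    rw [e4, ← Complex.cpow_mul_nat, ← Complex.cpow_add _ _ ht', hpq]
    congr 1
    push_cast
    ring
  rw [key, e5, sclDet]
  ring

end

section

/-! ### The boundary condition at `s → -∞` for `ξ = 1` -/

theorem tendsto_neg_inv_atBot : Tendsto (fun t : ℝ => -t⁻¹) atBot (𝓝 0) := by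
  simpa using (tendsto_inv_atBot_zero (𝕜 := ℝ)).neg

theorem hasDerivAt_neg_inv {t : ℝ} (ht : t ≠ 0) : HasDerivAt (fun t : ℝ => -t⁻¹) (t⁻¹ ^ 2) t :=
  (hasDerivAt_inv ht).fun_neg.congr_deriv (by simp)

/-- The limit of the `σ`-form along a solution `A t + ρ(-1/t)` with `ρ` twice continuously
differentiable at `0`. -/
theorem sigmaForm_limit {U ρ : ℝ → ℂ} {A : ℂ} {b : Fin 4 → ℂ} (hρ : ContDiffAt ℝ 2 ρ 0)
    (hU : ∀ᶠ t : ℝ in atBot, U t = A * t + ρ (-t⁻¹)) {S : Set ℝ} (hS : ∀ᶠ t : ℝ in atBot, t ∈ S)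
    (hσ : SatisfiesSigmaForm b U S) :
    (A * ρ 0 - Complex.I * (b 0 * b 1 * b 2 * b 3)) ^ 2 + ∏ k, (A + b k ^ 2) = 0 := by
  obtain ⟨u, hu, hρu⟩ := hρ.contDiffOn (m := 2) le_rfl (by simp)
  obtain ⟨v, hvu, hvo, h0v⟩ := mem_nhds_iff.mp hu
  have hv := hρu.mono hvu
  have hd1 : ∀ x ∈ v, HasDerivAt ρ (deriv ρ x) x := fun x hx =>
    ((hv.differentiableOn (by norm_num)).differentiableAt (hvo.mem_nhds hx)).hasDerivAt
  have hv1 : ContDiffOn ℝ 1 (deriv ρ) v := hv.deriv_of_isOpen hvo (by norm_num)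
  have hd2 : ∀ x ∈ v, HasDerivAt (deriv ρ) (deriv (deriv ρ) x) x := fun x hx =>
    ((hv1.differentiableOn (by norm_num)).differentiableAt (hvo.mem_nhds hx)).hasDerivAt
  have hc2 : ContinuousAt (deriv (deriv ρ)) 0 :=
    (hv1.continuousOn_deriv_of_isOpen hvo le_rfl).continuousAt (hvo.mem_nhds h0v)
  have hE : ∀ᶠ t : ℝ in atBot, U t = A * t + ρ (-t⁻¹) ∧ -t⁻¹ ∈ v ∧ t < 0 :=
    hU.and ((tendsto_neg_inv_atBot.eventually (hvo.mem_nhds h0v)).and (eventually_lt_atBot 0))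
  obtain ⟨T, hT⟩ := eventually_atBot.mp hE
  have hnear : ∀ t < T, ∀ᶠ r in 𝓝 t, r < T := fun t ht => isOpen_Iio.mem_nhds ht
  have g1 : ∀ t < T, HasDerivAt U (A + deriv ρ (-t⁻¹) * (t⁻¹ : ℝ) ^ 2) t := by
    intro t ht
    obtain ⟨_, h2, h3⟩ := hT t ht.le
    have hc := (hd1 _ h2).scomp t (hasDerivAt_neg_inv h3.ne)
    refine ((((hasDerivAt_ofReal t).const_mul A).add hc).congr_of_eventuallyEq ?_).congr_deriv ?_
    · filter_upwards [hnear t ht] with r hr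
      simpa using (hT r hr.le).1
    · rw [Complex.real_smul]; push_cast; ring
  have g2 : ∀ t < T, deriv (deriv U) t = deriv (deriv ρ) (-t⁻¹) * (t⁻¹ : ℝ) ^ 4 -
      2 * deriv ρ (-t⁻¹) * (t⁻¹ : ℝ) ^ 3 := by
    intro t ht
    obtain ⟨_, h2, h3⟩ := hT t ht.le
    have hc := (hd2 _ h2).scomp t (hasDerivAt_neg_inv h3.ne)
    have hi := ((hasDerivAt_inv h3.ne).ofReal_comp).fun_pow 2
    refine HasDerivAt.deriv ((((hc.mul hi).const_add A).congr_of_eventuallyEq ?_).congr_deriv ?_)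
    · filter_upwards [hnear t ht] with r hr
      exact (g1 r hr).deriv
    · simp only [Complex.real_smul, Function.comp_apply]
      push_cast
      ring
  have hinv : Tendsto (fun t : ℝ => ((t⁻¹ : ℝ) : ℂ)) atBot (𝓝 0) := by
    have := (Complex.continuous_ofReal.tendsto 0).comp (tendsto_inv_atBot_zero (𝕜 := ℝ))
    rwa [Complex.ofReal_zero] at this
  have l0 := (hd1 0 h0v).continuousAt.tendsto.comp tendsto_neg_inv_atBot
  have l1 := (hd2 0 h0v).continuousAt.tendsto.comp tendsto_neg_inv_atBot
  have l2 := hc2.tendsto.comp tendsto_neg_inv_atBot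
  -- The three ingredients of the `σ`-form converge: `U' → A`, `(1 + t²) U'' → 0` and `U - t U' → ρ
  -- 0`.
  have m1 : Tendsto (deriv U) atBot (𝓝 A) := by
    have := (l1.mul (hinv.pow 2)).const_add A
    simp only [ne_eq, OfNat.ofNat_ne_zero, not_false_eq_true, zero_pow, mul_zero, add_zero] at this
    refine this.congr' ?_
    filter_upwards [eventually_lt_atBot T] with t ht
    rw [(g1 t ht).deriv]
    rfl
  have m2 : Tendsto (fun t : ℝ => (1 + (t : ℂ) ^ 2) * deriv (deriv U) t) atBot (𝓝 0) := by
    have := (((l2.mul (hinv.pow 4)).sub ((l1.const_mul 2).mul (hinv.pow 3))).add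
      ((l2.mul (hinv.pow 2)).sub ((l1.const_mul 2).mul hinv)))
    simp only [ne_eq, OfNat.ofNat_ne_zero, not_false_eq_true, zero_pow, mul_zero, add_zero,
      sub_zero] at this
    refine this.congr' ?_
    filter_upwards [eventually_lt_atBot T] with t ht
    have h3 : (t : ℂ) ≠ 0 := by exact_mod_cast (hT t ht.le).2.2.ne
    rw [g2 t ht]
    simp only [Function.comp_apply]
    push_cast
    field_simp
  have m3 : Tendsto (fun t : ℝ => U t - t * deriv U t) atBot (𝓝 (ρ 0)) := by
    have := l0.sub (l1.mul hinv)
    rw [mul_zero, sub_zero] at this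
    refine this.congr' ?_
    filter_upwards [eventually_lt_atBot T] with t ht
    have h3 : (t : ℂ) ≠ 0 := by exact_mod_cast (hT t ht.le).2.2.ne
    rw [(g1 t ht).deriv, (hT t ht.le).1]
    simp only [Function.comp_apply]
    push_cast
    field_simp
    ring
  have hlim := ((m1.mul (m2.pow 2)).add ((((m1.mul m3).sub_const
    (Complex.I * (b 0 * b 1 * b 2 * b 3))).pow 2).const_mul 4)).add
    ((tendsto_finsetProd Finset.univ fun k _ => m1.add_const (b k ^ 2)).const_mul 4)
  have h0 := tendsto_nhds_unique (hlim.congr' (f₂ := fun _ => 0) (by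
    filter_upwards [hS] with t ht
    exact (hσ t ht).2.2)) tendsto_const_nhds
  linear_combination h0 / 4

variable {N : ℕ} {η₁ μ : ℝ} {C : ℂ}

theorem cauchyU_eq_logD1_cauchyE (η₂ : ℝ) (hμ : -1 < μ)
    (h : 2 * (N : ℝ) - 1 + μ < 2 * η₁) (ξ : ℂ) (hC : C ≠ 0) {s : ℝ}
    (hs : cauchyE C N η₁ η₂ μ ξ s ≠ 0) :
    cauchyU C N η₁ η₂ μ ξ s = logD1 (cauchyE C N η₁ η₂ μ ξ) s +
      e2' (bCy N η₁ η₂ μ) * s + η₂ * (μ - η₁) := by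
  have e : cauchyE C N η₁ η₂ μ ξ = _ := funext (cauchyE_eq_hdet N η₂ hμ h ξ C).2
  have hk : (1 / C * (N.factorial / pairConst N) : ℂ) ≠ 0 :=
    mul_ne_zero (one_div_ne_zero hC) (div_ne_zero (Nat.cast_ne_zero.mpr N.factorial_ne_zero)
      (pairConst_ne_zero N))
  simp only [← mul_assoc] at e
  rw [e] at hs
  rw [cauchyU_eq_logD1 N η₂ hμ h ξ hC (right_ne_zero_of_mul hs), e, logD1_const_mul hk]

theorem cauchyE_one_ne_zero (η₂ : ℝ) (hμ : -1 < μ)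
    (h : 2 * (N : ℝ) - 1 + μ < 2 * η₁) (hC : C ≠ 0) (s : ℝ) : cauchyE C N η₁ η₂ μ 1 s ≠ 0 := by
  rw [(cauchyE_eq_hdet N η₂ hμ h 1 C).2, bWt_one]
  refine mul_ne_zero (one_div_ne_zero hC) (mul_ne_zero (div_ne_zero
    (Nat.cast_ne_zero.mpr N.factorial_ne_zero) (pairConst_ne_zero N)) ?_)
  have := hdet_ne_zero hμ (exponent_lt η₂ h) (conj_pCy N η₁ η₂) (a := 1) (b := 0) zero_le_one le_rfl
    (Or.inl one_pos) N s
  simpa using this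

/-- The expansion of `U` at `-∞` for `ξ = 1`, without its constant term. -/
theorem cauchyU_one_expansion (η₂ : ℝ) (hμ : -1 < μ)
    (h : 2 * (N : ℝ) - 1 + μ < 2 * η₁) (hC : C ≠ 0) :
    ∃ ρ : ℝ → ℂ, ContDiffAt ℝ 2 ρ 0 ∧ ∀ᶠ t : ℝ in atBot,
      cauchyU C N η₁ η₂ μ 1 t = -(η₁ : ℂ) ^ 2 * t + ρ (-t⁻¹) := by
  obtain ⟨c, hc⟩ := cauchyE_one_neg (N := N) (η₁ := η₁) η₂ hμ h C
  set Γ := sclDet μ (pCy N η₁ η₂ - (N - 1)) (qCy N η₁ η₂ - (N - 1)) N with hΓ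
  have hs : ∀ n : ℕ, ContDiff ℝ n Γ := contDiff_sclDet hμ (edge_exponent η₂ h)
  set ν : ℂ := N * (N + μ - 2 * η₁) with hν
  -- With `ε = -1/t`, the logarithmic derivative of `(-t)^ν Γ(ε)` times `1 + t²` is `ν t - ν ε + (1
  -- + ε²) Γ'/Γ`. The term `ν t` joins `e2' t` to give `-η₁² t`.
  refine ⟨fun ε => -ν * ε + (1 + (ε : ℂ) ^ 2) * (deriv Γ ε / Γ ε) + η₂ * (μ - η₁), ?_, ?_⟩
  · have h1 : ContDiff ℝ 2 (deriv Γ) := by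
      have := hs 3
      push_cast at this
      exact ((contDiff_succ_iff_deriv (n := 2)).mp (by norm_num at this ⊢; exact this)).2.2
    have h0 : Γ 0 ≠ 0 := sclDet_zero_ne_zero hμ (edge_exponent η₂ h) (conj_pCy_sub N η₁ η₂)
    have hof : ContDiff ℝ 2 (fun ε : ℝ => (ε : ℂ)) := Complex.ofRealCLM.contDiff
    have hq : ContDiffAt ℝ 2 (fun ε => deriv Γ ε / Γ ε) 0 := by
      simp only [div_eq_mul_inv]
      exact h1.contDiffAt.mul ((hs 2).contDiffAt.inv h0)
    exact ((contDiff_const.mul hof).contDiffAt.add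
      ((contDiff_const.add (hof.pow 2)).contDiffAt.mul hq)).add contDiffAt_const
  · filter_upwards [eventually_lt_atBot 0] with t ht
    have htc : (t : ℂ) ≠ 0 := by exact_mod_cast ht.ne
    have hE := cauchyE_one_ne_zero η₂ hμ h hC t
    have hE' := hc (-t) (neg_pos.mpr ht)
    rw [neg_neg] at hE'
    have hne := hE
    rw [hE'] at hne
    have hc0 := left_ne_zero_of_mul hne
    have hp0 := left_ne_zero_of_mul (right_ne_zero_of_mul hne)
    have hΓ0 := right_ne_zero_of_mul (right_ne_zero_of_mul hne)
    have hsl : ((-t : ℝ) : ℂ) ∈ Complex.slitPlane := by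
      rw [Complex.ofReal_mem_slitPlane]; linarith
    have d1 : HasDerivAt (fun r : ℝ => ((-r : ℝ) : ℂ) ^ ν) (ν * ((-t : ℝ) : ℂ) ^ (ν - 1) * -1) t := by
      push_cast at hsl ⊢
      exact ((hasDerivAt_neg (t : ℂ)).cpow_const hsl).comp_ofReal
    have d2 : HasDerivAt (fun r : ℝ => Γ (-r)⁻¹) (t⁻¹ ^ 2 * deriv Γ (-t)⁻¹) t := by
      have h1 : HasDerivAt (fun r : ℝ => (-r)⁻¹) (t⁻¹ ^ 2) t := by
        simpa [inv_neg] using hasDerivAt_neg_inv ht.ne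
      have h2 := (((hs 1).differentiable (by simp)) (-t)⁻¹).hasDerivAt.scomp t h1
      refine h2.congr_deriv ?_
      rw [Complex.real_smul]; push_cast; ring
    have d3 : HasDerivAt (cauchyE C N η₁ η₂ μ 1) _ t :=
      ((d1.mul d2).const_mul c).congr_of_eventuallyEq (by
        filter_upwards [isOpen_Iio.mem_nhds ht] with r hr
        have := hc (-r) (neg_pos.mpr hr)
        rwa [neg_neg] at this)
    rw [cauchyU_eq_logD1_cauchyE η₂ hμ h 1 hC hE, logD1, opD, d3.deriv, hE',
      ← inv_neg, Complex.cpow_sub _ _ (Complex.slitPlane_ne_zero hsl), Complex.cpow_one]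
    have hk := e2'_add_mul_one N η₁ η₂ μ
    rw [← hν] at hk
    have hk' : e2' (bCy N η₁ η₂ μ) = -(η₁ : ℂ) ^ 2 - ν := by linear_combination hk
    rw [hk']
    generalize deriv Γ (-t)⁻¹ = G'
    generalize Γ (-t)⁻¹ = G at hΓ0 ⊢
    push_cast at hp0 ⊢
    field_simp
    ring

theorem cauchyU_one_isBigO {η₂ : ℝ} (hN : 1 ≤ N) (hμ : -1 < μ)
    (h : 2 * (N : ℝ) - 1 + μ < 2 * η₁) (hC : C ≠ 0) :
    (fun t : ℝ => cauchyU C N η₁ η₂ μ 1 t -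
          (((-η₁ ^ 2 * t - η₂ * (N - η₁) * (N + μ - η₁) / η₁ : ℝ)) : ℂ))
        =O[Filter.atBot] (fun t : ℝ => 1 / t) := by
  obtain ⟨ρ, hρ, hU⟩ := cauchyU_one_expansion η₂ hμ h hC
  have hη : (η₁ : ℂ) ≠ 0 := by
    have : (1 : ℝ) ≤ N := by exact_mod_cast hN
    exact_mod_cast (show η₁ ≠ 0 by linarith)
  -- The slope `-η₁²` equals `-b₃²`, so the product in the limiting relation vanishes. A perfect
  -- square equal to zero is left, which determines `ρ 0` because `η₁ ≠ 0`.
  have key := sigmaForm_limit hρ hU (Eventually.of_forall fun t => cauchyE_one_ne_zero η₂ hμ h hC t)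
    (satisfiesSigmaForm_cauchyU hN η₂ hμ h 1 hC)
  simp only [Fin.prod_univ_four, bCy, Matrix.cons_val_zero, Matrix.cons_val_one,
    Matrix.cons_val] at key
  have e : Complex.I * (((N : ℂ) - η₁) * (Complex.I * η₂) * η₁ * (-μ + η₁ - N)) =
      η₁ * (η₂ * (N - η₁) * (N + μ - η₁)) := by
    linear_combination (((N : ℂ) - η₁) * η₂ * η₁ * (-μ + η₁ - N)) * Complex.I_sq
  rw [e] at key
  have hρ0 : ρ 0 = -(η₂ * (N - η₁) * (N + μ - η₁) / η₁) := by
    have h2 : (η₁ : ℂ) * (η₁ * ρ 0 + η₂ * (N - η₁) * (N + μ - η₁)) = 0 := by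
      rw [← pow_eq_zero_iff two_ne_zero, ← key]
      ring
    have h3 := (mul_eq_zero.mp h2).resolve_left hη
    field_simp
    linear_combination h3
  have hO := ((hρ.differentiableAt (by norm_num)).hasDerivAt.isBigO_sub).comp_tendsto
    tendsto_neg_inv_atBot
  refine (hO.congr' ?_ ?_).trans (Asymptotics.isBigO_refl (fun t : ℝ => 1 / t) _).neg_left
  · filter_upwards [hU] with t ht
    rw [ht, Function.comp_apply, hρ0]
    push_cast
    ring
  · exact Eventually.of_forall fun t => by simp

end

/-! ### The circular Jacobi average as a Toeplitz determinant -/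

theorem exp_two_arctan (u : ℝ) : Complex.exp (Complex.I * ((2 * Real.arctan u : ℝ) : ℂ)) =
    (1 + Complex.I * u) / (1 - Complex.I * u) := by
  have h0 : (0 : ℝ) < 1 + u ^ 2 := by positivity
  have hs : ((√(1 + u ^ 2) : ℝ) : ℂ) ^ 2 = 1 + (u : ℂ) ^ 2 := by
    rw [← Complex.ofReal_pow, Real.sq_sqrt h0.le]; push_cast; rfl
  have hne : ((√(1 + u ^ 2) : ℝ) : ℂ) ≠ 0 := by exact_mod_cast (Real.sqrt_pos.mpr h0).ne'
  have h1 : Complex.exp (Complex.I * Real.arctan u) = (1 + Complex.I * u) / (√(1 + u ^ 2) : ℝ) := by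
    rw [mul_comm, Complex.exp_mul_I, ← Complex.ofReal_cos, ← Complex.ofReal_sin, Real.cos_arctan,
      Real.sin_arctan]
    push_cast
    field_simp
  have h2 := one_sub_ne_zero' u
  rw [show Complex.I * ((2 * Real.arctan u : ℝ) : ℂ) = Complex.I * Real.arctan u +
    Complex.I * Real.arctan u by push_cast; ring, Complex.exp_add, h1, div_mul_div_comm, ← sq, ← sq,
    hs, div_eq_div_iff (one_add_sq_ne_zero u) h2]
  linear_combination (-(1 + Complex.I * u) * u ^ 2) * Complex.I_sq

theorem log_one_add (u : ℝ) : Complex.log (1 + Complex.I * u) =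
    ((Real.log √(1 + u ^ 2) : ℝ) : ℂ) + Complex.I * Real.arctan u := by
  have hn := norm_one_add u
  apply Complex.ext
  · rw [Complex.log_re, hn]
    generalize Real.arctan u = A
    simp
  · rw [Complex.log_im, Complex.arg_of_re_nonneg (by simp), hn, Real.arctan_eq_arcsin]
    generalize Real.log √(1 + u ^ 2) = B
    generalize √(1 + u ^ 2) = A
    simp

theorem gW_eq_exp_arctan (ω u : ℝ) : gW (-(Complex.I * ω)) (Complex.I * ω) u =
    ((Real.exp (ω * (2 * Real.arctan u)) : ℝ) : ℂ) := by
  have h1 := log_one_add u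
  have h2 := log_one_add (-u)
  rw [Real.arctan_neg, neg_sq, Complex.ofReal_neg, Complex.ofReal_neg] at h2
  rw [mul_neg, ← sub_eq_add_neg] at h2
  rw [gW, Complex.cpow_def_of_ne_zero (one_add_ne_zero' u),
    Complex.cpow_def_of_ne_zero (one_sub_ne_zero' u), ← Complex.exp_add, h1, h2, Complex.ofReal_exp]
  congr 1
  rw [Complex.ofReal_mul, Complex.ofReal_mul, Complex.ofReal_ofNat]
  linear_combination (-2 * ω * (Real.arctan u : ℂ)) * Complex.I_sq

theorem norm_one_add_exp (u : ℝ) :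
    ‖1 + Complex.exp (Complex.I * ((2 * Real.arctan u : ℝ) : ℂ))‖ = 2 / √(1 + u ^ 2) := by
  have h := one_sub_ne_zero' u
  rw [exp_two_arctan, show 1 + (1 + Complex.I * u) / (1 - Complex.I * u) =
    2 / (1 - Complex.I * u) by field_simp; ring, norm_div, norm_one_sub]
  simp

theorem norm_exp_sub_exp (s u : ℝ) :
    ‖Complex.exp (Complex.I * ((2 * Real.arctan s : ℝ) : ℂ)) -
      Complex.exp (Complex.I * ((2 * Real.arctan u : ℝ) : ℂ))‖ =
      2 * |u - s| / (√(1 + s ^ 2) * √(1 + u ^ 2)) := by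
  have h := one_sub_ne_zero' u
  have h' := one_sub_ne_zero' s
  rw [exp_two_arctan, exp_two_arctan, div_sub_div _ _ h' h, norm_div, norm_mul, norm_one_sub,
    norm_one_sub, show (1 + Complex.I * s) * (1 - Complex.I * u) -
      (1 - Complex.I * s) * (1 + Complex.I * u) = -(2 * Complex.I) * ((u - s : ℝ) : ℂ) by
      push_cast; ring, norm_mul, Complex.norm_real, Real.norm_eq_abs]
  simp

theorem image_two_arctan : (fun u : ℝ => 2 * Real.arctan u) '' Set.univ =
    Set.Ioo (-Real.pi) Real.pi := by
  ext θ
  constructor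
  · rintro ⟨u, _, rfl⟩
    have h1 := Real.arctan_lt_pi_div_two u
    have h2 := Real.neg_pi_div_two_lt_arctan u
    exact ⟨by simp only []; linarith, by simp only []; linarith⟩
  · rintro ⟨h1, h2⟩
    exact ⟨Real.tan (θ / 2), Set.mem_univ _, by
      simp only []
      rw [Real.arctan_tan (by linarith) (by linarith)]; ring⟩

/-- The substitution `θ = 2 arctan u`. -/
theorem integral_angle (f : ℝ → ℂ)
    (h : Integrable fun u : ℝ => f (2 * Real.arctan u) * ((2 / (1 + u ^ 2) : ℝ) : ℂ)) :
    IntegrableOn f (Set.Icc (-Real.pi) Real.pi) ∧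
    ∫ θ in Set.Icc (-Real.pi) Real.pi, f θ =
      ∫ u : ℝ, f (2 * Real.arctan u) * ((2 / (1 + u ^ 2) : ℝ) : ℂ) := by
  have hd : ∀ u ∈ Set.univ, HasDerivWithinAt (fun u : ℝ => 2 * Real.arctan u) (2 / (1 + u ^ 2))
      Set.univ u := fun u _ => by
    have := ((Real.hasDerivAt_arctan u).const_mul 2).hasDerivWithinAt (s := Set.univ)
    refine this.congr_deriv (by ring)
  have hinj : Set.InjOn (fun u : ℝ => 2 * Real.arctan u) Set.univ := fun u _ v _ huv =>
    Real.arctan_injective (by simpa using huv)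
  have e : (fun u : ℝ => |2 / (1 + u ^ 2)| • f (2 * Real.arctan u)) =
      fun u : ℝ => f (2 * Real.arctan u) * ((2 / (1 + u ^ 2) : ℝ) : ℂ) := by
    funext u
    rw [abs_of_pos (by positivity), Complex.real_smul, mul_comm]
  constructor
  · rw [integrableOn_Icc_iff_integrableOn_Ioo, ← image_two_arctan,
      integrableOn_image_iff_integrableOn_abs_deriv_smul MeasurableSet.univ hd hinj,
      integrableOn_univ, e]
    exact h
  · rw [integral_Icc_eq_integral_Ioo, ← image_two_arctan,
      integral_image_eq_integral_abs_deriv_smul MeasurableSet.univ hd hinj, Measure.restrict_univ, e]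

/-- On the circle the conjugate of `z` is `1/z`, and `z = (1 + i u)/(1 - i u)`. So `z^j` times the
conjugate of `z^k` shifts the exponents to `p + j - k`, `q - j + k`, and Andréief's identity gives
the Toeplitz determinant of the Cauchy case. -/
theorem integral_circle {f : ℝ → ℂ} {μ : ℝ} {a b c p q : ℂ} {s : ℝ} (hμ : -1 < μ)
    (h : (p + q).re + μ < -1)
    (hf : ∀ u : ℝ, f (2 * Real.arctan u) * ((2 / (1 + u ^ 2) : ℝ) : ℂ) =
      c * (kap μ a b (u - s) * gW p q u)) (n : ℕ) :
    ∫ θ in Set.pi Set.univ (fun _ : Fin n => Set.Icc (-Real.pi) Real.pi),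
      (∏ l, f (θ l)) * ∏ j, ∏ k ∈ Finset.Ioi j,
        ((‖Complex.exp (Complex.I * θ k) - Complex.exp (Complex.I * θ j)‖ ^ 2 : ℝ) : ℂ) =
      n.factorial * (c ^ n * hdet μ a b p q n s) := by
  set z : ℝ → ℂ := fun θ => Complex.exp (Complex.I * θ) with hz
  have hI : ∀ j k : Fin n,
      IntegrableOn (fun θ => f θ * z θ ^ (j : ℕ) * (starRingEnd ℂ) (z θ) ^ (k : ℕ))
        (Set.Icc (-Real.pi) Real.pi) ∧
      ∫ θ in Set.Icc (-Real.pi) Real.pi, f θ * z θ ^ (j : ℕ) * (starRingEnd ℂ) (z θ) ^ (k : ℕ) =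
        c * fullI μ a b (p + ((j : ℕ) : ℂ) - ((k : ℕ) : ℂ)) (q - ((j : ℕ) : ℂ) + ((k : ℕ) : ℂ)) s := by
    intro j k
    have e : ∀ u : ℝ, f (2 * Real.arctan u) * z (2 * Real.arctan u) ^ (j : ℕ) *
        (starRingEnd ℂ) (z (2 * Real.arctan u)) ^ (k : ℕ) * ((2 / (1 + u ^ 2) : ℝ) : ℂ) =
        c * (kap μ a b (u - s) *
          gW (p + ((j : ℕ) : ℂ) - ((k : ℕ) : ℂ)) (q - ((j : ℕ) : ℂ) + ((k : ℕ) : ℂ)) u) := by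
      intro u
      have h1 := one_add_ne_zero' u
      have h2 := one_sub_ne_zero' u
      have e1 := gW_shift (p - ((k : ℕ) : ℂ)) (q - ((j : ℕ) : ℂ)) j k u
      have e2 := gW_shift (p - ((k : ℕ) : ℂ)) (q - ((j : ℕ) : ℂ)) k j u
      rw [sub_add_cancel, sub_add_cancel] at e2
      have e3 := hf u
      rw [e2] at e3
      have hz1 : z (2 * Real.arctan u) = (1 + Complex.I * u) / (1 - Complex.I * u) :=
        exp_two_arctan u
      have hz2 : (starRingEnd ℂ) (z (2 * Real.arctan u)) =
          (1 - Complex.I * u) / (1 + Complex.I * u) := by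
        rw [hz1, map_div₀]; simp [sub_eq_add_neg]
      rw [hz2, hz1, show p + ((j : ℕ) : ℂ) - ((k : ℕ) : ℂ) = p - ((k : ℕ) : ℂ) + ((j : ℕ) : ℂ) by ring,
        e1, show ∀ x y v w : ℂ, x * y * v * w = x * w * (y * v) from fun _ _ _ _ => by ring, e3, div_pow, div_pow]
      field_simp
    have hk := kap_mul_gW μ a b hμ (p := p + ((j : ℕ) : ℂ) - ((k : ℕ) : ℂ))
      (q := q - ((j : ℕ) : ℂ) + ((k : ℕ) : ℂ)) (by rwa [shift_re]) s
    have := integral_angle (fun θ => f θ * z θ ^ (j : ℕ) * (starRingEnd ℂ) (z θ) ^ (k : ℕ))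
      (by simp only [e]; exact hk.1.const_mul c)
    refine ⟨this.1, ?_⟩
    rw [this.2]
    simp only [e]
    rw [integral_const_mul, hk.2]
  have hA := (integral_det_mul_det (volume.restrict (Set.Icc (-Real.pi) Real.pi)) (n := n)
    (fun j θ => f θ * z θ ^ (j : ℕ)) (fun k θ => (starRingEnd ℂ) (z θ) ^ (k : ℕ))
    (fun j k => (hI j k).1)).2
  simp only [(fun j k => (hI j k).2 : ∀ j k : Fin n, _)] at hA
  rw [← Measure.restrict_pi_pi, ← volume_pi] at hA
  have hdet' : (Matrix.of fun j k : Fin n => c * fullI μ a b (p + ((j : ℕ) : ℂ) - ((k : ℕ) : ℂ))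
      (q - ((j : ℕ) : ℂ) + ((k : ℕ) : ℂ)) s).det = c ^ n * hdet μ a b p q n s := by
    rw [show (Matrix.of fun j k : Fin n => c * fullI μ a b (p + ((j : ℕ) : ℂ) - ((k : ℕ) : ℂ))
      (q - ((j : ℕ) : ℂ) + ((k : ℕ) : ℂ)) s) = c • Matrix.of fun j k : Fin n =>
        fullI μ a b (p + ((j : ℕ) : ℂ) - ((k : ℕ) : ℂ)) (q - ((j : ℕ) : ℂ) + ((k : ℕ) : ℂ)) s from rfl,
      Matrix.det_smul, Fintype.card_fin, hdet]
  rw [hdet'] at hA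
  rw [← hA]
  congr 1
  funext θ
  have e1 : (Matrix.of fun l j : Fin n => f (θ l) * z (θ l) ^ (j : ℕ)).det =
      (∏ l, f (θ l)) * (Matrix.vandermonde fun l => z (θ l)).det := by
    rw [← Matrix.det_mul_column]; rfl
  have e2 : (Matrix.of fun l k : Fin n => (starRingEnd ℂ) (z (θ l)) ^ (k : ℕ)) =
      Matrix.vandermonde fun l => (starRingEnd ℂ) (z (θ l)) := rfl
  rw [e1, e2, Matrix.det_vandermonde, Matrix.det_vandermonde, mul_assoc]
  congr 1
  rw [← Finset.prod_mul_distrib]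
  refine Finset.prod_congr rfl fun i _ => ?_
  rw [← Finset.prod_mul_distrib]
  refine Finset.prod_congr rfl fun j _ => ?_
  rw [← map_sub, Complex.mul_conj']
  push_cast
  rfl

/-! ### The circular average in the variable `tan (θ/2)`. -/

section

theorem cot_half_mem {φ : ℝ} (h0 : 0 < φ) (h1 : φ < 2 * Real.pi) :
    2 * Real.arctan (Real.cot (φ / 2)) = Real.pi - φ := by
  have e : Real.cot (φ / 2) = Real.tan (Real.pi / 2 - φ / 2) := by
    rw [Real.cot_eq_cos_div_sin, Real.tan_eq_sin_div_cos, Real.sin_pi_div_two_sub,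
      Real.cos_pi_div_two_sub]
  rw [e, Real.arctan_tan (by linarith) (by linarith)]
  ring

theorem kap_zero (y : ℝ) : kap 0 1 1 y = 1 := by simp [kap]

/-- The exponent `-1 - x/2 - i ω` of the weight `e^{ω θ} |1 + e^{i θ}|^x` in the variable
`tan (θ/2)`. -/
def angP (ω x : ℝ) : ℂ := -1 - x / 2 - Complex.I * ω

/-- The exponent `-1 - x/2 + i ω`. -/
def angQ (ω x : ℝ) : ℂ := -1 - x / 2 + Complex.I * ω

theorem conj_angP (ω x : ℝ) : (starRingEnd ℂ) (angP ω x) = angQ ω x := by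
  simp [angP, angQ, Complex.conj_ofNat]

theorem angP_add_angQ_re (ω x : ℝ) : (angP ω x + angQ ω x).re = -2 - x := by
  have : angP ω x + angQ ω x = ((-2 - x : ℝ) : ℂ) := by
    simp only [angP, angQ]; push_cast; ring
  rw [this, Complex.ofReal_re]

theorem two_div_sqrt_rpow (x u : ℝ) : (2 / √(1 + u ^ 2)) ^ x = 2 ^ x * (1 + u ^ 2) ^ (-x / 2) := by
  have h0 : (0 : ℝ) < 1 + u ^ 2 := by positivity
  rw [Real.div_rpow (by norm_num) (Real.sqrt_nonneg _), Real.sqrt_eq_rpow, ← Real.rpow_mul h0.le,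
    div_eq_mul_inv, ← Real.rpow_neg h0.le]
  congr 2
  ring

theorem angle_weight_eq (ω x u : ℝ) :
    ((Real.exp (ω * (2 * Real.arctan u)) *
      ‖1 + Complex.exp (Complex.I * ((2 * Real.arctan u : ℝ) : ℂ))‖ ^ x : ℝ) : ℂ) *
      ((2 / (1 + u ^ 2) : ℝ) : ℂ) = ((2 ^ (x + 1) : ℝ) : ℂ) * gW (angP ω x) (angQ ω x) u := by
  have h0 : (0 : ℝ) < 1 + u ^ 2 := by positivity
  have e : gW (angP ω x) (angQ ω x) u = gW (-(Complex.I * ω)) (Complex.I * ω) u *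
      gW ((-x / 2 + -1 : ℝ) : ℂ) ((-x / 2 + -1 : ℝ) : ℂ) u := by
    rw [gW_mul_gW]
    congr 1 <;> simp only [angP, angQ] <;> push_cast <;> ring
  rw [e, gW_eq_exp_arctan, gW_ofReal_self, norm_one_add_exp, two_div_sqrt_rpow,
    Real.rpow_add h0, Real.rpow_neg_one, Real.rpow_add two_pos, Real.rpow_one]
  push_cast
  ring

/-- The one-particle weight of the circular Jacobi average. -/
def cjW (ω₁ ω₂ μ : ℝ) (ξ : ℂ) (φ θ : ℝ) : ℂ :=
  (1 - ξ * Set.indicator (Set.Ioo (Real.pi - φ) Real.pi) (fun _ => (1 : ℂ)) θ) *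
    ((Real.exp (ω₂ * θ) * ‖Complex.exp (Complex.I * ((Real.pi - φ : ℝ) : ℂ)) -
      Complex.exp (Complex.I * θ)‖ ^ μ : ℝ) : ℂ) *
    ((‖1 + Complex.exp (Complex.I * θ)‖ ^ (2 * ω₁) : ℝ) : ℂ)

/-- With `s = cot (φ/2)` the angle `π - φ` is `2 arctan s`. The arc `(π - φ, π)` becomes `u > s`,
and the distance of the two points factors as `|u - s| (1 + s²)^{-1/2} |1 + e^{iθ}|`. -/
theorem cjW_angle (ω₁ ω₂ μ : ℝ) (ξ : ℂ) {φ : ℝ} (h0 : 0 < φ) (h1 : φ < 2 * Real.pi) (u : ℝ) :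
    cjW ω₁ ω₂ μ ξ φ (2 * Real.arctan u) * ((2 / (1 + u ^ 2) : ℝ) : ℂ) =
      ((2 ^ (2 * ω₁ + μ + 1) : ℝ) : ℂ) * ((1 + Real.cot (φ / 2) ^ 2) ^ (-μ / 2) : ℝ) *
        (kap μ 1 (1 - ξ) (u - Real.cot (φ / 2)) *
          gW (angP ω₂ (2 * ω₁ + μ)) (angQ ω₂ (2 * ω₁ + μ)) u) := by
  have hs := cot_half_mem h0 h1
  set s := Real.cot (φ / 2) with hsdef
  have hu0 : (0 : ℝ) < 1 + u ^ 2 := by positivity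
  have hs0 : (0 : ℝ) < 1 + s ^ 2 := by positivity
  have hind : (1 - ξ * Set.indicator (Set.Ioo (Real.pi - φ) Real.pi) (fun _ => (1 : ℂ))
      (2 * Real.arctan u)) * ((|u - s| ^ μ : ℝ) : ℂ) = kap μ 1 (1 - ξ) (u - s) := by
    rw [kap]
    rcases le_or_gt (u - s) 0 with h | h
    · rw [if_pos h, Set.indicator_of_notMem, abs_of_nonpos h]
      · simp
      · rintro ⟨h2, -⟩
        rw [← hs] at h2
        have := Real.arctan_strictMono.lt_iff_lt.mp (show Real.arctan s < Real.arctan u by linarith)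
        linarith
    · rw [if_neg (not_le.mpr h), Set.indicator_of_mem, abs_of_pos h, mul_one]
      refine ⟨?_, by linarith [Real.arctan_lt_pi_div_two u]⟩
      rw [← hs]
      linarith [Real.arctan_strictMono (show s < u by linarith)]
  have hn : ‖Complex.exp (Complex.I * ((Real.pi - φ : ℝ) : ℂ)) -
      Complex.exp (Complex.I * ((2 * Real.arctan u : ℝ) : ℂ))‖ ^ μ =
      |u - s| ^ μ * (1 + s ^ 2) ^ (-μ / 2) *
        ‖1 + Complex.exp (Complex.I * ((2 * Real.arctan u : ℝ) : ℂ))‖ ^ μ := by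
    rw [← hs, norm_exp_sub_exp, norm_one_add_exp,
      show 2 * |u - s| / (√(1 + s ^ 2) * √(1 + u ^ 2)) =
        |u - s| * (√(1 + s ^ 2))⁻¹ * (2 / √(1 + u ^ 2)) by field_simp,
      Real.mul_rpow (by positivity) (by positivity), Real.mul_rpow (by positivity) (by positivity),
      Real.inv_rpow (by positivity), ← Real.rpow_neg (by positivity), Real.sqrt_eq_rpow (1 + s ^ 2),
      ← Real.rpow_mul hs0.le]
    congr 3
    ring
  have hpos : 0 < ‖1 + Complex.exp (Complex.I * ((2 * Real.arctan u : ℝ) : ℂ))‖ := by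
    rw [norm_one_add_exp]; positivity
  have key := angle_weight_eq ω₂ (2 * ω₁ + μ) u
  rw [Real.rpow_add hpos] at key
  rw [cjW, hn, ← hind]
  push_cast at key ⊢
  linear_combination ((1 - ξ * Set.indicator (Set.Ioo (Real.pi - φ) Real.pi) (fun _ => (1 : ℂ))
      (2 * Real.arctan u)) * ((|u - s| ^ μ : ℝ) : ℂ) * ((1 + s ^ 2) ^ (-μ / 2) : ℝ)) * key

/-- At `φ = 0` the marked point is `-1`: its factor merges with `|1 + z|^{2 ω₁}`, and the arc is
empty. -/
theorem cjW_zero_angle (ω₁ ω₂ μ : ℝ) (ξ : ℂ) (u : ℝ) :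
    cjW ω₁ ω₂ μ ξ 0 (2 * Real.arctan u) * ((2 / (1 + u ^ 2) : ℝ) : ℂ) =
      ((2 ^ (2 * ω₁ + μ + 1) : ℝ) : ℂ) * (kap 0 1 1 (u - 0) *
          gW (angP ω₂ (2 * ω₁ + μ)) (angQ ω₂ (2 * ω₁ + μ)) u) := by
  have hpos : 0 < ‖1 + Complex.exp (Complex.I * ((2 * Real.arctan u : ℝ) : ℂ))‖ := by
    rw [norm_one_add_exp]; positivity
  have key := angle_weight_eq ω₂ (2 * ω₁ + μ) u
  rw [Real.rpow_add hpos] at key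
  have e : ‖Complex.exp (Complex.I * ((Real.pi - 0 : ℝ) : ℂ)) -
      Complex.exp (Complex.I * ((2 * Real.arctan u : ℝ) : ℂ))‖ =
      ‖1 + Complex.exp (Complex.I * ((2 * Real.arctan u : ℝ) : ℂ))‖ := by
    rw [sub_zero, mul_comm Complex.I (Real.pi : ℂ), Complex.exp_pi_mul_I, ← norm_neg]
    congr 1
    ring
  rw [cjW, e, kap_zero, sub_zero, Set.Ioo_self, Set.indicator_empty, one_mul, ← key]
  push_cast
  ring

theorem cJE_eq (N : ℕ) (ω₁ ω₂ μ : ℝ) (ξ : ℂ) (φ : ℝ) : cJE N ω₁ ω₂ μ ξ φ =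
    (∫ θ in Set.pi Set.univ (fun _ : Fin N => Set.Icc (-Real.pi) Real.pi),
      (∏ l, cjW ω₁ ω₂ μ ξ φ (θ l)) * ∏ j, ∏ k ∈ Finset.Ioi j,
        ((‖Complex.exp (Complex.I * θ k) - Complex.exp (Complex.I * θ j)‖ ^ 2 : ℝ) : ℂ)) /
    ((∫ θ in Set.pi Set.univ (fun _ : Fin N => Set.Icc (-Real.pi) Real.pi),
      cJUEWeight N ω₁ θ : ℝ) : ℂ) := by
  rw [cJE]
  congr 2
  funext θ
  simp only [cJUEWeight, cjW]
  rw [Finset.prod_mul_distrib (f := fun l => (1 - ξ * Set.indicator (Set.Ioo (Real.pi - φ) Real.pi)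
    (fun _ => (1 : ℂ)) (θ l)) * ((Real.exp (ω₂ * θ l) *
      ‖Complex.exp (Complex.I * ((Real.pi - φ : ℝ) : ℂ)) -
      Complex.exp (Complex.I * θ l)‖ ^ μ : ℝ) : ℂ))]
  push_cast
  ring

variable {N : ℕ} {ω₁ μ : ℝ}

theorem integral_angle_weight {ω x : ℝ} (hx : -1 < x) (n : ℕ) :
    ∫ θ in Set.pi Set.univ (fun _ : Fin n => Set.Icc (-Real.pi) Real.pi),
      (∏ l, ((Real.exp (ω * θ l) * ‖1 + Complex.exp (Complex.I * θ l)‖ ^ x : ℝ) : ℂ)) *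
        ∏ j, ∏ k ∈ Finset.Ioi j,
        ((‖Complex.exp (Complex.I * θ k) - Complex.exp (Complex.I * θ j)‖ ^ 2 : ℝ) : ℂ) =
      n.factorial * (((2 ^ (x + 1) : ℝ) : ℂ) ^ n * hdet 0 1 1 (angP ω x) (angQ ω x) n 0) :=
  integral_circle (f := fun θ => ((Real.exp (ω * θ) * ‖1 + Complex.exp (Complex.I * θ)‖ ^ x : ℝ) : ℂ))
    (by norm_num) (by rw [angP_add_angQ_re]; linarith)
    (fun u => by rw [kap_zero, one_mul]; exact angle_weight_eq ω x u) n

theorem hdet_ang_ne_zero {ω x : ℝ} (hx : -1 < x) (n : ℕ) :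
    hdet 0 1 1 (angP ω x) (angQ ω x) n 0 ≠ 0 := by
  simpa using hdet_ne_zero (μ := 0) (by norm_num) (by rw [angP_add_angQ_re]; linarith)
    (conj_angP ω x) (a := 1) (b := 1) zero_le_one zero_le_one (Or.inl one_pos) n 0

theorem integral_cJUEWeight (hω : -1 < 2 * ω₁) :
    ((∫ θ in Set.pi Set.univ (fun _ : Fin N => Set.Icc (-Real.pi) Real.pi),
      cJUEWeight N ω₁ θ : ℝ) : ℂ) = N.factorial * (((2 ^ (2 * ω₁ + 1) : ℝ) : ℂ) ^ N *
        hdet 0 1 1 (angP 0 (2 * ω₁)) (angQ 0 (2 * ω₁)) N 0) := by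
  rw [← integral_angle_weight hω, ← integral_complex_ofReal]
  congr 1
  funext θ
  simp [cJUEWeight]

theorem integral_cJUEWeight_ne_zero (hω : -1 < 2 * ω₁) :
    ((∫ θ in Set.pi Set.univ (fun _ : Fin N => Set.Icc (-Real.pi) Real.pi),
      cJUEWeight N ω₁ θ : ℝ) : ℂ) ≠ 0 := by
  rw [integral_cJUEWeight hω]
  refine mul_ne_zero (Nat.cast_ne_zero.mpr N.factorial_ne_zero)
    (mul_ne_zero (pow_ne_zero _ ?_) (hdet_ang_ne_zero hω N))
  exact_mod_cast (Real.rpow_pos_of_pos two_pos _).ne'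

open scoped Pointwise in
theorem morrisM_eq {a b : ℂ} {ω x : ℝ} (hx : -1 < x) (h1 : a - b = -(2 * Complex.I * ω))
    (h2 : a + b = x) (n : ℕ) :
    morrisM n a b = (((2 * Real.pi) ^ n : ℝ) : ℂ)⁻¹ *
      (n.factorial * (((2 ^ (x + 1) : ℝ) : ℂ) ^ n * hdet 0 1 1 (angP ω x) (angQ ω x) n 0)) := by
  have hpi : (0 : ℝ) < 2 * Real.pi := by positivity
  have e := Measure.setIntegral_comp_smul_of_pos (volume : Measure (Fin n → ℝ))
    (fun θ : Fin n → ℝ =>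
      (∏ l, ((Real.exp (ω * θ l) * ‖1 + Complex.exp (Complex.I * θ l)‖ ^ x : ℝ) : ℂ)) *
        ∏ j, ∏ k ∈ Finset.Ioi j,
        ((‖Complex.exp (Complex.I * θ k) - Complex.exp (Complex.I * θ j)‖ ^ 2 : ℝ) : ℂ))
    (Set.pi Set.univ fun _ => Set.Icc (-(1 / 2) : ℝ) (1 / 2)) hpi
  have hset : (2 * Real.pi) • (Set.pi Set.univ fun _ : Fin n => Set.Icc (-(1 / 2) : ℝ) (1 / 2)) =
      Set.pi Set.univ fun _ => Set.Icc (-Real.pi) Real.pi := by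
    ext θ
    rw [Set.mem_smul_set_iff_inv_smul_mem₀ hpi.ne']
    simp only [Set.mem_pi, Set.mem_univ, true_implies, Pi.smul_apply, smul_eq_mul, Set.mem_Icc]
    refine forall_congr' fun i => ?_
    rw [inv_mul_eq_div, le_div_iff₀ hpi, div_le_iff₀ hpi]
    constructor <;> rintro ⟨h1, h2⟩ <;> constructor <;> linarith
  rw [hset, integral_angle_weight hx, Module.finrank_fin_fun, Complex.real_smul,
    Complex.ofReal_inv] at e
  rw [← e, morrisM]
  congr 1
  funext y
  have hexp : ∀ l, Complex.exp (2 * Real.pi * Complex.I * y l) =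
      Complex.exp (Complex.I * (((2 * Real.pi) • y) l : ℝ)) := fun l => by
    congr 1
    simp only [Pi.smul_apply, smul_eq_mul]
    push_cast
    ring
  simp only [hexp]
  congr 1
  · refine Finset.prod_congr rfl fun l _ => ?_
    rw [h1, h2, Complex.ofReal_mul, ← Complex.ofReal_cpow (norm_nonneg _), Complex.ofReal_exp]
    congr 2
    simp only [Pi.smul_apply, smul_eq_mul]
    push_cast
    linear_combination (-2 * Real.pi * y l * ω : ℂ) * Complex.I_sq
  · refine Finset.prod_congr rfl fun i _ => Finset.prod_congr rfl fun j _ => ?_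
    rw [norm_sub_rev]

/-- The value of the numerator of `cJE` per unit of `hatDet`. -/
def cjConst (N : ℕ) (ω₁ μ : ℝ) : ℂ := N.factorial * ((2 ^ (2 * ω₁ + μ + 1) : ℝ) : ℂ) ^ N /
  ((∫ θ in Set.pi Set.univ (fun _ : Fin N => Set.Icc (-Real.pi) Real.pi),
      cJUEWeight N ω₁ θ : ℝ) : ℂ)

theorem cjConst_ne_zero (hω : -1 < 2 * ω₁) : cjConst N ω₁ μ ≠ 0 := by
  refine div_ne_zero (mul_ne_zero (Nat.cast_ne_zero.mpr N.factorial_ne_zero) (pow_ne_zero _ ?_))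
    (integral_cJUEWeight_ne_zero hω)
  exact_mod_cast (Real.rpow_pos_of_pos two_pos _).ne'

theorem cJE_eq_hatDet (ω₂ : ℝ) (hμ : -1 < μ) (hω : -1 < 2 * ω₁) (ξ : ℂ) {φ : ℝ} (h0 : 0 < φ)
    (h1 : φ < 2 * Real.pi) : cJE N ω₁ ω₂ μ ξ φ = cjConst N ω₁ μ *
      hatDet μ 1 (1 - ξ) (angP ω₂ (2 * ω₁ + μ)) (angQ ω₂ (2 * ω₁ + μ)) N (Real.cot (φ / 2)) := by
  rw [cJE_eq, integral_circle hμ (by rw [angP_add_angQ_re]; linarith)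
    (cjW_angle ω₁ ω₂ μ ξ h0 h1), hatDet_eq, gW_ofReal_self, cjConst, mul_pow, ← Complex.ofReal_pow
    ((1 + Real.cot (φ / 2) ^ 2) ^ (-μ / 2)), ← Real.rpow_mul_natCast (by positivity),
    mul_comm (-μ / 2)]
  ring

theorem cJE_zero (ω₂ : ℝ) (hω' : -1 < 2 * ω₁ + μ) (ξ : ℂ) :
    cJE N ω₁ ω₂ μ ξ 0 = cjConst N ω₁ μ *
      hdet 0 1 1 (angP ω₂ (2 * ω₁ + μ)) (angQ ω₂ (2 * ω₁ + μ)) N 0 := by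
  rw [cJE_eq, integral_circle (by norm_num) (by rw [angP_add_angQ_re]; linarith)
    (cjW_zero_angle ω₁ ω₂ μ ξ), cjConst]
  ring

theorem cJE_zero_eq_morrisM (ω₂ : ℝ) (hω : -1 < 2 * ω₁) (hω' : -1 < 2 * ω₁ + μ) (ξ : ℂ) :
    cJE N ω₁ ω₂ μ ξ 0 =
      morrisM N (ω₁ - Complex.I * ω₂ + μ / 2) (ω₁ + Complex.I * ω₂ + μ / 2) /
        morrisM N ω₁ ω₁ := by
  have hpi : (((2 * Real.pi) ^ N : ℝ) : ℂ)⁻¹ ≠ 0 :=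
    inv_ne_zero (by exact_mod_cast (by positivity : (0 : ℝ) < (2 * Real.pi) ^ N).ne')
  rw [cJE_zero ω₂ hω', cjConst, integral_cJUEWeight hω,
    morrisM_eq (ω := ω₂) (x := 2 * ω₁ + μ) hω' (by ring) (by push_cast; ring),
    morrisM_eq (ω := 0) (x := 2 * ω₁) hω (by simp) (by push_cast; ring), mul_div_mul_left _ _ hpi]
  ring

end

/-! ### Comparison of the two averages and integration of the logarithmic derivative. -/

section

variable {N : ℕ} {ω₁ μ : ℝ}

theorem pCy_eq_angP (N : ℕ) (ω₁ ω₂ μ : ℝ) :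
    pCy N (N + ω₁ + μ / 2) ω₂ = angP ω₂ (2 * ω₁ + μ) := by
  simp only [pCy, angP]; push_cast; ring

theorem qCy_eq_angQ (N : ℕ) (ω₁ ω₂ μ : ℝ) :
    qCy N (N + ω₁ + μ / 2) ω₂ = angQ ω₂ (2 * ω₁ + μ) := by
  simp only [qCy, angQ]; push_cast; ring

/-- The circular average uses `|·|^μ` on both sides of the marked point, the Cauchy average a phase
on one side. The modified parameter carries this phase. -/
theorem one_sub_xiStar (ξ : ℂ) (μ : ℝ) :
    1 - (1 - (1 - ξ) * Complex.exp (-(Real.pi * Complex.I * μ))) = bWt ξ μ := by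
  rw [sub_sub_cancel, bWt]

theorem cJE_eq_cauchyE (ω₂ : ℝ) (hμ : -1 < μ) (hω : -1 < 2 * ω₁) (ξ : ℂ) {C : ℂ} (hC : C ≠ 0) :
    ∃ c : ℂ, c ≠ 0 ∧ ∀ φ : ℝ, 0 < φ → φ < 2 * Real.pi →
      cJE N ω₁ ω₂ μ (1 - (1 - ξ) * Complex.exp (-(Real.pi * Complex.I * μ))) φ
        = c * (1 / (((1 + Real.cot (φ / 2) ^ 2) ^ (N * μ / 2) : ℝ) : ℂ)) *
          cauchyE C N (N + ω₁ + μ / 2) ω₂ μ ξ (Real.cot (φ / 2)) := by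
  have hf : (N.factorial : ℂ) ≠ 0 := Nat.cast_ne_zero.mpr N.factorial_ne_zero
  have hp := pairConst_ne_zero N
  refine ⟨cjConst N ω₁ μ * (C * pairConst N / N.factorial), mul_ne_zero (cjConst_ne_zero hω)
    (div_ne_zero (mul_ne_zero hC hp) hf), fun φ h0 h1 => ?_⟩
  have hE := (cauchyE_eq_hdet N (η₁ := N + ω₁ + μ / 2) ω₂ hμ (by linarith) ξ C).2
  have e : (((1 + Real.cot (φ / 2) ^ 2) ^ (N * (-μ / 2)) : ℝ) : ℂ) =
      1 / (((1 + Real.cot (φ / 2) ^ 2) ^ (N * μ / 2) : ℝ) : ℂ) := by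
    rw [one_div, ← Complex.ofReal_inv, ← Real.rpow_neg (by positivity)]
    congr 2
    ring
  rw [cJE_eq_hatDet ω₂ hμ hω _ h0 h1, one_sub_xiStar, hatDet_eq, gW_ofReal_self, hE, pCy_eq_angP,
    qCy_eq_angQ, ← e]
  field_simp

theorem hasDerivAt_cot_half {θ : ℝ} (h0 : 0 < θ) (h1 : θ < 2 * Real.pi) :
    HasDerivAt (fun θ : ℝ => Real.cot (θ / 2)) (-(1 + Real.cot (θ / 2) ^ 2) / 2) θ := by
  have hs : Real.sin (θ / 2) ≠ 0 := (Real.sin_pos_of_pos_of_lt_pi (by linarith) (by linarith)).ne'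
  have hd := (hasDerivAt_id θ).div_const 2
  have := ((Real.hasDerivAt_cos (θ / 2)).comp θ hd).div ((Real.hasDerivAt_sin (θ / 2)).comp θ hd)
    (by simpa using hs)
  have e : (fun θ : ℝ => Real.cot (θ / 2)) = fun θ : ℝ => Real.cos (θ / 2) / Real.sin (θ / 2) :=
    funext fun θ => Real.cot_eq_cos_div_sin _
  rw [e]
  refine this.congr_deriv ?_
  simp only [Function.comp_apply, id_eq]
  rw [Real.cot_eq_cos_div_sin]
  field_simp
  ring

theorem tendsto_cot_half : Tendsto (fun θ : ℝ => Real.cot (θ / 2)) (𝓝[>] 0) atTop := by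
  have e : (fun θ : ℝ => Real.cot (θ / 2)) = fun θ : ℝ => Real.cos (θ / 2) * (Real.sin (θ / 2))⁻¹ :=
    funext fun θ => by rw [Real.cot_eq_cos_div_sin, div_eq_mul_inv]
  rw [e]
  have hc : Tendsto (fun θ : ℝ => Real.cos (θ / 2)) (𝓝[>] 0) (𝓝 1) := by
    have : Continuous fun θ : ℝ => Real.cos (θ / 2) := by fun_prop
    simpa using (this.tendsto 0).mono_left nhdsWithin_le_nhds
  refine hc.pos_mul_atTop one_pos (tendsto_inv_nhdsGT_zero.comp ?_)
  refine tendsto_nhdsWithin_iff.mpr ⟨?_, ?_⟩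
  · have : Continuous fun θ : ℝ => Real.sin (θ / 2) := by fun_prop
    simpa using (this.tendsto 0).mono_left nhdsWithin_le_nhds
  · filter_upwards [Ioo_mem_nhdsGT Real.pi_pos] with θ hθ
    exact Real.sin_pos_of_pos_of_lt_pi (by linarith [hθ.1]) (by linarith [hθ.2, Real.pi_pos])

theorem cot_half_le {θ : ℝ} (h0 : 0 < θ) (h1 : θ < Real.pi) : Real.cot (θ / 2) ≤ 2 / θ := by
  have h2 := Real.lt_tan (x := θ / 2) (by linarith) (by linarith)
  have e : Real.cot (θ / 2) = (Real.tan (θ / 2))⁻¹ := by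
    rw [Real.cot_eq_cos_div_sin, Real.tan_eq_sin_div_cos, inv_div]
  rw [e, ← inv_div θ 2]
  exact inv_anti₀ (by linarith) h2.le

/-- The product of `F` with `exp (½ ∫ G)` is constant on `(0, φ]`. Its limit at `0` is `F₀`, because
the primitive of an integrable function is continuous there; no regularity of `F` at `0` beyond the
limit is needed. -/
theorem eq_mul_exp_integral {F G : ℝ → ℂ} {φ : ℝ} (hφ : 0 < φ)
    (hG : IntervalIntegrable G volume 0 φ) {S : Set ℝ} (hS : IsOpen S) (hSφ : Set.Ioc 0 φ ⊆ S)
    (hGc : ContinuousOn G S) (hF : ∀ θ ∈ Set.Ioc 0 φ, HasDerivAt F (-(1 / 2) * G θ * F θ) θ)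
    {F₀ : ℂ} (hlim : Tendsto F (𝓝[>] 0) (𝓝 F₀)) :
    F φ = F₀ * Complex.exp (-(1 / 2) * ∫ θ in (0 : ℝ)..φ, G θ) := by
  set I : ℝ → ℂ := fun θ => ∫ x in (0 : ℝ)..θ, G x with hI
  set H : ℝ → ℂ := fun θ => F θ * Complex.exp (1 / 2 * I θ) with hH
  have hId : ∀ θ ∈ Set.Ioc 0 φ, HasDerivAt I (G θ) θ := fun θ hθ =>
    intervalIntegral.integral_hasDerivAt_right
      (hG.mono_set (by
        rw [Set.uIcc_of_le hφ.le, Set.uIcc_of_le hθ.1.le]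
        exact Set.Icc_subset_Icc_right hθ.2))
      (hGc.stronglyMeasurableAtFilter hS θ (hSφ hθ))
      (hGc.continuousAt (hS.mem_nhds (hSφ hθ)))
  have hHd : ∀ θ ∈ Set.Ioc 0 φ, HasDerivAt H 0 θ := fun θ hθ => by
    refine ((hF θ hθ).mul ((hId θ hθ).const_mul (1 / 2)).cexp).congr_deriv ?_
    ring
  have hconst : ∀ θ ∈ Set.Ioc 0 φ, H φ = H θ := fun θ hθ =>
    constant_of_has_deriv_right_zero (a := θ) (b := φ)
      (fun x hx => (hHd x ⟨hθ.1.trans_le hx.1, hx.2⟩).continuousAt.continuousWithinAt)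
      (fun x hx => (hHd x ⟨hθ.1.trans_le hx.1, hx.2.le⟩).hasDerivWithinAt) φ ⟨hθ.2, le_rfl⟩
  have hI0 : Tendsto I (𝓝[>] 0) (𝓝 0) := by
    have hc := intervalIntegral.continuousOn_primitive_interval' hG Set.left_mem_uIcc
    rw [Set.uIcc_of_le hφ.le] at hc
    have := (hc 0 (Set.left_mem_Icc.mpr hφ.le)).tendsto
    rw [intervalIntegral.integral_same] at this
    refine this.mono_left ?_
    rw [← nhdsWithin_Ioo_eq_nhdsGT hφ]
    exact nhdsWithin_mono _ Set.Ioo_subset_Icc_self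
  have hHlim : Tendsto H (𝓝[>] 0) (𝓝 (F₀ * Complex.exp (1 / 2 * 0))) :=
    hlim.mul ((hI0.const_mul (1 / 2)).cexp)
  have hH2 : Tendsto H (𝓝[>] 0) (𝓝 (H φ)) := by
    refine tendsto_const_nhds.congr' ?_
    filter_upwards [Ioc_mem_nhdsGT hφ] with θ hθ
    exact hconst θ hθ
  have key := tendsto_nhds_unique hH2 hHlim
  rw [mul_zero, Complex.exp_zero, mul_one] at key
  rw [← key, hH]
  simp only []
  rw [mul_assoc, ← Complex.exp_add, show 1 / 2 * I φ + -(1 / 2) * ∫ θ in (0 : ℝ)..φ, G θ = 0 by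
    rw [hI]; ring, Complex.exp_zero, mul_one]

theorem intervalIntegrable_of_isBigO {G : ℝ → ℂ} {φ ε : ℝ} (hε : 0 < ε) (hφ : 0 < φ)
    (hGc : ContinuousOn G (Set.Ioc 0 φ))
    (hO : G =O[𝓝[>] 0] fun θ => θ ^ (ε - 1)) : IntervalIntegrable G volume 0 φ := by
  rw [intervalIntegrable_iff_integrableOn_Ioc_of_le hφ.le]
  obtain ⟨c, hc⟩ := hO.bound
  obtain ⟨δ, hδ, hδ'⟩ := mem_nhdsGT_iff_exists_Ioc_subset.mp hc
  have hδ0 : 0 < δ := hδ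
  set m := min δ φ with hm
  have hm0 : 0 < m := lt_min hδ0 hφ
  have h1 : IntegrableOn G (Set.Ioc 0 m) := by
    have hr : IntegrableOn (fun θ : ℝ => c * ‖θ ^ (ε - 1)‖) (Set.Ioc 0 m) := by
      have := (intervalIntegral.intervalIntegrable_rpow' (a := 0) (b := m) (r := ε - 1)
        (by linarith))
      rw [intervalIntegrable_iff_integrableOn_Ioc_of_le hm0.le] at this
      exact this.norm.const_mul c
    refine Integrable.mono' hr ((hGc.mono (Set.Ioc_subset_Ioc_right
      (min_le_right _ _))).aestronglyMeasurable measurableSet_Ioc) ?_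
    filter_upwards [ae_restrict_mem measurableSet_Ioc] with θ hθ
    exact hδ' ⟨hθ.1, hθ.2.trans (min_le_left _ _)⟩
  have h2 : IntegrableOn G (Set.Icc m φ) :=
    (hGc.mono fun x hx => ⟨hm0.trans_le hx.1, hx.2⟩).integrableOn_compact isCompact_Icc
  refine (h1.union h2).mono_set fun x hx => ?_
  rcases le_total x m with h | h
  · exact Or.inl ⟨hx.1, h⟩
  · exact Or.inr ⟨h, hx.2⟩

end

/-! ### The exponential formula for the circular average. -/

section

variable {N : ℕ} {ω₁ μ : ℝ}

theorem contDiff_hatDet {p q : ℂ} (hμ : -1 < μ) (h : (p + q).re + μ < -1) (a b : ℂ) (n m : ℕ) :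
    ContDiff ℝ m (hatDet μ a b p q n) := by
  rw [funext (hatDet_eq μ a b p q n)]
  exact (contDiff_gW _ _ m).mul (contDiff_hdet hμ h a b n m)

/-- The terms added to `U` cancel its linear growth and its constant, leaving the logarithmic
derivative of the determinant normalised to converge at `+∞`. -/
theorem cauchyU_add_eq_logD1 (ω₂ : ℝ) (hμ : -1 < μ) (hω : -1 < 2 * ω₁) (ξ : ℂ) {C : ℂ}
    (hC : C ≠ 0) {s : ℝ}
    (hs : hatDet μ 1 (bWt ξ μ) (angP ω₂ (2 * ω₁ + μ)) (angQ ω₂ (2 * ω₁ + μ)) N s ≠ 0) :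
    cauchyU C N (N + ω₁ + μ / 2) ω₂ μ ξ s +
      ((ω₂ * (N + ω₁ - μ / 2) + (ω₁ + μ / 2) ^ 2 * s : ℝ) : ℂ) =
      logD1 (hatDet μ 1 (bWt ξ μ) (angP ω₂ (2 * ω₁ + μ)) (angQ ω₂ (2 * ω₁ + μ)) N) s := by
  have h : 2 * (N : ℝ) - 1 + μ < 2 * (N + ω₁ + μ / 2) := by linarith
  have h' : (angP ω₂ (2 * ω₁ + μ) + angQ ω₂ (2 * ω₁ + μ)).re + μ < -1 := by
    rw [angP_add_angQ_re]; linarith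
  have hd := hs
  rw [hatDet_eq] at hd
  have hU := cauchyU_eq_logD1 N ω₂ hμ h ξ hC (s := s)
    (by rw [pCy_eq_angP, qCy_eq_angQ]; exact right_ne_zero_of_mul hd)
  rw [pCy_eq_angP, qCy_eq_angQ, logD1_hdet_eq hμ h' 1 _ N hs] at hU
  have he := e2'_add_mul N (N + ω₁ + μ / 2) ω₂ μ
  rw [hU]
  push_cast at he ⊢
  linear_combination (s : ℂ) * he

theorem cJE_eq_morrisM_mul_exp (ω₂ : ℝ) (hμ : -1 < μ) (hω : -1 < 2 * ω₁) (hω' : -1 < 2 * ω₁ + μ)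
    (ξ : ℂ) {C : ℂ} (hC : C ≠ 0) {φ : ℝ} (h0 : 0 ≤ φ) (h1 : φ < 2 * Real.pi)
    (hne : ∀ θ : ℝ, 0 < θ → θ ≤ φ →
      cJE N ω₁ ω₂ μ (1 - (1 - ξ) * Complex.exp (-(Real.pi * Complex.I * μ))) θ ≠ 0) :
    IntervalIntegrable (fun θ : ℝ => cauchyU C N (N + ω₁ + μ / 2) ω₂ μ ξ (Real.cot (θ / 2))
      + ((ω₂ * (N + ω₁ - μ / 2) + (ω₁ + μ / 2) ^ 2 * Real.cot (θ / 2) : ℝ) : ℂ)) volume 0 φ ∧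
    cJE N ω₁ ω₂ μ (1 - (1 - ξ) * Complex.exp (-(Real.pi * Complex.I * μ))) φ
      = morrisM N (ω₁ - Complex.I * ω₂ + μ / 2) (ω₁ + Complex.I * ω₂ + μ / 2) / morrisM N ω₁ ω₁ *
        Complex.exp (-(1 / 2) * ∫ θ in (0 : ℝ)..φ,
          (cauchyU C N (N + ω₁ + μ / 2) ω₂ μ ξ (Real.cot (θ / 2))
            + ((ω₂ * (N + ω₁ - μ / 2) + (ω₁ + μ / 2) ^ 2 * Real.cot (θ / 2) : ℝ) : ℂ))) := by
  rw [← cJE_zero_eq_morrisM ω₂ hω hω' (1 - (1 - ξ) * Complex.exp (-(Real.pi * Complex.I * μ)))]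
  rcases h0.eq_or_lt with rfl | hφ
  · simp
  set p := angP ω₂ (2 * ω₁ + μ) with hp
  set q := angQ ω₂ (2 * ω₁ + μ) with hq
  set T := hatDet μ 1 (bWt ξ μ) p q N with hT
  set F := cJE N ω₁ ω₂ μ (1 - (1 - ξ) * Complex.exp (-(Real.pi * Complex.I * μ))) with hF
  set G : ℝ → ℂ := fun θ : ℝ => cauchyU C N (N + ω₁ + μ / 2) ω₂ μ ξ (Real.cot (θ / 2))
      + ((ω₂ * (N + ω₁ - μ / 2) + (ω₁ + μ / 2) ^ 2 * Real.cot (θ / 2) : ℝ) : ℂ) with hG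
  have hpq : (p + q).re + μ < -1 := by rw [hp, hq, angP_add_angQ_re]; linarith
  have hσ : (p + q).re < -1 := by rw [hp, hq, angP_add_angQ_re]; linarith
  have hTs : ∀ m : ℕ, ContDiff ℝ m T := contDiff_hatDet hμ hpq 1 _ N
  have hk : cjConst N ω₁ μ ≠ 0 := cjConst_ne_zero hω
  have hFT : ∀ θ : ℝ, 0 < θ → θ < 2 * Real.pi → F θ = cjConst N ω₁ μ * T (Real.cot (θ / 2)) := by
    intro θ hθ0 hθ1
    rw [hF, cJE_eq_hatDet ω₂ hμ hω _ hθ0 hθ1, one_sub_xiStar]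
  have hGT : ∀ θ : ℝ, T (Real.cot (θ / 2)) ≠ 0 → G θ = logD1 T (Real.cot (θ / 2)) :=
    fun θ hθ => cauchyU_add_eq_logD1 ω₂ hμ hω ξ hC hθ
  have hcot : ContinuousOn (fun θ : ℝ => Real.cot (θ / 2)) (Set.Ioo 0 (2 * Real.pi)) :=
    fun θ hθ => (hasDerivAt_cot_half hθ.1 hθ.2).continuousAt.continuousWithinAt
  set S : Set ℝ := Set.Ioo 0 (2 * Real.pi) ∩ (fun θ : ℝ => T (Real.cot (θ / 2))) ⁻¹' {0}ᶜ with hS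
  have hSo : IsOpen S := ((hTs 0).continuous.comp_continuousOn hcot).isOpen_inter_preimage isOpen_Ioo
    isOpen_compl_singleton
  have hSφ : Set.Ioc 0 φ ⊆ S := by
    intro θ hθ
    have hθ2 : θ < 2 * Real.pi := hθ.2.trans_lt h1
    have := hne θ hθ.1 hθ.2
    rw [hFT θ hθ.1 hθ2] at this
    exact ⟨⟨hθ.1, hθ2⟩, right_ne_zero_of_mul this⟩
  have hGc : ContinuousOn G S := by
    have : ContinuousOn (fun θ => logD1 T (Real.cot (θ / 2))) S :=
      ((contDiff_opD hTs 0).continuous.comp_continuousOn (hcot.mono Set.inter_subset_left)).div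
        ((hTs 0).continuous.comp_continuousOn (hcot.mono Set.inter_subset_left))
        (fun θ hθ => hθ.2)
    exact this.congr fun θ hθ => hGT θ hθ.2
  have hFd : ∀ θ ∈ Set.Ioc 0 φ, HasDerivAt F (-(1 / 2) * G θ * F θ) θ := by
    intro θ hθ
    have hm := hSφ hθ
    have hd := ((hasDerivAt_opD hTs (Real.cot (θ / 2))).scomp θ
      (hasDerivAt_cot_half hm.1.1 hm.1.2)).const_mul (cjConst N ω₁ μ)
    refine (hd.congr_of_eventuallyEq ?_).congr_deriv ?_
    · filter_upwards [isOpen_Ioo.mem_nhds hm.1] with x hx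
      exact hFT x hx.1 hx.2
    · have hT0 : T (Real.cot (θ / 2)) ≠ 0 := hm.2
      have h2 := one_add_sq_ne_zero (Real.cot (θ / 2))
      rw [hGT θ hT0, hFT θ hm.1.1 hm.1.2, logD1, Complex.real_smul]
      push_cast at h2 ⊢
      field_simp
  -- As `θ → 0` the variable `s` tends to `+∞`, where the half line `x > s` drops out; the limiting
  -- determinant is the one computed directly at `φ = 0`.
  have hlim : Tendsto F (𝓝[>] 0) (𝓝 (F 0)) := by
    have := ((tendsto_hatDet hμ hpq 1 (bWt ξ μ) hσ N).comp tendsto_cot_half).const_mul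
      (cjConst N ω₁ μ)
    rw [one_pow, one_mul, ← cJE_zero ω₂ hω'
      (1 - (1 - ξ) * Complex.exp (-(Real.pi * Complex.I * μ)))] at this
    refine this.congr' ?_
    filter_upwards [Ioo_mem_nhdsGT (show (0 : ℝ) < 2 * Real.pi by positivity)] with θ hθ
    exact (hFT θ hθ.1 hθ.2).symm
  -- The integrand is `O(s^(1 - ε))` as `s → +∞`, and `cot (θ/2) ≤ 2/θ` turns this into the
  -- integrable singularity `θ^(ε - 1)`.
  have hint : IntervalIntegrable G volume 0 φ := by
    obtain ⟨ε, hε, hε1, hε2⟩ : ∃ ε : ℝ, 0 < ε ∧ ε ≤ 1 ∧ (p + q).re + ε < -1 :=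
      ⟨min 1 ((-1 - (p + q).re) / 2), lt_min one_pos (by linarith), min_le_left _ _, by
        linarith [min_le_right 1 ((-1 - (p + q).re) / 2)]⟩
    refine intervalIntegrable_of_isBigO hε hφ (hGc.mono hSφ) ?_
    have hinv := ((tendsto_hatDet hμ hpq 1 (bWt ξ μ) hσ N).inv₀
      (hatDet_limit_ne_zero (conj_angP _ _) one_ne_zero hσ N)).isBigO_one ℝ
    have hO := (((slowlyVarying_hatDet hμ hpq 1 (bWt ξ μ) hε hε1 hε2 N).2.2.mul hinv).comp_tendsto
      tendsto_cot_half)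
    refine (hO.congr' (f₂ := G) ?_ EventuallyEq.rfl).trans ?_
    · filter_upwards [Ioc_mem_nhdsGT hφ] with θ hθ
      rw [hGT θ (hSφ hθ).2]
      rfl
    · refine Asymptotics.IsBigO.of_bound (2 ^ (1 - ε)) ?_
      filter_upwards [Ioo_mem_nhdsGT Real.pi_pos,
        tendsto_cot_half.eventually (eventually_gt_atTop 0)] with θ hθ hc
      simp only [Function.comp_apply, mul_one]
      rw [Real.norm_of_nonneg (Real.rpow_nonneg hc.le _),
        Real.norm_of_nonneg (Real.rpow_nonneg hθ.1.le _), show ε - 1 = -(1 - ε) by ring,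
        Real.rpow_neg hθ.1.le, ← div_eq_mul_inv, ← Real.div_rpow two_pos.le hθ.1.le]
      exact Real.rpow_le_rpow hc.le (cot_half_le hθ.1 hθ.2) (by linarith)
  exact ⟨hint, eq_mul_exp_integral hφ hint hSo hSφ hGc hFd hlim⟩

end

end CauchyPVI
end

theorem proposition12 (N : ℕ) (hN : 1 ≤ N) (μ : ℝ) (hμ : -1 < μ) (ξ C : ℂ) (hC : C ≠ 0) :
    -- the Cauchy average
    (∀ η₁ η₂ : ℝ, 2 * (N : ℝ) - 1 + μ < 2 * η₁ →
      -- the integrals converge, and the average is differentiable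
      (∀ s : ℝ, MeasureTheory.Integrable (CauchyPVI.cauchyIntegrand N η₁ η₂ μ ξ s)) ∧
      Differentiable ℝ (CauchyPVI.cauchyE C N η₁ η₂ μ ξ) ∧
      -- the average is the `N`-th member of every Hamiltonian `τ`-sequence with the given `τ₃[1]`
      (∀ (D : Set ℂ) (q p τ : ℕ → ℂ → ℂ), IsOpen D → IsPreconnected D →
        D ⊆ {t : ℂ | 0 < t.re ∧ t.re < 1} →
        CauchyPVI.IsTauSequence (CauchyPVI.bSeed N η₁ η₂ μ) N D q p τ →
        (∃ k : ℂ, k ≠ 0 ∧ ∀ s : ℝ, CauchyPVI.linePt s ∈ D →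
          τ 1 (CauchyPVI.linePt s) = k * CauchyPVI.tauOne (CauchyPVI.bSeed N η₁ η₂ μ) ξ s) →
        ∃ c : ℂ, c ≠ 0 ∧ ∀ s : ℝ, CauchyPVI.linePt s ∈ D →
          CauchyPVI.cauchyE C N η₁ η₂ μ ξ s = c * τ N (CauchyPVI.linePt s)) ∧
      -- and of the one given by the Toda lattice determinant, on the whole line
      (∃ c : ℂ, c ≠ 0 ∧ ∀ s : ℝ,
        CauchyPVI.cauchyE C N η₁ η₂ μ ξ s
          = c * CauchyPVI.tauDet (CauchyPVI.bSeed N η₁ η₂ μ) ξ N s) ∧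
      -- the `σ`-form
      CauchyPVI.SatisfiesSigmaForm (CauchyPVI.bCy N η₁ η₂ μ)
        (CauchyPVI.cauchyU C N η₁ η₂ μ ξ) {t | CauchyPVI.cauchyE C N η₁ η₂ μ ξ t ≠ 0} ∧
      -- the boundary condition for `ξ = 1`
      CauchyPVI.e2' (CauchyPVI.bCy N η₁ η₂ μ) + N * (N + μ - 2 * η₁) = -(η₁ : ℂ) ^ 2 ∧
      (fun t : ℝ => CauchyPVI.cauchyU C N η₁ η₂ μ 1 t -
          (((-η₁ ^ 2 * t - η₂ * (N - η₁) * (N + μ - η₁) / η₁ : ℝ)) : ℂ))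
        =O[Filter.atBot] (fun t : ℝ => 1 / t) ∧
      -- the boundary condition for `ξ = 0`
      CauchyPVI.e2' (CauchyPVI.bCy N η₁ η₂ μ) + N * μ = -((N : ℂ) - η₁) ^ 2 ∧
      (2 * (N : ℝ) - 1 < 2 * η₁ →
        Filter.Tendsto (fun t : ℝ => CauchyPVI.cauchyU C N η₁ η₂ μ 0 t / t) Filter.atBot
          (nhds (-((N : ℂ) - η₁) ^ 2))) ∧
      ((N : ℝ) < η₁ →
        (fun t : ℝ => CauchyPVI.cauchyU C N η₁ η₂ μ 0 t - (((-(N - η₁) ^ 2 * t : ℝ)) : ℂ))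
          =O[Filter.atBot] (fun _ : ℝ => (1 : ℝ)))) ∧
    -- the circular Jacobi average
    (∀ ω₁ ω₂ : ℝ, -1 < 2 * ω₁ →
      (∃ c : ℂ, c ≠ 0 ∧ ∀ φ : ℝ, 0 < φ → φ < 2 * Real.pi →
        CauchyPVI.cJE N ω₁ ω₂ μ (1 - (1 - ξ) * Complex.exp (-(Real.pi * Complex.I * μ))) φ
          = c * (1 / (((1 + Real.cot (φ / 2) ^ 2) ^ (N * μ / 2) : ℝ) : ℂ)) *
            CauchyPVI.cauchyE C N (N + ω₁ + μ / 2) ω₂ μ ξ (Real.cot (φ / 2))) ∧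
      (-1 < 2 * ω₁ + μ → ∀ φ : ℝ, 0 ≤ φ → φ < 2 * Real.pi →
        (∀ θ : ℝ, 0 < θ → θ ≤ φ →
          CauchyPVI.cJE N ω₁ ω₂ μ
            (1 - (1 - ξ) * Complex.exp (-(Real.pi * Complex.I * μ))) θ ≠ 0) →
        IntervalIntegrable (fun θ : ℝ =>
          CauchyPVI.cauchyU C N (N + ω₁ + μ / 2) ω₂ μ ξ (Real.cot (θ / 2))
            + ((ω₂ * (N + ω₁ - μ / 2) + (ω₁ + μ / 2) ^ 2 * Real.cot (θ / 2) : ℝ) : ℂ))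
          MeasureTheory.volume 0 φ ∧
        CauchyPVI.cJE N ω₁ ω₂ μ (1 - (1 - ξ) * Complex.exp (-(Real.pi * Complex.I * μ))) φ
          = CauchyPVI.morrisM N (ω₁ - Complex.I * ω₂ + μ / 2) (ω₁ + Complex.I * ω₂ + μ / 2) /
              CauchyPVI.morrisM N ω₁ ω₁ *
            Complex.exp (-(1 / 2) * ∫ θ in (0 : ℝ)..φ,
              (CauchyPVI.cauchyU C N (N + ω₁ + μ / 2) ω₂ μ ξ (Real.cot (θ / 2))
                + ((ω₂ * (N + ω₁ - μ / 2)
                    + (ω₁ + μ / 2) ^ 2 * Real.cot (θ / 2) : ℝ) : ℂ))))) := by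
  refine ⟨fun η₁ η₂ h => ⟨(CauchyPVI.cauchyE_eq_hdet N η₂ hμ h ξ C).1,
    CauchyPVI.differentiable_cauchyE N η₂ hμ h ξ C,
    fun D q p τ hD hDc hD0 hτ h1 => CauchyPVI.cauchyE_eq_tau hμ h ξ hC hD hDc hD0 hτ h1,
    CauchyPVI.cauchyE_eq_tauDet N η₂ hμ h ξ hC,
    CauchyPVI.satisfiesSigmaForm_cauchyU hN η₂ hμ h ξ hC,
    CauchyPVI.e2'_add_mul_one N η₁ η₂ μ, CauchyPVI.cauchyU_one_isBigO hN hμ h hC,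
    CauchyPVI.e2'_add_mul N η₁ η₂ μ,
    CauchyPVI.tendsto_cauchyU_zero_div hμ h hC, CauchyPVI.cauchyU_zero_isBigO hμ h hC⟩,
    fun ω₁ ω₂ hω => ⟨CauchyPVI.cJE_eq_cauchyE ω₂ hμ hω ξ hC, fun hω' φ h0 h1 hne =>
      CauchyPVI.cJE_eq_morrisM_mul_exp ω₂ hμ hω hω' ξ hC h0 h1 hne⟩⟩
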